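/- Let $0<p,q<1$ with $q^{2n}\notin p^{\mathbb Z}$ for all integers $n\ge 1$. Put $\theta(x)=\prod_{i\ge0}(1-xp^i)(1-p^{i+1}/x)$ for $x\neq 0$, $\theta(a_1,\dots,a_m)=\prod_i\theta(a_i)$, $(a)_n=\prod_{i=0}^{n-1}\theta(aq^{2i})$ and $(a)_{-n}=1/(aq^{-2n})_n$ for $n\ge 0$, $(a_1,\dots,a_m)_n=\prod_i(a_i)_n$, $\begin{bmatrix}k\\l\end{bmatrix}=\prod_{i=1}^l\theta(q^{2(k-l+i)})/\theta(q^{2i})$, and $${}_{r+1}V_r(a_1;a_6,\dots,a_{r+1})=\sum_{n\ge0}\frac{\theta(a_1q^{4n})}{\theta(a_1)}\,\frac{q^{2n}\,(a_1,a_6,\dots,a_{r+1})_n}{(q^2,q^2a_1/a_6,\dots,q^2a_1/a_{r+1})_n}.$$ Let $\mathcal M$ be the field of meromorphic functions of $\lambda\in\mathbb C$, let $(T_\alpha f)(\lambda)=f(\lambda+\alpha)$, and let $D$ be the algebra of difference operators $\sum_i f_iT_{\alpha_i}$ on $\mathcal M$, with $D_{\alpha\alpha}=\mathcal M T_{-\alpha}$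 and $D_{\alpha\beta}=0$ for $\alpha\ne\beta$. Let $R(\lambda,z)(e_a\otimes e_b)=\sum_{x,y}R^{ab}_{xy}(\lambda,z)\,e_x\otimes e_y$ ($a,b,x,y\in\{1,-1\}$) be the elliptic dynamical $R$-matrix, whose nonzero entries are $R^{1,1}_{1,1}=R^{-1,-1}_{-1,-1}=1$ and $$R^{1,-1}_{1,-1}=\frac{\theta(z,q^{2(\lambda+2)})}{\theta(q^2z,q^{2(\lambda+1)})},\quad R^{-1,1}_{1,-1}=\frac{\theta(q^2,q^{-2(\lambda+1)}z)}{\theta(q^2z,q^{-2(\lambda+1)})},\quad R^{1,-1}_{-1,1}=\frac{\theta(q^2,q^{2(\lambda+1)}z)}{\theta(q^2z,q^{2(\lambda+1)})},\quad R^{-1,1}_{-1,1}=\frac{\theta(z,q^{-2\lambda})}{\theta(q^2z,q^{-2(\lambda+1)})}.$$ For $\Omega\subseteq\mathbb C\setminus\{0\}$ with $q^{\pm2}\Omega\subseteq\Omega$ let $\mathcal E(\Omega)$ be the algebra of the elliptic $U(2)$ dynamical quantum group with spectral parameters in $\Omega$: the unital complex algebra generated by two commuting copies $\mu_l(\mathcal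 M)$, $\mu_r(\mathcal M)$ of $\mathcal M$, by $\alpha(z)=L_{1,1}(z)$, $\beta(z)=L_{1,-1}(z)$, $\gamma(z)=L_{-1,1}(z)$, $\delta(z)=L_{-1,-1}(z)$ and by $\det^{-1}(z)$ ($z\in\Omega$), with relations $\mu_l(f)L_{ab}(z)=L_{ab}(z)\mu_l(T_af)$, $\mu_r(f)L_{ab}(z)=L_{ab}(z)\mu_r(T_bf)$, the $RLL$-relations $$\sum_{x,y}\mu_l\bigl(R^{xy}_{ac}(\cdot,z_1/z_2)\bigr)L_{xb}(z_1)L_{yd}(z_2)=\sum_{x,y}\mu_r\bigl(R^{bd}_{xy}(\cdot,z_1/z_2)\bigr)L_{cy}(z_2)L_{ax}(z_1)$$ multiplied by $\theta(q^2z_1/z_2)$ (so that they make sense for all $z_1,z_2\in\Omega$), and with $\det^{-1}(z)$ a two-sided inverse of $\det(z)=\mu_r(F)\mu_l(F^{-1})[\alpha(z)\delta(q^2z)-\gamma(z)\beta(q^2z)]$, $F(\lambda)=q^\lambda\theta(q^{-2(\lambda+1)})$. It is bigraded by $\mu_l(f),\mu_r(f),\det^{-1}(z)\in\mathcal E_{00}$,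 $L_{ab}(z)\in\mathcal E_{ab}$, with $\Delta(L_{ab}(z))=\sum_xL_{ax}(z)\otimes L_{xb}(z)$, $\varepsilon(L_{ab}(z))=\delta_{ab}T_{-a}$, and $\det^{-1}(z)$ group-like. For $0\le k,j\le N$ put $$t^N_{kj}(z)=\sum_{l=\max(0,k+j-N)}^{\min(k,j)}\begin{bmatrix}k\\l\end{bmatrix}\begin{bmatrix}N-k\\j-l\end{bmatrix}\mu_r\Bigl(\tfrac{(q^{2(\cdot+N-k-2j+l+2)})_l}{(q^{2(\cdot+N-2j+2)})_l}\tfrac{(q^{2(\cdot+l-j+2)})_{j-l}}{(q^{2(\cdot+N-2j-k+2l+2)})_{j-l}}\Bigr)\gamma(q^{2(N-k-1)}z)\cdots\gamma(q^{2(N-j-k+l)}z)$$ $$\times\ \delta(q^{2(N-j-k+l-1)}z)\cdots\delta(z)\ \alpha(q^{2(N-1)}z)\cdots\alpha(q^{2(N-l)}z)\ \beta(q^{2(N-l-1)}z)\cdots\beta(q^{2(N-k)}z),$$ the matrix elements of the $(N+1)$-dimensional irreducible corepresentation. Let $\Omega_1,\Omega_2$ be two such sets with $w/z\notin p^{\mathbb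 Z}$ for all $w\in\Omega_1$, $z\in\Omega_2$. Then there is exactly one $\mathbb C$-bilinear map $\langle\cdot,\cdot\rangle:\mathcal E(\Omega_1)^{\mathrm{cop}}\times\mathcal E(\Omega_2)\to D$ that is a pairing of bialgebroids, i.e. (with gradings, moment maps and coproducts those of $\mathcal E$) $\langle\mathcal E_{\alpha\beta},\mathcal E_{\gamma\delta}\rangle\subseteq D_{\beta+\delta,\alpha+\gamma}$, $\langle\mu_r(f)X,a\rangle=\langle X,\mu_l(f)a\rangle=f\circ\langle X,a\rangle$, $\langle X\mu_l(f),a\rangle=\langle X,a\mu_r(f)\rangle=\langle X,a\rangle\circ f$, $\langle XY,a\rangle=\sum\langle X,a_{(1)}\rangle T_\rho\langle Y,a_{(2)}\rangle$ ($\rho$ the right weight of $a_{(1)}$), $\langle X,ab\rangle=\sum\langle X_{(2)},a\rangle T_\rho\langle X_{(1)},b\rangle$ ($\rho$ the left weight of $X_{(2)}$), $\langle X,1\rangle=\varepsilon(X)$, $\langle1,a\rangle=\varepsilon(a)$, and that satisfies $\langle L_{ij}(w),L_{kl}(z)\rangle=R^{jl}_{ik}(\lambda,w/z)\,T_{-i-k}$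 (the cobraiding pairing). For all integers $0\le r,s\le M$, $0\le k,j\le N$ and all $w\in\Omega_1$, $z\in\Omega_2$ it satisfies $$\langle t^M_{rs}(w),t^N_{kj}(z)\rangle=\delta_{s+j,r+k}\;C\;{}_{12}V_{11}(a_1;a_6,\dots,a_{12})\;T_{N+M-2s-2j},$$ where $a_1=q^{2(\lambda+M-2s-r+1)}$ and $$(a_6,\dots,a_{12})=\bigl(q^{-2r},\,q^{-2s},\,q^{2(\lambda-s+1)},\,q^{2(\lambda+M+N-k-s-r+2)},\,q^{2(\lambda+M-k-s-r+1)},\,q^{2(k-s)}z/w,\,q^{2(M-N+k-s+1)}w/z\bigr),$$ $$C=(-1)^{M-r-s}\,q^{(M-r-s)(2(\lambda-s+1)+M-r-s-1)}\,\frac{(q^{2(M-r-s+1)},q^{2(k-s+1)},q^{2(\lambda+M-s-k-r+2)}w/z)_s}{(q^2,q^{2(\lambda+M-2s-r+2)},q^{2(M-r-s+1)}w/z)_s}$$ $$\times\frac{(q^{2(N-k+s-r+1)},q^{2(-\lambda-N+k+s)}w/z)_r}{(q^{-2(\lambda+M-2s)},q^{2(M-r+1)}w/z)_r}\;\frac{(q^{2(k+s+r-\lambda-M)},q^{2(s-k+1)}w/z)_{M-r-s}}{(q^{2(\lambda-s+1)},q^2w/z)_{M-r-s}}.$$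 The series terminates after the term $n=\min(r,s)$ and is balanced: $(a_6\cdots a_{12})^2q^4=(a_1q^2)^6$. For $r+s\le M$ and $s\le k$ the formula holds as it stands; if $r+s>M$ or $s>k$, where a vanishing factor of $C$ meets a vanishing denominator of the series, the product of $C$ and the $n$-th term is read with $(q^{2(M-r-s+1)},q^{2(k-s+1)})_s/(q^{2(M-r-s+1)},q^{2(k-s+1)})_n=(q^{2(M-r-s+1+n)},q^{2(k-s+1+n)})_{s-n}$ (a reading that is valid, and agrees with the literal one, for all $r,s,k$ with $r+s\le M$, $s\le k$ too). -/

import Mathlib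

open scoped BigOperators

noncomputable section

namespace EllU2

/-! ### Meromorphic functions on `ℂ` and difference operators -/

/-- The algebra of functions `ℂ → ℂ` that are meromorphic on all of `ℂ`. -/
def meroFun : Subalgebra ℂ (ℂ → ℂ) where
  carrier := {f | Meromorphic f}
  mul_mem' := fun ha hb => fun x => (ha x).mul (hb x)
  add_mem' := fun ha hb => fun x => (ha x).add (hb x)
  algebraMap_mem' := fun r => fun x => MeromorphicAt.const r x

/-- The ideal of meromorphic functions that vanish off a discrete closed set. -/
def negligible : Ideal meroFun where
  carrier := {f | ∀ᶠ x in Filter.codiscrete ℂ, (f : ℂ → ℂ) x = 0}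
  add_mem' := by
    intro a b ha hb
    have ha' : ∀ᶠ x in Filter.codiscrete ℂ, (a : ℂ → ℂ) x = 0 := ha
    have hb' : ∀ᶠ x in Filter.codiscrete ℂ, (b : ℂ → ℂ) x = 0 := hb
    change ∀ᶠ x in Filter.codiscrete ℂ, ((a + b : meroFun) : ℂ → ℂ) x = 0
    filter_upwards [ha', hb'] with x h1 h2
    simp [h1, h2]
  zero_mem' := by simp
  smul_mem' := by
    intro c f hf
    have hf' : ∀ᶠ x in Filter.codiscrete ℂ, (f : ℂ → ℂ) x = 0 := hf
    change ∀ᶠ x in Filter.codiscrete ℂ, ((c • f : meroFun) : ℂ → ℂ) x = 0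
    filter_upwards [hf'] with x h1
    simp [h1]

/-- The field of meromorphic functions on `ℂ` (the values at the points of a discrete closed set
are forgotten). -/
abbrev Mero : Type := meroFun ⧸ negligible

open Classical in
/-- The meromorphic function given by the formula `f`. It is only used for formulas that are
meromorphic in the variable; the value is `0` if `f` is not meromorphic. -/
def Mero.of (f : ℂ → ℂ) : Mero :=
  if h : Meromorphic f then Ideal.Quotient.mk negligible ⟨f, h⟩ else 0

/-- Translation `f ↦ f (· + α)` on meromorphic functions on `ℂ`, before passing to the
quotient. -/
def shiftFun (α : ℂ) : meroFun →ₐ[ℂ] meroFun where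
  toFun f := ⟨fun x => (f : ℂ → ℂ) (x + α), fun x => by
    exact (f.2 (x + α)).comp_analyticAt (f := (f : ℂ → ℂ)) (g := fun y => y + α) (by fun_prop)⟩
  map_one' := rfl
  map_mul' _ _ := rfl
  map_zero' := rfl
  map_add' _ _ := rfl
  commutes' _ := rfl

theorem negligible_le_comap_shiftFun (α : ℂ) :
    negligible ≤ negligible.comap (shiftFun α) := by
  intro f hf
  have hf' : {x | (f : ℂ → ℂ) x = 0} ∈ Filter.codiscrete ℂ := hf
  change {x | (f : ℂ → ℂ) (x + α) = 0} ∈ Filter.codiscrete ℂ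
  simp only [Filter.codiscrete, mem_codiscreteWithin_iff_forall_mem_nhdsNE, Set.mem_univ,
    Set.compl_univ, Set.union_empty, forall_true_left] at hf' ⊢
  intro x
  have ht : Filter.Tendsto (fun y => y + α) (nhdsWithin x {x}ᶜ)
      (nhdsWithin (x + α) {x + α}ᶜ) := by
    refine tendsto_nhdsWithin_iff.2 ⟨?_, ?_⟩
    · exact ((continuous_id.add continuous_const).tendsto x).mono_left nhdsWithin_le_nhds
    · filter_upwards [self_mem_nhdsWithin] with y hy
      simpa using hy
  exact ht (hf' (x + α))

/-- The automorphism `(T_α f)(λ) = f (λ + α)` of the meromorphic functions. -/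
def shift (α : ℂ) : Mero →ₐ[ℂ] Mero :=
  Ideal.quotientMapₐ negligible (shiftFun α) (negligible_le_comap_shiftFun α)

/-- The operators on meromorphic functions; the difference operators `∑ fᵢ T_{αᵢ}` live here,
with composition as multiplication. -/
abbrev Op : Type := Module.End ℂ Mero

/-- The operator `T_α`. -/
def T (α : ℂ) : Op := (shift α).toLinearMap

/-- The operator of multiplication by `f`. -/
def mulOp (f : Mero) : Op := LinearMap.mulLeft ℂ f

/-- The component of bidegree `(α, β)` of the algebra of difference operators:
`{f T_{-α}}` if `α = β`, and `{0}` otherwise. -/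
def opPart (α β : ℤ) : Set Op :=
  {A | A = 0 ∨ (α = β ∧ ∃ f : Mero, A = mulOp f * T (-(α : ℂ)))}

/-! ### Theta functions and elliptic shifted factorials -/

/-- `(a; p)_∞`. -/
def pochInf (p : ℝ) (a : ℂ) : ℂ := ∏' i : ℕ, (1 - a * (p : ℂ) ^ i)

/-- `θ(x) = (x, p/x; p)_∞`, for `x ≠ 0`. -/
def theta (p : ℝ) (x : ℂ) : ℂ := pochInf p x * pochInf p ((p : ℂ) / x)

/-- `q ^ e` with complex exponent, for `0 < q`. -/
def qp (q : ℝ) (e : ℂ) : ℂ := (q : ℂ) ^ e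

/-- The elliptic shifted factorial `(a)_n = ∏_{0 ≤ i < n} θ(a q^{2i})`, with the usual extension
`(a)_{-n} = 1 / (a q^{-2n})_n` to negative subscripts. -/
def ellFac (p q : ℝ) (a : ℂ) : ℤ → ℂ
  | Int.ofNat n => ∏ i ∈ Finset.range n, theta p (a * qp q (2 * i))
  | Int.negSucc n => (∏ i ∈ Finset.range (n + 1), theta p (a * qp q (-2 * (i + 1))))⁻¹

/-- `(a_1, …, a_k)_n`. -/
def ellFacs (p q : ℝ) (as : List ℂ) (n : ℤ) : ℂ := (as.map fun a => ellFac p q a n).prod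

/-- The elliptic binomial coefficient. -/
def ellBinom (p q : ℝ) (k l : ℕ) : ℂ :=
  ∏ i ∈ Finset.Icc 1 l, theta p (qp q (2 * ((k : ℂ) - l + i))) / theta p (qp q (2 * i))

/-- The `n`-th term of the very-well-poised elliptic hypergeometric series
`V(a₁; a₆, …, a_{r+1})`, in base `q²`. -/
def ellVTerm (p q : ℝ) (a₁ : ℂ) (as : List ℂ) (n : ℕ) : ℂ :=
  theta p (a₁ * qp q (4 * n)) / theta p a₁ *
    (qp q (2 * n) * ellFacs p q (a₁ :: as) n /
      ellFacs p q (qp q 2 :: as.map fun a => qp q 2 * a₁ / a) n)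

/-- The very-well-poised elliptic hypergeometric series `_{r+1}V_r(a₁; a₆, …, a_{r+1})`, where
`as = [a₆, …, a_{r+1}]`. -/
def ellV (p q : ℝ) (a₁ : ℂ) (as : List ℂ) : ℂ := ∑' n : ℕ, ellVTerm p q a₁ as n

/-- The elliptic balancing condition `(a₆ ⋯ a_{r+1})² q⁴ = (a₁ q²)^{r-5}`. -/
def EllBalanced (q : ℝ) (a₁ : ℂ) (as : List ℂ) : Prop :=
  as.prod ^ 2 * qp q 4 = (a₁ * qp q 2) ^ (as.length - 1)

/-! ### The `R`-matrix -/

/-- The weight of a basis vector: `true` stands for the index `1`, `false` for `-1`. -/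
def wt : Bool → ℤ
  | true => 1
  | false => -1

/-- `rNum a b x y z l = θ(q² z) · R^{ab}_{xy}(l, z)`, where
`R(l, z)(e_a ⊗ e_b) = ∑ R^{ab}_{xy}(l, z) e_x ⊗ e_y`: the elliptic dynamical `R`-matrix with its
only denominator depending on `z` alone removed. -/
def rNum (p q : ℝ) : Bool → Bool → Bool → Bool → ℂ → ℂ → ℂ
  | true, true, true, true, z, _ => theta p (qp q 2 * z)
  | false, false, false, false, z, _ => theta p (qp q 2 * z)
  | true, false, true, false, z, l =>
      theta p z * theta p (qp q (2 * (l + 2))) / theta p (qp q (2 * (l + 1)))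
  | false, true, true, false, z, l =>
      theta p (qp q 2) * theta p (qp q (-2 * (l + 1)) * z) / theta p (qp q (-2 * (l + 1)))
  | true, false, false, true, z, l =>
      theta p (qp q 2) * theta p (qp q (2 * (l + 1)) * z) / theta p (qp q (2 * (l + 1)))
  | false, true, false, true, z, l =>
      theta p z * theta p (qp q (-2 * l)) / theta p (qp q (-2 * (l + 1)))
  | _, _, _, _, _, _ => 0

/-- `rMat a b x y z l = R^{ab}_{xy}(l, z)`. -/
def rMat (p q : ℝ) (a b x y : Bool) (z l : ℂ) : ℂ :=
  rNum p q a b x y z l / theta p (qp q 2 * z)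

/-! ### The algebra -/

/-- A set of nonzero spectral parameters that is stable under multiplication by `q^{±2}`. -/
structure SpectralSet (q : ℝ) where
  carrier : Set ℂ
  zero_notMem : (0 : ℂ) ∉ carrier
  shift_mem : ∀ z ∈ carrier, ∀ n : ℤ, (q : ℂ) ^ (2 * n) * z ∈ carrier

/-- The points of a spectral set. -/
abbrev SpectralSet.Pt {q : ℝ} (Ω : SpectralSet q) : Type := {z : ℂ // z ∈ Ω.carrier}

/-- The point `q^{2n} z`. -/
def SpectralSet.move {q : ℝ} {Ω : SpectralSet q} (n : ℤ) (z : Ω.Pt) : Ω.Pt :=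
  ⟨(q : ℂ) ^ (2 * n) * z, Ω.shift_mem z z.2 n⟩

/-- The noncommutative generators: the entries `L_{ab}(z)` of the `L`-matrix, that is
`α(z) = L_{1,1}(z)`, `β(z) = L_{1,-1}(z)`, `γ(z) = L_{-1,1}(z)`, `δ(z) = L_{-1,-1}(z)`, and the
inverse determinants `det⁻¹(z)`. -/
inductive Letter {q : ℝ} (Ω : SpectralSet q) : Type
  | L (a b : Bool) (z : Ω.Pt)
  | detInv (z : Ω.Pt)

/-- All generators: two copies of the meromorphic functions and the letters. -/
inductive Gen {q : ℝ} (Ω : SpectralSet q) : Type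
  | muL (f : Mero)
  | muR (f : Mero)
  | letter (x : Letter Ω)

section Free

variable {q : ℝ} (Ω : SpectralSet q)

/-- The free algebra on all generators. -/
abbrev Free : Type := FreeAlgebra ℂ (Gen Ω)

variable {Ω}

/-- `f(λ)` in the free algebra. -/
def fmuL (f : Mero) : Free Ω := FreeAlgebra.ι ℂ (Gen.muL f)

/-- `f(μ)` in the free algebra. -/
def fmuR (f : Mero) : Free Ω := FreeAlgebra.ι ℂ (Gen.muR f)

/-- A letter in the free algebra. -/
def fletter (x : Letter Ω) : Free Ω := FreeAlgebra.ι ℂ (Gen.letter x)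

/-- `L_{ab}(z)` in the free algebra. -/
def fL (a b : Bool) (z : Ω.Pt) : Free Ω := fletter (Letter.L a b z)

/-- `F(λ) = q^λ θ(q^{-2(λ+1)})`. -/
def detF (p q : ℝ) (l : ℂ) : ℂ := qp q l * theta p (qp q (-2 * (l + 1)))

/-- `det(z) = μ_r(F) μ_l(F⁻¹) [α(z) δ(q² z) - γ(z) β(q² z)]` in the free algebra. -/
def fdet (p : ℝ) (z : Ω.Pt) : Free Ω :=
  fmuR (Mero.of (detF p q)) * fmuL (Mero.of fun l => (detF p q l)⁻¹) *
    (fL true true z * fL false false (SpectralSet.move 1 z) -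
      fL false true z * fL true false (SpectralSet.move 1 z))

/-- The defining relations. The `RLL`-relations are multiplied by `θ(q² z₁/z₂)`, so that they make
sense for all spectral parameters. -/
inductive Rel (p : ℝ) : Free Ω → Free Ω → Prop
  | muL_add (f g : Mero) : Rel p (fmuL (f + g)) (fmuL f + fmuL g)
  | muL_mul (f g : Mero) : Rel p (fmuL (f * g)) (fmuL f * fmuL g)
  | muL_const (c : ℂ) : Rel p (fmuL (algebraMap ℂ Mero c)) (algebraMap ℂ (Free Ω) c)
  | muR_add (f g : Mero) : Rel p (fmuR (f + g)) (fmuR f + fmuR g)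
  | muR_mul (f g : Mero) : Rel p (fmuR (f * g)) (fmuR f * fmuR g)
  | muR_const (c : ℂ) : Rel p (fmuR (algebraMap ℂ Mero c)) (algebraMap ℂ (Free Ω) c)
  | mu_comm (f g : Mero) : Rel p (fmuL f * fmuR g) (fmuR g * fmuL f)
  | muL_L (f : Mero) (a b : Bool) (z : Ω.Pt) :
      Rel p (fmuL f * fL a b z) (fL a b z * fmuL (shift (wt a) f))
  | muR_L (f : Mero) (a b : Bool) (z : Ω.Pt) :
      Rel p (fmuR f * fL a b z) (fL a b z * fmuR (shift (wt b) f))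
  | rll (a b c d : Bool) (z₁ z₂ : Ω.Pt) :
      Rel p
        (∑ x : Bool, ∑ y : Bool,
          fmuL (Mero.of (rNum p q x y a c ((z₁ : ℂ) / z₂))) * fL x b z₁ * fL y d z₂)
        (∑ x : Bool, ∑ y : Bool,
          fmuR (Mero.of (rNum p q b d x y ((z₁ : ℂ) / z₂))) * fL c y z₂ * fL a x z₁)
  | det_mul_detInv (z : Ω.Pt) : Rel p (fdet p z * fletter (Letter.detInv z)) 1
  | detInv_mul_det (z : Ω.Pt) : Rel p (fletter (Letter.detInv z) * fdet p z) 1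

end Free

/-- The algebra of the elliptic `U(2)` dynamical quantum group, with spectral parameters in `Ω`. -/
abbrev E (p : ℝ) {q : ℝ} (Ω : SpectralSet q) : Type := RingQuot (Rel (Ω := Ω) p)

section Structure

variable (p : ℝ) {q : ℝ} {Ω : SpectralSet q}

/-- The quotient map from the free algebra. -/
def toE : Free Ω →ₐ[ℂ] E p Ω := RingQuot.mkAlgHom ℂ (Rel p)

/-- The left moment map. -/
def muL (f : Mero) : E p Ω := toE p (fmuL f)

/-- The right moment map. -/
def muR (f : Mero) : E p Ω := toE p (fmuR f)

/-- The product of the letters of a word. -/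
def word (u : List (Letter Ω)) : E p Ω := (u.map fun x => toE p (fletter x)).prod

/-- Left weight of a letter. -/
def Letter.wtL : Letter Ω → ℤ
  | .L a _ _ => wt a
  | .detInv _ => 0

/-- Right weight of a letter. -/
def Letter.wtR : Letter Ω → ℤ
  | .L _ b _ => wt b
  | .detInv _ => 0

/-- Left weight of a word. -/
def wordWtL (u : List (Letter Ω)) : ℤ := (u.map Letter.wtL).sum

/-- Right weight of a word. -/
def wordWtR (u : List (Letter Ω)) : ℤ := (u.map Letter.wtR).sum

/-- The component of bidegree `(α, β)` of the algebra. -/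
def homog (α β : ℤ) : Submodule ℂ (E p Ω) :=
  Submodule.span ℂ {X | ∃ (f g : Mero) (u : List (Letter Ω)),
    wordWtL u = α ∧ wordWtR u = β ∧ X = muL p f * muR p g * word p u}

/-- The comultiplication on letters, `Δ(L_{ab}(z)) = ∑ₓ L_{ax}(z) ⊗ L_{xb}(z)` and
`Δ(det⁻¹(z)) = det⁻¹(z) ⊗ det⁻¹(z)`, as the list of the occurring tensors. -/
def Letter.comul : Letter Ω → List (Letter Ω × Letter Ω)
  | .L a b z => [(.L a true z, .L true b z), (.L a false z, .L false b z)]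
  | .detInv z => [(.detInv z, .detInv z)]

/-- The comultiplication on words, extended multiplicatively from letters: the list of the pairs
`(u₁, u₂)` with `Δ(u) = ∑ u₁ ⊗ u₂`. Every element of the algebra is a linear combination of
elements `μ_l(f) u μ_r(g)` with `u` a word, and `Δ(μ_l(f) u μ_r(g)) = ∑ μ_l(f) u₁ ⊗ u₂ μ_r(g)`. -/
def comulWord : List (Letter Ω) → List (List (Letter Ω) × List (Letter Ω))
  | [] => [([], [])]
  | x :: u => x.comul.flatMap fun y => (comulWord u).map fun v => (y.1 :: v.1, y.2 :: v.2)

/-- The counit on letters: `ε(L_{ab}(z)) = δ_{ab} T_{-ω(a)}`, `ε(det⁻¹(z)) = 1`. -/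
def Letter.counit : Letter Ω → Op
  | .L a b _ => if a = b then T (-(wt a : ℂ)) else 0
  | .detInv _ => 1

/-- The counit on words. -/
def counitWord (u : List (Letter Ω)) : Op := (u.map Letter.counit).prod

/-- The coefficient function of the `l`-th term in the expression for the matrix element
`t^N_{kj}(z)`. -/
def tCoeff (p q : ℝ) (N k j l : ℕ) (x : ℂ) : ℂ :=
  ellBinom p q k l * ellBinom p q (N - k) (j - l) *
    (ellFac p q (qp q (2 * (x + N - k - 2 * j + l + 2))) l /
        ellFac p q (qp q (2 * (x + N - 2 * j + 2))) l *
      (ellFac p q (qp q (2 * (x + l - j + 2))) ((j : ℤ) - l) /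
        ellFac p q (qp q (2 * (x + N - 2 * j - k + 2 * l + 2))) ((j : ℤ) - l)))

/-- `L_{ab}(q^{2e} z) L_{ab}(q^{2(e-1)} z) ⋯` with `n` factors, as a word. -/
def descWord (a b : Bool) (e : ℤ) (n : ℕ) (z : Ω.Pt) : List (Letter Ω) :=
  (List.range n).map fun i => Letter.L a b (SpectralSet.move (e - i) z)

/-- The matrix elements `t^N_{kj}(z)`, `0 ≤ k, j ≤ N`, of the `(N+1)`-dimensional irreducible
corepresentation: the sum over `max(0, k+j-N) ≤ l ≤ min(k, j)` of `μ_r(coefficient)` times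
`γ(q^{2(N-k-1)}z) ⋯ γ(q^{2(N-j-k+l)}z) δ(q^{2(N-j-k+l-1)}z) ⋯ δ(z)
α(q^{2(N-1)}z) ⋯ α(q^{2(N-l)}z) β(q^{2(N-l-1)}z) ⋯ β(q^{2(N-k)}z)`. -/
def matElt (N k j : ℕ) (z : Ω.Pt) : E p Ω :=
  ∑ l ∈ Finset.Icc (k + j - N) (min k j),
    muR p (Mero.of (tCoeff p q N k j l)) *
      word p (descWord false true ((N : ℤ) - k - 1) (j - l) z ++
        descWord false false ((N : ℤ) - j - k + l - 1) (N + l - j - k) z ++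
        descWord true true ((N : ℤ) - 1) l z ++
        descWord true false ((N : ℤ) - l - 1) (k - l) z)

end Structure

/-- `P` is the pairing `E(Ω₁)^cop × E(Ω₂) → D` of bialgebroids given on the generators by the
`R`-matrix. The coopposite `E^cop` has the same multiplication as `E`, while its left and right
moment maps and weights are interchanged and its comultiplication is flipped; this is spelled out
in each clause. -/
structure IsRMatrixPairing (p : ℝ) {q : ℝ} {Ω₁ Ω₂ : SpectralSet q}
    (P : E p Ω₁ →ₗ[ℂ] E p Ω₂ →ₗ[ℂ] Op) : Prop where
  /-- `⟨U_{βα}, A_{γδ}⟩ ⊆ D_{β+δ, α+γ}` with `U = E^cop`, `U_{βα} = E_{αβ}`. -/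
  target : ∀ (α β γ δ : ℤ), ∀ X ∈ homog p (Ω := Ω₁) α β, ∀ a ∈ homog p (Ω := Ω₂) γ δ,
    P X a ∈ opPart (β + δ) (α + γ)
  left_moment₁ : ∀ (f : Mero) (X : E p Ω₁) (a : E p Ω₂),
    P (muR p f * X) a = mulOp f * P X a
  left_moment₂ : ∀ (f : Mero) (X : E p Ω₁) (a : E p Ω₂),
    P X (muL p f * a) = mulOp f * P X a
  right_moment₁ : ∀ (f : Mero) (X : E p Ω₁) (a : E p Ω₂),
    P (X * muL p f) a = P X a * mulOp f
  right_moment₂ : ∀ (f : Mero) (X : E p Ω₁) (a : E p Ω₂),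
    P X (a * muR p f) = P X a * mulOp f
  /-- `⟨XY, a⟩ = ∑ ⟨X, a₁⟩ T_ρ ⟨Y, a₂⟩`, where `a₁` has right weight `ρ`. -/
  left_product : ∀ (X Y : E p Ω₁) (u : List (Letter Ω₂)),
    P (X * Y) (word p u) =
      ((comulWord u).map fun v =>
        P X (word p v.1) * T (wordWtR v.1) * P Y (word p v.2)).sum
  /-- `⟨X, ab⟩ = ∑ ⟨X₂, a⟩ T_ρ ⟨X₁, b⟩`, where `X₂` has left weight `ρ` (right weight in
  `E^cop`). -/
  right_product : ∀ (u : List (Letter Ω₁)) (a b : E p Ω₂),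
    P (word p u) (a * b) =
      ((comulWord u).map fun v =>
        P (word p v.2) a * T (wordWtL v.2) * P (word p v.1) b).sum
  counit₁ : ∀ u : List (Letter Ω₁), P (word p u) 1 = counitWord u
  counit₂ : ∀ u : List (Letter Ω₂), P 1 (word p u) = counitWord u
  /-- `⟨L_{ij}(w), L_{kl}(z)⟩ = R^{jl}_{ik}(λ, w/z) T_{-ω(i)-ω(k)}`. -/
  generators : ∀ (i j k l : Bool) (w : Ω₁.Pt) (z : Ω₂.Pt),
    P (word p [Letter.L i j w]) (word p [Letter.L k l z]) =
      mulOp (Mero.of (rMat p q j l i k ((w : ℂ) / z))) * T (-(wt i : ℂ) - (wt k : ℂ))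

/-! ### The right-hand side

In the following `x` stands for `w/z` and `l` for the dynamical variable. -/

/-- The factors of `C` other than `(q^{2(M-r-s+1)}, q^{2(k-s+1)})_s`. -/
def constReg (p q : ℝ) (M r s N k : ℕ) (x l : ℂ) : ℂ :=
  (-1) ^ ((M : ℤ) - r - s) *
    qp q (((M : ℂ) - r - s) * (2 * (l - s + 1) + ((M : ℂ) - r - s - 1))) *
    (ellFac p q (qp q (2 * (l + M - s - k - r + 2)) * x) s /
      ellFacs p q [qp q 2, qp q (2 * (l + M - 2 * s - r + 2)),
        qp q (2 * ((M : ℂ) - r - s + 1)) * x] s) *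
    (ellFacs p q [qp q (2 * ((N : ℂ) - k + s - r + 1)), qp q (2 * (-l - N + k + s)) * x] r /
      ellFacs p q [qp q (-2 * (l + M - 2 * s)), qp q (2 * ((M : ℂ) - r + 1)) * x] r) *
    (ellFacs p q [qp q (2 * ((k : ℂ) + s + r - l - M)), qp q (2 * ((s : ℂ) - k + 1)) * x]
        ((M : ℤ) - r - s) /
      ellFacs p q [qp q (2 * (l - s + 1)), qp q 2 * x] ((M : ℤ) - r - s))

/-- The constant `C`. -/
def constC (p q : ℝ) (M r s N k : ℕ) (x l : ℂ) : ℂ :=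
  ellFacs p q [qp q (2 * ((M : ℂ) - r - s + 1)), qp q (2 * ((k : ℂ) - s + 1))] s *
    constReg p q M r s N k x l

/-- The parameter `a₁` of the series. -/
def vBase (q : ℝ) (M r s : ℕ) (l : ℂ) : ℂ := qp q (2 * (l + M - 2 * s - r + 1))

/-- The parameters `a₆, …, a₁₂` of the series. -/
def vParams (q : ℝ) (M r s N k : ℕ) (x l : ℂ) : List ℂ :=
  [qp q (-2 * r), qp q (-2 * s), qp q (2 * (l - s + 1)),
    qp q (2 * (l + M + N - k - s - r + 2)), qp q (2 * (l + M - k - s - r + 1)),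
    qp q (2 * ((k : ℂ) - s)) * x⁻¹, qp q (2 * ((M : ℂ) - N + k - s + 1)) * x]

/-- The product of `C` and the series, with each quotient
`(q^{2(M-r-s+1)}, q^{2(k-s+1)})_s / (q^{2(M-r-s+1)}, q^{2(k-s+1)})_n` of a factor of `C` and a
denominator of the `n`-th term written as
`(q^{2(M-r-s+1+n)}, q^{2(k-s+1+n)})_{s-n}`. The two denominators come from the parameters
`a₈ = q^{2(l-s+1)}` and `a₁₀ = q^{2(l+M-k-s-r+1)}`. -/
def regProduct (p q : ℝ) (M r s N k : ℕ) (x l : ℂ) : ℂ :=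
  constReg p q M r s N k x l *
    ∑ n ∈ Finset.range (min r s + 1),
      ellFacs p q [qp q (2 * ((M : ℂ) - r - s + 1 + n)), qp q (2 * ((k : ℂ) - s + 1 + n))]
          ((s : ℤ) - n) *
        (ellFacs p q [qp q (2 * (l - s + 1)), qp q (2 * (l + M - k - s - r + 1))] n *
          ellVTerm p q (vBase q M r s l)
            [qp q (-2 * r), qp q (-2 * s), qp q (2 * (l + M + N - k - s - r + 2)),
              qp q (2 * ((k : ℂ) - s)) * x⁻¹, qp q (2 * ((M : ℂ) - N + k - s + 1)) * x] n)

end EllU2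

end

open scoped BigOperators

noncomputable section

namespace EllU2

open Filter

/-! ### Calculus of meromorphic functions and difference operators -/

/-! Existence. Words in the generators form a bigraded coalgebra, and functions from words to
difference operators form a ring `Conv` under a convolution that inserts a shift between the two
factors. A pairing of letters extends to words by expanding one argument and then the other. The
order does not matter (`pairWords_symm`), because homogeneous operators of matching weights can be
interchanged (`IsHomog.T_comm`). Thus every letter of one algebra is an element of the convolution
ring over the words of the other. Once these elements are known to satisfy the defining relations,
they give algebra homomorphisms `leftHom` and `rightHom`. The two agree on pairs of words, and words
with functions attached span the algebra (`mem_span_normal`), so they glue to a single bilinear map.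
Multiplicativity of `leftHom` is one product rule of the pairing, that of `rightHom` is the other.

The relations. The exchange relation propagates from single letters to words (`MultFamily.rll`), and
on the generators `L` it is the dynamical Yang–Baxter equation (`yangBaxterAt`), which follows entry
by entry from the addition formula `sf_add_formula`. For the latter, a function on the punctured
plane with the multiplier of two theta functions has only two free Laurent coefficients, so the four
functions θ(xy_i)θ(x/y_i) are linearly dependent. Evaluation at x = y_j yields a singular
alternating 4×4 matrix, and the vanishing of its Pfaffian is the three-term relation. At z₁/z₂ =
q^{-2} the numerator of the R-matrix has rank one, so the exchange relation says that the
antisymmetric vector is preserved (`antisymm_of_rll`). Hence the determinant is multiplicative on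
words. Corrected by the moment maps, it is a scalar character times the counit (`leftDet_eq`,
`rightDet_eq`). The inverse scalars serve as the values of det⁻¹; they make sense because q^{2n}w/z
is never a power of p.

Uniqueness. The R-matrix prescribes the pairing of the generators `L`. The values on det⁻¹ are
forced by det · det⁻¹ = 1 and the invertibility of the character (`right_detInv_of_L`,
`left_detInv_of_L`). The product rules then give all words, and the moment maps give everything
else.

The formula. The element t^N_{kj} is the normally ordered form of a matrix element of a tensor
product of vector corepresentations at z, q²z, …, summed over all column indices with j entries 1
(`matElt_eq`). The virtue of this form is fusion: pairing a letter with such a sum gives one product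
of theta functions that depends on the row index only through its length and its number of 1s
(`IsRMatrixPairing.letter_tau`). Hence a word pairs with it to a product without summation
(`IsRMatrixPairing.word_tau`). Expanding only t^M_{rs} by its definition leaves a single sum. Its
terms are matched with those of C times the series (`term_identity`): everything is written with the
odd theta function, powers of q are compared separately (`qe_identity`), and the remaining factors
are sorted by the coset of ℤ in which their arguments lie (`sfac_identity`). -/

theorem Mero.of_eq_mk {f : ℂ → ℂ} (h : Meromorphic f) :
    Mero.of f = Ideal.Quotient.mk negligible ⟨f, h⟩ := dif_pos h

/-- Meromorphy of `f` passes to anything that agrees with it off a discrete closed set, so only one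
side has to be checked. Identities of meromorphic coefficients are proved through this lemma, at
generic points only. -/
theorem Mero.of_congr {f g : ℂ → ℂ} (hf : Meromorphic f) (h : f =ᶠ[codiscrete ℂ] g) :
    Mero.of f = Mero.of g := by
  have hg : Meromorphic g := hf.congr_codiscrete h
  rw [Mero.of_eq_mk hf, Mero.of_eq_mk hg, Ideal.Quotient.eq]
  change ∀ᶠ x in codiscrete ℂ, f x - g x = 0
  filter_upwards [h] with x hx
  rw [hx, sub_self]

theorem Mero.of_mul {f g : ℂ → ℂ} (hf : Meromorphic f) (hg : Meromorphic g) :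
    Mero.of f * Mero.of g = Mero.of fun x => f x * g x := by
  have h : Meromorphic fun x => f x * g x := hf.mul hg
  rw [Mero.of_eq_mk hf, Mero.of_eq_mk hg, Mero.of_eq_mk h, ← map_mul]
  rfl

theorem Mero.of_add {f g : ℂ → ℂ} (hf : Meromorphic f) (hg : Meromorphic g) :
    Mero.of f + Mero.of g = Mero.of fun x => f x + g x := by
  have h : Meromorphic fun x => f x + g x := hf.add hg
  rw [Mero.of_eq_mk hf, Mero.of_eq_mk hg, Mero.of_eq_mk h, ← map_add]
  rfl

theorem Mero.of_const (c : ℂ) : Mero.of (fun _ => c) = algebraMap ℂ Mero c := by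
  rw [Mero.of_eq_mk (Meromorphic.const c)]
  rfl

theorem Mero.of_zero : Mero.of (fun _ => 0) = 0 := by
  rw [Mero.of_const, map_zero]

theorem Mero.of_one : Mero.of (fun _ => 1) = 1 := by
  rw [Mero.of_const, map_one]

theorem Mero.of_neg {f : ℂ → ℂ} (hf : Meromorphic f) :
    -Mero.of f = Mero.of fun x => -f x := by
  have h : Meromorphic fun x => -f x := hf.neg
  rw [Mero.of_eq_mk hf, Mero.of_eq_mk h, ← map_neg]
  rfl

theorem Mero.of_sum {ι : Type*} (s : Finset ι) {f : ι → ℂ → ℂ} (hf : ∀ i, Meromorphic (f i)) :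
    ∑ i ∈ s, Mero.of (f i) = Mero.of fun x => ∑ i ∈ s, f i x := by
  classical
  induction s using Finset.induction_on with
  | empty => simp [Mero.of_zero]
  | insert a s ha ih =>
    rw [Finset.sum_insert ha, ih, Mero.of_add (hf a)]
    · simp [Finset.sum_insert ha]
    · intro x
      exact MeromorphicAt.fun_sum fun i _ => hf i x

theorem meromorphic_comp_add {f : ℂ → ℂ} (hf : Meromorphic f) (α : ℂ) :
    Meromorphic fun x => f (x + α) := (shiftFun α ⟨f, hf⟩).2

theorem shift_of {f : ℂ → ℂ} (hf : Meromorphic f) (α : ℂ) :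
    shift α (Mero.of f) = Mero.of fun x => f (x + α) := by
  rw [Mero.of_eq_mk hf, Mero.of_eq_mk (meromorphic_comp_add hf α)]
  rfl

theorem shift_shift (α β : ℂ) (f : Mero) : shift α (shift β f) = shift (α + β) f := by
  obtain ⟨f, rfl⟩ := Ideal.Quotient.mk_surjective f
  change Ideal.Quotient.mk negligible (shiftFun α (shiftFun β f)) =
    Ideal.Quotient.mk negligible (shiftFun (α + β) f)
  congr 1
  apply Subtype.ext
  funext x
  change (f : ℂ → ℂ) (x + α + β) = (f : ℂ → ℂ) (x + (α + β))
  rw [add_assoc]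

theorem shift_zero (f : Mero) : shift 0 f = f := by
  obtain ⟨f, rfl⟩ := Ideal.Quotient.mk_surjective f
  change Ideal.Quotient.mk negligible (shiftFun 0 f) = Ideal.Quotient.mk negligible f
  congr 1
  apply Subtype.ext
  funext x
  change (f : ℂ → ℂ) (x + 0) = (f : ℂ → ℂ) x
  rw [add_zero]

instance instRingOp : Ring Op := Module.End.instRing

instance instAlgebraOp : Algebra ℂ Op := Module.End.instAlgebra ℂ ℂ Mero

theorem T_mul_T (α β : ℂ) : T α * T β = T (α + β) :=
  LinearMap.ext fun f => shift_shift α β f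

theorem T_zero : T 0 = 1 := LinearMap.ext fun f => shift_zero f

theorem mulOp_mul (f g : Mero) : mulOp (f * g) = mulOp f * mulOp g :=
  LinearMap.ext fun h => mul_assoc f g h

theorem mulOp_add (f g : Mero) : mulOp (f + g) = mulOp f + mulOp g :=
  LinearMap.ext fun h => add_mul f g h

theorem mulOp_one : mulOp 1 = 1 := LinearMap.ext fun h => one_mul h

theorem mulOp_zero : mulOp 0 = 0 := LinearMap.ext fun h => zero_mul h

theorem mulOp_neg (f : Mero) : mulOp (-f) = -mulOp f := LinearMap.ext fun h => neg_mul f h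

theorem mulOp_algebraMap (c : ℂ) : mulOp (algebraMap ℂ Mero c) = algebraMap ℂ Op c :=
  LinearMap.ext fun h => (Algebra.smul_def c h).symm

theorem mulOp_sum {ι : Type*} (s : Finset ι) (f : ι → Mero) :
    mulOp (∑ i ∈ s, f i) = ∑ i ∈ s, mulOp (f i) := by
  classical
  induction s using Finset.induction_on with
  | empty => exact mulOp_zero
  | insert a s ha ih => rw [Finset.sum_insert ha, Finset.sum_insert ha, mulOp_add, ih]

theorem mulOp_comm (f g : Mero) : mulOp f * mulOp g = mulOp g * mulOp f := by
  rw [← mulOp_mul, ← mulOp_mul]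
  exact congrArg mulOp (mul_comm f g)

theorem T_mul_mulOp (α : ℂ) (f : Mero) : T α * mulOp f = mulOp (shift α f) * T α :=
  LinearMap.ext fun g => map_mul (shift α) f g

/-- The product of two difference operators with one term each. -/
theorem mulOp_T_mul (f g : Mero) (α β : ℂ) :
    mulOp f * T α * (mulOp g * T β) = mulOp (f * shift α g) * T (α + β) := by
  rw [mulOp_mul, ← T_mul_T, mul_assoc, mul_assoc, ← mul_assoc (T α), T_mul_mulOp, mul_assoc]

open Filter Topology

/-! ### The theta function -/

section Theta

variable {p : ℝ}

theorem summable_mul_pow (hp₀ : 0 < p) (hp₁ : p < 1) (a : ℂ) :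
    Summable fun i : ℕ => ‖-(a * (p : ℂ) ^ i)‖ := by
  simp only [norm_neg, norm_mul, norm_pow, Complex.norm_real, Real.norm_of_nonneg hp₀.le]
  exact (summable_geometric_of_lt_one hp₀.le hp₁).mul_left _

theorem multipliable_pochInf (hp₀ : 0 < p) (hp₁ : p < 1) (a : ℂ) :
    Multipliable fun i : ℕ => 1 - a * (p : ℂ) ^ i := by
  simpa only [sub_eq_add_neg] using
    multipliable_one_add_of_summable (summable_mul_pow hp₀ hp₁ a)

theorem pochInf_eq_mul (hp₀ : 0 < p) (hp₁ : p < 1) (a : ℂ) :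
    pochInf p a = (1 - a) * pochInf p (p * a) := by
  have h := multipliable_pochInf hp₀ hp₁ (p * a)
  have he : (fun i : ℕ => 1 - a * (p : ℂ) ^ (i + 1)) = fun i : ℕ => 1 - p * a * (p : ℂ) ^ i := by
    funext i
    ring
  unfold pochInf
  rw [tprod_eq_zero_mul' (f := fun i : ℕ => 1 - a * (p : ℂ) ^ i)
    (by rw [he]; exact h), he, pow_zero, mul_one]

/-- An infinite product with absolutely summable deviations from 1 vanishes only if one of its
factors does. -/
theorem pochInf_eq_zero (hp₀ : 0 < p) (hp₁ : p < 1) {a : ℂ} (h : pochInf p a = 0) :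
    ∃ i : ℕ, a * (p : ℂ) ^ i = 1 := by
  by_contra! hne
  refine tprod_one_add_ne_zero_of_summable (f := fun i : ℕ => -(a * (p : ℂ) ^ i))
    (fun i hi => hne i ?_) (summable_mul_pow hp₀ hp₁ a) ?_
  · linear_combination -hi
  · simpa only [← sub_eq_add_neg, pochInf] using h

/-- On a compact set bounded by C the i-th factor differs from 1 by at most C p^i, so the product
converges locally uniformly and the limit is holomorphic. -/
theorem differentiable_pochInf (hp₀ : 0 < p) (hp₁ : p < 1) :
    Differentiable ℂ (pochInf p) := by
  have key : HasProdLocallyUniformlyOn (fun (i : ℕ) (a : ℂ) => 1 + -(a * (p : ℂ) ^ i))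
      (fun a => ∏' i : ℕ, (1 + -(a * (p : ℂ) ^ i))) Set.univ := by
    refine hasProdLocallyUniformlyOn_of_forall_compact isOpen_univ fun K _ hK => ?_
    obtain ⟨C, hC⟩ := hK.isBounded.exists_norm_le
    refine Summable.hasProdUniformlyOn_nat_one_add (u := fun i => C * p ^ i) hK
      ((summable_geometric_of_lt_one hp₀.le hp₁).mul_left _) (.of_forall fun n x hx => ?_)
      (fun i => by fun_prop)
    rw [norm_neg, norm_mul, norm_pow, Complex.norm_real, Real.norm_of_nonneg hp₀.le]
    exact mul_le_mul_of_nonneg_right (hC x hx) (by positivity)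
  have h := key.differentiableOn (.of_forall fun s => by
    simpa [Finset.prod_fn] using
      DifferentiableOn.finsetProd (fun _ _ => by fun_prop)) isOpen_univ
  rw [differentiableOn_univ] at h
  have he : pochInf p = fun a => ∏' i : ℕ, (1 + -(a * (p : ℂ) ^ i)) := by
    funext a
    simp only [pochInf, sub_eq_add_neg]
  rw [he]
  exact h

/-- Splitting the first factor off (1/x; p)_∞ and off (x; p)_∞ leaves the same two products on both
sides, and (1 - 1/x) = -(1 - x)/x. -/
theorem theta_inv (hp₀ : 0 < p) (hp₁ : p < 1) {x : ℂ} (hx : x ≠ 0) :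
    theta p x⁻¹ = -x⁻¹ * theta p x := by
  unfold theta
  rw [pochInf_eq_mul hp₀ hp₁ x⁻¹, pochInf_eq_mul hp₀ hp₁ x, div_inv_eq_mul, div_eq_mul_inv]
  field_simp
  ring

theorem theta_p_mul (hp₀ : 0 < p) (hp₁ : p < 1) {x : ℂ} (hx : x ≠ 0) :
    theta p (p * x) = -x⁻¹ * theta p x := by
  rw [← theta_inv hp₀ hp₁ hx]
  have hp : (p : ℂ) ≠ 0 := by exact_mod_cast hp₀.ne'
  unfold theta
  rw [mul_comm, div_inv_eq_mul]
  congr 2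
  field_simp

theorem theta_one (hp₀ : 0 < p) (hp₁ : p < 1) : theta p 1 = 0 := by
  unfold theta
  rw [pochInf_eq_mul hp₀ hp₁ 1]
  ring

theorem theta_eq_zero (hp₀ : 0 < p) (hp₁ : p < 1) {x : ℂ} (hx : x ≠ 0) (h : theta p x = 0) :
    ∃ m : ℤ, x = (p : ℂ) ^ m := by
  have hp : (p : ℂ) ≠ 0 := by exact_mod_cast hp₀.ne'
  rcases mul_eq_zero.1 h with h | h
  · obtain ⟨i, hi⟩ := pochInf_eq_zero hp₀ hp₁ h
    refine ⟨-i, ?_⟩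
    rw [zpow_neg, zpow_natCast]
    exact eq_inv_of_mul_eq_one_left hi
  · obtain ⟨i, hi⟩ := pochInf_eq_zero hp₀ hp₁ h
    refine ⟨i + 1, ?_⟩
    rw [← Nat.cast_succ, zpow_natCast, pow_succ]
    field_simp at hi
    linear_combination -hi

theorem differentiableAt_theta (hp₀ : 0 < p) (hp₁ : p < 1) {x : ℂ} (hx : x ≠ 0) :
    DifferentiableAt ℂ (theta p) x := by
  have h := differentiable_pochInf hp₀ hp₁
  unfold theta
  exact (h x).mul ((h _).comp x (by fun_prop (disch := assumption)))

/-! ### Laurent coefficients and the three-term relation -/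

/-- A continuous function on a circle all of whose Laurent coefficients vanish is zero. -/
theorem eq_zero_of_circleIntegral_eq_zero {g : ℂ → ℂ} {r : ℝ} (hr : 0 < r)
    (hg : Continuous fun t : ℝ => g (circleMap 0 r t))
    (h : ∀ k : ℤ, (∮ x in C(0, r), x ^ (-k - 1) * g x) = 0) (t : ℝ) :
    g (circleMap 0 r t) = 0 := by
  have : Fact (0 < 2 * Real.pi) := ⟨Real.two_pi_pos⟩
  have hper : Function.Periodic (fun t : ℝ => g (circleMap 0 r t)) (2 * Real.pi) := fun t => by
    change g (circleMap 0 r (t + 2 * Real.pi)) = _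
    rw [periodic_circleMap 0 r t]
  let G : C(AddCircle (2 * Real.pi), ℂ) :=
    ⟨hper.lift, continuous_coinduced_dom.2 hg⟩
  have hcoeff : ∀ n : ℤ, fourierCoeff G n = 0 := by
    intro n
    have hn := h n
    rw [circleIntegral] at hn
    rw [fourierCoeff_eq_intervalIntegral _ _ 0]
    -- On the circle dx = i x dt, so the integrand of the n-th Fourier coefficient is r^n / i times
    -- the integrand of the n-th Laurent coefficient.
    have he : ∀ x : ℝ, fourier (-n) (x : AddCircle (2 * Real.pi)) • G (x : AddCircle (2 * Real.pi)) =
        ((r : ℂ) ^ n * Complex.I⁻¹) * (deriv (circleMap 0 r) x •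
          (circleMap 0 r x ^ (-n - 1) * g (circleMap 0 r x))) := by
      intro x
      have hG : G (x : AddCircle (2 * Real.pi)) = g (circleMap 0 r x) := rfl
      have hr' : (r : ℂ) ≠ 0 := by exact_mod_cast hr.ne'
      have hc : circleMap 0 r x ≠ 0 := circleMap_ne_center hr.ne'
      have hf : fourier (-n) (x : AddCircle (2 * Real.pi)) = (r : ℂ) ^ n * circleMap 0 r x ^ (-n) := by
        rw [fourier_coe_apply, circleMap_zero, mul_zpow, ← mul_assoc, ← zpow_add₀ hr', add_neg_cancel,
          zpow_zero, one_mul, ← Complex.exp_int_mul]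
        congr 1
        have : (Real.pi : ℂ) ≠ 0 := by exact_mod_cast Real.pi_ne_zero
        push_cast
        field_simp
      rw [hG, hf, deriv_circleMap, smul_eq_mul, smul_eq_mul, zpow_sub_one₀ hc]
      have hI := Complex.I_ne_zero
      field_simp
    simp_rw [he]
    rw [intervalIntegral.integral_const_mul, zero_add, hn, mul_zero, smul_zero]
  have hs : Summable (fourierCoeff G) := by
    rw [show fourierCoeff G = 0 from funext hcoeff]
    exact summable_zero
  have h1 := has_pointwise_sum_fourier_series_of_summable hs (t : AddCircle (2 * Real.pi))
  simp only [hcoeff, zero_smul] at h1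
  exact h1.unique hasSum_zero

/-- The holomorphic functions on the punctured plane with the multiplier of a product of two theta
functions. -/
def IsThetaTwo (p : ℝ) (g : ℂ → ℂ) : Prop :=
  (∀ x, x ≠ 0 → DifferentiableAt ℂ g x) ∧ ∀ x, x ≠ 0 → g (p * x) = (x⁻¹) ^ 2 * g x

theorem circleIntegral_eq_of_punctured {g : ℂ → ℂ} (hg : ∀ x, x ≠ 0 → DifferentiableAt ℂ g x)
    {r s : ℝ} (hr : 0 < r) (hs : 0 < s) :
    (∮ x in C(0, r), g x) = ∮ x in C(0, s), g x := by
  wlog hrs : r ≤ s generalizing r s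
  · exact (this hs hr (le_of_not_ge hrs)).symm
  refine (Complex.circleIntegral_eq_of_differentiable_on_annulus_off_countable hr hrs
    Set.countable_empty ?_ ?_).symm
  · intro x hx
    refine (hg x ?_).continuousAt.continuousWithinAt
    rintro rfl
    exact hx.2 (by simpa using hr)
  · intro x hx
    refine hg x ?_
    rintro rfl
    exact hx.1.2 (by simpa using hr.le)

theorem circleIntegral_scale (g : ℂ → ℂ) (p : ℝ) :
    (∮ x in C(0, p), g x) = ∮ x in C(0, 1), p * g (p * x) := by
  simp only [circleIntegral, deriv_circleMap, circleMap_zero, smul_eq_mul]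
  congr 1
  funext t
  push_cast
  ring_nf

/-- Move the contour from |x| = 1 to |x| = p by Cauchy's theorem and substitute x ↦ px: the
multiplier x^{-2} raises the index of the coefficient by two, and the powers of p collect to p^{-k}.
-/
theorem IsThetaTwo.laurent_succ (hp₀ : 0 < p) {g : ℂ → ℂ} (hg : IsThetaTwo p g) (k : ℤ) :
    (∮ x in C(0, 1), x ^ (-(k + 2) - 1) * g x) =
      (p : ℂ) ^ k * ∮ x in C(0, 1), x ^ (-k - 1) * g x := by
  have hp : (p : ℂ) ≠ 0 := by exact_mod_cast hp₀.ne'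
  rw [circleIntegral_eq_of_punctured (g := fun x => x ^ (-k - 1) * g x) (r := 1) (s := p)
    (fun x hx => ((differentiableAt_zpow.2 (Or.inl hx))).mul (hg.1 x hx)) one_pos hp₀,
    circleIntegral_scale (fun x => x ^ (-k - 1) * g x) p, ← circleIntegral.integral_const_mul]
  apply circleIntegral.integral_congr zero_le_one
  intro x hx
  have hx0 : x ≠ 0 := by
    rintro rfl
    simp at hx
  beta_reduce
  rw [hg.2 x hx0, mul_zpow, show (-(k + 2) - 1 : ℤ) = (-k - 1) + (-2) by ring, zpow_add₀ hx0,
    show (x : ℂ) ^ (-2 : ℤ) = (x⁻¹) ^ 2 by rw [zpow_neg, inv_pow]; norm_cast,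
    show (p : ℂ) ^ (-k - 1) = ((p : ℂ) ^ k * p)⁻¹ by
      rw [zpow_sub_one₀ hp, zpow_neg, mul_inv]]
  have := zpow_ne_zero k hp
  field_simp

/-- The recursion of step two runs in both directions, so the coefficients with index 0 and 1
determine all others. In particular the space of such functions has dimension at most two. -/
theorem IsThetaTwo.eq_zero (hp₀ : 0 < p) {g : ℂ → ℂ} (hg : IsThetaTwo p g)
    (h0 : (∮ x in C(0, 1), x ^ (-(0 : ℤ) - 1) * g x) = 0)
    (h1 : (∮ x in C(0, 1), x ^ (-(1 : ℤ) - 1) * g x) = 0) {x : ℂ} (hx : x ≠ 0) : g x = 0 := by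
  have hp : (p : ℂ) ≠ 0 := by exact_mod_cast hp₀.ne'
  have hall : ∀ k : ℤ, (∮ x in C(0, 1), x ^ (-k - 1) * g x) = 0 ∧
      (∮ x in C(0, 1), x ^ (-(k + 1) - 1) * g x) = 0 := by
    intro k
    induction k using Int.induction_on with
    | zero => exact ⟨h0, by simpa using h1⟩
    | succ k ih =>
      refine ⟨ih.2, ?_⟩
      rw [add_assoc, one_add_one_eq_two, hg.laurent_succ hp₀, ih.1, mul_zero]
    | pred k ih =>
      have h2 := hg.laurent_succ hp₀ (-(k : ℤ) - 1)
      rw [show (-(k : ℤ) - 1 + 2 : ℤ) = -k + 1 by ring, ih.2] at h2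
      refine ⟨(mul_eq_zero.1 h2.symm).resolve_left (zpow_ne_zero _ hp), ?_⟩
      rw [sub_add_cancel]
      exact ih.1
  have hr : 0 < ‖x‖ := norm_pos_iff.2 hx
  have hc : Continuous fun t : ℝ => g (circleMap 0 ‖x‖ t) := by
    refine continuous_iff_continuousAt.2 fun t => ?_
    exact ContinuousAt.comp (f := fun t : ℝ => circleMap 0 ‖x‖ t)
      (hg.1 _ (circleMap_ne_center hr.ne')).continuousAt (continuous_circleMap _ _).continuousAt
  have := eq_zero_of_circleIntegral_eq_zero hr hc (fun k => by
    rw [circleIntegral_eq_of_punctured (g := fun x => x ^ (-k - 1) * g x)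
      (fun x hx => ((differentiableAt_zpow.2 (Or.inl hx))).mul (hg.1 x hx)) hr one_pos]
    exact (hall k).1) x.arg
  rwa [circleMap_zero, Complex.norm_mul_exp_arg_mul_I] at this

theorem isThetaTwo_theta_mul_theta (hp₀ : 0 < p) (hp₁ : p < 1) {y : ℂ} (hy : y ≠ 0) :
    IsThetaTwo p fun x => theta p (x * y) * theta p (x / y) := by
  refine ⟨fun x hx => ?_, fun x hx => ?_⟩
  · have h1 := (differentiableAt_theta hp₀ hp₁ (mul_ne_zero hx hy)).comp x
      (f := fun x => x * y) (by fun_prop)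
    have h2 := (differentiableAt_theta hp₀ hp₁ (div_ne_zero hx hy)).comp x
      (f := fun x => x / y) (by fun_prop)
    exact h1.mul h2
  · beta_reduce
    rw [mul_assoc, mul_div_assoc, theta_p_mul hp₀ hp₁ (mul_ne_zero hx hy),
      theta_p_mul hp₀ hp₁ (div_ne_zero hx hy)]
    field_simp

/-- Vanishing of the two free Laurent coefficients imposes two linear conditions on four unknowns.
-/
theorem exists_ne_zero_sum_theta_eq_zero (hp₀ : 0 < p) (hp₁ : p < 1) (y : Fin 4 → ℂ)
    (hy : ∀ i, y i ≠ 0) :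
    ∃ c : Fin 4 → ℂ, c ≠ 0 ∧
      ∀ x, x ≠ 0 → ∑ i, theta p (x * y i) * theta p (x / y i) * c i = 0 := by
  let coeff : ℤ → (ℂ → ℂ) → ℂ := fun k g => ∮ x in C(0, 1), x ^ (-k - 1) * g x
  let h : Fin 4 → ℂ → ℂ := fun i x => theta p (x * y i) * theta p (x / y i)
  have hh : ∀ i, IsThetaTwo p (h i) := fun i => isThetaTwo_theta_mul_theta hp₀ hp₁ (hy i)
  let A : Matrix (Fin 2) (Fin 4) ℂ := fun k i => coeff (k : ℕ) (h i)
  obtain ⟨c, hc0, hc⟩ : ∃ c : Fin 4 → ℂ, c ≠ 0 ∧ A.mulVec c = 0 := by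
    have hlt : Module.finrank ℂ (Fin 2 → ℂ) < Module.finrank ℂ (Fin 4 → ℂ) := by simp
    have hk := LinearMap.ker_ne_bot_of_finrank_lt (f := A.mulVecLin) hlt
    obtain ⟨c, hc, hc0⟩ := (Submodule.ne_bot_iff _).1 hk
    exact ⟨c, hc0, by simpa using hc⟩
  refine ⟨c, hc0, fun x hx => ?_⟩
  have hsum : IsThetaTwo p fun x => ∑ i, h i x * c i := by
    refine ⟨fun x hx => ?_, fun x hx => ?_⟩
    · exact DifferentiableAt.fun_sum fun i _ => ((hh i).1 x hx).mul_const _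
    · rw [Finset.mul_sum]
      exact Finset.sum_congr rfl fun i _ => by rw [(hh i).2 x hx, mul_assoc]
  have hci : ∀ (k : ℤ) (i : Fin 4), CircleIntegrable (fun x => x ^ (-k - 1) * h i x * c i) 0 1 := by
    intro k i
    refine ContinuousOn.circleIntegrable zero_le_one fun x hx => ?_
    have hx0 : x ≠ 0 := by
      rintro rfl
      simp at hx
    exact ((((differentiableAt_zpow.2 (Or.inl hx0))).mul
      ((hh i).1 x hx0)).mul_const _).continuousAt.continuousWithinAt
  have hco : ∀ k : Fin 2, coeff (k : ℕ) (fun x => ∑ i, h i x * c i) = 0 := by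
    intro k
    have hk := congrFun hc k
    rw [Matrix.mulVec, dotProduct, Pi.zero_apply] at hk
    rw [← hk]
    simp only [coeff, A, Finset.mul_sum, ← mul_assoc]
    rw [circleIntegral.integral_fun_sum fun i _ => hci _ i]
    refine Finset.sum_congr rfl fun i _ => ?_
    rw [mul_comm, ← circleIntegral.integral_const_mul]
    simp only [mul_comm]
  exact hsum.eq_zero hp₀ (hco 0) (hco 1) hx

/-- The Pfaffian of a singular alternating `4 × 4` matrix vanishes. -/
theorem pfaffian_eq_zero {a b c d e f : ℂ} {v : Fin 4 → ℂ} (hv : v ≠ 0)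
    (h0 : a * v 1 + b * v 2 + c * v 3 = 0) (h1 : -a * v 0 + d * v 2 + e * v 3 = 0)
    (h2 : -b * v 0 - d * v 1 + f * v 3 = 0) (h3 : -c * v 0 - e * v 1 - f * v 2 = 0) :
    a * f - b * e + c * d = 0 := by
  by_contra hne
  apply hv
  funext i
  have : ∀ i, (a * f - b * e + c * d) * v i = 0 := by
    intro i
    fin_cases i
    · simp only [Fin.zero_eta]
      linear_combination -f * h1 + e * h2 - d * h3
    · simp only [Fin.mk_one]
      linear_combination f * h0 + b * h3 - c * h2
    · simp only [Fin.reduceFinMk]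
      linear_combination -e * h0 + c * h1 - a * h3
    · simp only [Fin.reduceFinMk]
      linear_combination d * h0 - b * h1 + a * h2
  exact (mul_eq_zero.1 (this i)).resolve_left hne

/-- The left side is the Pfaffian of the alternating matrix with entries s⁻¹ θ(st) θ(s/t), where s,
t run through x, y, u, v. This matrix kills the vector of coefficients of a linear dependence among
the four functions, evaluated at the four points. -/
theorem theta_three_term (hp₀ : 0 < p) (hp₁ : p < 1) {x y u v : ℂ} (hx : x ≠ 0) (hy : y ≠ 0)
    (hu : u ≠ 0) (hv : v ≠ 0) :
    x⁻¹ * (theta p (x * y) * theta p (x / y)) * (u⁻¹ * (theta p (u * v) * theta p (u / v))) -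
      x⁻¹ * (theta p (x * u) * theta p (x / u)) * (y⁻¹ * (theta p (y * v) * theta p (y / v))) +
      x⁻¹ * (theta p (x * v) * theta p (x / v)) * (y⁻¹ * (theta p (y * u) * theta p (y / u))) =
      0 := by
  have hanti : ∀ s t : ℂ, s ≠ 0 → t ≠ 0 → theta p (s * t) * theta p (s / t) =
      -(s * t⁻¹) * (theta p (t * s) * theta p (t / s)) := by
    intro s t hs ht
    rw [← inv_div, theta_inv hp₀ hp₁ (div_ne_zero ht hs), mul_comm s t]
    field_simp
  have hdiag : ∀ s : ℂ, s ≠ 0 → theta p (s * s) * theta p (s / s) = 0 := by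
    intro s hs
    rw [div_self hs, theta_one hp₀ hp₁, mul_zero]
  obtain ⟨c, hc0, hc⟩ := exists_ne_zero_sum_theta_eq_zero hp₀ hp₁ ![x, y, u, v]
    (by intro i; fin_cases i <;> assumption)
  simp only [Fin.sum_univ_four, Matrix.cons_val_zero, Matrix.cons_val_one, Matrix.cons_val] at hc
  have e0 := hc x hx
  have e1 := hc y hy
  have e2 := hc u hu
  have e3 := hc v hv
  rw [hdiag x hx] at e0
  rw [hdiag y hy, hanti y x hy hx] at e1
  rw [hdiag u hu, hanti u x hu hx, hanti u y hu hy] at e2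
  rw [hdiag v hv, hanti v x hv hx, hanti v y hv hy, hanti v u hv hu] at e3
  refine pfaffian_eq_zero hc0 ?_ ?_ ?_ ?_
  · linear_combination x⁻¹ * e0
  · linear_combination y⁻¹ * e1 + (x⁻¹ * (theta p (x * y) * theta p (x / y)) * c 0) * (mul_inv_cancel₀ hy)
  · linear_combination u⁻¹ * e2 + (x⁻¹ * (theta p (x * u) * theta p (x / u)) * c 0 + y⁻¹ * (theta p (y * u) * theta p (y / u)) * c 1) * (mul_inv_cancel₀ hu)
  · linear_combination v⁻¹ * e3 + (x⁻¹ * (theta p (x * v) * theta p (x / v)) * c 0 + y⁻¹ * (theta p (y * v) * theta p (y / v)) * c 1 + u⁻¹ * (theta p (u * v) * theta p (u / v)) * c 2) * (mul_inv_cancel₀ hv)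

end Theta

open Filter Topology

/-! ### The odd theta function in additive notation -/

section Qp

variable {q : ℝ}

theorem qp_add (hq₀ : 0 < q) (a b : ℂ) : qp q (a + b) = qp q a * qp q b :=
  Complex.cpow_add _ _ (by exact_mod_cast hq₀.ne')

theorem qp_ne_zero (hq₀ : 0 < q) (a : ℂ) : qp q a ≠ 0 := by
  simp [qp, Complex.cpow_eq_zero_iff, hq₀.ne']

theorem qp_zero : qp q 0 = 1 := Complex.cpow_zero _

theorem qp_neg (a : ℂ) : qp q (-a) = (qp q a)⁻¹ := Complex.cpow_neg _ _

theorem qp_intCast (n : ℤ) : qp q n = (q : ℂ) ^ n := Complex.cpow_intCast _ _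

theorem differentiable_qp (hq₀ : 0 < q) : Differentiable ℂ (qp q) := fun a =>
  (hasDerivAt_id a).const_cpow (Or.inl (by exact_mod_cast hq₀.ne')) |>.differentiableAt

/-- Allows every nonzero spectral parameter to be written additively, as q^{2u}. -/
theorem exists_qp_two_mul (hq₀ : 0 < q) (hq₁ : q < 1) {z : ℂ} (hz : z ≠ 0) :
    ∃ u : ℂ, qp q (2 * u) = z := by
  have hq : (q : ℂ) ≠ 0 := by exact_mod_cast hq₀.ne'
  have hl : Complex.log q ≠ 0 := by
    rw [← Complex.ofReal_log hq₀.le]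
    exact_mod_cast (Real.log_neg hq₀ hq₁).ne
  refine ⟨Complex.log z / (2 * Complex.log q), ?_⟩
  rw [qp, Complex.cpow_def_of_ne_zero hq]
  have : Complex.log q * (2 * (Complex.log z / (2 * Complex.log q))) = Complex.log z := by
    field_simp
  rw [this, Complex.exp_log hz]

end Qp

/-- The odd theta function `q^{-u} θ(q^{2u})`. -/
def sf (p q : ℝ) (u : ℂ) : ℂ := qp q (-u) * theta p (qp q (2 * u))

section Sf

variable {p q : ℝ}

theorem theta_qp (hq₀ : 0 < q) (u : ℂ) : theta p (qp q (2 * u)) = qp q u * sf p q u := by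
  rw [sf, ← mul_assoc, ← qp_add hq₀, add_neg_cancel, qp_zero, one_mul]

theorem sf_neg (hp₀ : 0 < p) (hp₁ : p < 1) (hq₀ : 0 < q) (u : ℂ) :
    sf p q (-u) = -sf p q u := by
  rw [sf, sf, mul_neg, qp_neg (2 * u), theta_inv hp₀ hp₁ (qp_ne_zero hq₀ _), neg_neg, ← qp_neg,
    show qp q (-u) = qp q u * qp q (-(2 * u)) by rw [← qp_add hq₀]; ring_nf]
  ring

theorem sf_zero (hp₀ : 0 < p) (hp₁ : p < 1) : sf p q 0 = 0 := by
  rw [sf, mul_zero, qp_zero, theta_one hp₀ hp₁, mul_zero]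

theorem sf_ne_zero (hp₀ : 0 < p) (hp₁ : p < 1) (hq₀ : 0 < q) {u : ℂ}
    (h : ∀ m : ℤ, qp q (2 * u) ≠ (p : ℂ) ^ m) : sf p q u ≠ 0 := by
  intro h0
  rcases mul_eq_zero.1 h0 with h1 | h1
  · exact qp_ne_zero hq₀ _ h1
  · obtain ⟨m, hm⟩ := theta_eq_zero hp₀ hp₁ (qp_ne_zero hq₀ _) h1
    exact h m hm

theorem sf_intCast_ne_zero (hp₀ : 0 < p) (hp₁ : p < 1) (hq₀ : 0 < q)
    (hpq : ∀ n : ℕ, 0 < n → ∀ m : ℤ, q ^ (2 * n) ≠ p ^ m) {n : ℤ} (hn : n ≠ 0) :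
    sf p q n ≠ 0 := by
  refine sf_ne_zero hp₀ hp₁ hq₀ fun m hm => ?_
  have h2 : q ^ (2 * n) = p ^ m := by
    have : qp q (2 * (n : ℂ)) = (q : ℂ) ^ (2 * n) := by
      rw [← qp_intCast]
      push_cast
      rfl
    rw [this] at hm
    exact_mod_cast hm
  rcases lt_or_gt_of_ne hn with h | h
  · refine hpq n.natAbs (by omega) (-m) ?_
    rw [zpow_neg, ← h2, ← zpow_neg, ← zpow_natCast]
    congr 1
    push_cast
    rw [abs_of_neg h]
    ring
  · refine hpq n.natAbs (by omega) m ?_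
    rw [← h2, ← zpow_natCast]
    congr 1
    push_cast
    rw [abs_of_pos h]

theorem differentiable_sf (hp₀ : 0 < p) (hp₁ : p < 1) (hq₀ : 0 < q) :
    Differentiable ℂ (sf p q) := by
  intro u
  have h1 := differentiable_qp hq₀
  refine DifferentiableAt.mul ?_ ?_
  · exact (h1 _).comp u (by fun_prop)
  · exact (differentiableAt_theta hp₀ hp₁ (qp_ne_zero hq₀ (2 * u))).comp u
      (f := fun u => qp q (2 * u)) ((h1 (2 * u)).comp u (by fun_prop))

theorem analyticOnNhd_sf (hp₀ : 0 < p) (hp₁ : p < 1) (hq₀ : 0 < q) {g : ℂ → ℂ}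
    (hg : Differentiable ℂ g) : AnalyticOnNhd ℂ (fun l => sf p q (g l)) Set.univ :=
  (((differentiable_sf hp₀ hp₁ hq₀).comp hg).differentiableOn).analyticOnNhd isOpen_univ

theorem meromorphic_sf (hp₀ : 0 < p) (hp₁ : p < 1) (hq₀ : 0 < q) {g : ℂ → ℂ}
    (hg : Differentiable ℂ g) : Meromorphic fun l => sf p q (g l) := fun x =>
  (analyticOnNhd_sf hp₀ hp₁ hq₀ hg x (Set.mem_univ x)).meromorphicAt

/-- Since `sf` does not vanish at 1, by genericity of p and q, the composite is not identically zero
as soon as `g` takes the value 1. Its zeros are then isolated by the identity theorem. -/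
theorem eventually_sf_ne_zero (hp₀ : 0 < p) (hp₁ : p < 1) (hq₀ : 0 < q)
    (hpq : ∀ n : ℕ, 0 < n → ∀ m : ℤ, q ^ (2 * n) ≠ p ^ m) {g : ℂ → ℂ}
    (hg : Differentiable ℂ g) {x : ℂ} (hx : g x = 1) :
    ∀ᶠ l in codiscrete ℂ, sf p q (g l) ≠ 0 := by
  rcases (analyticOnNhd_sf hp₀ hp₁ hq₀ hg).eqOn_zero_or_eventually_ne_zero_of_preconnected
    isPreconnected_univ with h | h
  · have h1 := h (Set.mem_univ x)
    have h2 := sf_intCast_ne_zero hp₀ hp₁ hq₀ hpq one_ne_zero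
    rw [Int.cast_one] at h2
    simp only [hx, Pi.zero_apply] at h1
    exact absurd h1 h2
  · exact h

theorem eventually_sf_add_ne_zero (hp₀ : 0 < p) (hp₁ : p < 1) (hq₀ : 0 < q)
    (hpq : ∀ n : ℕ, 0 < n → ∀ m : ℤ, q ^ (2 * n) ≠ p ^ m) (c : ℂ) :
    ∀ᶠ l in codiscrete ℂ, sf p q (l + c) ≠ 0 :=
  eventually_sf_ne_zero hp₀ hp₁ hq₀ hpq (g := fun l => l + c) (by fun_prop) (x := 1 - c) (by ring)

theorem eventually_forall_sf_add_ne_zero (hp₀ : 0 < p) (hp₁ : p < 1) (hq₀ : 0 < q)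
    (hpq : ∀ n : ℕ, 0 < n → ∀ m : ℤ, q ^ (2 * n) ≠ p ^ m) (c : ℂ) (B : ℤ) :
    ∀ᶠ l in codiscrete ℂ, ∀ n : ℤ, -B ≤ n → n ≤ B → sf p q (l + c + n) ≠ 0 := by
  have h : ∀ᶠ l in codiscrete ℂ, ∀ n ∈ Finset.Icc (-B) B, sf p q (l + c + n) ≠ 0 := by
    rw [Filter.eventually_all_finset]
    intro n _
    simpa only [add_assoc] using eventually_sf_add_ne_zero hp₀ hp₁ hq₀ hpq (c + n)
  filter_upwards [h] with l hl n h1 h2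
  exact hl n (Finset.mem_Icc.2 ⟨h1, h2⟩)

/-- The addition formula for the odd theta function. -/
theorem sf_add_formula (hp₀ : 0 < p) (hp₁ : p < 1) (hq₀ : 0 < q) (a b c d : ℂ) :
    sf p q a * sf p q (a + 2 * b + c + d) * sf p q c * sf p q d -
      sf p q (a + b) * sf p q (a + b + c + d) * sf p q (b + c) * sf p q (b + d) +
      sf p q (a + b + c) * sf p q (a + b + d) * sf p q b * sf p q (b + c + d) = 0 := by
  have hW : ∀ s t : ℂ, (qp q (2 * s))⁻¹ * (theta p (qp q (2 * s) * qp q (2 * t)) *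
      theta p (qp q (2 * s) / qp q (2 * t))) = sf p q (s + t) * sf p q (s - t) := by
    intro s t
    rw [div_eq_mul_inv, ← qp_neg, ← qp_neg, ← qp_add hq₀, ← qp_add hq₀,
      show 2 * s + 2 * t = 2 * (s + t) by ring, show 2 * s + -(2 * t) = 2 * (s - t) by ring,
      theta_qp hq₀, theta_qp hq₀]
    have : qp q (-(2 * s)) * (qp q (s + t) * qp q (s - t)) = 1 := by
      rw [← qp_add hq₀, ← qp_add hq₀, show -(2 * s) + (s + t + (s - t)) = 0 by ring, qp_zero]
    linear_combination (sf p q (s + t) * sf p q (s - t)) * this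
  -- The four exponents are chosen so that their pairwise sums and differences are exactly the
  -- arguments in the claim; for example the first plus or minus the second gives a + 2b + c + d and
  -- a.
  have h := theta_three_term hp₀ hp₁ (qp_ne_zero hq₀ (2 * (a + b + (c + d) / 2)))
    (qp_ne_zero hq₀ (2 * (b + (c + d) / 2))) (qp_ne_zero hq₀ (2 * ((c + d) / 2)))
    (qp_ne_zero hq₀ (2 * ((d - c) / 2)))
  simp only [hW] at h
  ring_nf at h ⊢
  linear_combination h

/-! ### The `R`-matrix in additive notation and the dynamical Yang–Baxter equation -/

/-- The `R`-matrix in additive notation, multiplied by `sf (u + 1)`. -/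
def rs (p q : ℝ) : Bool → Bool → Bool → Bool → ℂ → ℂ → ℂ
  | true, true, true, true, u, _ => sf p q (u + 1)
  | false, false, false, false, u, _ => sf p q (u + 1)
  | true, false, true, false, u, l => sf p q u * sf p q (l + 2) / sf p q (l + 1)
  | false, true, true, false, u, l => sf p q 1 * sf p q (l + 1 - u) / sf p q (l + 1)
  | true, false, false, true, u, l => sf p q 1 * sf p q (l + 1 + u) / sf p q (l + 1)
  | false, true, false, true, u, l => sf p q u * sf p q l / sf p q (l + 1)
  | _, _, _, _, _, _ => 0

theorem rs_eq_zero {a b x y : Bool} (h : wt a + wt b ≠ wt x + wt y) (u l : ℂ) :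
    rs p q a b x y u l = 0 := by
  cases a <;> cases b <;> cases x <;> cases y <;> simp_all [rs, wt]

/-- Interchanging the two basis vectors amounts to the reflection l ↦ -l - 2 of the dynamical
variable. This symmetry halves the number of entries of the Yang–Baxter equation to be checked. -/
theorem rs_not (hp₀ : 0 < p) (hp₁ : p < 1) (hq₀ : 0 < q) (a b x y : Bool) (u l : ℂ) :
    rs p q (!a) (!b) (!x) (!y) u (-l - 2) = rs p q a b x y u l := by
  have e1 : sf p q (-l - 2 + 1) = -sf p q (l + 1) := by
    rw [← sf_neg hp₀ hp₁ hq₀]; ring_nf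
  have e2 : sf p q (-l - 2 + 2) = -sf p q l := by
    rw [← sf_neg hp₀ hp₁ hq₀]; ring_nf
  have e3 : sf p q (-l - 2 + 1 - u) = -sf p q (l + 1 + u) := by
    rw [← sf_neg hp₀ hp₁ hq₀]; ring_nf
  have e4 : sf p q (-l - 2 + 1 + u) = -sf p q (l + 1 - u) := by
    rw [← sf_neg hp₀ hp₁ hq₀]; ring_nf
  have e5 : sf p q (-l - 2) = -sf p q (l + 2) := by
    rw [← sf_neg hp₀ hp₁ hq₀]; ring_nf
  cases a <;> cases b <;> cases x <;> cases y <;>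
    simp only [rs, Bool.not_true, Bool.not_false, e1, e2, e3, e4, e5, mul_neg, neg_div_neg_eq]

theorem meromorphic_rs (hp₀ : 0 < p) (hp₁ : p < 1) (hq₀ : 0 < q) (a b x y : Bool) (u : ℂ) :
    Meromorphic (rs p q a b x y u) := by
  have h : ∀ {g : ℂ → ℂ}, Differentiable ℂ g → Meromorphic fun l => sf p q (g l) :=
    fun hg => meromorphic_sf hp₀ hp₁ hq₀ hg
  have hd : ∀ (c : ℂ) {f k : ℂ → ℂ}, Meromorphic f → Meromorphic k →
      Meromorphic fun l => c * f l / k l := fun c f k hf hk =>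
    ((Meromorphic.const c).mul hf).div hk
  change Meromorphic fun l => rs p q a b x y u l
  cases a <;> cases b <;> cases x <;> cases y <;> simp only [rs] <;>
    first
    | exact Meromorphic.const _
    | exact hd _ (h (by fun_prop)) (h (by fun_prop))

theorem rNum_qp (hp₀ : 0 < p) (hp₁ : p < 1) (hq₀ : 0 < q) (a b x y : Bool) (u l : ℂ) :
    rNum p q a b x y (qp q (2 * u)) l = qp q (u + 1) * rs p q a b x y u l := by
  have hz : theta p (qp q (2 * u)) = qp q u * sf p q u := theta_qp hq₀ u
  have h1 : theta p (qp q 2 * qp q (2 * u)) = qp q (u + 1) * sf p q (u + 1) := by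
    rw [← qp_add hq₀, ← theta_qp hq₀]; ring_nf
  have h2 : theta p (qp q 2) = qp q 1 * sf p q 1 := by rw [← theta_qp hq₀, mul_one]
  have h3 : theta p (qp q (-2 * (l + 1)) * qp q (2 * u)) =
      qp q (u - (l + 1)) * -sf p q (l + 1 - u) := by
    rw [← qp_add hq₀, ← sf_neg hp₀ hp₁ hq₀, neg_sub, ← theta_qp hq₀]; ring_nf
  have h4 : theta p (qp q (2 * (l + 1)) * qp q (2 * u)) =
      qp q (u + (l + 1)) * sf p q (l + 1 + u) := by
    rw [← qp_add hq₀, add_comm u, ← theta_qp hq₀]; ring_nf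
  have h5 : ∀ c : ℂ, theta p (qp q (-2 * c)) = qp q (-c) * -sf p q c := by
    intro c
    rw [← sf_neg hp₀ hp₁ hq₀, ← theta_qp hq₀]; ring_nf
  have hn : ∀ c : ℂ, qp q c ≠ 0 := qp_ne_zero hq₀
  have hs : ∀ c d : ℂ, qp q (c - d) = qp q c / qp q d := by
    intro c d
    rw [sub_eq_add_neg, qp_add hq₀, qp_neg, div_eq_mul_inv]
  have hl : qp q (l + 2) = qp q (l + 1) * qp q 1 := by rw [← qp_add hq₀]; ring_nf
  have hn1 := hn u
  have hn2 := hn (l + 1)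
  have hn3 := hn 1
  cases a <;> cases b <;> cases x <;> cases y <;> simp only [rNum, rs, mul_zero] <;>
    simp only [hz, h1, h2, h3, h4, h5, theta_qp hq₀, hs, qp_neg, mul_neg, neg_div_neg_eq] <;>
    -- At the poles both sides are 0, division by zero having value 0, so the identity holds for
    -- every l.
    by_cases h0 : sf p q (l + 1) = 0 <;>
    (try simp only [h0, mul_zero, div_zero]) <;>
    simp only [hl, qp_add hq₀ u] <;> field_simp
  rw [qp_add hq₀ l]
  field_simp [hn l]

theorem rMat_qp (hp₀ : 0 < p) (hp₁ : p < 1) (hq₀ : 0 < q) (a b x y : Bool) (u l : ℂ) :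
    rMat p q a b x y (qp q (2 * u)) l = rs p q a b x y u l / sf p q (u + 1) := by
  have h1 : theta p (qp q 2 * qp q (2 * u)) = qp q (u + 1) * sf p q (u + 1) := by
    rw [← qp_add hq₀, ← theta_qp hq₀]; ring_nf
  rw [rMat, rNum_qp hp₀ hp₁ hq₀, h1, mul_div_mul_left _ _ (qp_ne_zero hq₀ _)]

/-- The dynamical Yang–Baxter equation. -/
def YangBaxterAt (p q : ℝ) (w v l : ℂ) (a c k b d e : Bool) : Prop :=
  ∑ x : Bool, ∑ y : Bool, ∑ m : Bool, rs p q x y a c w (l - wt k) *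
      (rs p q b m x k (v + w) l * rs p q d e y m v (l - wt b)) =
    ∑ x : Bool, ∑ y : Bool, ∑ m : Bool, rs p q b d x y w l *
      (rs p q y m c k v l * rs p q x e a m (v + w) (l - wt y))

/-- Three weights ±1 have an odd sum, so this covers the entries with b + d + e equal to 1 or 3.
After clearing denominators each is trivial or a multiple of the addition formula, up to one
exception that needs two instances of it. -/
theorem yangBaxterAt_of_pos (hp₀ : 0 < p) (hp₁ : p < 1) (hq₀ : 0 < q) (w v : ℂ) {l : ℂ}
    (h0 : sf p q l ≠ 0) (h1 : sf p q (l + 1) ≠ 0) (a c k b d e : Bool)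
    (hpos : 0 ≤ wt b + wt d + wt e) : YangBaxterAt p q w v l a c k b d e := by
  have e1 : l - 1 + 1 = l := by ring
  have e2 : l - 1 + 2 = l + 1 := by ring
  have H := sf_add_formula hp₀ hp₁ hq₀
  cases b <;> cases d <;> cases e <;> (try (simp [wt] at hpos; done)) <;>
    cases a <;> cases c <;> cases k <;>
    simp only [YangBaxterAt, Fintype.sum_bool, rs, wt, Int.cast_one, mul_zero, zero_mul, add_zero,
      zero_add, e1, e2]
  all_goals try field_simp
  · have h := H (l - v - w) v w 1
    ring_nf at h ⊢
    linear_combination -sf p q 1 * h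
  · have h := H w 1 (l - v - w) v
    ring_nf at h ⊢
    linear_combination -sf p q 1 * h
  · have h := H (l - v) v 1 w
    ring_nf at h ⊢
    linear_combination sf p q 1 * sf p q (-1 + l) * h
  -- The exceptional entry: no single instance of the addition formula suffices, and the two
  -- instances enter with different coefficients.
  · have h := H 1 (l - 1) 1 1
    have h' := H v (l - v - w) w (1 + v + w)
    ring_nf at h h' ⊢
    linear_combination sf p q v * sf p q w * sf p q (1 + v + w) * h - sf p q 1 ^ 3 * h'
  · have h := H 1 w v (l - v - w)
    ring_nf at h ⊢
    linear_combination -sf p q 1 * sf p q (2 + l) * h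
  · have h := H v 1 (l - 1) w
    ring_nf at h ⊢
    linear_combination sf p q 1 * h
  · have h := H (l - w) w 1 v
    ring_nf at h ⊢
    linear_combination sf p q 1 * h

theorem yangBaxterAt (hp₀ : 0 < p) (hp₁ : p < 1) (hq₀ : 0 < q) (w v : ℂ) {l : ℂ}
    (h0 : sf p q l ≠ 0) (h1 : sf p q (l + 1) ≠ 0) (h2 : sf p q (l + 2) ≠ 0)
    (a c k b d e : Bool) : YangBaxterAt p q w v l a c k b d e := by
  by_cases hpos : 0 ≤ wt b + wt d + wt e
  · exact yangBaxterAt_of_pos hp₀ hp₁ hq₀ w v h0 h1 a c k b d e hpos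
  · have hw : ∀ b, wt (!b) = -wt b := by decide
    have e1 : -l - 2 + 1 = -(l + 1) := by ring
    have e0 : -l - 2 = -(l + 2) := by ring
    -- Negative total weight becomes positive after flipping all indices; flipping the summation
    -- indices as well only permutes the terms.
    have h := yangBaxterAt_of_pos hp₀ hp₁ hq₀ w v (l := -l - 2)
      (by rw [e0, sf_neg hp₀ hp₁ hq₀]; exact neg_ne_zero.2 h2)
      (by rw [e1, sf_neg hp₀ hp₁ hq₀]; exact neg_ne_zero.2 h1)
      (!a) (!c) (!k) (!b) (!d) (!e) (by rw [hw, hw, hw]; omega)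
    have hs : ∀ F : Bool → Bool → Bool → ℂ, ∑ x, ∑ y, ∑ m, F (!x) (!y) (!m) =
        ∑ x, ∑ y, ∑ m, F x y m := fun F => by
      simp only [Fintype.sum_bool, Bool.not_true, Bool.not_false]
      ring
    have hl : ∀ b, -l - 2 - ((wt (!b) : ℤ) : ℂ) = -(l - wt b) - 2 := fun b => by
      rw [hw]; push_cast; ring
    unfold YangBaxterAt at h ⊢
    have h' := (hs _).trans (h.trans (hs _).symm)
    simpa only [hl, rs_not hp₀ hp₁ hq₀] using h'

end Sf

/-! ### Graded coalgebras with a distinguished basis -/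

/-- A coalgebra with a basis on which the comultiplication is given by lists of pairs of basis
elements, together with a bigrading. -/
structure Alphabet (A : Type) where
  comul : A → List (A × A)
  wl : A → ℤ
  wr : A → ℤ
  diag : A → Bool
  wl_fst : ∀ x, ∀ y ∈ comul x, wl y.1 = wl x
  wr_fst : ∀ x, ∀ y ∈ comul x, wr y.1 = wl y.2
  wr_snd : ∀ x, ∀ y ∈ comul x, wr y.2 = wr x
  wl_eq_wr : ∀ x, diag x = true → wl x = wr x
  coassoc : ∀ {M : Type} [AddCommMonoid M] (F : A → A → A → M) (x : A),
    ((comul x).map fun y => ((comul y.1).map fun y' => F y'.1 y'.2 y.2).sum).sum =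
      ((comul x).map fun y => ((comul y.2).map fun y' => F y.1 y'.1 y'.2).sum).sum
  counit_left : ∀ {M : Type} [AddCommMonoid M] (F : A → M) (x : A),
    ((comul x).map fun y => if diag y.1 then F y.2 else 0).sum = F x
  counit_right : ∀ {M : Type} [AddCommMonoid M] (F : A → M) (x : A),
    ((comul x).map fun y => if diag y.2 then F y.1 else 0).sum = F x

namespace Alphabet

variable {A B : Type} (𝒜 : Alphabet A) (ℬ : Alphabet B)

section Sum

variable {M : Type} [AddCommMonoid M]

/-- `∑ F(x₁, x₂)` over the terms of the comultiplication of `x`. -/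
def sum (x : A) (F : A → A → M) : M := ((𝒜.comul x).map fun y => F y.1 y.2).sum

theorem sum_congr {x : A} {F G : A → A → M}
    (h : ∀ y z, 𝒜.wl y = 𝒜.wl x → 𝒜.wr y = 𝒜.wl z → 𝒜.wr z = 𝒜.wr x → F y z = G y z) :
    𝒜.sum x F = 𝒜.sum x G := by
  unfold sum
  congr 1
  exact List.map_congr_left fun y hy =>
    h _ _ (𝒜.wl_fst x y hy) (𝒜.wr_fst x y hy) (𝒜.wr_snd x y hy)

theorem sum_assoc (x : A) (F : A → A → A → M) :
    𝒜.sum x (fun y z => 𝒜.sum y fun y₁ y₂ => F y₁ y₂ z) =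
      𝒜.sum x (fun y z => 𝒜.sum z fun z₁ z₂ => F y z₁ z₂) := 𝒜.coassoc F x

theorem sum_add (x : A) (F G : A → A → M) :
    𝒜.sum x (fun y z => F y z + G y z) = 𝒜.sum x F + 𝒜.sum x G := by
  unfold sum
  exact List.sum_map_add

theorem sum_const_zero (x : A) : 𝒜.sum x (fun _ _ => (0 : M)) = 0 := by
  unfold sum
  exact List.sum_map_zero

theorem list_sum_map_comm {ι κ : Type} (s : List ι) (t : List κ) (F : ι → κ → M) :
    (s.map fun i => (t.map fun j => F i j).sum).sum =
      (t.map fun j => (s.map fun i => F i j).sum).sum := by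
  induction s with
  | nil => simp
  | cons a s ih => simp [ih, List.sum_map_add]

theorem sum_comm (x : A) (y : B) (F : A → A → B → B → M) :
    𝒜.sum x (fun a a' => ℬ.sum y fun b b' => F a a' b b') =
      ℬ.sum y (fun b b' => 𝒜.sum x fun a a' => F a a' b b') :=
  list_sum_map_comm _ _ _

end Sum

section SumRing

variable {D : Type} [Ring D]

theorem mul_sum (x : A) (c : D) (F : A → A → D) :
    c * 𝒜.sum x F = 𝒜.sum x fun y z => c * F y z := by
  unfold sum
  rw [← List.sum_map_mul_left]

theorem sum_mul (x : A) (c : D) (F : A → A → D) :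
    𝒜.sum x F * c = 𝒜.sum x fun y z => F y z * c := by
  unfold sum
  rw [← List.sum_map_mul_right]

end SumRing

/-- The coopposite coalgebra. -/
def cop : Alphabet A where
  comul x := (𝒜.comul x).map Prod.swap
  wl := 𝒜.wr
  wr := 𝒜.wl
  diag := 𝒜.diag
  wl_fst x y hy := by
    obtain ⟨z, hz, rfl⟩ := List.mem_map.1 hy
    exact 𝒜.wr_snd x z hz
  wr_fst x y hy := by
    obtain ⟨z, hz, rfl⟩ := List.mem_map.1 hy
    exact (𝒜.wr_fst x z hz).symm
  wr_snd x y hy := by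
    obtain ⟨z, hz, rfl⟩ := List.mem_map.1 hy
    exact 𝒜.wl_fst x z hz
  wl_eq_wr x hx := (𝒜.wl_eq_wr x hx).symm
  coassoc F x := by
    simp only [List.map_map, Function.comp_def, Prod.fst_swap, Prod.snd_swap]
    exact (𝒜.coassoc (fun a b c => F c b a) x).symm
  counit_left F x := by
    simp only [List.map_map, Function.comp_def, Prod.fst_swap, Prod.snd_swap]
    exact 𝒜.counit_right F x
  counit_right F x := by
    simp only [List.map_map, Function.comp_def, Prod.fst_swap, Prod.snd_swap]
    exact 𝒜.counit_left F x

theorem cop_sum {M : Type} [AddCommMonoid M] (x : A) (F : A → A → M) :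
    𝒜.cop.sum x F = 𝒜.sum x fun y z => F z y := by
  simp only [sum, cop, List.map_map, Function.comp_def, Prod.fst_swap, Prod.snd_swap]

/-- The comultiplication on words. -/
def wordComul : List A → List (List A × List A)
  | [] => [([], [])]
  | x :: u => (𝒜.comul x).flatMap fun y => (wordComul u).map fun v => (y.1 :: v.1, y.2 :: v.2)

theorem sum_wordComul_cons {M : Type} [AddCommMonoid M] (x : A) (u : List A)
    (F : List A × List A → M) :
    ((𝒜.wordComul (x :: u)).map F).sum =
      ((𝒜.comul x).map fun y => ((𝒜.wordComul u).map fun v =>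
        F (y.1 :: v.1, y.2 :: v.2)).sum).sum := by
  rw [wordComul, List.map_flatMap, List.flatMap_def, List.sum_flatten]
  simp only [List.map_map, Function.comp_def]

theorem mem_wordComul_cons {x : A} {u : List A} {v : List A × List A}
    (hv : v ∈ 𝒜.wordComul (x :: u)) : ∃ y ∈ 𝒜.comul x, ∃ v' ∈ 𝒜.wordComul u,
      v = (y.1 :: v'.1, y.2 :: v'.2) := by
  rw [wordComul, List.mem_flatMap] at hv
  obtain ⟨y, hy, hv⟩ := hv
  obtain ⟨v', hv', rfl⟩ := List.mem_map.1 hv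
  exact ⟨y, hy, v', hv', rfl⟩

/-- The coalgebra of words. -/
def words : Alphabet (List A) where
  comul := 𝒜.wordComul
  wl u := (u.map 𝒜.wl).sum
  wr u := (u.map 𝒜.wr).sum
  diag u := u.all 𝒜.diag
  wl_fst u := by
    induction u with
    | nil => simp [wordComul]
    | cons x u ih =>
      intro v hv
      obtain ⟨y, hy, v', hv', rfl⟩ := 𝒜.mem_wordComul_cons hv
      simp [ih v' hv', 𝒜.wl_fst x y hy]
  wr_fst u := by
    induction u with
    | nil => simp [wordComul]
    | cons x u ih =>
      intro v hv
      obtain ⟨y, hy, v', hv', rfl⟩ := 𝒜.mem_wordComul_cons hv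
      simp [ih v' hv', 𝒜.wr_fst x y hy]
  wr_snd u := by
    induction u with
    | nil => simp [wordComul]
    | cons x u ih =>
      intro v hv
      obtain ⟨y, hy, v', hv', rfl⟩ := 𝒜.mem_wordComul_cons hv
      simp [ih v' hv', 𝒜.wr_snd x y hy]
  wl_eq_wr u hu := by
    induction u with
    | nil => rfl
    | cons x u ih =>
      simp only [List.all_cons, Bool.and_eq_true] at hu
      simp [ih hu.2, 𝒜.wl_eq_wr x hu.1]
  coassoc F u := by
    induction u generalizing F with
    | nil => simp [wordComul]
    | cons x u ih =>
      simp only [sum_wordComul_cons]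
      have h1 : ∀ y : A × A, ((𝒜.wordComul u).map fun v => ((𝒜.comul y.1).map fun z =>
          ((𝒜.wordComul v.1).map fun w =>
            F (z.1 :: w.1) (z.2 :: w.2) (y.2 :: v.2)).sum).sum).sum =
          ((𝒜.comul y.1).map fun z => ((𝒜.wordComul u).map fun v =>
            ((𝒜.wordComul v.2).map fun w =>
              F (z.1 :: v.1) (z.2 :: w.1) (y.2 :: w.2)).sum).sum).sum := by
        intro y
        rw [list_sum_map_comm]
        congr 1
        exact List.map_congr_left fun z _ =>
          ih (fun a b c => F (z.1 :: a) (z.2 :: b) (y.2 :: c))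
      simp only [h1]
      rw [𝒜.coassoc fun a b c => ((𝒜.wordComul u).map fun v =>
        ((𝒜.wordComul v.2).map fun w => F (a :: v.1) (b :: w.1) (c :: w.2)).sum).sum]
      congr 1
      exact List.map_congr_left fun y _ => list_sum_map_comm _ _ _
  counit_left F u := by
    induction u generalizing F with
    | nil => simp [wordComul]
    | cons x u ih =>
      rw [sum_wordComul_cons, ← 𝒜.counit_left (fun y => F (y :: u)) x]
      congr 1
      refine List.map_congr_left fun y _ => ?_
      cases h : 𝒜.diag y.1
      · simp [h]
      · simpa [h] using ih fun v => F (y.2 :: v)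
  counit_right F u := by
    induction u generalizing F with
    | nil => simp [wordComul]
    | cons x u ih =>
      rw [sum_wordComul_cons, ← 𝒜.counit_right (fun y => F (y :: u)) x]
      congr 1
      refine List.map_congr_left fun y _ => ?_
      cases h : 𝒜.diag y.2
      · simp [h]
      · simpa [h] using ih fun v => F (y.1 :: v)

theorem words_sum_nil {M : Type} [AddCommMonoid M] (F : List A → List A → M) :
    𝒜.words.sum [] F = F [] [] := by
  simp [sum, words, wordComul]

theorem words_sum_cons {M : Type} [AddCommMonoid M] (x : A) (u : List A)
    (F : List A → List A → M) :
    𝒜.words.sum (x :: u) F =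
      𝒜.sum x fun y z => 𝒜.words.sum u fun v w => F (y :: v) (z :: w) :=
  𝒜.sum_wordComul_cons x u fun v => F v.1 v.2

theorem cop_words_sum {M : Type} [AddCommMonoid M] (u : List A) (F : List A → List A → M) :
    𝒜.cop.words.sum u F = 𝒜.words.sum u fun v w => F w v := by
  induction u generalizing F with
  | nil => simp only [words_sum_nil]
  | cons x u ih => simp only [words_sum_cons, cop_sum, ih]

end Alphabet

/-! ### Convolution -/

/-- A ring with a subring of commuting operators `K` and with shift operators normalizing it. -/
structure ShiftRing (D : Type) [Ring D] where
  T : ℤ → D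
  K : Subring D
  T_zero : T 0 = 1
  T_mul : ∀ m n, T m * T n = T (m + n)
  comm : ∀ f ∈ K, ∀ g ∈ K, f * g = g * f
  conj : ∀ n, ∀ f ∈ K, T n * f * T (-n) ∈ K

namespace ShiftRing

variable {D : Type} [Ring D] (𝒟 : ShiftRing D)

theorem T_mul_assoc (m n : ℤ) (x : D) : 𝒟.T m * (𝒟.T n * x) = 𝒟.T (m + n) * x := by
  rw [← mul_assoc, 𝒟.T_mul]

/-- The conjugate of a multiplication operator by a shift. -/
def cj (n : ℤ) (f : D) : D := 𝒟.T n * f * 𝒟.T (-n)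

theorem T_mul_eq (n : ℤ) (f : D) : 𝒟.T n * f = 𝒟.cj n f * 𝒟.T n := by
  rw [cj, mul_assoc, 𝒟.T_mul, neg_add_cancel, 𝒟.T_zero, mul_one]

theorem T_mul_eq_assoc (n : ℤ) (f x : D) : 𝒟.T n * (f * x) = 𝒟.cj n f * (𝒟.T n * x) := by
  rw [← mul_assoc, 𝒟.T_mul_eq, mul_assoc]

theorem cj_mem {f : D} (n : ℤ) (hf : f ∈ 𝒟.K) : 𝒟.cj n f ∈ 𝒟.K := 𝒟.conj n f hf

theorem cj_cj (m n : ℤ) (f : D) : 𝒟.cj m (𝒟.cj n f) = 𝒟.cj (m + n) f := by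
  simp only [cj, mul_assoc, 𝒟.T_mul]
  rw [T_mul_assoc, neg_add, add_comm (-n)]

theorem cj_zero (f : D) : 𝒟.cj 0 f = f := by
  simp [cj, 𝒟.T_zero]

end ShiftRing

section Conv

variable {D : Type} [Ring D] (𝒟 : ShiftRing D) {W : Type} (𝒲 : Alphabet W)

/-- The counit of a basis element. -/
def counitOp (x : W) : D := if 𝒲.diag x then 𝒟.T (-𝒲.wl x) else 0

/-- The functions on a graded coalgebra, with the convolution product. -/
@[ext]
structure Conv (𝒟 : ShiftRing D) (𝒲 : Alphabet W) where
  toFun : W → D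

namespace Conv

variable {𝒟 𝒲}

instance : CoeFun (Conv 𝒟 𝒲) (fun _ => W → D) := ⟨Conv.toFun⟩

instance : Zero (Conv 𝒟 𝒲) := ⟨⟨fun _ => 0⟩⟩
instance : One (Conv 𝒟 𝒲) := ⟨⟨counitOp 𝒟 𝒲⟩⟩
instance : Add (Conv 𝒟 𝒲) := ⟨fun φ ψ => ⟨fun x => φ x + ψ x⟩⟩
instance : Neg (Conv 𝒟 𝒲) := ⟨fun φ => ⟨fun x => -φ x⟩⟩
-- The inserted shift cancels the intermediate weight, which would otherwise be counted by both
-- factors. With it the counit x ↦ T_{-wt x} is a two-sided unit.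
instance : Mul (Conv 𝒟 𝒲) :=
  ⟨fun φ ψ => ⟨fun x => 𝒲.sum x fun y z => φ y * 𝒟.T (𝒲.wr y) * ψ z⟩⟩

@[simp] theorem zero_apply (x : W) : (0 : Conv 𝒟 𝒲) x = 0 := rfl
theorem one_apply (x : W) : (1 : Conv 𝒟 𝒲) x = counitOp 𝒟 𝒲 x := rfl
@[simp] theorem add_apply (φ ψ : Conv 𝒟 𝒲) (x : W) : (φ + ψ) x = φ x + ψ x := rfl
@[simp] theorem neg_apply (φ : Conv 𝒟 𝒲) (x : W) : (-φ) x = -φ x := rfl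
theorem mul_apply (φ ψ : Conv 𝒟 𝒲) (x : W) :
    (φ * ψ) x = 𝒲.sum x fun y z => φ y * 𝒟.T (𝒲.wr y) * ψ z := rfl

/-- On diagonal elements the left and right weights agree, so the shift of the counit cancels the
one inserted by the convolution, and the counit axiom of the coalgebra remains. -/
theorem counitOp_mul_sum (F : W → D) (x : W) :
    𝒲.sum x (fun y z => counitOp 𝒟 𝒲 y * 𝒟.T (𝒲.wr y) * F z) = F x := by
  rw [← 𝒲.counit_left F x]
  unfold Alphabet.sum
  congr 1
  refine List.map_congr_left fun y _ => ?_
  simp only [counitOp]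
  split_ifs with h
  · rw [𝒲.wl_eq_wr _ h, 𝒟.T_mul, neg_add_cancel, 𝒟.T_zero, one_mul]
  · rw [zero_mul, zero_mul]

theorem sum_mul_counitOp (F : W → D) (x : W) :
    𝒲.sum x (fun y z => F y * 𝒟.T (𝒲.wr y) * counitOp 𝒟 𝒲 z) = F x := by
  rw [← 𝒲.counit_right F x]
  unfold Alphabet.sum
  congr 1
  refine List.map_congr_left fun y hy => ?_
  simp only [counitOp]
  split_ifs with h
  · rw [𝒲.wr_fst x y hy, mul_assoc, 𝒟.T_mul, add_neg_cancel, 𝒟.T_zero, mul_one]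
  · rw [mul_zero]

instance : Ring (Conv 𝒟 𝒲) where
  add_assoc φ ψ χ := Conv.ext (funext fun x => add_assoc _ _ _)
  zero_add φ := Conv.ext (funext fun x => zero_add _)
  add_zero φ := Conv.ext (funext fun x => add_zero _)
  add_comm φ ψ := Conv.ext (funext fun x => add_comm _ _)
  neg_add_cancel φ := Conv.ext (funext fun x => neg_add_cancel _)
  nsmul := nsmulRec
  zsmul := zsmulRec
  left_distrib φ ψ χ := Conv.ext (funext fun x => by
    simp only [mul_apply, add_apply, mul_add, Alphabet.sum_add])
  right_distrib φ ψ χ := Conv.ext (funext fun x => by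
    simp only [mul_apply, add_apply, add_mul, Alphabet.sum_add])
  zero_mul φ := Conv.ext (funext fun x => by
    simp only [mul_apply, zero_apply, zero_mul, Alphabet.sum_const_zero])
  mul_zero φ := Conv.ext (funext fun x => by
    simp only [mul_apply, zero_apply, mul_zero, Alphabet.sum_const_zero])
  -- Associativity is coassociativity; the inserted shifts match since comultiplication preserves
  -- the outer weights.
  mul_assoc φ ψ χ := Conv.ext (funext fun x => by
    simp only [mul_apply, Alphabet.sum_mul, Alphabet.mul_sum]
    rw [← 𝒲.sum_assoc x fun a b c =>
      φ a * 𝒟.T (𝒲.wr a) * (ψ b * 𝒟.T (𝒲.wr b) * χ c)]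
    refine 𝒲.sum_congr fun y z _ hy _ => 𝒲.sum_congr fun y₁ y₂ _ _ h => ?_
    simp only [mul_assoc, h])
  one_mul φ := Conv.ext (funext fun x => counitOp_mul_sum _ x)
  mul_one φ := Conv.ext (funext fun x => sum_mul_counitOp _ x)

@[simp] theorem sub_apply (φ ψ : Conv 𝒟 𝒲) (x : W) : (φ - ψ) x = φ x - ψ x := by
  rw [sub_eq_add_neg, add_apply, neg_apply, sub_eq_add_neg]

/-- Evaluation at a basis element. -/
def evalHom (x : W) : Conv 𝒟 𝒲 →+ D where
  toFun φ := φ x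
  map_zero' := rfl
  map_add' _ _ := rfl

theorem sum_apply {ι : Type*} (s : Finset ι) (φ : ι → Conv 𝒟 𝒲) (x : W) :
    (∑ i ∈ s, φ i) x = ∑ i ∈ s, φ i x := map_sum (evalHom x) φ s

variable [Algebra ℂ D]

instance : SMul ℂ (Conv 𝒟 𝒲) := ⟨fun c φ => ⟨fun x => c • φ x⟩⟩

@[simp] theorem smul_apply (c : ℂ) (φ : Conv 𝒟 𝒲) (x : W) : (c • φ) x = c • φ x := rfl

instance : Module ℂ (Conv 𝒟 𝒲) where
  one_smul _ := Conv.ext (funext fun _ => one_smul _ _)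
  mul_smul _ _ _ := Conv.ext (funext fun _ => mul_smul _ _ _)
  smul_zero _ := Conv.ext (funext fun _ => smul_zero _)
  smul_add _ _ _ := Conv.ext (funext fun _ => smul_add _ _ _)
  add_smul _ _ _ := Conv.ext (funext fun _ => add_smul _ _ _)
  zero_smul _ := Conv.ext (funext fun _ => zero_smul _ _)

instance : Algebra ℂ (Conv 𝒟 𝒲) := Algebra.ofModule
  (fun c φ ψ => Conv.ext (funext fun x => by
    simp only [mul_apply, smul_apply, Algebra.smul_def, mul_assoc, Alphabet.mul_sum]))
  (fun c φ ψ => Conv.ext (funext fun x => by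
    simp only [mul_apply, smul_apply, Algebra.smul_def, mul_assoc, Alphabet.mul_sum]
    refine 𝒲.sum_congr fun y z _ _ _ => ?_
    rw [Algebra.left_comm (𝒟.T _) c, Algebra.left_comm (φ y) c]))

theorem algebraMap_apply (c : ℂ) (x : W) :
    (algebraMap ℂ (Conv 𝒟 𝒲) c) x = algebraMap ℂ D c * counitOp 𝒟 𝒲 x := by
  rw [Algebra.algebraMap_eq_smul_one, smul_apply, Algebra.smul_def]
  rfl

end Conv

end Conv

/-! ### Extension of a pairing from letters to words -/

section Homog

variable {D : Type} [Ring D] (𝒟 : ShiftRing D)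

/-- The elements of bidegree `(i, j)`. -/
def IsHomog (i j : ℤ) (P : D) : Prop := P = 0 ∨ (i = j ∧ ∃ f ∈ 𝒟.K, P = f * 𝒟.T (-i))

variable {𝒟}

theorem IsHomog.zero (i j : ℤ) : IsHomog 𝒟 i j 0 := Or.inl rfl

theorem IsHomog.symm {i j : ℤ} {P : D} (h : IsHomog 𝒟 i j P) : IsHomog 𝒟 j i P := by
  rcases h with h | ⟨rfl, h⟩
  · exact Or.inl h
  · exact Or.inr ⟨rfl, h⟩

theorem IsHomog.add {i j : ℤ} {P Q : D} (hP : IsHomog 𝒟 i j P) (hQ : IsHomog 𝒟 i j Q) :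
    IsHomog 𝒟 i j (P + Q) := by
  rcases hP with rfl | ⟨rfl, f, hf, rfl⟩
  · rwa [zero_add]
  · rcases hQ with rfl | ⟨_, g, hg, rfl⟩
    · rw [add_zero]
      exact Or.inr ⟨rfl, f, hf, rfl⟩
    · exact Or.inr ⟨rfl, f + g, add_mem hf hg, (add_mul _ _ _).symm⟩

theorem IsHomog.mul_T_mul {i j i' j' n : ℤ} {P Q : D} (hP : IsHomog 𝒟 i j P)
    (hQ : IsHomog 𝒟 i' j' Q) : IsHomog 𝒟 (i + i' - n) (j + j' - n) (P * 𝒟.T n * Q) := by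
  rcases hP with rfl | ⟨rfl, f, hf, rfl⟩
  · rw [zero_mul, zero_mul]
    exact .zero _ _
  · rcases hQ with rfl | ⟨rfl, g, hg, rfl⟩
    · rw [mul_zero]
      exact .zero _ _
    · refine Or.inr ⟨rfl, f * 𝒟.cj (-i + n) g, mul_mem hf (𝒟.cj_mem _ hg), ?_⟩
      rw [mul_assoc f, 𝒟.T_mul, mul_assoc, 𝒟.T_mul_eq_assoc, 𝒟.T_mul, mul_assoc]
      congr 3
      ring

theorem isHomog_alphabet_sum {A : Type} (𝒜 : Alphabet A) {i j : ℤ} {x : A} {F : A → A → D}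
    (h : ∀ y z, 𝒜.wl y = 𝒜.wl x → 𝒜.wr y = 𝒜.wl z → 𝒜.wr z = 𝒜.wr x →
      IsHomog 𝒟 i j (F y z)) : IsHomog 𝒟 i j (𝒜.sum x F) := by
  have key : ∀ s : List (A × A), (∀ y ∈ s, IsHomog 𝒟 i j (F y.1 y.2)) →
      IsHomog 𝒟 i j (s.map fun y => F y.1 y.2).sum := by
    intro s hs
    induction s with
    | nil => exact .zero _ _
    | cons y s ih =>
      rw [List.map_cons, List.sum_cons]
      exact (hs y (by simp)).add (ih fun z hz => hs z (by simp [hz]))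
  exact key _ fun y hy => h _ _ (𝒜.wl_fst x y hy) (𝒜.wr_fst x y hy) (𝒜.wr_snd x y hy)

theorem isHomog_counitOp {W : Type} (𝒲 : Alphabet W) (x : W) :
    IsHomog 𝒟 (𝒲.wl x) (𝒲.wr x) (counitOp 𝒟 𝒲 x) := by
  unfold counitOp
  split_ifs with h
  · exact Or.inr ⟨𝒲.wl_eq_wr x h, 1, one_mem _, (one_mul _).symm⟩
  · exact .zero _ _

/-- Multiplication operators commute past a homogeneous element up to a shift. -/
theorem IsHomog.mul_cj {i j : ℤ} {P : D} (hP : IsHomog 𝒟 i j P) {f : D} (hf : f ∈ 𝒟.K) (n : ℤ) :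
    P * 𝒟.cj n f = 𝒟.cj (n - j) f * P := by
  rcases hP with rfl | ⟨rfl, g, hg, rfl⟩
  · rw [zero_mul, mul_zero]
  · rw [mul_assoc, 𝒟.T_mul_eq, 𝒟.cj_cj, ← mul_assoc, ← mul_assoc,
      𝒟.comm g hg _ (𝒟.cj_mem _ hf), neg_add_eq_sub]

end Homog

section Words

variable {D : Type} [Ring D] (𝒟 : ShiftRing D) {A B : Type} (𝒜 : Alphabet A) (ℬ : Alphabet B)
  (c : A → B → D)

/-- The extension of a pairing to words in the second argument. -/
def extR (x : A) : List B → D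
  | [] => counitOp 𝒟 𝒜 x
  | y :: v => 𝒜.sum x fun x₁ x₂ => c x₁ y * 𝒟.T (𝒜.wr x₁) * extR x₂ v

/-- The extension of a pairing to words in both arguments. -/
def pairWords (u : List A) (v : List B) : D :=
  extR 𝒟 ℬ.words (fun v x => extR 𝒟 𝒜 c x v) v u

variable {𝒟 𝒜 ℬ c}

theorem counitOp_nil : counitOp 𝒟 𝒜.words [] = 1 := by
  simp [counitOp, Alphabet.words, 𝒟.T_zero]

theorem words_wl_cons (x : A) (u : List A) : 𝒜.words.wl (x :: u) = 𝒜.wl x + 𝒜.words.wl u := rfl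
theorem words_wr_cons (x : A) (u : List A) : 𝒜.words.wr (x :: u) = 𝒜.wr x + 𝒜.words.wr u := rfl
theorem words_wl_nil : 𝒜.words.wl [] = 0 := rfl
theorem words_wr_nil : 𝒜.words.wr [] = 0 := rfl

theorem words_diag_cons (x : A) (u : List A) :
    𝒜.words.diag (x :: u) = (𝒜.diag x && 𝒜.words.diag u) := rfl

theorem counitOp_cons (x : A) (u : List A) :
    counitOp 𝒟 𝒜.words (x :: u) = counitOp 𝒟 𝒜 x * counitOp 𝒟 𝒜.words u := by
  have hd := words_diag_cons (𝒜 := 𝒜) x u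
  have hw := words_wl_cons (𝒜 := 𝒜) x u
  unfold counitOp
  generalize 𝒜.words.diag (x :: u) = b at hd ⊢
  generalize 𝒜.words.wl (x :: u) = n at hw ⊢
  subst hd hw
  by_cases h : 𝒜.diag x = true
  · by_cases h' : 𝒜.words.diag u = true
    · rw [if_pos h, if_pos h', if_pos (by rw [h, h']; rfl), 𝒟.T_mul, neg_add]
    · rw [if_neg h', mul_zero, if_neg (by simp [h'])]
  · rw [if_neg h, zero_mul, if_neg (by simp [h])]

theorem extR_isHomog (hc : ∀ x y, IsHomog 𝒟 (𝒜.wl x + ℬ.wr y) (𝒜.wr x + ℬ.wl y) (c x y))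
    (x : A) (v : List B) :
    IsHomog 𝒟 (𝒜.wl x + ℬ.words.wr v) (𝒜.wr x + ℬ.words.wl v) (extR 𝒟 𝒜 c x v) := by
  induction v generalizing x with
  | nil =>
    rw [words_wr_nil, words_wl_nil, add_zero, add_zero]
    exact isHomog_counitOp 𝒜 x
  | cons y v ih =>
    refine isHomog_alphabet_sum 𝒜 fun x₁ x₂ h1 h2 h3 => ?_
    have h := (hc x₁ y).mul_T_mul (n := 𝒜.wr x₁) (ih x₂)
    convert h using 1
    · rw [words_wr_cons, h1, h2]
      ring
    · rw [words_wl_cons, h3]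
      ring

theorem extR_singleton (x : A) (y : B) : extR 𝒟 𝒜 c x [y] = c x y :=
  Conv.sum_mul_counitOp (fun x => c x y) x

theorem pairWords_isHomog
    (hc : ∀ x y, IsHomog 𝒟 (𝒜.wl x + ℬ.wr y) (𝒜.wr x + ℬ.wl y) (c x y))
    (u : List A) (v : List B) :
    IsHomog 𝒟 (𝒜.words.wl u + ℬ.words.wr v) (𝒜.words.wr u + ℬ.words.wl v)
      (pairWords 𝒟 𝒜 ℬ c u v) := by
  rw [add_comm (𝒜.words.wl u), add_comm (𝒜.words.wr u)]
  refine (extR_isHomog (fun v x => ?_) v u).symm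
  rw [add_comm (ℬ.words.wl v), add_comm (ℬ.words.wr v)]
  exact (extR_isHomog hc x v).symm

theorem pairWords_nil_left (v : List B) : pairWords 𝒟 𝒜 ℬ c [] v = counitOp 𝒟 ℬ.words v := rfl

theorem pairWords_cons_left (x : A) (u : List A) (v : List B) :
    pairWords 𝒟 𝒜 ℬ c (x :: u) v = ℬ.words.sum v fun v₁ v₂ =>
      extR 𝒟 𝒜 c x v₁ * 𝒟.T (ℬ.words.wr v₁) * pairWords 𝒟 𝒜 ℬ c u v₂ := rfl

theorem pairWords_nil_right (u : List A) :
    pairWords 𝒟 𝒜 ℬ c u [] = counitOp 𝒟 𝒜.words u := by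
  induction u with
  | nil => rw [pairWords_nil_left, counitOp_nil, counitOp_nil]
  | cons x u ih =>
    rw [pairWords_cons_left, Alphabet.words_sum_nil, ih, counitOp_cons, words_wr_nil, 𝒟.T_zero,
      mul_one]
    rfl

theorem pairWords_singleton_right (u : List A) (y : B) :
    pairWords 𝒟 𝒜 ℬ c u [y] = extR 𝒟 ℬ (fun y x => c x y) y u := by
  induction u generalizing y with
  | nil =>
    rw [pairWords_nil_left, counitOp_cons, counitOp_nil, mul_one]
    rfl
  | cons x u ih =>
    rw [pairWords_cons_left, Alphabet.words_sum_cons, extR]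
    simp only [Alphabet.words_sum_nil, extR_singleton, ih, words_wr_cons, words_wr_nil, add_zero]

theorem pairWords_singleton_left (x : A) (v : List B) :
    pairWords 𝒟 𝒜 ℬ c [x] v = extR 𝒟 𝒜 c x v := by
  rw [pairWords_cons_left]
  exact Conv.sum_mul_counitOp (fun v => extR 𝒟 𝒜 c x v) v

/-- Two homogeneous elements commute after suitable shifts. -/
theorem IsHomog.T_comm {a b m n m' n' : ℤ} {P Q : D} (hP : IsHomog 𝒟 (a + m) m' P)
    (hQ : IsHomog 𝒟 n' (n + b) Q) :
    𝒟.T a * P * 𝒟.T (b + m) * Q * 𝒟.T n = 𝒟.T b * Q * 𝒟.T (a + n) * P * 𝒟.T m := by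
  rcases hP with rfl | ⟨rfl, f, hf, rfl⟩
  · simp only [mul_zero, zero_mul]
  · rcases hQ with rfl | ⟨rfl, g, hg, rfl⟩
    · simp only [mul_zero, zero_mul]
    · have h1 : 𝒟.T a * (f * 𝒟.T (-(a + m))) * 𝒟.T (b + m) = 𝒟.cj a f * 𝒟.T b := by
        rw [𝒟.T_mul_eq_assoc, mul_assoc, 𝒟.T_mul, 𝒟.T_mul]
        congr 2
        ring
      have h2 : 𝒟.T b * (g * 𝒟.T (-(n + b))) * 𝒟.T (a + n) = 𝒟.cj b g * 𝒟.T a := by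
        rw [𝒟.T_mul_eq_assoc, mul_assoc, 𝒟.T_mul, 𝒟.T_mul]
        congr 2
        ring
      rw [h1, h2, mul_assoc (𝒟.cj a f), mul_assoc (𝒟.cj b g), 𝒟.T_mul_eq_assoc b,
        𝒟.T_mul_eq_assoc a, 𝒟.T_mul, 𝒟.T_mul, mul_assoc, mul_assoc, mul_assoc, mul_assoc, 𝒟.T_mul,
        𝒟.T_mul, ← mul_assoc, ← mul_assoc, 𝒟.comm _ (𝒟.cj_mem a hf) _ (𝒟.cj_mem b hg)]
      congr 2
      ring

/-- The definition expands the first argument letter by letter; this is the rule for expanding the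
second. In the induction both expansions are carried out, and the two inner factors, which then
occur in opposite order, are interchanged by `IsHomog.T_comm`. -/
theorem pairWords_cons_right
    (hc : ∀ x y, IsHomog 𝒟 (𝒜.wl x + ℬ.wr y) (𝒜.wr x + ℬ.wl y) (c x y))
    (u : List A) (y : B) (v : List B) :
    pairWords 𝒟 𝒜 ℬ c u (y :: v) = 𝒜.words.sum u fun u₁ u₂ =>
      pairWords 𝒟 𝒜 ℬ c u₁ [y] * 𝒟.T (𝒜.words.wr u₁) * pairWords 𝒟 𝒜 ℬ c u₂ v := by
  induction u generalizing y v with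
  | nil =>
    rw [Alphabet.words_sum_nil, pairWords_nil_left, pairWords_nil_left, pairWords_nil_left,
      words_wr_nil, 𝒟.T_zero, counitOp_cons, counitOp_cons, counitOp_nil, mul_one, mul_one]
  | cons x u ih =>
    simp only [pairWords_cons_left, Alphabet.words_sum_cons, Alphabet.words_sum_nil, ih,
      extR_singleton]
    simp only [extR, words_wr_cons, words_wr_nil, add_zero, Alphabet.sum_mul, Alphabet.mul_sum]
    -- Reorders the four independent summations so that both sides run over the same index set in
    -- the same order.
    have e1 : ∀ (F : B → B → List B → List B → A → A → List A → List A → D),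
        (ℬ.sum y fun y₁ y₂ => ℬ.words.sum v fun v₁ v₂ => 𝒜.words.sum u fun u₁ u₂ =>
          𝒜.sum x fun x₁ x₂ => F y₁ y₂ v₁ v₂ x₁ x₂ u₁ u₂) =
        𝒜.sum x fun x₁ x₂ => 𝒜.words.sum u fun u₁ u₂ => ℬ.words.sum v fun v₁ v₂ =>
          ℬ.sum y fun y₁ y₂ => F y₁ y₂ v₁ v₂ x₁ x₂ u₁ u₂ := by
      intro F
      simp only [Alphabet.sum_comm 𝒜.words 𝒜, Alphabet.sum_comm ℬ.words 𝒜,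
        Alphabet.sum_comm ℬ 𝒜]
      refine 𝒜.sum_congr fun x₁ x₂ _ _ _ => ?_
      simp only [Alphabet.sum_comm ℬ.words 𝒜.words, Alphabet.sum_comm ℬ 𝒜.words]
      refine 𝒜.words.sum_congr fun u₁ u₂ _ _ _ => ?_
      rw [Alphabet.sum_comm]
    rw [e1]
    refine 𝒜.sum_congr fun x₁ x₂ hx1 hx2 hx3 => 𝒜.words.sum_congr fun u₁ u₂ hu1 hu2 hu3 =>
      ℬ.words.sum_congr fun v₁ v₂ hv1 hv2 hv3 => ℬ.sum_congr fun y₁ y₂ hy1 hy2 hy3 => ?_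
    have hP := extR_isHomog hc x₂ v₁
    have hQ := pairWords_isHomog hc u₁ [y₂]
    rw [words_wl_cons, words_wl_nil, add_zero, ← hy2] at hQ
    rw [← hx2] at hP
    have h := hP.T_comm hQ
    simp only [mul_assoc] at h ⊢
    have h' := congrArg (fun z => c x₁ y₁ * (z * pairWords 𝒟 𝒜 ℬ c u₂ v₂)) h
    simpa only [mul_assoc] using h'

/-- The extension of a pairing to words does not depend on the argument that is extended first. -/
theorem pairWords_symm
    (hc : ∀ x y, IsHomog 𝒟 (𝒜.wl x + ℬ.wr y) (𝒜.wr x + ℬ.wl y) (c x y))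
    (u : List A) (v : List B) :
    pairWords 𝒟 ℬ 𝒜 (fun y x => c x y) v u = pairWords 𝒟 𝒜 ℬ c u v := by
  induction v generalizing u with
  | nil => rw [pairWords_nil_left, pairWords_nil_right]
  | cons y v ih =>
    rw [pairWords_cons_left, pairWords_cons_right hc]
    simp only [ih, pairWords_singleton_right]

end Words

/-! ### Moment maps and relations in the convolution algebra -/

section Moment

variable {D : Type} [Ring D] {𝒟 : ShiftRing D} {W : Type} {𝒲 : Alphabet W}

/-- The left moment map of the convolution algebra. -/
def lmu (𝒟 : ShiftRing D) (𝒲 : Alphabet W) (f : D) : Conv 𝒟 𝒲 :=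
  ⟨fun x => f * counitOp 𝒟 𝒲 x⟩

/-- The right moment map of the convolution algebra. -/
def rmu (𝒟 : ShiftRing D) (𝒲 : Alphabet W) (f : D) : Conv 𝒟 𝒲 :=
  ⟨fun x => counitOp 𝒟 𝒲 x * f⟩

theorem lmu_mul_apply (f : D) (φ : Conv 𝒟 𝒲) (x : W) : (lmu 𝒟 𝒲 f * φ) x = f * φ x := by
  have h := congrArg (fun ψ : Conv 𝒟 𝒲 => f * ψ x) (one_mul φ)
  beta_reduce at h
  rw [← h, Conv.mul_apply, Conv.mul_apply, Alphabet.mul_sum]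
  simp only [lmu, Conv.one_apply, mul_assoc]

theorem mul_rmu_apply (f : D) (φ : Conv 𝒟 𝒲) (x : W) : (φ * rmu 𝒟 𝒲 f) x = φ x * f := by
  have h := congrArg (fun ψ : Conv 𝒟 𝒲 => ψ x * f) (mul_one φ)
  beta_reduce at h
  rw [← h, Conv.mul_apply, Conv.mul_apply, Alphabet.sum_mul]
  simp only [rmu, Conv.one_apply, mul_assoc]

/-- The function has to pass the counit, which is a shift by minus the left weight; hence the
conjugation. -/
theorem rmu_mul_apply (f : D) (φ : Conv 𝒟 𝒲) (x : W) :
    (rmu 𝒟 𝒲 f * φ) x = 𝒟.cj (-𝒲.wl x) f * φ x := by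
  have h := congrArg (fun ψ : Conv 𝒟 𝒲 => 𝒟.cj (-𝒲.wl x) f * ψ x) (one_mul φ)
  beta_reduce at h
  rw [← h, Conv.mul_apply, Conv.mul_apply, Alphabet.mul_sum]
  refine 𝒲.sum_congr fun y z hy _ _ => ?_
  simp only [rmu, Conv.one_apply, counitOp]
  split_ifs with hd
  · rw [hy, 𝒟.T_mul_eq]
    simp only [mul_assoc]
  · simp

theorem mul_lmu_apply (f : D) (φ : Conv 𝒟 𝒲) (x : W) :
    (φ * lmu 𝒟 𝒲 f) x = φ x * 𝒟.cj (𝒲.wr x) f := by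
  have h := congrArg (fun ψ : Conv 𝒟 𝒲 => ψ x * 𝒟.cj (𝒲.wr x) f) (mul_one φ)
  beta_reduce at h
  rw [← h, Conv.mul_apply, Conv.mul_apply, Alphabet.sum_mul]
  refine 𝒲.sum_congr fun y z _ hyz hz => ?_
  simp only [lmu, Conv.one_apply, counitOp]
  split_ifs with hd
  · rw [hyz, 𝒲.wl_eq_wr z hd, hz, mul_assoc, mul_assoc, mul_assoc, 𝒟.T_mul_assoc,
      add_neg_cancel, 𝒟.T_zero, one_mul, ShiftRing.cj, mul_assoc]
  · simp

theorem lmu_add (f g : D) : lmu 𝒟 𝒲 (f + g) = lmu 𝒟 𝒲 f + lmu 𝒟 𝒲 g :=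
  Conv.ext (funext fun _ => add_mul _ _ _)

theorem rmu_add (f g : D) : rmu 𝒟 𝒲 (f + g) = rmu 𝒟 𝒲 f + rmu 𝒟 𝒲 g :=
  Conv.ext (funext fun _ => mul_add _ _ _)

theorem lmu_mul (f g : D) : lmu 𝒟 𝒲 (f * g) = lmu 𝒟 𝒲 f * lmu 𝒟 𝒲 g :=
  Conv.ext (funext fun x => by rw [lmu_mul_apply]; exact mul_assoc _ _ _)

theorem rmu_mul (f g : D) : rmu 𝒟 𝒲 (f * g) = rmu 𝒟 𝒲 f * rmu 𝒟 𝒲 g :=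
  Conv.ext (funext fun x => by rw [mul_rmu_apply]; exact (mul_assoc _ _ _).symm)

theorem rmu_mul_lmu {f g : D} (hf : f ∈ 𝒟.K) (hg : g ∈ 𝒟.K) :
    rmu 𝒟 𝒲 g * lmu 𝒟 𝒲 f = lmu 𝒟 𝒲 f * rmu 𝒟 𝒲 g :=
  Conv.ext (funext fun x => by
    rw [rmu_mul_apply, mul_rmu_apply]
    simp only [lmu]
    rw [← mul_assoc, 𝒟.comm _ (𝒟.cj_mem _ hg) f hf, mul_assoc, mul_assoc]
    congr 1
    have h := (isHomog_counitOp (𝒟 := 𝒟) 𝒲 x).symm.mul_cj hg 0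
    rw [𝒟.cj_zero, zero_sub] at h
    exact h.symm)

/-- The functions of bidegree `(a, b)`. -/
def ConvHomog (a b : ℤ) (φ : Conv 𝒟 𝒲) : Prop :=
  ∀ x, IsHomog 𝒟 (a + 𝒲.wr x) (b + 𝒲.wl x) (φ x)

theorem ConvHomog.lmu_mul {a b : ℤ} {φ : Conv 𝒟 𝒲} (hφ : ConvHomog a b φ) {f : D}
    (hf : f ∈ 𝒟.K) : lmu 𝒟 𝒲 f * φ = φ * lmu 𝒟 𝒲 (𝒟.cj a f) :=
  Conv.ext (funext fun x => by
    rw [lmu_mul_apply, mul_lmu_apply, 𝒟.cj_cj, (hφ x).symm.mul_cj hf,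
      show 𝒲.wr x + a - (a + 𝒲.wr x) = 0 by ring, 𝒟.cj_zero])

theorem ConvHomog.rmu_mul {a b : ℤ} {φ : Conv 𝒟 𝒲} (hφ : ConvHomog a b φ) {f : D}
    (hf : f ∈ 𝒟.K) : rmu 𝒟 𝒲 f * φ = φ * rmu 𝒟 𝒲 (𝒟.cj b f) :=
  Conv.ext (funext fun x => by
    rw [rmu_mul_apply, mul_rmu_apply, (hφ x).mul_cj hf, show b - (b + 𝒲.wl x) = -𝒲.wl x by ring])

end Moment

/-! ### Matrices of functionals: propagation of the exchange and determinant relations from letters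
to words. -/

section Family

variable {D : Type} [Ring D] {𝒟 : ShiftRing D} {B : Type} {ℬ : Alphabet B} {I : Type} [Fintype I]
  [DecidableEq I]

/-- A matrix of functions on words that is comultiplicative in the word. -/
structure MultFamily (ω : I → ℤ) (a : I → I → Conv 𝒟 ℬ.words) : Prop where
  nil : ∀ i j, a i j [] = if i = j then 𝒟.T (-ω i) else 0
  cons : ∀ i j y v, a i j (y :: v) = ∑ k, a i k [y] * 𝒟.T (ω k) * a k j v
  homog : ∀ i j, ConvHomog (ω i) (ω j) (a i j)

/-- A matrix of words that comultiplies like the entries of a corepresentation matrix yields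
functionals with the matrix product rule in the other argument. -/
theorem multFamily_pairWords {A : Type} {𝒜 : Alphabet A} {c : A → B → D}
    (hc : ∀ x y, IsHomog 𝒟 (𝒜.wl x + ℬ.wr y) (𝒜.wr x + ℬ.wl y) (c x y)) {ω : I → ℤ}
    (u : I → I → List A)
    (hu : ∀ i j (F : List A → List A → D),
      𝒜.words.sum (u i j) F = ∑ k, F (u i k) (u k j))
    (hl : ∀ i j, 𝒜.words.wl (u i j) = ω i) (hr : ∀ i j, 𝒜.words.wr (u i j) = ω j)
    (hd : ∀ i j, 𝒜.words.diag (u i j) = decide (i = j)) :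
    MultFamily ω fun i j => (⟨pairWords 𝒟 𝒜 ℬ c (u i j)⟩ : Conv 𝒟 ℬ.words) where
  nil i j := by
    simp only [pairWords_nil_right, counitOp, hl, hd, decide_eq_true_eq]
  cons i j y v := by
    simp only [pairWords_cons_right hc _ y v, hu, hr]
  homog i j v := by
    have h := pairWords_isHomog hc (u i j) v
    rwa [hl, hr] at h

/-- An intertwiner for each letter is an intertwiner for each word. In the induction step ρ is
carried through the first letter by the base case, then through the rest of the word by the
induction hypothesis. That ρ vanishes between different weights lets the shifts on the two sides be
identified. -/
theorem MultFamily.rll {ω : I → ℤ} {a b : I → I → Conv 𝒟 ℬ.words} (ha : MultFamily ω a)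
    (hb : MultFamily ω b) {ρ : I → I → D} (hρ : ∀ i j, ρ i j ∈ 𝒟.K)
    (hρ0 : ∀ i j, ω i ≠ ω j → ρ i j = 0)
    (hbase : ∀ y i j, ∑ k, ρ k i * a k j [y] = ∑ k, 𝒟.cj (-ℬ.wl y) (ρ j k) * b i k [y])
    (i j : I) :
    ∑ k, lmu 𝒟 _ (ρ k i) * a k j = ∑ k, rmu 𝒟 _ (ρ j k) * b i k := by
  refine Conv.ext (funext fun v => ?_)
  rw [Conv.sum_apply, Conv.sum_apply]
  simp only [lmu_mul_apply, rmu_mul_apply]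
  induction v generalizing i j with
  | nil =>
    simp only [ha.nil, hb.nil, mul_ite, mul_zero, Finset.sum_ite_eq, Finset.sum_ite_eq',
      Finset.mem_univ, if_true, words_wl_nil, neg_zero, 𝒟.cj_zero]
    by_cases h : ω j = ω i
    · rw [h]
    · rw [hρ0 j i h, zero_mul, zero_mul]
  | cons y v ih =>
    have h1 : ∀ m k, 𝒟.cj (-ℬ.wl y) (ρ m k) * b i k [y] * 𝒟.T (ω m) =
        b i k [y] * 𝒟.T (ω k) * ρ m k := by
      intro m k
      by_cases h : ω m = ω k
      · have hh := (hb.homog i k [y]).mul_cj (hρ m k) (ω k)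
        rw [show ω k - (ω k + ℬ.words.wl [y]) = -ℬ.wl y by
          rw [words_wl_cons, words_wl_nil]; ring] at hh
        rw [← hh, h, mul_assoc, ← 𝒟.T_mul_eq, mul_assoc]
      · simp only [hρ0 m k h, mul_zero, ShiftRing.cj, zero_mul]
    -- The conjugation by the weight of the tail becomes, after passing the first letter, the
    -- conjugation by the weight of the whole word.
    have h2 : ∀ k m, b i k [y] * 𝒟.T (ω k) * 𝒟.cj (-ℬ.words.wl v) (ρ j m) =
        𝒟.cj (-(ℬ.words.wl (y :: v))) (ρ j m) * (b i k [y] * 𝒟.T (ω k)) := by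
      intro k m
      rw [mul_assoc, 𝒟.T_mul_eq, 𝒟.cj_cj, ← mul_assoc,
        (hb.homog i k [y]).mul_cj (hρ j m), words_wl_cons, words_wl_nil, words_wl_cons,
        show ω k + -ℬ.words.wl v - (ω k + (ℬ.wl y + 0)) = -(ℬ.wl y + ℬ.words.wl v) by ring,
        mul_assoc]
    calc ∑ k, ρ k i * a k j (y :: v)
        = ∑ m, (∑ k, ρ k i * a k m [y]) * 𝒟.T (ω m) * a m j v := by
          rw [Finset.sum_congr rfl fun k _ => by rw [ha.cons k j y v]]
          simp only [Finset.mul_sum, Finset.sum_mul]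
          rw [Finset.sum_comm]
          simp only [mul_assoc]
      _ = ∑ k, b i k [y] * 𝒟.T (ω k) * ∑ m, ρ m k * a m j v := by
          simp only [hbase, Finset.sum_mul, h1, Finset.mul_sum]
          rw [Finset.sum_comm]
          simp only [mul_assoc]
      _ = ∑ m, 𝒟.cj (-(ℬ.words.wl (y :: v))) (ρ j m) * b i m (y :: v) := by
          have h3 := fun m => hb.cons i m y v
          generalize y :: v = v' at *
          simp only [ih, Finset.mul_sum, h3]
          rw [Finset.sum_comm]
          refine Finset.sum_congr rfl fun m _ => Finset.sum_congr rfl fun k _ => ?_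
          rw [← mul_assoc, h2, mul_assoc]

/-- The vector s is a left eigenvector of the matrix of functionals with eigenvalue d, so d is
multiplicative like any one-dimensional constituent. Where s is nonzero the weight is zero, and the
inserted shift disappears. -/
theorem MultFamily.det_row {ω : I → ℤ} {a : I → I → Conv 𝒟 ℬ.words} (ha : MultFamily ω a)
    {s : I → ℤ} (hs : ∀ i, s i ≠ 0 → ω i = 0) {d : Conv 𝒟 ℬ.words}
    (hd : ∀ j, ∑ i, s i • a i j = s j • d) {j₀ : I} (hj : s j₀ = 1) (y : B) (v : List B) :
    d (y :: v) = d [y] * d v := by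
  have hd' : ∀ v, ∀ j, ∑ i, s i • a i j v = s j • d v := by
    intro v j
    have h := congrArg (Conv.evalHom v) (hd j)
    simp only [map_sum, map_zsmul] at h
    exact h
  have e : ∀ v, d v = ∑ i, s i • a i j₀ v := fun v => by rw [hd' v j₀, hj, one_smul]
  rw [e (y :: v), e v, Finset.sum_congr rfl fun i _ => by rw [ha.cons i j₀ y v]]
  simp only [Finset.smul_sum, Finset.mul_sum]
  rw [Finset.sum_comm]
  refine Finset.sum_congr rfl fun k _ => ?_
  have h := hd' [y] k
  simp only [← smul_mul_assoc, ← Finset.sum_mul]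
  rw [h]
  by_cases hk : s k = 0
  · simp [hk]
  · rw [hs k hk, 𝒟.T_zero, mul_one, smul_mul_assoc, mul_smul_comm]

/-- The same for right eigenvectors, which is the form met in the first argument, where the
coopposite transposes matrices. -/
theorem MultFamily.det_col {ω : I → ℤ} {a : I → I → Conv 𝒟 ℬ.words} (ha : MultFamily ω a)
    {s : I → ℤ} (hs : ∀ i, s i ≠ 0 → ω i = 0) {d : Conv 𝒟 ℬ.words}
    (hd : ∀ i, ∑ j, s j • a i j = s i • d) {i₀ : I} (hi : s i₀ = 1) (y : B) (v : List B) :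
    d (y :: v) = d [y] * d v := by
  have hd' : ∀ v, ∀ i, ∑ j, s j • a i j v = s i • d v := by
    intro v i
    have h := congrArg (Conv.evalHom v) (hd i)
    simp only [map_sum, map_zsmul] at h
    exact h
  have e : ∀ v, d v = ∑ j, s j • a i₀ j v := fun v => by rw [hd' v i₀, hi, one_smul]
  rw [e (y :: v), e [y], Finset.sum_congr rfl fun j _ => by rw [ha.cons i₀ j y v]]
  simp only [Finset.smul_sum, Finset.sum_mul]
  rw [Finset.sum_comm]
  refine Finset.sum_congr rfl fun k _ => ?_
  have h := hd' v k
  simp only [← mul_smul_comm, ← Finset.mul_sum]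
  rw [h]
  by_cases hk : s k = 0
  · simp [hk]
  · rw [hs k hk, 𝒟.T_zero, mul_one, smul_mul_assoc, mul_smul_comm]

end Family

/-! ### Difference operators as a shift ring -/

/-- The range of a map that respects the ring operations. -/
def rangeSubring {R D : Type} [Ring R] [Ring D] (m : R → D) (h1 : m 1 = 1)
    (hm : ∀ f g, m (f * g) = m f * m g) (h0 : m 0 = 0) (ha : ∀ f g, m (f + g) = m f + m g)
    (hn : ∀ f, m (-f) = -m f) : Subring D where
  carrier := Set.range m
  mul_mem' := by
    rintro _ _ ⟨f, rfl⟩ ⟨g, rfl⟩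
    exact ⟨f * g, hm f g⟩
  one_mem' := ⟨1, h1⟩
  add_mem' := by
    rintro _ _ ⟨f, rfl⟩ ⟨g, rfl⟩
    exact ⟨f + g, ha f g⟩
  zero_mem' := ⟨0, h0⟩
  neg_mem' := by
    rintro _ ⟨f, rfl⟩
    exact ⟨-f, hn f⟩

/-- The shifts by integers and the multiplication operators. -/
def opRing : ShiftRing Op where
  T n := T n
  K := rangeSubring mulOp mulOp_one mulOp_mul mulOp_zero mulOp_add mulOp_neg
  T_zero := by rw [Int.cast_zero, T_zero]
  T_mul m n := by rw [T_mul_T, Int.cast_add]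
  comm := by
    rintro _ ⟨f, rfl⟩ _ ⟨g, rfl⟩
    exact mulOp_comm f g
  conj := by
    rintro n _ ⟨f, rfl⟩
    refine ⟨shift n f, ?_⟩
    rw [T_mul_mulOp, mul_assoc, T_mul_T, Int.cast_neg, add_neg_cancel, T_zero, mul_one]

theorem opRing_T (n : ℤ) : opRing.T n = T n := rfl

theorem mulOp_mem (f : Mero) : mulOp f ∈ opRing.K := ⟨f, rfl⟩

theorem opRing_cj (n : ℤ) (f : Mero) : opRing.cj n (mulOp f) = mulOp (shift n f) := by
  rw [ShiftRing.cj, opRing_T, opRing_T, T_mul_mulOp, mul_assoc, T_mul_T, Int.cast_neg,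
    add_neg_cancel, T_zero, mul_one]

theorem isHomog_iff_mem_opPart {i j : ℤ} {P : Op} : IsHomog opRing i j P ↔ P ∈ opPart i j := by
  constructor
  · rintro (h | ⟨h, _, ⟨f, rfl⟩, rfl⟩)
    · exact Or.inl h
    · refine Or.inr ⟨h, f, ?_⟩
      rw [opRing_T, Int.cast_neg]
  · rintro (h | ⟨h, f, rfl⟩)
    · exact Or.inl h
    · refine Or.inr ⟨h, _, mulOp_mem f, ?_⟩
      rw [opRing_T, Int.cast_neg]

/-- The difference operator `f T_n`. -/
def op (f : ℂ → ℂ) (n : ℤ) : Op := mulOp (Mero.of f) * opRing.T n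

theorem op_congr {f g : ℂ → ℂ} (hf : Meromorphic f) (h : f =ᶠ[codiscrete ℂ] g) (n : ℤ) :
    op f n = op g n := by
  rw [op, op, Mero.of_congr hf h]

theorem op_add {f g : ℂ → ℂ} (hf : Meromorphic f) (hg : Meromorphic g) (n : ℤ) :
    op f n + op g n = op (fun l => f l + g l) n := by
  rw [op, op, op, ← Mero.of_add hf hg, mulOp_add, add_mul]

theorem op_zero (n : ℤ) : op (fun _ => 0) n = 0 := by
  rw [op, Mero.of_zero, mulOp_zero, zero_mul]

theorem op_sum {ι : Type*} (s : Finset ι) {f : ι → ℂ → ℂ} (hf : ∀ i, Meromorphic (f i)) (n : ℤ) :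
    ∑ i ∈ s, op (f i) n = op (fun l => ∑ i ∈ s, f i l) n := by
  rw [op, ← Mero.of_sum s hf, mulOp_sum, Finset.sum_mul]
  rfl

theorem mulOp_mul_op {f g : ℂ → ℂ} (hf : Meromorphic f) (hg : Meromorphic g) (n : ℤ) :
    mulOp (Mero.of f) * op g n = op (fun l => f l * g l) n := by
  rw [op, ← mul_assoc, ← mulOp_mul, Mero.of_mul hf hg, op]

theorem op_mul_T (f : ℂ → ℂ) (m n : ℤ) : op f m * opRing.T n = op f (m + n) := by
  rw [op, mul_assoc, opRing.T_mul, op]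

theorem op_mul_op {f g : ℂ → ℂ} (hf : Meromorphic f) (hg : Meromorphic g) (m n : ℤ) :
    op f m * op g n = op (fun l => f l * g (l + m)) (m + n) := by
  rw [op, op, opRing_T, opRing_T, mulOp_T_mul, shift_of hg, Mero.of_mul hf (meromorphic_comp_add hg _),
    op, opRing_T, Int.cast_add]

theorem op_const (c : ℂ) (n : ℤ) : op (fun _ => c) n = c • opRing.T n := by
  rw [op, Mero.of_const, mulOp_algebraMap, ← Algebra.smul_def]

theorem cj_of {f : ℂ → ℂ} (hf : Meromorphic f) (n : ℤ) :
    opRing.cj n (mulOp (Mero.of f)) = mulOp (Mero.of fun l => f (l + n)) := by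
  rw [opRing_cj, shift_of hf]

/-! ### The letters as a graded coalgebra -/

section Letters

variable {q : ℝ} (Ω : SpectralSet q)

/-- The letters as an alphabet. -/
def letters : Alphabet (Letter Ω) where
  comul := Letter.comul
  wl := Letter.wtL
  wr := Letter.wtR
  diag | .L a b _ => a == b
       | .detInv _ => true
  wl_fst x y hy := by
    cases x with
    | L a b z => simp only [Letter.comul, List.mem_cons, List.not_mem_nil, or_false] at hy
                 rcases hy with rfl | rfl <;> rfl
    | detInv z => simp only [Letter.comul, List.mem_cons, List.not_mem_nil, or_false] at hy
                  subst hy; rfl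
  wr_fst x y hy := by
    cases x with
    | L a b z => simp only [Letter.comul, List.mem_cons, List.not_mem_nil, or_false] at hy
                 rcases hy with rfl | rfl <;> rfl
    | detInv z => simp only [Letter.comul, List.mem_cons, List.not_mem_nil, or_false] at hy
                  subst hy; rfl
  wr_snd x y hy := by
    cases x with
    | L a b z => simp only [Letter.comul, List.mem_cons, List.not_mem_nil, or_false] at hy
                 rcases hy with rfl | rfl <;> rfl
    | detInv z => simp only [Letter.comul, List.mem_cons, List.not_mem_nil, or_false] at hy
                  subst hy; rfl
  wl_eq_wr x hx := by
    cases x with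
    | L a b z => rw [beq_iff_eq] at hx
                 subst hx; rfl
    | detInv z => rfl
  coassoc F x := by
    cases x with
    | L a b z => simp only [Letter.comul, List.map_cons, List.map_nil, List.sum_cons,
                   List.sum_nil, add_zero]
                 exact add_add_add_comm _ _ _ _
    | detInv z => rfl
  counit_left F x := by
    cases x with
    | L a b z => cases a <;> simp [Letter.comul]
    | detInv z => simp [Letter.comul]
  counit_right F x := by
    cases x with
    | L a b z => cases b <;> simp [Letter.comul]
    | detInv z => simp [Letter.comul]

variable {Ω}

theorem letters_sum_L {M : Type} [AddCommMonoid M] (a b : Bool) (z : Ω.Pt)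
    (F : Letter Ω → Letter Ω → M) :
    (letters Ω).sum (.L a b z) F = ∑ m : Bool, F (.L a m z) (.L m b z) := by
  simp [Alphabet.sum, letters, Letter.comul]

theorem letters_sum_detInv {M : Type} [AddCommMonoid M] (z : Ω.Pt)
    (F : Letter Ω → Letter Ω → M) :
    (letters Ω).sum (.detInv z) F = F (.detInv z) (.detInv z) := by
  simp [Alphabet.sum, letters, Letter.comul]

theorem comulWord_eq (u : List (Letter Ω)) : comulWord u = (letters Ω).wordComul u := by
  induction u with
  | nil => rfl
  | cons x u ih => rw [comulWord, Alphabet.wordComul, ih]; rfl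

theorem sum_comulWord {M : Type} [AddCommMonoid M] (u : List (Letter Ω))
    (F : List (Letter Ω) → List (Letter Ω) → M) :
    ((comulWord u).map fun v => F v.1 v.2).sum = (letters Ω).words.sum u F := by
  rw [comulWord_eq]
  rfl

theorem counit_eq (x : Letter Ω) : x.counit = counitOp opRing (letters Ω) x := by
  cases x with
  | L a b z =>
    cases a <;> cases b <;> simp [Letter.counit, counitOp, letters, opRing_T, Letter.wtL]
  | detInv z => simp [Letter.counit, counitOp, letters, Letter.wtL, opRing.T_zero]

theorem counitWord_eq (u : List (Letter Ω)) :
    counitWord u = counitOp opRing (letters Ω).words u := by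
  induction u with
  | nil => rw [counitOp_nil]; rfl
  | cons x u ih => rw [counitOp_cons, ← counit_eq, ← ih]; rfl

theorem counitOp_cop {A : Type} (𝒜 : Alphabet A) (x : A) :
    counitOp opRing 𝒜.cop x = counitOp opRing 𝒜 x := by
  unfold counitOp
  by_cases h : 𝒜.diag x = true
  · rw [if_pos h, if_pos (show 𝒜.cop.diag x = true from h), 𝒜.wl_eq_wr x h]
    rfl
  · rw [if_neg h, if_neg (show ¬ 𝒜.cop.diag x = true from h)]

theorem counitOp_cop_words {A : Type} (𝒜 : Alphabet A) (u : List A) :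
    counitOp opRing 𝒜.cop.words u = counitOp opRing 𝒜.words u :=
  counitOp_cop 𝒜.words u

end Letters

/-! ### The pairing on letters -/

/-- The conditions on the two nomes. -/
structure Nomes (p q : ℝ) : Prop where
  p_pos : 0 < p
  p_lt : p < 1
  q_pos : 0 < q
  q_lt : q < 1
  generic : ∀ n : ℕ, 0 < n → ∀ m : ℤ, q ^ (2 * n) ≠ p ^ m

/-- The parameters `u` at which the entries of the `R`-matrix and their shifts are regular. -/
def Generic (p q : ℝ) (u : ℂ) : Prop := ∀ n : ℤ, sf p q (u + n) ≠ 0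

/-- The quotient of two shifted theta functions. -/
def thetaRatio (p q : ℝ) (a b : ℤ) (x : ℂ) : ℂ :=
  qp q (b - a) * (theta p (qp q (2 * a) * x) / theta p (qp q (2 * b) * x))

/-- The entries of the `R`-matrix in additive notation. -/
def rm (p q : ℝ) (a b x y : Bool) (u l : ℂ) : ℂ := rs p q a b x y u l / sf p q (u + 1)

section Basic

variable {p q : ℝ}

theorem thetaRatio_qp (H : Nomes p q) (a b : ℤ) (u : ℂ) :
    thetaRatio p q a b (qp q (2 * u)) = sf p q (u + a) / sf p q (u + b) := by
  have h : ∀ n : ℤ, theta p (qp q (2 * n) * qp q (2 * u)) = qp q (u + n) * sf p q (u + n) := by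
    intro n
    rw [← qp_add H.q_pos, ← theta_qp H.q_pos]
    ring_nf
  rw [thetaRatio, h, h, show u + b = b - a + (u + a) by ring, qp_add H.q_pos (b - a),
    mul_assoc (qp q (b - a)),
    ← mul_div_assoc, mul_div_mul_left _ _ (qp_ne_zero H.q_pos _),
    mul_div_mul_left _ _ (qp_ne_zero H.q_pos _)]

theorem meromorphic_rm (H : Nomes p q) (a b x y : Bool) (u : ℂ) : Meromorphic (rm p q a b x y u) := fun l =>
  (meromorphic_rs H.p_pos H.p_lt H.q_pos a b x y u l).div (MeromorphicAt.const _ _)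

theorem rm_eq_zero {a b x y : Bool} (h : wt a + wt b ≠ wt x + wt y) (u l : ℂ) :
    rm p q a b x y u l = 0 := by
  rw [rm, rs_eq_zero h, zero_div]

theorem rMat_eq_rm (H : Nomes p q) (a b x y : Bool) (u : ℂ) :
    rMat p q a b x y (qp q (2 * u)) = rm p q a b x y u :=
  funext fun l => rMat_qp H.p_pos H.p_lt H.q_pos a b x y u l

theorem rNum_eq_rs (H : Nomes p q) (a b x y : Bool) (u : ℂ) :
    rNum p q a b x y (qp q (2 * u)) = fun l => qp q (u + 1) * rs p q a b x y u l :=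
  funext fun l => rNum_qp H.p_pos H.p_lt H.q_pos a b x y u l

theorem meromorphic_rNum (H : Nomes p q) (a b x y : Bool) {z : ℂ} (hz : z ≠ 0) :
    Meromorphic (rNum p q a b x y z) := by
  obtain ⟨u, rfl⟩ := exists_qp_two_mul H.q_pos H.q_lt hz
  rw [rNum_eq_rs H]
  exact fun l => (MeromorphicAt.const _ _).mul (meromorphic_rs H.p_pos H.p_lt H.q_pos a b x y u l)

/-- The shift that comes out of the composition is -wt c - wt k + wt m. Where the first entry is
nonzero, weight conservation makes it -wt y, which is how the Yang–Baxter equation is written;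
elsewhere both sides vanish. -/
theorem op_rm_mul_left (H : Nomes p q) (y m c k x e a : Bool) (u v : ℂ) :
    op (rm p q y m c k u) (-wt c - wt k) * opRing.T (wt m) *
        op (rm p q x e a m v) (-wt a - wt m) =
      op (fun l => rm p q y m c k u l * rm p q x e a m v (l - wt y)) (-wt a - wt c - wt k) := by
  rw [op_mul_T, op_mul_op (meromorphic_rm H _ _ _ _ _) (meromorphic_rm H _ _ _ _ _)]
  have e : (fun l => rm p q y m c k u l * rm p q x e a m v
        (l + ((-wt c - wt k + wt m : ℤ) : ℂ))) =
      fun l => rm p q y m c k u l * rm p q x e a m v (l - wt y) := by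
    funext l
    by_cases h : wt y + wt m = wt c + wt k
    · rw [show -wt c - wt k + wt m = -wt y by linarith, Int.cast_neg, ← sub_eq_add_neg]
    · rw [rm_eq_zero h, zero_mul, zero_mul]
  rw [e]
  congr 1
  ring

theorem op_rm_mul_right (H : Nomes p q) (j b m x d i y : Bool) (u v : ℂ) :
    op (rm p q j b m x u) (-wt m - wt x) * opRing.T (wt m) *
        op (rm p q m d i y v) (-wt i - wt y) =
      op (fun l => rm p q j b m x u l * rm p q m d i y v (l - wt x)) (-wt i - wt x - wt y) := by
  rw [op_mul_T, op_mul_op (meromorphic_rm H _ _ _ _ _) (meromorphic_rm H _ _ _ _ _)]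
  have e : -wt m - wt x + wt m = -wt x := by ring
  rw [e]
  congr 1
  · funext l
    rw [Int.cast_neg, ← sub_eq_add_neg]
  · ring

theorem meromorphic_rm_mul (H : Nomes p q) (y m c k x e a n : Bool) (u v t : ℂ) :
    Meromorphic fun l => rm p q y m c k u l * rm p q x e a n v (l - t) := by
  have h := meromorphic_comp_add (meromorphic_rm H x e a n v) (-t)
  exact fun l => (meromorphic_rm H y m c k u l).mul (by simpa only [sub_eq_add_neg] using h l)

theorem eventually_yangBaxter (H : Nomes p q) (w v : ℂ) :
    ∀ᶠ l in codiscrete ℂ, ∀ a c k b d e, YangBaxterAt p q w v l a c k b d e := by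
  filter_upwards [eventually_sf_add_ne_zero H.p_pos H.p_lt H.q_pos H.generic 0,
    eventually_sf_add_ne_zero H.p_pos H.p_lt H.q_pos H.generic 1,
    eventually_sf_add_ne_zero H.p_pos H.p_lt H.q_pos H.generic 2] with l h0 h1 h2
  rw [add_zero] at h0
  exact fun a c k b d e => yangBaxterAt H.p_pos H.p_lt H.q_pos w v h0 h1 h2 a c k b d e

/-- The scaled sums that occur in the exchange relations, as a single difference operator. -/
theorem sum_mulOp_mul_op {f : Bool × Bool → ℂ → ℂ} {g : Bool × Bool → Bool → ℂ → ℂ}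
    {n : Bool × Bool → ℤ} {n₀ : ℤ} (hf : ∀ k, Meromorphic (f k)) (hg : ∀ k m, Meromorphic (g k m))
    (hn : ∀ k, n k ≠ n₀ → f k = fun _ => 0) :
    ∑ k, mulOp (Mero.of (f k)) * ∑ m, op (g k m) (n k) =
      op (fun l => ∑ x, ∑ y, ∑ m, f (x, y) l * g (x, y) m l) n₀ := by
  have h : ∀ k, mulOp (Mero.of (f k)) * ∑ m, op (g k m) (n k) =
      op (fun l => ∑ m, f k l * g k m l) n₀ := by
    intro k
    by_cases hk : n k = n₀
    · rw [hk, Finset.mul_sum, ← op_sum _ (f := fun m l => f k l * g k m l)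
        fun m l => (hf k l).mul (hg k m l)]
      exact Finset.sum_congr rfl fun m _ => mulOp_mul_op (hf k) (hg k m) _
    · rw [hn k hk, Mero.of_zero, mulOp_zero, zero_mul]
      simp only [zero_mul, Finset.sum_const_zero]
      rw [op_zero]
  rw [Finset.sum_congr rfl fun k _ => h k,
    op_sum _ (f := fun k l => ∑ m, f k l * g k m l) fun k l => MeromorphicAt.fun_sum fun m _ => (hf k l).mul (hg k m l)]
  simp only [Fintype.sum_prod_type]

end Basic

/-! ### Values of the pairing on letters and the exchange relations at the generators. -/

section LetterPair

variable (p : ℝ) {q : ℝ} {Ω₁ Ω₂ : SpectralSet q}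

/-- The pairing on letters. -/
def letterPair : Letter Ω₁ → Letter Ω₂ → Op
  | .L i j w, .L k l z => op (rMat p q j l i k ((w : ℂ) / z)) (-wt i - wt k)
  -- The values that involve det⁻¹ are forced: they are the inverses of the characters by which the
  -- determinant will turn out to act, see `leftChar` and `rightChar`.
  | .L i j w, .detInv z => if i = j then thetaRatio p q 0 (-1) ((w : ℂ) / z) • opRing.T (-wt i) else 0
  | .detInv w, .L k l z => if k = l then thetaRatio p q 1 0 ((w : ℂ) / z) • opRing.T (-wt k) else 0
  | .detInv w, .detInv z => thetaRatio p q (-1) 1 ((w : ℂ) / z) • 1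

theorem smul_T_isHomog (c : ℂ) (n : ℤ) : IsHomog opRing n n (c • opRing.T (-n)) :=
  Or.inr ⟨rfl, mulOp (algebraMap ℂ Mero c), mulOp_mem _, by
    rw [mulOp_algebraMap, Algebra.smul_def]⟩

variable {p}

theorem letterPair_isHomog (H : Nomes p q) (x : Letter Ω₁) (y : Letter Ω₂) :
    IsHomog opRing ((letters Ω₁).cop.wl x + (letters Ω₂).wr y)
      ((letters Ω₁).cop.wr x + (letters Ω₂).wl y) (letterPair p x y) := by
  cases x with
  | L i j w =>
    cases y with
    | L k l z =>
      change IsHomog opRing (wt j + wt l) (wt i + wt k) _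
      have hx : (w : ℂ) / z ≠ 0 := div_ne_zero (fun h => Ω₁.zero_notMem (h ▸ w.2))
        (fun h => Ω₂.zero_notMem (h ▸ z.2))
      obtain ⟨u, hu⟩ := exists_qp_two_mul H.q_pos H.q_lt hx
      rw [letterPair, ← hu, rMat_eq_rm H]
      by_cases h : wt j + wt l = wt i + wt k
      · refine Or.inr ⟨h, _, mulOp_mem (Mero.of (rm p q j l i k u)), ?_⟩
        rw [op]
        congr 2
        rw [h]
        ring
      · left
        rw [show rm p q j l i k u = fun _ => 0 from funext fun l => rm_eq_zero h u l, op_zero]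
    | detInv z =>
      change IsHomog opRing (wt j + 0) (wt i + 0) _
      rw [letterPair]
      split_ifs with h
      · subst h
        rw [add_zero]
        exact smul_T_isHomog _ _
      · exact .zero _ _
  | detInv w =>
    cases y with
    | L k l z =>
      change IsHomog opRing (0 + wt l) (0 + wt k) _
      rw [letterPair]
      split_ifs with h
      · subst h
        rw [zero_add]
        exact smul_T_isHomog _ _
      · exact .zero _ _
    | detInv z =>
      change IsHomog opRing (0 + 0) (0 + 0) _
      have h := smul_T_isHomog (thetaRatio p q (-1) 1 ((w : ℂ) / z)) 0
      rw [neg_zero, opRing.T_zero] at h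
      simpa only [letterPair, add_zero] using h

theorem SpectralSet.Pt.ne_zero {Ω : SpectralSet q} (z : Ω.Pt) : (z : ℂ) ≠ 0 :=
  fun h => Ω.zero_notMem (h ▸ z.2)

theorem exists_log (H : Nomes p q) {Ω : SpectralSet q} (z : Ω.Pt) : ∃ u, qp q (2 * u) = z :=
  exists_qp_two_mul H.q_pos H.q_lt z.ne_zero

theorem qp_div (H : Nomes p q) (u v : ℂ) : qp q (2 * u) / qp q (2 * v) = qp q (2 * (u - v)) := by
  rw [mul_sub, sub_eq_add_neg, qp_add H.q_pos, qp_neg, div_eq_mul_inv]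

/-- The base case of the exchange relation in the first argument, at the generators `L`. -/
theorem exchange_left_L (H : Nomes p q) (z₁ z₂ : Ω₁.Pt) (z : Ω₂.Pt) (a b c d k e : Bool) :
    ∑ t : Bool × Bool, mulOp (Mero.of (rNum p q b d t.1 t.2 ((z₁ : ℂ) / z₂))) *
        ∑ m, letterPair p (.L c t.2 z₂) (.L k m z) * opRing.T (wt m) *
          letterPair p (.L a t.1 z₁) (.L m e z) =
      ∑ t : Bool × Bool, opRing.cj (-wt k) (mulOp (Mero.of (rNum p q t.1 t.2 a c ((z₁ : ℂ) / z₂)))) *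
        ∑ m, letterPair p (.L t.1 b z₁) (.L k m z) * opRing.T (wt m) *
          letterPair p (.L t.2 d z₂) (.L m e z) := by
  obtain ⟨u₁, h₁⟩ := exists_log H z₁
  obtain ⟨u₂, h₂⟩ := exists_log H z₂
  obtain ⟨v, hv⟩ := exists_log H z
  have hn : ∀ a b x y, Meromorphic (rNum p q a b x y ((z₁ : ℂ) / z₂)) := fun a b x y =>
    meromorphic_rNum H a b x y (div_ne_zero z₁.ne_zero z₂.ne_zero)
  have hn' : ∀ a b x y, Meromorphic fun l => rNum p q a b x y ((z₁ : ℂ) / z₂)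
    (l + ((-wt k : ℤ) : ℂ)) := fun a b x y => meromorphic_comp_add (hn a b x y) _
  have h0 : ∀ a b x y, wt a + wt b ≠ wt x + wt y →
      rNum p q a b x y ((z₁ : ℂ) / z₂) = fun _ => 0 := by
    intro a b x y h
    rw [← h₁, ← h₂, qp_div H, rNum_eq_rs H]
    funext l
    rw [rs_eq_zero h, mul_zero]
  simp only [letterPair, cj_of (hn _ _ _ _)]
  have e₁ : (z₁ : ℂ) / z = qp q (2 * (u₁ - v)) := by rw [← h₁, ← hv, qp_div H]
  have e₂ : (z₂ : ℂ) / z = qp q (2 * (u₂ - v)) := by rw [← h₂, ← hv, qp_div H]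
  simp only [e₁, e₂, rMat_eq_rm H, op_rm_mul_left H]
  rw [sum_mulOp_mul_op (n₀ := -wt a - wt c - wt k) (fun t => hn _ _ _ _)
      (fun t m => meromorphic_rm_mul H _ _ _ _ _ _ _ _ _ _ _) (fun t h => absurd rfl h),
    sum_mulOp_mul_op (n₀ := -wt a - wt c - wt k) (fun t => hn' _ _ _ _)
      (fun t m => meromorphic_rm_mul H _ _ _ _ _ _ _ _ _ _ _) (fun t h => by
        rw [h0 _ _ _ _ fun h' => h (by linarith)])]
  refine op_congr ?_ ?_ _
  · exact fun l => MeromorphicAt.fun_sum fun x _ => MeromorphicAt.fun_sum fun y _ =>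
      MeromorphicAt.fun_sum fun m _ => (hn _ _ _ _ l).mul (meromorphic_rm_mul H _ _ _ _ _ _ _ _ _ _ _ l)
  -- With w = q^{2(u₁ - u₂)} for the pair exchanged and u₂ - v for the second letter, the third
  -- argument of the Yang–Baxter equation is u₁ - v. The scalar denominators are common to all
  -- terms.
  · filter_upwards [eventually_yangBaxter H (u₁ - u₂) (u₂ - v)] with l hl
    have h := hl a c k b d e
    rw [YangBaxterAt, show u₂ - v + (u₁ - u₂) = u₁ - v by ring] at h
    simp only [← h₁, ← h₂, qp_div H, rNum_eq_rs H, rm, Int.cast_neg, ← sub_eq_add_neg]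
    simp only [Fintype.sum_bool] at h ⊢
    linear_combination (-qp q (u₁ - u₂ + 1) / (sf p q (u₁ - v + 1) * sf p q (u₂ - v + 1))) * h

/-- The base case of the exchange relation in the second argument, at the generators `L`. -/
theorem exchange_right_L (H : Nomes p q) (z₁ z₂ : Ω₂.Pt) (w : Ω₁.Pt) (a b c d i j : Bool) :
    ∑ t : Bool × Bool, mulOp (Mero.of (rNum p q t.1 t.2 a c ((z₁ : ℂ) / z₂))) *
        ∑ m, letterPair p (.L m j w) (.L t.1 b z₁) * opRing.T (wt m) *
          letterPair p (.L i m w) (.L t.2 d z₂) =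
      ∑ t : Bool × Bool, opRing.cj (-wt j) (mulOp (Mero.of (rNum p q b d t.1 t.2 ((z₁ : ℂ) / z₂)))) *
        ∑ m, letterPair p (.L m j w) (.L c t.2 z₂) * opRing.T (wt m) *
          letterPair p (.L i m w) (.L a t.1 z₁) := by
  obtain ⟨u₁, h₁⟩ := exists_log H z₁
  obtain ⟨u₂, h₂⟩ := exists_log H z₂
  obtain ⟨v, hv⟩ := exists_log H w
  have hn : ∀ a b x y, Meromorphic (rNum p q a b x y ((z₁ : ℂ) / z₂)) := fun a b x y =>
    meromorphic_rNum H a b x y (div_ne_zero z₁.ne_zero z₂.ne_zero)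
  have hn' : ∀ a b x y, Meromorphic fun l => rNum p q a b x y ((z₁ : ℂ) / z₂)
    (l + ((-wt j : ℤ) : ℂ)) := fun a b x y => meromorphic_comp_add (hn a b x y) _
  have h0 : ∀ a b x y, wt a + wt b ≠ wt x + wt y →
      rNum p q a b x y ((z₁ : ℂ) / z₂) = fun _ => 0 := by
    intro a b x y h
    rw [← h₁, ← h₂, qp_div H, rNum_eq_rs H]
    funext l
    rw [rs_eq_zero h, mul_zero]
  simp only [letterPair, cj_of (hn _ _ _ _)]
  have e₁ : (w : ℂ) / z₁ = qp q (2 * (v - u₁)) := by rw [← h₁, ← hv, qp_div H]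
  have e₂ : (w : ℂ) / z₂ = qp q (2 * (v - u₂)) := by rw [← h₂, ← hv, qp_div H]
  simp only [e₁, e₂, rMat_eq_rm H, op_rm_mul_right H]
  rw [sum_mulOp_mul_op (n₀ := -wt i - wt a - wt c) (fun t => hn _ _ _ _)
      (fun t m => meromorphic_rm_mul H _ _ _ _ _ _ _ _ _ _ _) (fun t h => by
        rw [h0 _ _ _ _ fun h' => h (by linarith)]),
    sum_mulOp_mul_op (n₀ := -wt i - wt a - wt c) (fun t => hn' _ _ _ _)
      (fun t m => meromorphic_rm_mul H _ _ _ _ _ _ _ _ _ _ _) (fun t h => absurd (by ring) h)]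
  refine op_congr ?_ ?_ _
  · exact fun l => MeromorphicAt.fun_sum fun x _ => MeromorphicAt.fun_sum fun y _ =>
      MeromorphicAt.fun_sum fun m _ => (hn _ _ _ _ l).mul (meromorphic_rm_mul H _ _ _ _ _ _ _ _ _ _ _ l)
  · filter_upwards [eventually_yangBaxter H (v - u₁) (u₁ - u₂)] with l hl
    have h := hl i a c j b d
    rw [YangBaxterAt, show u₁ - u₂ + (v - u₁) = v - u₂ by ring] at h
    simp only [← h₁, ← h₂, qp_div H, rNum_eq_rs H, rm, Int.cast_neg, ← sub_eq_add_neg]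
    simp only [Fintype.sum_bool] at h ⊢
    linear_combination (-qp q (u₁ - u₂ + 1) / (sf p q (v - u₁ + 1) * sf p q (v - u₂ + 1))) * h

end LetterPair

/-! ### Algebra homomorphisms out of the elliptic quantum group -/

section Lift

variable {p q : ℝ} {Ω : SpectralSet q} {R : Type} [Ring R] [Algebra ℂ R]

/-- The images of the generators satisfy the defining relations. -/
structure IsRealization (p : ℝ) {q : ℝ} {Ω : SpectralSet q} {R : Type} [Ring R] [Algebra ℂ R]
    (mL mR : Mero → R) (ℓ : Letter Ω → R) : Prop where
  mL_add : ∀ f g, mL (f + g) = mL f + mL g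
  mL_mul : ∀ f g, mL (f * g) = mL f * mL g
  mL_const : ∀ c, mL (algebraMap ℂ Mero c) = algebraMap ℂ R c
  mR_add : ∀ f g, mR (f + g) = mR f + mR g
  mR_mul : ∀ f g, mR (f * g) = mR f * mR g
  mR_const : ∀ c, mR (algebraMap ℂ Mero c) = algebraMap ℂ R c
  comm : ∀ f g, mL f * mR g = mR g * mL f
  mL_L : ∀ f a b z, mL f * ℓ (.L a b z) = ℓ (.L a b z) * mL (shift (wt a) f)
  mR_L : ∀ f a b z, mR f * ℓ (.L a b z) = ℓ (.L a b z) * mR (shift (wt b) f)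
  rll : ∀ (a b c d : Bool) (z₁ z₂ : Ω.Pt),
    ∑ x : Bool, ∑ y : Bool, mL (Mero.of (rNum p q x y a c ((z₁ : ℂ) / z₂))) *
        ℓ (.L x b z₁) * ℓ (.L y d z₂) =
      ∑ x : Bool, ∑ y : Bool, mR (Mero.of (rNum p q b d x y ((z₁ : ℂ) / z₂))) *
        ℓ (.L c y z₂) * ℓ (.L a x z₁)
  det_mul : ∀ z : Ω.Pt, mR (Mero.of (detF p q)) * mL (Mero.of fun l => (detF p q l)⁻¹) *
      (ℓ (.L true true z) * ℓ (.L false false (SpectralSet.move 1 z)) -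
        ℓ (.L false true z) * ℓ (.L true false (SpectralSet.move 1 z))) * ℓ (.detInv z) = 1
  mul_det : ∀ z : Ω.Pt, ℓ (.detInv z) * (mR (Mero.of (detF p q)) *
      mL (Mero.of fun l => (detF p q l)⁻¹) *
      (ℓ (.L true true z) * ℓ (.L false false (SpectralSet.move 1 z)) -
        ℓ (.L false true z) * ℓ (.L true false (SpectralSet.move 1 z)))) = 1

/-- The images of all generators. -/
def genMap (mL mR : Mero → R) (ℓ : Letter Ω → R) : Gen Ω → R
  | .muL f => mL f
  | .muR f => mR f
  | .letter x => ℓ x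

variable {mL mR : Mero → R} {ℓ : Letter Ω → R}

theorem IsRealization.lift_rel (h : IsRealization p mL mR ℓ) {a b : Free Ω} (hab : Rel p a b) :
    FreeAlgebra.lift ℂ (genMap mL mR ℓ) a = FreeAlgebra.lift ℂ (genMap mL mR ℓ) b := by
  have eL : ∀ f, FreeAlgebra.lift ℂ (genMap mL mR ℓ) (fmuL f) = mL f := fun f =>
    FreeAlgebra.lift_ι_apply _ _
  have eR : ∀ f, FreeAlgebra.lift ℂ (genMap mL mR ℓ) (fmuR f) = mR f := fun f =>
    FreeAlgebra.lift_ι_apply _ _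
  have el : ∀ x, FreeAlgebra.lift ℂ (genMap mL mR ℓ) (fletter x) = ℓ x := fun x =>
    FreeAlgebra.lift_ι_apply _ _
  cases hab <;> simp only [fdet, fL, map_add, map_sub, map_mul, map_sum, map_one, eL, eR, el,
    AlgHom.commutes]
  · exact h.mL_add _ _
  · exact h.mL_mul _ _
  · exact h.mL_const _
  · exact h.mR_add _ _
  · exact h.mR_mul _ _
  · exact h.mR_const _
  · exact h.comm _ _
  · exact h.mL_L _ _ _ _
  · exact h.mR_L _ _ _ _
  · exact h.rll _ _ _ _ _ _
  · exact h.det_mul _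
  · exact h.mul_det _

/-- The homomorphism given by the images of the generators. -/
def IsRealization.lift (h : IsRealization p mL mR ℓ) : E p Ω →ₐ[ℂ] R :=
  RingQuot.liftAlgHom ℂ ⟨FreeAlgebra.lift ℂ (genMap mL mR ℓ), fun _ _ hab => h.lift_rel hab⟩

theorem IsRealization.lift_toE (h : IsRealization p mL mR ℓ) (a : Free Ω) :
    h.lift (toE p a) = FreeAlgebra.lift ℂ (genMap mL mR ℓ) a :=
  RingQuot.liftAlgHom_mkAlgHom_apply _ _ _ _

theorem IsRealization.lift_muL (h : IsRealization p mL mR ℓ) (f : Mero) :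
    h.lift (muL p f) = mL f := (h.lift_toE _).trans (FreeAlgebra.lift_ι_apply _ _)

theorem IsRealization.lift_muR (h : IsRealization p mL mR ℓ) (f : Mero) :
    h.lift (muR p f) = mR f := (h.lift_toE _).trans (FreeAlgebra.lift_ι_apply _ _)

theorem IsRealization.lift_letter (h : IsRealization p mL mR ℓ) (x : Letter Ω) :
    h.lift (toE p (fletter x)) = ℓ x := (h.lift_toE _).trans (FreeAlgebra.lift_ι_apply _ _)

theorem IsRealization.lift_word (h : IsRealization p mL mR ℓ) (u : List (Letter Ω)) :
    h.lift (word p u) = (u.map ℓ).prod := by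
  rw [word, map_list_prod, List.map_map]
  congr 1
  exact List.map_congr_left fun x _ => h.lift_letter x

end Lift

/-! ### The exchange relation at neighbouring points -/

/-- The coefficients of the antisymmetric vector. -/
def antisymm : Bool × Bool → ℤ
  | (true, false) => 1
  | (false, true) => -1
  | _ => 0

section Antisymm

variable {p q : ℝ}

theorem antisymm_ne_zero {i : Bool × Bool} (h : antisymm i ≠ 0) : wt i.1 + wt i.2 = 0 := by
  obtain ⟨a, b⟩ := i
  cases a <;> cases b <;> simp_all [antisymm, wt]

/-- The residue function of the `R`-matrix. -/
def resFun (p q : ℝ) (i : Bool × Bool) (l : ℂ) : ℂ :=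
  match i with
  | (true, false) => sf p q 1 * sf p q (l + 2) / sf p q (l + 1)
  | (false, true) => -(sf p q 1 * sf p q l / sf p q (l + 1))
  | _ => 0

/-- At u = -1 the weight-zero block has rank one and the other entries vanish because sf 0 = 0. This
degeneration is what makes a determinant exist. -/
theorem rs_neg_one (H : Nomes p q) (k i : Bool × Bool) (l : ℂ) :
    rs p q k.1 k.2 i.1 i.2 (-1) l = -((antisymm k : ℂ) * resFun p q i l) := by
  have h0 : sf p q 0 = 0 := sf_zero H.p_pos H.p_lt
  have h1 : sf p q (-1) = -sf p q 1 := sf_neg H.p_pos H.p_lt H.q_pos 1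
  have e1 : l + 1 - -1 = l + 2 := by ring
  have e2 : l + 1 + -1 = l := by ring
  obtain ⟨a, b⟩ := k
  obtain ⟨c, d⟩ := i
  cases a <;> cases b <;> cases c <;> cases d <;>
    simp [rs, antisymm, resFun, h0, h1, e1, e2] <;> ring

theorem meromorphic_resFun (H : Nomes p q) (i : Bool × Bool) : Meromorphic (resFun p q i) := by
  have h : ∀ {g : ℂ → ℂ}, Differentiable ℂ g → Meromorphic fun l => sf p q (g l) :=
    fun hg => meromorphic_sf H.p_pos H.p_lt H.q_pos hg
  have h0 : Meromorphic fun l => sf p q l := h differentiable_id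
  have h1 : Meromorphic fun l => sf p q (l + 1) := h (by fun_prop)
  have h2 : Meromorphic fun l => sf p q (l + 2) := h (by fun_prop)
  obtain ⟨a, b⟩ := i
  cases a <;> cases b
  · exact fun l => MeromorphicAt.const _ _
  · exact fun l => (((MeromorphicAt.const _ _).mul (h0 l)).div (h1 l)).neg
  · exact fun l => ((MeromorphicAt.const _ _).mul (h2 l)).div (h1 l)
  · exact fun l => MeromorphicAt.const _ _

theorem sf_one_ne_zero (H : Nomes p q) : sf p q 1 ≠ 0 := by
  have h := sf_intCast_ne_zero H.p_pos H.p_lt H.q_pos H.generic (n := 1) one_ne_zero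
  rwa [Int.cast_one] at h

theorem resFun_inv_mul (H : Nomes p q) :
    Mero.of (fun l => (resFun p q (true, false) l)⁻¹) * Mero.of (resFun p q (true, false)) = 1 := by
  have h := meromorphic_resFun H (true, false)
  have hi : Meromorphic fun l => (resFun p q (true, false) l)⁻¹ := fun l => (h l).inv
  rw [Mero.of_mul hi h, ← Mero.of_one]
  refine Mero.of_congr (fun l => (hi l).mul (h l)) ?_
  filter_upwards [eventually_sf_add_ne_zero H.p_pos H.p_lt H.q_pos H.generic 1,
    eventually_sf_add_ne_zero H.p_pos H.p_lt H.q_pos H.generic 2] with l h1 h2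
  exact inv_mul_cancel₀ (div_ne_zero (mul_ne_zero (sf_one_ne_zero H) h2) h1)

theorem div_move (H : Nomes p q) {Ω : SpectralSet q} (z : Ω.Pt) :
    (z : ℂ) / (SpectralSet.move 1 z : Ω.Pt) = qp q (2 * (-1)) := by
  have hq : (q : ℂ) ≠ 0 := by exact_mod_cast H.q_pos.ne'
  have hz := z.ne_zero
  change (z : ℂ) / ((q : ℂ) ^ (2 * (1 : ℤ)) * z) = _
  rw [show (2 : ℂ) * -1 = ((-2 : ℤ) : ℂ) by push_cast; ring, qp_intCast,
    show (2 : ℤ) * 1 = 2 by norm_num, zpow_neg]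
  field_simp

theorem rNum_move (H : Nomes p q) {Ω : SpectralSet q} (z : Ω.Pt) (k i : Bool × Bool) :
    rNum p q k.1 k.2 i.1 i.2 ((z : ℂ) / (SpectralSet.move 1 z : Ω.Pt)) =
      fun l => -((antisymm k : ℂ) * resFun p q i l) := by
  rw [div_move H, rNum_eq_rs H]
  funext l
  rw [neg_add_cancel, qp_zero, one_mul, rs_neg_one H]

/-- The exchange relations at neighbouring points say that the antisymmetric vector is
preserved. -/
theorem antisymm_of_rll (H : Nomes p q) {Ω : SpectralSet q} (z : Ω.Pt) {R : Type} [Ring R]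
    {mL mR : Mero → R} (hL_add : ∀ f g, mL (f + g) = mL f + mL g)
    (hR_add : ∀ f g, mR (f + g) = mR f + mR g) (hL_mul : ∀ f g, mL (f * g) = mL f * mL g)
    (hL_one : mL 1 = 1) {A B : Bool × Bool → Bool × Bool → R}
    (h : ∀ i j, ∑ k : Bool × Bool,
        mL (Mero.of (rNum p q k.1 k.2 i.1 i.2 ((z : ℂ) / (SpectralSet.move 1 z : Ω.Pt)))) * A k j =
      ∑ k : Bool × Bool,
        mR (Mero.of (rNum p q j.1 j.2 k.1 k.2 ((z : ℂ) / (SpectralSet.move 1 z : Ω.Pt)))) * B i k)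
    (j : Bool × Bool) :
    ∑ k, antisymm k • A k j = antisymm j • (A (true, false) (true, false) -
      A (false, true) (true, false)) := by
  have key : ∀ m : Mero → R, (∀ f g, m (f + g) = m f + m g) → ∀ k i : Bool × Bool,
      m (Mero.of (rNum p q k.1 k.2 i.1 i.2 ((z : ℂ) / (SpectralSet.move 1 z : Ω.Pt)))) =
        -(antisymm k • m (Mero.of (resFun p q i))) := by
    intro m hm k i
    have m0 : m 0 = 0 := by
      have h0 := hm 0 0
      rw [show (0 : Mero) + 0 = 0 from add_zero 0] at h0
      exact left_eq_add.1 h0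
    have mneg : ∀ f, m (-f) = -m f := fun f => by
      have h0 := hm f (-f)
      rw [show f + -f = 0 from add_neg_cancel f, m0] at h0
      exact eq_neg_of_add_eq_zero_right h0.symm
    rw [rNum_move H]
    obtain ⟨a, b⟩ := k
    cases a <;> cases b <;> simp only [antisymm, Int.cast_zero, Int.cast_one, Int.cast_neg,
      zero_mul, neg_zero, one_mul, neg_mul, neg_neg, zero_smul, one_smul, neg_smul, Mero.of_zero, m0]
    rw [← mneg, Mero.of_neg (meromorphic_resFun H i)]
  -- Only the row (true, false) of the relation is used. Its right side depends on j through the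
  -- sign `antisymm j` alone, so comparison with j = (true, false) identifies the common factor.
  have h' : ∀ j, mL (Mero.of (resFun p q (true, false))) * ∑ k, antisymm k • A k j =
      antisymm j • ∑ k, mR (Mero.of (resFun p q k)) * B (true, false) k := by
    intro j
    have hj := h (true, false) j
    have hj' : ∑ k, -(antisymm k • mL (Mero.of (resFun p q (true, false)))) * A k j =
        ∑ k, -(antisymm j • mR (Mero.of (resFun p q k))) * B (true, false) k :=
      (Finset.sum_congr rfl fun k _ => by rw [← key mL hL_add k (true, false)]).trans
        (hj.trans (Finset.sum_congr rfl fun k _ => by rw [← key mR hR_add j k]))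
    simp only [neg_mul, Finset.sum_neg_distrib, neg_inj, smul_mul_assoc] at hj'
    rw [Finset.mul_sum, Finset.smul_sum, ← hj']
    exact Finset.sum_congr rfl fun k _ => mul_smul_comm _ _ _
  -- The residue function is not identically zero, hence invertible in the field of meromorphic
  -- functions, and can be cancelled.
  have hX : ∀ X : R, mL (Mero.of fun l => (resFun p q (true, false) l)⁻¹) *
      (mL (Mero.of (resFun p q (true, false))) * X) = X := by
    intro X
    rw [← mul_assoc, ← hL_mul, resFun_inv_mul H, hL_one, one_mul]
  have e : ∑ k, antisymm k • A k (true, false) =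
      A (true, false) (true, false) - A (false, true) (true, false) := by
    simp [Fintype.sum_prod_type, antisymm, sub_eq_add_neg]
  have h1 := h' (true, false)
  rw [antisymm, one_smul, e] at h1
  have h2 := h' j
  rw [← h1, ← mul_smul_comm] at h2
  rw [← hX (∑ k, antisymm k • A k j), h2, hX]

end Antisymm

/-! ### Group-like functionals -/

section Char

variable {D : Type} [Ring D] [Algebra ℂ D] {𝒟 : ShiftRing D} {B : Type} {ℬ : Alphabet B}

/-- The functional that multiplies the counit by a character. -/
def charConv (𝒟 : ShiftRing D) (ℬ : Alphabet B) (κ : B → ℂ) : Conv 𝒟 ℬ.words :=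
  ⟨fun v => (v.map κ).prod • counitOp 𝒟 ℬ.words v⟩

theorem charConv_cons (κ : B → ℂ) (y : B) (v : List B) :
    charConv 𝒟 ℬ κ (y :: v) = κ y • counitOp 𝒟 ℬ y * charConv 𝒟 ℬ κ v := by
  simp only [charConv, List.map_cons, List.prod_cons, counitOp_cons, mul_smul, smul_mul_assoc,
    mul_smul_comm]
  exact smul_comm _ _ _

theorem charConv_nil (κ : B → ℂ) : charConv 𝒟 ℬ κ [] = 1 := by
  simp only [charConv, List.map_nil, List.prod_nil, one_smul, counitOp_nil]

theorem eq_charConv {φ : Conv 𝒟 ℬ.words} {κ : B → ℂ} (hnil : φ [] = 1)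
    (hcons : ∀ y v, φ (y :: v) = κ y • counitOp 𝒟 ℬ y * φ v) : φ = charConv 𝒟 ℬ κ := by
  refine Conv.ext (funext fun v => ?_)
  induction v with
  | nil => rw [hnil, charConv_nil]
  | cons y v ih => rw [hcons, ih, charConv_cons]

/-- Both characters are constant along the terms of a comultiplication, so their product factors out
as 1 and the convolution of the counit with itself is left. -/
theorem charConv_mul_charConv {κ κ' : B → ℂ} (hκ : ∀ x, ∀ y ∈ ℬ.comul x, κ y.1 = κ x)
    (hκ' : ∀ x, ∀ y ∈ ℬ.comul x, κ' y.2 = κ' x) (h : ∀ x, κ x * κ' x = 1) :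
    charConv 𝒟 ℬ κ * charConv 𝒟 ℬ κ' = 1 := by
  have h1 : ∀ u : List B, ∀ v ∈ ℬ.wordComul u,
      (v.1.map κ).prod * (v.2.map κ').prod = 1 := by
    intro u
    induction u with
    | nil => simp [Alphabet.wordComul]
    | cons x u ih =>
      intro v hv
      obtain ⟨y, hy, v', hv', rfl⟩ := ℬ.mem_wordComul_cons hv
      rw [List.map_cons, List.map_cons, List.prod_cons, List.prod_cons, mul_mul_mul_comm,
        ih v' hv', hκ x y hy, hκ' x y hy, h, mul_one]
  refine Conv.ext (funext fun u => ?_)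
  rw [Conv.mul_apply, Conv.one_apply, ← Conv.counitOp_mul_sum (counitOp 𝒟 ℬ.words) u]
  unfold Alphabet.sum
  congr 1
  refine List.map_congr_left fun v hv => ?_
  simp only [charConv, smul_mul_assoc, mul_smul_comm, smul_smul]
  rw [mul_comm, h1 u v hv, one_smul]

theorem cj_mul (n : ℤ) (f g : D) : 𝒟.cj n (f * g) = 𝒟.cj n f * 𝒟.cj n g := by
  simp only [ShiftRing.cj, mul_assoc, 𝒟.T_mul_assoc, neg_add_cancel, 𝒟.T_zero, one_mul]

/-- A multiplicative functional, corrected by the moment maps, is given by its values on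
letters. -/
theorem rmu_mul_lmu_mul_eq_charConv {d : Conv 𝒟 ℬ.words} (hd : ConvHomog 0 0 d)
    (hnil : d [] = 1) (hcons : ∀ y v, d (y :: v) = d [y] * d v) {F G : D} (hF : F ∈ 𝒟.K)
    (hG : G ∈ 𝒟.K) (hFG : F * G = 1) {κ : B → ℂ}
    (hκ : ∀ y, 𝒟.cj (-ℬ.wl y) F * (G * d [y]) = κ y • counitOp 𝒟 ℬ y) :
    rmu 𝒟 _ F * (lmu 𝒟 _ G * d) = charConv 𝒟 ℬ κ := by
  refine eq_charConv ?_ fun y v => ?_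
  -- The corrections by F and G telescope: between the first letter and the tail a pair F, G
  -- conjugated by the weight of the letter is inserted, whose product is 1.
  · rw [rmu_mul_apply, lmu_mul_apply, hnil, words_wl_nil, neg_zero, 𝒟.cj_zero, mul_one, hFG]
  · rw [rmu_mul_apply, lmu_mul_apply, rmu_mul_apply, lmu_mul_apply, hcons, ← hκ, words_wl_cons]
    have h1 : ∀ g ∈ 𝒟.K, d [y] * g = 𝒟.cj (-ℬ.wl y) g * d [y] := by
      intro g hg
      have h := (hd [y]).mul_cj hg 0
      rw [𝒟.cj_zero, words_wl_cons, words_wl_nil] at h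
      rw [h]
      congr 2
      ring
    have h2 : G * 𝒟.cj (-(ℬ.wl y)) (F) = 𝒟.cj (-(ℬ.wl y)) F * G :=
      𝒟.comm _ hG _ (𝒟.cj_mem _ hF)
    have h3 : 𝒟.cj (-ℬ.wl y) F * 𝒟.cj (-ℬ.wl y) G = 1 := by
      rw [← cj_mul, hFG, ShiftRing.cj, mul_one, 𝒟.T_mul, add_neg_cancel, 𝒟.T_zero]
    calc 𝒟.cj (-(ℬ.wl y + ℬ.words.wl v)) F * (G * (d [y] * d v))
        = 𝒟.cj (-(ℬ.wl y + ℬ.words.wl v)) F * G * d [y] * d v := by simp only [mul_assoc]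
      _ = (𝒟.cj (-ℬ.wl y) F * 𝒟.cj (-ℬ.wl y) G) *
          (𝒟.cj (-(ℬ.wl y + ℬ.words.wl v)) F * G) * d [y] * d v := by rw [h3, one_mul]
      _ = 𝒟.cj (-ℬ.wl y) F * G * (𝒟.cj (-ℬ.wl y) (𝒟.cj (-ℬ.words.wl v) F) *
            𝒟.cj (-ℬ.wl y) G) * d [y] * d v := by
          rw [𝒟.cj_cj, neg_add]
          have c1 := 𝒟.comm _ (𝒟.cj_mem (-ℬ.wl y) hG) _
            (mul_mem (𝒟.cj_mem (-ℬ.wl y + -ℬ.words.wl v) hF) hG)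
          have c2 := 𝒟.comm _ (𝒟.cj_mem (-ℬ.wl y + -ℬ.words.wl v) hF) _ hG
          rw [mul_assoc (𝒟.cj (-ℬ.wl y) F), c1, c2]
          simp only [mul_assoc]
      _ = 𝒟.cj (-ℬ.wl y) F * (G * d [y]) * (𝒟.cj (-ℬ.words.wl v) F * (G * d v)) := by
          have h4 := h1 _ (mul_mem (𝒟.cj_mem (-ℬ.words.wl v) hF) hG)
          rw [cj_mul] at h4
          simp only [mul_assoc] at h4 ⊢
          rw [← mul_assoc (d [y]), ← mul_assoc (d [y] * _), mul_assoc (d [y]), h4]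
          simp only [mul_assoc]

theorem pairWords_pair {A : Type} {𝒜 : Alphabet A} {c : A → B → D} (x₁ x₂ : A) (y : B) :
    pairWords 𝒟 𝒜 ℬ c [x₁, x₂] [y] =
      ℬ.sum y fun y₁ y₂ => c x₁ y₁ * 𝒟.T (ℬ.wr y₁) * c x₂ y₂ := by
  rw [pairWords_cons_left, Alphabet.words_sum_cons]
  simp only [Alphabet.words_sum_nil, extR_singleton, pairWords_singleton_left, words_wr_cons,
    words_wr_nil, add_zero]

theorem extR_toConv_mul {A : Type} {𝒜 : Alphabet A} {c : A → B → D} (x₁ x₂ : A) :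
    (⟨extR 𝒟 𝒜 c x₁⟩ * ⟨extR 𝒟 𝒜 c x₂⟩ : Conv 𝒟 ℬ.words) =
      ⟨pairWords 𝒟 𝒜 ℬ c [x₁, x₂]⟩ := by
  refine Conv.ext (funext fun v => ?_)
  rw [Conv.mul_apply]
  change _ = pairWords 𝒟 𝒜 ℬ c [x₁, x₂] v
  rw [pairWords_cons_left]
  simp only [pairWords_singleton_left]

theorem prod_extR {A : Type} {𝒜 : Alphabet A} {c : A → B → D} (u : List A) :
    (u.map fun x => (⟨extR 𝒟 𝒜 c x⟩ : Conv 𝒟 ℬ.words)).prod = ⟨pairWords 𝒟 𝒜 ℬ c u⟩ := by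
  induction u with
  | nil => rfl
  | cons x u ih => rw [List.map_cons, List.prod_cons, ih]; rfl

end Char

/-! ### Words of length two -/

section TwoWords

variable {q : ℝ} {Ω : SpectralSet q}

/-- `L(z₁)₁ L(z₂)₂`. -/
def wordAB (z₁ z₂ : Ω.Pt) (i j : Bool × Bool) : List (Letter Ω) := [.L i.1 j.1 z₁, .L i.2 j.2 z₂]

/-- `L(z₂)₂ L(z₁)₁`. -/
def wordBA (z₁ z₂ : Ω.Pt) (i j : Bool × Bool) : List (Letter Ω) := [.L i.2 j.2 z₂, .L i.1 j.1 z₁]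

/-- The weight of a pair of indices. -/
def wt₂ (i : Bool × Bool) : ℤ := wt i.1 + wt i.2

theorem sum_wordAB {M : Type} [AddCommMonoid M] (z₁ z₂ : Ω.Pt) (i j : Bool × Bool)
    (F : List (Letter Ω) → List (Letter Ω) → M) :
    (letters Ω).words.sum (wordAB z₁ z₂ i j) F =
      ∑ k, F (wordAB z₁ z₂ i k) (wordAB z₁ z₂ k j) := by
  simp only [wordAB, Alphabet.words_sum_cons, Alphabet.words_sum_nil, letters_sum_L,
    Fintype.sum_prod_type]

theorem sum_wordBA {M : Type} [AddCommMonoid M] (z₁ z₂ : Ω.Pt) (i j : Bool × Bool)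
    (F : List (Letter Ω) → List (Letter Ω) → M) :
    (letters Ω).words.sum (wordBA z₁ z₂ i j) F =
      ∑ k, F (wordBA z₁ z₂ i k) (wordBA z₁ z₂ k j) := by
  simp only [wordBA, Alphabet.words_sum_cons, Alphabet.words_sum_nil, letters_sum_L,
    Fintype.sum_prod_type]
  exact Finset.sum_comm

theorem wl_wordAB (z₁ z₂ : Ω.Pt) (i j : Bool × Bool) :
    (letters Ω).words.wl (wordAB z₁ z₂ i j) = wt₂ i := by
  rw [wordAB, words_wl_cons, words_wl_cons, words_wl_nil, add_zero]; rfl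

theorem wr_wordAB (z₁ z₂ : Ω.Pt) (i j : Bool × Bool) :
    (letters Ω).words.wr (wordAB z₁ z₂ i j) = wt₂ j := by
  rw [wordAB, words_wr_cons, words_wr_cons, words_wr_nil, add_zero]; rfl

theorem wl_wordBA (z₁ z₂ : Ω.Pt) (i j : Bool × Bool) :
    (letters Ω).words.wl (wordBA z₁ z₂ i j) = wt₂ i := by
  rw [wordBA, words_wl_cons, words_wl_cons, words_wl_nil, add_zero, add_comm]; rfl

theorem wr_wordBA (z₁ z₂ : Ω.Pt) (i j : Bool × Bool) :
    (letters Ω).words.wr (wordBA z₁ z₂ i j) = wt₂ j := by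
  rw [wordBA, words_wr_cons, words_wr_cons, words_wr_nil, add_zero, add_comm]; rfl

theorem diag_wordAB (z₁ z₂ : Ω.Pt) (i j : Bool × Bool) :
    (letters Ω).words.diag (wordAB z₁ z₂ i j) = decide (i = j) := by
  obtain ⟨a, b⟩ := i
  obtain ⟨c, d⟩ := j
  cases a <;> cases b <;> cases c <;> cases d <;> rfl

theorem diag_wordBA (z₁ z₂ : Ω.Pt) (i j : Bool × Bool) :
    (letters Ω).words.diag (wordBA z₁ z₂ i j) = decide (i = j) := by
  obtain ⟨a, b⟩ := i
  obtain ⟨c, d⟩ := j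
  cases a <;> cases b <;> cases c <;> cases d <;> rfl

end TwoWords

/-! ### The determinant on generators -/

section DetGenerators

variable {p q : ℝ}

theorem op_sub {f g : ℂ → ℂ} (hf : Meromorphic f) (hg : Meromorphic g) (n : ℤ) :
    op f n - op g n = op (fun l => f l - g l) n := by
  have h : Meromorphic fun l => f l - g l := fun l => (hf l).sub (hg l)
  rw [sub_eq_iff_eq_add, op_add h hg]
  simp only [sub_add_cancel]

/-- The determinant of the weight-zero block of the R-matrix, with its dynamical denominators
cleared; it is the addition formula with c = v and d = -v. -/
theorem sf_det (H : Nomes p q) (v l : ℂ) :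
    sf p q v ^ 2 * sf p q l * sf p q (l + 2) -
      sf p q 1 ^ 2 * sf p q (l + 1 - v) * sf p q (l + 1 + v) =
        sf p q (v - 1) * sf p q (v + 1) * sf p q (l + 1) ^ 2 := by
  have h := sf_add_formula H.p_pos H.p_lt H.q_pos l 1 v (-v)
  have e1 : sf p q (-v) = -sf p q v := sf_neg H.p_pos H.p_lt H.q_pos v
  have e2 : sf p q (1 + -v) = -sf p q (v - 1) := by
    rw [← sf_neg H.p_pos H.p_lt H.q_pos]
    ring_nf
  rw [e1, e2, show l + 2 * 1 + v + -v = l + 2 by ring, show l + 1 + v + -v = l + 1 by ring,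
    show l + 1 + -v = l + 1 - v by ring, show (1 : ℂ) + v + -v = 1 by ring,
    show 1 + v = v + 1 by ring] at h
  linear_combination -h

theorem detF_eq (H : Nomes p q) (l : ℂ) : detF p q l = -(qp q (-1) * sf p q (l + 1)) := by
  rw [detF, show -2 * (l + 1) = 2 * (-(l + 1)) by ring, theta_qp H.q_pos,
    sf_neg H.p_pos H.p_lt H.q_pos, ← mul_assoc, ← qp_add H.q_pos]
  ring_nf

theorem meromorphic_detF (H : Nomes p q) : Meromorphic (detF p q) := by
  rw [show detF p q = fun l => -(qp q (-1) * sf p q (l + 1)) from funext fun l => detF_eq H l]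
  have h1 : Meromorphic fun l => sf p q (l + 1) :=
    meromorphic_sf H.p_pos H.p_lt H.q_pos (by fun_prop)
  exact fun l => ((MeromorphicAt.const _ _).mul (h1 l)).neg

theorem meromorphic_detF_inv (H : Nomes p q) : Meromorphic fun l => (detF p q l)⁻¹ :=
  fun l => (meromorphic_detF H l).inv

theorem detF_mul_inv (H : Nomes p q) :
    mulOp (Mero.of (detF p q)) * mulOp (Mero.of fun l => (detF p q l)⁻¹) = 1 := by
  have h := meromorphic_detF H
  have hi := meromorphic_detF_inv H
  rw [← mulOp_mul, Mero.of_mul h hi, ← mulOp_one, ← Mero.of_one]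
  congr 1
  refine Mero.of_congr (fun l => (h l).mul (hi l)) ?_
  filter_upwards [eventually_sf_add_ne_zero H.p_pos H.p_lt H.q_pos H.generic 1] with l h1
  refine mul_inv_cancel₀ ?_
  rw [detF_eq H]
  exact neg_ne_zero.2 (mul_ne_zero (qp_ne_zero H.q_pos _) h1)

variable {Ω₁ Ω₂ : SpectralSet q}

theorem move_log (H : Nomes p q) {Ω : SpectralSet q} {z : Ω.Pt} {u : ℂ} (hu : qp q (2 * u) = z)
    (n : ℤ) : qp q (2 * (u + n)) = (SpectralSet.move n z : Ω.Pt) := by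
  change _ = (q : ℂ) ^ (2 * n) * (z : ℂ)
  rw [mul_add, qp_add H.q_pos, hu, ← qp_intCast, mul_comm]
  push_cast
  rfl

/-- The spectral parameters are never congruent modulo `p`. -/
def Separated (p : ℝ) (Ω₁ Ω₂ : SpectralSet q) : Prop :=
  ∀ w ∈ Ω₁.carrier, ∀ z ∈ Ω₂.carrier, ∀ m : ℤ, w ≠ (p : ℂ) ^ m * z

/-- The set Ω₁ is stable under multiplication by q^{2n}, so separation of w from z also keeps
q^{2n}w away from all p^m z. -/
theorem Separated.generic (H : Nomes p q) (hΩ : Separated p Ω₁ Ω₂) (w : Ω₁.Pt) (z : Ω₂.Pt) {u v : ℂ}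
    (hu : qp q (2 * u) = w) (hv : qp q (2 * v) = z) : Generic p q (u - v) := by
  intro n
  refine sf_ne_zero H.p_pos H.p_lt H.q_pos fun m hm => ?_
  refine hΩ _ (SpectralSet.move n w).2 z z.2 m ?_
  rw [← hm, ← move_log H hu n, ← hv, ← qp_add H.q_pos]
  ring_nf

/-- Off-diagonal entries vanish by weight. On the diagonal one entry uses `sf_det` at t + 1 and l -
1, and the moment-map correction by F removes the dependence on l. -/
theorem det_left_L (H : Nomes p q) (hΩ : Separated p Ω₁ Ω₂) (w : Ω₁.Pt) (z : Ω₂.Pt) (k e : Bool) :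
    opRing.cj (-wt k) (mulOp (Mero.of fun l => (detF p q l)⁻¹)) * (mulOp (Mero.of (detF p q)) *
      ((∑ m, letterPair p (.L true true w) (.L k m z) * opRing.T (wt m) *
          letterPair p (.L false false (SpectralSet.move 1 w)) (.L m e z)) -
        ∑ m, letterPair p (.L false true w) (.L k m z) * opRing.T (wt m) *
          letterPair p (.L true false (SpectralSet.move 1 w)) (.L m e z))) =
      if k = e then thetaRatio p q 0 1 ((w : ℂ) / z) • opRing.T (-wt k) else 0 := by
  obtain ⟨u, hu⟩ := exists_log H w
  obtain ⟨v, hv⟩ := exists_log H z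
  have hg := hΩ.generic H w z hu hv
  have h0 := hg 0
  have h1 := hg 1
  have h2 := hg 2
  have e₁ : (w : ℂ) / z = qp q (2 * (u - v)) := by rw [← hu, ← hv, qp_div H]
  have e₂ : ((SpectralSet.move 1 w : Ω₁.Pt) : ℂ) / z = qp q (2 * (u - v + 1)) := by
    rw [← move_log H hu, ← hv, qp_div H]
    push_cast
    ring_nf
  simp only [letterPair, e₁, e₂, rMat_eq_rm H, op_rm_mul_left H, thetaRatio_qp H]
  generalize u - v = t at *
  rw [show -wt false - wt true - wt k = -wt k by simp [wt],
    show -wt true - wt false - wt k = -wt k by simp [wt],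
    op_sum _ fun m => meromorphic_rm_mul H _ _ _ _ _ _ _ _ _ _ _,
    op_sum _ fun m => meromorphic_rm_mul H _ _ _ _ _ _ _ _ _ _ _,
    op_sub (fun l => MeromorphicAt.fun_sum fun m _ => meromorphic_rm_mul H _ _ _ _ _ _ _ _ _ _ _ l)
      (fun l => MeromorphicAt.fun_sum fun m _ => meromorphic_rm_mul H _ _ _ _ _ _ _ _ _ _ _ l)]
  have hm : Meromorphic fun l => (∑ m, rm p q true m true k t l *
      rm p q false e false m (t + 1) (l - wt true)) - ∑ m, rm p q true m false k t l *
      rm p q false e true m (t + 1) (l - wt true) := fun l =>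
    (MeromorphicAt.fun_sum fun m _ => meromorphic_rm_mul H _ _ _ _ _ _ _ _ _ _ _ l).sub
      (MeromorphicAt.fun_sum fun m _ => meromorphic_rm_mul H _ _ _ _ _ _ _ _ _ _ _ l)
  have hd : Meromorphic fun l => (detF p q (l + ((-wt k : ℤ) : ℂ)))⁻¹ :=
    meromorphic_comp_add (meromorphic_detF_inv H) _
  have hdm : Meromorphic fun l => detF p q l * ((∑ m, rm p q true m true k t l *
      rm p q false e false m (t + 1) (l - wt true)) - ∑ m, rm p q true m false k t l *
      rm p q false e true m (t + 1) (l - wt true)) := fun l => (meromorphic_detF H l).mul (hm l)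
  rw [mulOp_mul_op (meromorphic_detF H) hm, cj_of (meromorphic_detF_inv H),
    mulOp_mul_op hd hdm,
    show (if k = e then (sf p q (t + (0 : ℤ)) / sf p q (t + (1 : ℤ))) • opRing.T (-wt k) else 0) =
      op (fun _ => if k = e then sf p q t / sf p q (t + 1) else 0) (-wt k) by
        rw [Int.cast_zero, Int.cast_one, add_zero, op_const]
        split_ifs
        · rfl
        · rw [zero_smul]]
  refine op_congr (fun l => (hd l).mul (hdm l)) ?_ _
  filter_upwards [eventually_sf_add_ne_zero H.p_pos H.p_lt H.q_pos H.generic 0,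
    eventually_sf_add_ne_zero H.p_pos H.p_lt H.q_pos H.generic 1,
    eventually_sf_add_ne_zero H.p_pos H.p_lt H.q_pos H.generic 2] with l l0 l1 l2
  have hq := qp_ne_zero H.q_pos (-1)
  rw [Int.cast_zero, add_zero] at h0
  rw [Int.cast_one] at h1
  rw [Int.cast_ofNat] at h2
  rw [add_zero] at l0
  have hid := sf_det H (t + 1) (l - 1)
  rw [show l - 1 + 2 = l + 1 by ring, show l - 1 + 1 = l by ring, show t + 1 - 1 = t by ring,
    show t + 1 + 1 = t + 2 by ring, show l - (t + 1) = l - 1 - t by ring,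
    show l + (t + 1) = l + 1 + t by ring] at hid
  have e3 : l + -1 + 1 = l := by ring
  have e4 : l + 1 + 1 = l + 2 := by ring
  have e5 : t + 1 + 1 = t + 2 := by ring
  have e6 : l - 1 + 1 = l := by ring
  have e7 : l - (t + 1) = l - 1 - t := by ring
  simp only [detF_eq H, rm]
  cases k <;> cases e <;> simp [rs, wt, e3, e4, e5, e6, e7] <;> field_simp
  linear_combination hid

/-- The counterpart of `det_left_L` with the determinant in the second argument, where `sf_det`
enters at t and l. -/
theorem det_right_L (H : Nomes p q) (hΩ : Separated p Ω₁ Ω₂) (w : Ω₁.Pt) (z : Ω₂.Pt) (i j : Bool) :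
    opRing.cj (-wt j) (mulOp (Mero.of (detF p q))) * (mulOp (Mero.of fun l => (detF p q l)⁻¹) *
      ((∑ m, letterPair p (.L m j w) (.L true true z) * opRing.T (wt m) *
          letterPair p (.L i m w) (.L false false (SpectralSet.move 1 z))) -
        ∑ m, letterPair p (.L m j w) (.L false true z) * opRing.T (wt m) *
          letterPair p (.L i m w) (.L true false (SpectralSet.move 1 z)))) =
      if i = j then thetaRatio p q (-1) 0 ((w : ℂ) / z) • opRing.T (-wt j) else 0 := by
  obtain ⟨u, hu⟩ := exists_log H w
  obtain ⟨v, hv⟩ := exists_log H z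
  have hg := hΩ.generic H w z hu hv
  have h0 := hg 0
  have h1 := hg 1
  have h2 := hg (-1)
  have e₁ : (w : ℂ) / z = qp q (2 * (u - v)) := by rw [← hu, ← hv, qp_div H]
  have e₂ : (w : ℂ) / ((SpectralSet.move 1 z : Ω₂.Pt) : ℂ) = qp q (2 * (u - v - 1)) := by
    rw [← move_log H hv, ← hu, qp_div H]
    push_cast
    ring_nf
  simp only [letterPair, e₁, e₂, rMat_eq_rm H, op_rm_mul_right H, thetaRatio_qp H]
  generalize u - v = t at *
  rw [show -wt i - wt true - wt false = -wt i by simp [wt],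
    show -wt i - wt false - wt true = -wt i by simp [wt],
    op_sum _ fun m => meromorphic_rm_mul H _ _ _ _ _ _ _ _ _ _ _,
    op_sum _ fun m => meromorphic_rm_mul H _ _ _ _ _ _ _ _ _ _ _,
    op_sub (fun l => MeromorphicAt.fun_sum fun m _ => meromorphic_rm_mul H _ _ _ _ _ _ _ _ _ _ _ l)
      (fun l => MeromorphicAt.fun_sum fun m _ => meromorphic_rm_mul H _ _ _ _ _ _ _ _ _ _ _ l)]
  have hm : Meromorphic fun l => (∑ m, rm p q j true m true t l *
      rm p q m false i false (t - 1) (l - wt true)) - ∑ m, rm p q j true m false t l *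
      rm p q m false i true (t - 1) (l - wt false) := fun l =>
    (MeromorphicAt.fun_sum fun m _ => meromorphic_rm_mul H _ _ _ _ _ _ _ _ _ _ _ l).sub
      (MeromorphicAt.fun_sum fun m _ => meromorphic_rm_mul H _ _ _ _ _ _ _ _ _ _ _ l)
  have hd : Meromorphic fun l => detF p q (l + ((-wt j : ℤ) : ℂ)) :=
    meromorphic_comp_add (meromorphic_detF H) _
  have hdm : Meromorphic fun l => (detF p q l)⁻¹ * ((∑ m, rm p q j true m true t l *
      rm p q m false i false (t - 1) (l - wt true)) - ∑ m, rm p q j true m false t l *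
      rm p q m false i true (t - 1) (l - wt false)) := fun l =>
    (meromorphic_detF_inv H l).mul (hm l)
  rw [mulOp_mul_op (meromorphic_detF_inv H) hm, cj_of (meromorphic_detF H),
    mulOp_mul_op hd hdm,
    show (if i = j then (sf p q (t + ((-1 : ℤ) : ℂ)) / sf p q (t + (0 : ℤ))) • opRing.T (-wt j)
        else 0) =
      op (fun _ => if i = j then sf p q (t - 1) / sf p q t else 0) (-wt i) by
        rw [Int.cast_zero, Int.cast_neg, Int.cast_one, add_zero, op_const, ← sub_eq_add_neg]
        split_ifs with h
        · rw [h]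
        · rw [zero_smul]]
  refine op_congr (fun l => (hd l).mul (hdm l)) ?_ _
  filter_upwards [eventually_sf_add_ne_zero H.p_pos H.p_lt H.q_pos H.generic 0,
    eventually_sf_add_ne_zero H.p_pos H.p_lt H.q_pos H.generic 1,
    eventually_sf_add_ne_zero H.p_pos H.p_lt H.q_pos H.generic 2] with l l0 l1 l2
  have hq := qp_ne_zero H.q_pos (-1)
  rw [Int.cast_zero, add_zero] at h0
  rw [Int.cast_one] at h1
  rw [Int.cast_neg, Int.cast_one, ← sub_eq_add_neg] at h2
  rw [add_zero] at l0
  have hid := sf_det H t l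
  have e3 : l + -1 + 1 = l := by ring
  have e4 : l + 1 + 1 = l + 2 := by ring
  have e5 : l - 1 + 2 = l + 1 := by ring
  have e6 : l - 1 + 1 = l := by ring
  have e7 : l + 2 + (t - 1) = l + 1 + t := by ring
  simp only [detF_eq H, rm]
  cases i <;> cases j <;> simp [rs, wt, e3, e4, e5, e6, e7] <;> field_simp
  linear_combination hid

end DetGenerators

/-! ### The two homomorphisms into convolution algebras -/

section Realization

variable {p q : ℝ} {Ω₁ Ω₂ : SpectralSet q}

/-- The functional on words in the second argument given by a letter. -/
def leftLetter (p : ℝ) (Ω₂ : SpectralSet q) (x : Letter Ω₁) : Conv opRing (letters Ω₂).words :=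
  ⟨extR opRing (letters Ω₁).cop (letterPair p) x⟩

/-- The functional on words in the first argument given by a letter. -/
def rightLetter (p : ℝ) (Ω₁ : SpectralSet q) (y : Letter Ω₂) :
    Conv opRing (letters Ω₁).cop.words :=
  ⟨extR opRing (letters Ω₂) (fun y x => letterPair p x y) y⟩

theorem letterPair_isHomog_flip (H : Nomes p q) (y : Letter Ω₂) (x : Letter Ω₁) :
    IsHomog opRing ((letters Ω₂).wl y + (letters Ω₁).cop.wr x)
      ((letters Ω₂).wr y + (letters Ω₁).cop.wl x) (letterPair p x y) := by
  rw [add_comm, add_comm ((letters Ω₂).wr y)]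
  exact (letterPair_isHomog H x y).symm

theorem rNum_eq_zero (H : Nomes p q) {i j : Bool × Bool} (h : wt₂ i ≠ wt₂ j) {z : ℂ} (hz : z ≠ 0) :
    mulOp (Mero.of (rNum p q i.1 i.2 j.1 j.2 z)) = 0 := by
  obtain ⟨u, rfl⟩ := exists_qp_two_mul H.q_pos H.q_lt hz
  rw [rNum_eq_rs H, show (fun l => qp q (u + 1) * rs p q i.1 i.2 j.1 j.2 u l) = fun _ => 0 from
    funext fun l => by rw [rs_eq_zero h, mul_zero], Mero.of_zero, mulOp_zero]

/-- Scalar matrices satisfy the exchange relation. -/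
theorem exchange_scalar (H : Nomes p q) {z : ℂ} (hz : z ≠ 0) (K : ℂ) (i j : Bool × Bool) :
    mulOp (Mero.of (rNum p q j.1 j.2 i.1 i.2 z)) * (K • opRing.T (-wt₂ j)) =
      mulOp (Mero.of (rNum p q j.1 j.2 i.1 i.2 z)) * (K • opRing.T (-wt₂ i)) := by
  by_cases h : wt₂ j = wt₂ i
  · rw [h]
  · rw [rNum_eq_zero H h hz, zero_mul, zero_mul]

theorem ite_smul_T_mul (c c' : ℂ) (a b a' b' : Bool) :
    (if a = b then c • opRing.T (-wt a) else 0) * (if a' = b' then c' • opRing.T (-wt a') else 0) =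
      if (a, a') = (b, b') then (c * c') • opRing.T (-wt₂ (a, a')) else 0 := by
  simp only [Prod.mk.injEq, ite_and]
  split_ifs
  · rw [smul_mul_smul_comm, opRing.T_mul, wt₂, neg_add]
  · rw [mul_zero]
  · rw [zero_mul]
  · rw [zero_mul]

theorem ite_smul_T_mul' (c c' : ℂ) (a b a' b' : Bool) :
    (if a' = b' then c' • opRing.T (-wt a') else 0) * (if a = b then c • opRing.T (-wt a) else 0) =
      if (a, a') = (b, b') then (c * c') • opRing.T (-wt₂ (a, a')) else 0 := by
  simp only [Prod.mk.injEq, ite_and]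
  split_ifs
  · rw [smul_mul_smul_comm, opRing.T_mul, wt₂, mul_comm c', neg_add, add_comm]
  · rw [mul_zero]
  · rw [zero_mul]
  · rw [zero_mul]

/-- The exchange relation in the first argument. -/
theorem rll_left (H : Nomes p q) (z₁ z₂ : Ω₁.Pt) (i j : Bool × Bool) :
    ∑ k : Bool × Bool, rmu opRing (letters Ω₂).words
        (mulOp (Mero.of (rNum p q k.1 k.2 i.1 i.2 ((z₁ : ℂ) / z₂)))) *
        ⟨pairWords opRing (letters Ω₁).cop (letters Ω₂) (letterPair p) (wordAB z₁ z₂ k j)⟩ =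
      ∑ k : Bool × Bool, lmu opRing (letters Ω₂).words
        (mulOp (Mero.of (rNum p q j.1 j.2 k.1 k.2 ((z₁ : ℂ) / z₂)))) *
        ⟨pairWords opRing (letters Ω₁).cop (letters Ω₂) (letterPair p) (wordBA z₁ z₂ i k)⟩ := by
  have hz : (z₁ : ℂ) / z₂ ≠ 0 := div_ne_zero z₁.ne_zero z₂.ne_zero
  -- Words of the first argument comultiply in the coopposite coalgebra, which transposes the
  -- matrix; the indices of the words and of the R-matrix are therefore swapped throughout.
  have ha := multFamily_pairWords (ω := wt₂) (letterPair_isHomog (Ω₁ := Ω₁) (Ω₂ := Ω₂) H)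
    (fun i j => wordBA z₁ z₂ j i)
    (fun i j F => by
      rw [Alphabet.cop_words_sum, sum_wordBA])
    (fun i j => wr_wordBA z₁ z₂ j i) (fun i j => wl_wordBA z₁ z₂ j i)
    (fun i j => (diag_wordBA z₁ z₂ j i).trans (by simp only [eq_comm]))
  have hb := multFamily_pairWords (ω := wt₂) (letterPair_isHomog (Ω₁ := Ω₁) (Ω₂ := Ω₂) H)
    (fun i j => wordAB z₁ z₂ j i)
    (fun i j F => by
      rw [Alphabet.cop_words_sum, sum_wordAB])
    (fun i j => wr_wordAB z₁ z₂ j i) (fun i j => wl_wordAB z₁ z₂ j i)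
    (fun i j => (diag_wordAB z₁ z₂ j i).trans (by simp only [eq_comm]))
  refine (ha.rll hb (ρ := fun k i => mulOp (Mero.of (rNum p q i.1 i.2 k.1 k.2 ((z₁ : ℂ) / z₂))))
    (fun k i => mulOp_mem _) (fun k i h => rNum_eq_zero H h.symm hz) ?_ j i).symm
  intro y i j
  simp only [wordAB, wordBA, pairWords_pair]
  cases y with
  | L k e z =>
    simp only [letters_sum_L]
    exact exchange_left_L H z₁ z₂ z j.1 i.1 j.2 i.2 k e
  | detInv z =>
    -- Against det⁻¹ both matrices are scalar with the same scalar, and the R-matrix commutes with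
    -- them by weight conservation.
    have hw : (letters Ω₂).wl (.detInv z) = 0 := rfl
    have hw' : (letters Ω₂).wr (.detInv z) = 0 := rfl
    simp only [letters_sum_detInv, hw, hw', neg_zero, opRing.cj_zero, opRing.T_zero, mul_one,
      letterPair]
    have h1 := fun (c c' : ℂ) (x : Bool × Bool) => ite_smul_T_mul' c c' j.1 x.1 j.2 x.2
    have h2 := fun (c c' : ℂ) (x : Bool × Bool) => ite_smul_T_mul c c' x.1 i.1 x.2 i.2
    simp only [h1, h2, Prod.mk.eta, mul_ite, mul_zero, Finset.sum_ite_eq, Finset.sum_ite_eq',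
      Finset.mem_univ, if_true]
    exact (exchange_scalar H hz _ _ _).symm

/-- The exchange relation in the second argument. -/
theorem rll_right (H : Nomes p q) (z₁ z₂ : Ω₂.Pt) (i j : Bool × Bool) :
    ∑ k : Bool × Bool, lmu opRing (letters Ω₁).cop.words
        (mulOp (Mero.of (rNum p q k.1 k.2 i.1 i.2 ((z₁ : ℂ) / z₂)))) *
        ⟨pairWords opRing (letters Ω₂) (letters Ω₁).cop (fun y x => letterPair p x y)
          (wordAB z₁ z₂ k j)⟩ =
      ∑ k : Bool × Bool, rmu opRing (letters Ω₁).cop.words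
        (mulOp (Mero.of (rNum p q j.1 j.2 k.1 k.2 ((z₁ : ℂ) / z₂)))) *
        ⟨pairWords opRing (letters Ω₂) (letters Ω₁).cop (fun y x => letterPair p x y)
          (wordBA z₁ z₂ i k)⟩ := by
  have hz : (z₁ : ℂ) / z₂ ≠ 0 := div_ne_zero z₁.ne_zero z₂.ne_zero
  have ha := multFamily_pairWords (ω := wt₂) (letterPair_isHomog_flip (Ω₁ := Ω₁) (Ω₂ := Ω₂) H)
    (fun i j => wordAB z₁ z₂ i j) (fun i j F => sum_wordAB z₁ z₂ i j F)
    (fun i j => wl_wordAB z₁ z₂ i j) (fun i j => wr_wordAB z₁ z₂ i j)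
    (fun i j => diag_wordAB z₁ z₂ i j)
  have hb := multFamily_pairWords (ω := wt₂) (letterPair_isHomog_flip (Ω₁ := Ω₁) (Ω₂ := Ω₂) H)
    (fun i j => wordBA z₁ z₂ i j) (fun i j F => sum_wordBA z₁ z₂ i j F)
    (fun i j => wl_wordBA z₁ z₂ i j) (fun i j => wr_wordBA z₁ z₂ i j)
    (fun i j => diag_wordBA z₁ z₂ i j)
  refine ha.rll hb (ρ := fun k i => mulOp (Mero.of (rNum p q k.1 k.2 i.1 i.2 ((z₁ : ℂ) / z₂))))
    (fun k i => mulOp_mem _) (fun k i h => rNum_eq_zero H h hz) ?_ i j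
  intro y i j
  simp only [wordAB, wordBA, pairWords_pair, Alphabet.cop_sum]
  cases y with
  | L k e z =>
    simp only [letters_sum_L]
    exact exchange_right_L H z₁ z₂ z i.1 j.1 i.2 j.2 k e
  | detInv z =>
    have hw : (letters Ω₁).cop.wl (.detInv z) = 0 := rfl
    have hw' : (letters Ω₁).cop.wr (.detInv z) = 0 := rfl
    simp only [letters_sum_detInv, hw, hw', neg_zero, opRing.cj_zero, opRing.T_zero, mul_one,
      letterPair]
    have h1 := fun (c c' : ℂ) (x : Bool × Bool) => ite_smul_T_mul c c' x.1 j.1 x.2 j.2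
    have h2 := fun (c c' : ℂ) (x : Bool × Bool) => ite_smul_T_mul' c c' i.1 x.1 i.2 x.2
    simp only [h1, h2, Prod.mk.eta, mul_ite, mul_zero, Finset.sum_ite_eq, Finset.sum_ite_eq',
      Finset.mem_univ, if_true]
    exact exchange_scalar H hz _ _ _

end Realization

/-! ### The determinant as a group-like functional, and the two algebra homomorphisms. -/

section Realization

variable {p q : ℝ} {Ω₁ Ω₂ : SpectralSet q}

theorem IsHomog.sub {D : Type} [Ring D] {𝒟 : ShiftRing D} {i j : ℤ} {P Q : D}
    (hP : IsHomog 𝒟 i j P) (hQ : IsHomog 𝒟 i j Q) : IsHomog 𝒟 i j (P - Q) := by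
  rw [sub_eq_add_neg]
  refine hP.add ?_
  rcases hQ with rfl | ⟨rfl, f, hf, rfl⟩
  · rw [neg_zero]
    exact .zero _ _
  · exact Or.inr ⟨rfl, -f, neg_mem hf, (neg_mul _ _).symm⟩

theorem counitOp_L {Ω : SpectralSet q} (a b : Bool) (z : Ω.Pt) :
    counitOp opRing (letters Ω) (.L a b z) = if a = b then opRing.T (-wt a) else 0 := by
  cases a <;> cases b <;> rfl

theorem counitOp_detInv {Ω : SpectralSet q} (z : Ω.Pt) :
    counitOp opRing (letters Ω) (.detInv z) = 1 := opRing.T_zero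

theorem lmu_algebraMap {W : Type} {𝒲 : Alphabet W} (c : ℂ) :
    lmu opRing 𝒲 (mulOp (algebraMap ℂ Mero c)) = algebraMap ℂ _ c :=
  Conv.ext (funext fun x => by
    rw [Conv.algebraMap_apply, mulOp_algebraMap]
    rfl)

theorem rmu_algebraMap {W : Type} {𝒲 : Alphabet W} (c : ℂ) :
    rmu opRing 𝒲 (mulOp (algebraMap ℂ Mero c)) = algebraMap ℂ _ c :=
  Conv.ext (funext fun x => by
    rw [Conv.algebraMap_apply, mulOp_algebraMap, Algebra.commutes]
    rfl)

/-- The functional given by the determinant in the first argument. -/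
def leftDet (p : ℝ) (Ω₂ : SpectralSet q) (w : Ω₁.Pt) : Conv opRing (letters Ω₂).words :=
  leftLetter p Ω₂ (.L true true w) * leftLetter p Ω₂ (.L false false (SpectralSet.move 1 w)) -
    leftLetter p Ω₂ (.L false true w) * leftLetter p Ω₂ (.L true false (SpectralSet.move 1 w))

/-- The functional given by the determinant in the second argument. -/
def rightDet (p : ℝ) (Ω₁ : SpectralSet q) (z : Ω₂.Pt) : Conv opRing (letters Ω₁).cop.words :=
  rightLetter p Ω₁ (.L true true z) * rightLetter p Ω₁ (.L false false (SpectralSet.move 1 z)) -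
    rightLetter p Ω₁ (.L false true z) * rightLetter p Ω₁ (.L true false (SpectralSet.move 1 z))

/-- The character by which the determinant acts from the left. -/
def leftChar (p : ℝ) {Ω₁ Ω₂ : SpectralSet q} (w : Ω₁.Pt) : Letter Ω₂ → ℂ
  | .L _ _ z => thetaRatio p q 0 1 ((w : ℂ) / z)
  | .detInv z => thetaRatio p q 1 (-1) ((w : ℂ) / z)

/-- The character by which the determinant acts from the right. -/
def rightChar (p : ℝ) {Ω₁ Ω₂ : SpectralSet q} (z : Ω₂.Pt) : Letter Ω₁ → ℂ
  | .L _ _ w => thetaRatio p q (-1) 0 ((w : ℂ) / z)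
  | .detInv w => thetaRatio p q 1 (-1) ((w : ℂ) / z)

theorem thetaRatio_ne_zero (H : Nomes p q) (hΩ : Separated p Ω₁ Ω₂) (a b : ℤ) (w : Ω₁.Pt)
    (z : Ω₂.Pt) : thetaRatio p q a b ((w : ℂ) / z) ≠ 0 := by
  obtain ⟨u, hu⟩ := exists_log H w
  obtain ⟨v, hv⟩ := exists_log H z
  have hg := hΩ.generic H w z hu hv
  rw [← hu, ← hv, qp_div H, thetaRatio_qp H]
  exact div_ne_zero (hg a) (hg b)

theorem thetaRatio_inv (H : Nomes p q) (a b : ℤ) (w : Ω₁.Pt)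
    (z : Ω₂.Pt) : (thetaRatio p q a b ((w : ℂ) / z))⁻¹ = thetaRatio p q b a ((w : ℂ) / z) := by
  obtain ⟨u, hu⟩ := exists_log H w
  obtain ⟨v, hv⟩ := exists_log H z
  rw [← hu, ← hv, qp_div H, thetaRatio_qp H, thetaRatio_qp H, inv_div]

/-- The exchange relation at w and q²w makes the antisymmetric vector an eigenvector with eigenvalue
the determinant, so the determinant is multiplicative on words. It remains to know it on letters: on
`L` this is `det_left_L`, and on det⁻¹ two neighbouring scalars multiply and a common theta factor
cancels. -/
theorem leftDet_eq (H : Nomes p q) (hΩ : Separated p Ω₁ Ω₂) (w : Ω₁.Pt) :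
    rmu opRing _ (mulOp (Mero.of fun l => (detF p q l)⁻¹)) *
      (lmu opRing _ (mulOp (Mero.of (detF p q))) * leftDet p Ω₂ w) =
        charConv opRing (letters Ω₂) (leftChar p w) := by
  have hw : leftDet p Ω₂ w =
      ⟨pairWords opRing (letters Ω₁).cop (letters Ω₂) (letterPair p)
        (wordAB w (SpectralSet.move 1 w) (true, false) (true, false))⟩ -
      ⟨pairWords opRing (letters Ω₁).cop (letters Ω₂) (letterPair p)
        (wordAB w (SpectralSet.move 1 w) (false, true) (true, false))⟩ := by
    rw [leftDet, leftLetter, leftLetter, leftLetter, leftLetter, extR_toConv_mul, extR_toConv_mul]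
    rfl
  have hb := multFamily_pairWords (ω := wt₂) (letterPair_isHomog (Ω₁ := Ω₁) (Ω₂ := Ω₂) H)
    (fun i j => wordAB w (SpectralSet.move 1 w) j i)
    (fun i j F => by
      rw [Alphabet.cop_words_sum, sum_wordAB])
    (fun i j => wr_wordAB w _ j i) (fun i j => wl_wordAB w _ j i)
    (fun i j => (diag_wordAB w _ j i).trans (by simp only [eq_comm]))
  have hd : ∀ i, ∑ j, antisymm j • (⟨pairWords opRing (letters Ω₁).cop (letters Ω₂) (letterPair p)
      (wordAB w (SpectralSet.move 1 w) j i)⟩ : Conv opRing (letters Ω₂).words) =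
      antisymm i • leftDet p Ω₂ w := by
    intro i
    rw [hw]
    exact antisymm_of_rll H w (mL := fun f => rmu opRing _ (mulOp f))
      (mR := fun f => lmu opRing _ (mulOp f))
      (fun f g => by rw [mulOp_add, rmu_add]) (fun f g => by rw [mulOp_add, lmu_add])
      (fun f g => by rw [mulOp_mul, rmu_mul])
      (by rw [show (1 : Mero) = algebraMap ℂ Mero 1 from (map_one _).symm, rmu_algebraMap, map_one])
      (A := fun k j => ⟨pairWords opRing (letters Ω₁).cop (letters Ω₂) (letterPair p)
        (wordAB w (SpectralSet.move 1 w) k j)⟩)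
      (B := fun i k => ⟨pairWords opRing (letters Ω₁).cop (letters Ω₂) (letterPair p)
        (wordBA w (SpectralSet.move 1 w) i k)⟩)
      (fun i j => rll_left H w (SpectralSet.move 1 w) i j) i
  refine rmu_mul_lmu_mul_eq_charConv ?_ ?_
    (hb.det_col (fun i hi => antisymm_ne_zero hi) hd (i₀ := (true, false)) rfl)
    (mulOp_mem _) (mulOp_mem _) ?_ ?_
  · rw [hw]
    intro v
    rw [Conv.sub_apply]
    exact (hb.homog (true, false) (true, false) v).sub (hb.homog (true, false) (false, true) v)
  · rw [hw, Conv.sub_apply]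
    have h1 := hb.nil (true, false) (true, false)
    have h2 := hb.nil (true, false) (false, true)
    rw [if_pos rfl] at h1
    rw [if_neg (by simp)] at h2
    rw [h1, h2, sub_zero]
    exact opRing.T_zero
  · rw [mulOp_comm, detF_mul_inv H]
  · intro y
    rw [hw, Conv.sub_apply]
    simp only [wordAB, pairWords_pair]
    cases y with
    | L k e z =>
      simp only [letters_sum_L]
      refine (det_left_L H hΩ w z k e).trans ?_
      rw [counitOp_L, smul_ite, smul_zero]
      rfl
    | detInv z =>
      have hwl : (letters Ω₂).wl (.detInv z) = 0 := rfl
      have hwr : (letters Ω₂).wr (.detInv z) = 0 := rfl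
      have hT : opRing.T (-wt true) * opRing.T (-wt false) = 1 := by
        rw [opRing.T_mul, ← opRing.T_zero]
        rfl
      simp only [letters_sum_detInv, hwl, hwr, neg_zero, opRing.cj_zero, opRing.T_zero, mul_one,
        letterPair, if_true, reduceCtorEq, if_false, zero_mul, sub_zero, smul_mul_smul_comm, hT,
        counitOp_detInv, leftChar]
      rw [← mul_assoc, mulOp_comm, detF_mul_inv H, one_mul]
      congr 1
      obtain ⟨u, hu⟩ := exists_log H w
      obtain ⟨v, hv⟩ := exists_log H z
      have h0 := hΩ.generic H w z hu hv 0
      rw [← move_log H hu, ← hu, ← hv, qp_div H, qp_div H, thetaRatio_qp H, thetaRatio_qp H,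
        thetaRatio_qp H]
      push_cast at h0 ⊢
      rw [add_zero] at h0
      rw [show u + 1 - v + 0 = u - v + 1 by ring, show u + 1 - v + -1 = u - v by ring, add_zero,
        div_mul_div_comm, mul_comm (sf p q (u - v)), mul_div_mul_right _ _ h0]

/-- As for the first argument, with rows in place of columns and F in place of its inverse. -/
theorem rightDet_eq (H : Nomes p q) (hΩ : Separated p Ω₁ Ω₂) (z : Ω₂.Pt) :
    rmu opRing _ (mulOp (Mero.of (detF p q))) *
      (lmu opRing _ (mulOp (Mero.of fun l => (detF p q l)⁻¹)) * rightDet p Ω₁ z) =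
        charConv opRing (letters Ω₁).cop (rightChar p z) := by
  have hw : rightDet p Ω₁ z =
      ⟨pairWords opRing (letters Ω₂) (letters Ω₁).cop (fun y x => letterPair p x y)
        (wordAB z (SpectralSet.move 1 z) (true, false) (true, false))⟩ -
      ⟨pairWords opRing (letters Ω₂) (letters Ω₁).cop (fun y x => letterPair p x y)
        (wordAB z (SpectralSet.move 1 z) (false, true) (true, false))⟩ := by
    rw [rightDet, rightLetter, rightLetter, rightLetter, rightLetter, extR_toConv_mul,
      extR_toConv_mul]
    rfl
  have hb := multFamily_pairWords (ω := wt₂) (letterPair_isHomog_flip (Ω₁ := Ω₁) (Ω₂ := Ω₂) H)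
    (fun i j => wordAB z (SpectralSet.move 1 z) i j) (fun i j F => sum_wordAB z _ i j F)
    (fun i j => wl_wordAB z _ i j) (fun i j => wr_wordAB z _ i j)
    (fun i j => diag_wordAB z _ i j)
  have hd : ∀ j, ∑ i, antisymm i • (⟨pairWords opRing (letters Ω₂) (letters Ω₁).cop
      (fun y x => letterPair p x y) (wordAB z (SpectralSet.move 1 z) i j)⟩ :
        Conv opRing (letters Ω₁).cop.words) = antisymm j • rightDet p Ω₁ z := by
    intro i
    rw [hw]
    exact antisymm_of_rll H z (mL := fun f => lmu opRing _ (mulOp f))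
      (mR := fun f => rmu opRing _ (mulOp f))
      (fun f g => by rw [mulOp_add, lmu_add]) (fun f g => by rw [mulOp_add, rmu_add])
      (fun f g => by rw [mulOp_mul, lmu_mul])
      (by rw [show (1 : Mero) = algebraMap ℂ Mero 1 from (map_one _).symm, lmu_algebraMap, map_one])
      (A := fun k j => ⟨pairWords opRing (letters Ω₂) (letters Ω₁).cop (fun y x => letterPair p x y)
        (wordAB z (SpectralSet.move 1 z) k j)⟩)
      (B := fun i k => ⟨pairWords opRing (letters Ω₂) (letters Ω₁).cop (fun y x => letterPair p x y)
        (wordBA z (SpectralSet.move 1 z) i k)⟩)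
      (fun i j => rll_right H z (SpectralSet.move 1 z) i j) i
  refine rmu_mul_lmu_mul_eq_charConv ?_ ?_
    (hb.det_row (fun i hi => antisymm_ne_zero hi) hd (j₀ := (true, false)) rfl)
    (mulOp_mem _) (mulOp_mem _) (detF_mul_inv H) ?_
  · rw [hw]
    intro v
    rw [Conv.sub_apply]
    exact (hb.homog (true, false) (true, false) v).sub (hb.homog (false, true) (true, false) v)
  · rw [hw, Conv.sub_apply]
    have h1 := hb.nil (true, false) (true, false)
    have h2 := hb.nil (false, true) (true, false)
    rw [if_pos rfl] at h1
    rw [if_neg (by simp)] at h2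
    rw [h1, h2, sub_zero]
    exact opRing.T_zero
  · intro y
    rw [hw, Conv.sub_apply, counitOp_cop]
    simp only [wordAB, pairWords_pair, Alphabet.cop_sum]
    cases y with
    | L i j w =>
      simp only [letters_sum_L]
      refine (det_right_L H hΩ w z i j).trans ?_
      rw [counitOp_L, smul_ite, smul_zero]
      split_ifs with h
      · rw [h]
        rfl
      · rfl
    | detInv w =>
      have hwl : (letters Ω₁).cop.wl (.detInv w) = 0 := rfl
      have hwr : (letters Ω₁).cop.wr (.detInv w) = 0 := rfl
      have hT : opRing.T (-wt true) * opRing.T (-wt false) = 1 := by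
        rw [opRing.T_mul, ← opRing.T_zero]
        rfl
      simp only [letters_sum_detInv, hwl, hwr, neg_zero, opRing.cj_zero, opRing.T_zero, mul_one,
        letterPair, if_true, reduceCtorEq, if_false, zero_mul, sub_zero, smul_mul_smul_comm, hT,
        counitOp_detInv, rightChar]
      rw [← mul_assoc, detF_mul_inv H, one_mul]
      congr 1
      obtain ⟨u, hu⟩ := exists_log H w
      obtain ⟨v, hv⟩ := exists_log H z
      have h0 := hΩ.generic H w z hu hv 0
      rw [← move_log H hv, ← hu, ← hv, qp_div H, qp_div H, thetaRatio_qp H, thetaRatio_qp H,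
        thetaRatio_qp H]
      push_cast at h0 ⊢
      rw [add_zero] at h0
      rw [show u - (v + 1) + 1 = u - v by ring, show u - (v + 1) + 0 = u - v + -1 by ring, add_zero,
        div_mul_div_comm, mul_comm (sf p q (u - v)), mul_div_mul_right _ _ h0]

/-- The comultiplication of det⁻¹ has a single term of weight zero, so its functional is
multiplicative in the word and given by the scalars prescribed on letters. -/
theorem leftLetter_detInv (H : Nomes p q) (w : Ω₁.Pt) :
    leftLetter p Ω₂ (.detInv w) =
      charConv opRing (letters Ω₂) (fun y => (leftChar p w y)⁻¹) := by
  refine eq_charConv ?_ fun y v => ?_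
  · change counitOp opRing (letters Ω₁).cop (.detInv w) = 1
    rw [counitOp_cop, counitOp_detInv]
  · change extR opRing (letters Ω₁).cop (letterPair p) (.detInv w) (y :: v) =
      _ * extR opRing (letters Ω₁).cop (letterPair p) (.detInv w) v
    rw [extR, Alphabet.cop_sum, letters_sum_detInv, show (letters Ω₁).cop.wr (.detInv w) = 0 from rfl,
      opRing.T_zero, mul_one]
    congr 1
    cases y with
    | L a b z =>
      rw [counitOp_L, smul_ite, smul_zero, letterPair, leftChar, thetaRatio_inv H]
    | detInv z => rw [counitOp_detInv, letterPair, leftChar, thetaRatio_inv H]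

theorem rightLetter_detInv (H : Nomes p q) (z : Ω₂.Pt) :
    rightLetter p Ω₁ (.detInv z) =
      charConv opRing (letters Ω₁).cop (fun y => (rightChar p z y)⁻¹) := by
  refine eq_charConv ?_ fun y v => ?_
  · exact counitOp_detInv z
  · change extR opRing (letters Ω₂) (fun y x => letterPair p x y) (.detInv z) (y :: v) =
      _ * extR opRing (letters Ω₂) (fun y x => letterPair p x y) (.detInv z) v
    rw [extR, letters_sum_detInv, show (letters Ω₂).wr (.detInv z) = 0 from rfl,
      opRing.T_zero, mul_one, counitOp_cop]
    congr 1
    cases y with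
    | L a b w =>
      rw [counitOp_L, smul_ite, smul_zero, letterPair, rightChar, thetaRatio_inv H]
    | detInv w => rw [counitOp_detInv, letterPair, rightChar, thetaRatio_inv H]

theorem leftChar_ne_zero (H : Nomes p q) (hΩ : Separated p Ω₁ Ω₂) (w : Ω₁.Pt) (y : Letter Ω₂) :
    leftChar p w y ≠ 0 := by
  cases y <;> exact thetaRatio_ne_zero H hΩ _ _ _ _

theorem rightChar_ne_zero (H : Nomes p q) (hΩ : Separated p Ω₁ Ω₂) (z : Ω₂.Pt) (y : Letter Ω₁) :
    rightChar p z y ≠ 0 := by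
  cases y <;> exact thetaRatio_ne_zero H hΩ _ _ _ _

theorem leftChar_comul (w : Ω₁.Pt) (x : Letter Ω₂) (y : Letter Ω₂ × Letter Ω₂)
    (hy : y ∈ (letters Ω₂).comul x) :
    leftChar p w y.1 = leftChar p w x ∧ leftChar p w y.2 = leftChar p w x := by
  change y ∈ x.comul at hy
  cases x with
  | L a b z => simp only [Letter.comul, List.mem_cons, List.not_mem_nil, or_false] at hy
               rcases hy with rfl | rfl <;> exact ⟨rfl, rfl⟩
  | detInv z => simp only [Letter.comul, List.mem_cons, List.not_mem_nil, or_false] at hy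
                subst hy; exact ⟨rfl, rfl⟩

theorem rightChar_comul (z : Ω₂.Pt) (x : Letter Ω₁) (y : Letter Ω₁ × Letter Ω₁)
    (hy : y ∈ (letters Ω₁).cop.comul x) :
    rightChar p z y.1 = rightChar p z x ∧ rightChar p z y.2 = rightChar p z x := by
  obtain ⟨y', hy', rfl⟩ := List.mem_map.1 hy
  change y' ∈ x.comul at hy'
  cases x with
  | L a b w => simp only [Letter.comul, List.mem_cons, List.not_mem_nil, or_false] at hy'
               rcases hy' with rfl | rfl <;> exact ⟨rfl, rfl⟩
  | detInv w => simp only [Letter.comul, List.mem_cons, List.not_mem_nil, or_false] at hy'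
                subst hy'; exact ⟨rfl, rfl⟩

theorem leftLetter_homog (H : Nomes p q) (x : Letter Ω₁) :
    ConvHomog x.wtR x.wtL (leftLetter p Ω₂ x) := fun v =>
  extR_isHomog (letterPair_isHomog (Ω₁ := Ω₁) (Ω₂ := Ω₂) H) x v

theorem rightLetter_homog (H : Nomes p q) (y : Letter Ω₂) :
    ConvHomog y.wtL y.wtR (rightLetter p Ω₁ y) := fun v =>
  extR_isHomog (letterPair_isHomog_flip (Ω₁ := Ω₁) (Ω₂ := Ω₂) H) y v

/-- The left moment map goes to the right one and conversely, since the first argument carries the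
coopposite structure. The exchange relation is `rll_left`, and invertibility of the determinant
holds because it acts as a nowhere zero character. -/
theorem isRealization_left (H : Nomes p q) (hΩ : Separated p Ω₁ Ω₂) :
    IsRealization p (fun f => rmu opRing (letters Ω₂).words (mulOp f))
      (fun f => lmu opRing (letters Ω₂).words (mulOp f)) (leftLetter (Ω₁ := Ω₁) p Ω₂) where
  mL_add f g := by rw [mulOp_add, rmu_add]
  mL_mul f g := by rw [mulOp_mul, rmu_mul]
  mL_const c := rmu_algebraMap c
  mR_add f g := by rw [mulOp_add, lmu_add]
  mR_mul f g := by rw [mulOp_mul, lmu_mul]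
  mR_const c := lmu_algebraMap c
  comm f g := rmu_mul_lmu (mulOp_mem _) (mulOp_mem _)
  mL_L f a b z := by
    rw [(leftLetter_homog H _).rmu_mul (mulOp_mem f), opRing_cj]
    rfl
  mR_L f a b z := by
    rw [(leftLetter_homog H _).lmu_mul (mulOp_mem f), opRing_cj]
    rfl
  rll a b c d z₁ z₂ := by
    have h := rll_left (Ω₂ := Ω₂) H z₁ z₂ (a, c) (b, d)
    simp only [Fintype.sum_prod_type, wordAB, wordBA, ← extR_toConv_mul, ← mul_assoc] at h
    exact h
  det_mul w := by
    rw [← rmu_mul_lmu (mulOp_mem _) (mulOp_mem _), mul_assoc (rmu _ _ _)]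
    change rmu _ _ _ * (lmu _ _ _ * leftDet p Ω₂ w) * _ = 1
    rw [leftDet_eq H hΩ, leftLetter_detInv H]
    exact charConv_mul_charConv (fun x y hy => (leftChar_comul w x y hy).1)
      (fun x y hy => by rw [(leftChar_comul w x y hy).2])
      (fun x => mul_inv_cancel₀ (leftChar_ne_zero H hΩ w x))
  mul_det w := by
    rw [← rmu_mul_lmu (mulOp_mem _) (mulOp_mem _), mul_assoc (rmu _ _ _)]
    change _ * (rmu _ _ _ * (lmu _ _ _ * leftDet p Ω₂ w)) = 1
    rw [leftDet_eq H hΩ, leftLetter_detInv H]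
    exact charConv_mul_charConv (fun x y hy => by rw [(leftChar_comul w x y hy).1])
      (fun x y hy => (leftChar_comul w x y hy).2)
      (fun x => inv_mul_cancel₀ (leftChar_ne_zero H hΩ w x))

theorem isRealization_right (H : Nomes p q) (hΩ : Separated p Ω₁ Ω₂) :
    IsRealization p (fun f => lmu opRing (letters Ω₁).cop.words (mulOp f))
      (fun f => rmu opRing (letters Ω₁).cop.words (mulOp f)) (rightLetter (Ω₂ := Ω₂) p Ω₁) where
  mL_add f g := by rw [mulOp_add, lmu_add]
  mL_mul f g := by rw [mulOp_mul, lmu_mul]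
  mL_const c := lmu_algebraMap c
  mR_add f g := by rw [mulOp_add, rmu_add]
  mR_mul f g := by rw [mulOp_mul, rmu_mul]
  mR_const c := rmu_algebraMap c
  comm f g := (rmu_mul_lmu (mulOp_mem _) (mulOp_mem _)).symm
  mL_L f a b z := by
    rw [(rightLetter_homog H _).lmu_mul (mulOp_mem f), opRing_cj]
    rfl
  mR_L f a b z := by
    rw [(rightLetter_homog H _).rmu_mul (mulOp_mem f), opRing_cj]
    rfl
  rll a b c d z₁ z₂ := by
    have h := rll_right (Ω₁ := Ω₁) H z₁ z₂ (a, c) (b, d)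
    simp only [Fintype.sum_prod_type, wordAB, wordBA, ← extR_toConv_mul, ← mul_assoc] at h
    exact h
  det_mul z := by
    rw [mul_assoc (rmu _ _ _)]
    change rmu _ _ _ * (lmu _ _ _ * rightDet p Ω₁ z) * _ = 1
    rw [rightDet_eq H hΩ, rightLetter_detInv H]
    exact charConv_mul_charConv (fun x y hy => (rightChar_comul z x y hy).1)
      (fun x y hy => by rw [(rightChar_comul z x y hy).2])
      (fun x => mul_inv_cancel₀ (rightChar_ne_zero H hΩ z x))
  mul_det z := by
    rw [mul_assoc (rmu _ _ _)]
    change _ * (rmu _ _ _ * (lmu _ _ _ * rightDet p Ω₁ z)) = 1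
    rw [rightDet_eq H hΩ, rightLetter_detInv H]
    exact charConv_mul_charConv (fun x y hy => by rw [(rightChar_comul z x y hy).1])
      (fun x y hy => (rightChar_comul z x y hy).2)
      (fun x => inv_mul_cancel₀ (rightChar_ne_zero H hΩ z x))

end Realization

/-! ### Normal forms in the elliptic quantum group -/

section NormalForm

variable {p q : ℝ} {Ω : SpectralSet q}

theorem toE_rel {a b : Free Ω} (h : Rel p a b) : toE p a = toE p b :=
  RingQuot.mkAlgHom_rel ℂ h

theorem muL_add (f g : Mero) : muL p (Ω := Ω) (f + g) = muL p f + muL p g := by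
  have h := toE_rel (Rel.muL_add (p := p) (Ω := Ω) f g)
  rwa [map_add] at h

theorem muR_add (f g : Mero) : muR p (Ω := Ω) (f + g) = muR p f + muR p g := by
  have h := toE_rel (Rel.muR_add (p := p) (Ω := Ω) f g)
  rwa [map_add] at h

theorem muL_mul (f g : Mero) : muL p (Ω := Ω) (f * g) = muL p f * muL p g := by
  have h := toE_rel (Rel.muL_mul (p := p) (Ω := Ω) f g)
  rwa [map_mul] at h

theorem muR_mul (f g : Mero) : muR p (Ω := Ω) (f * g) = muR p f * muR p g := by
  have h := toE_rel (Rel.muR_mul (p := p) (Ω := Ω) f g)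
  rwa [map_mul] at h

theorem muL_algebraMap (c : ℂ) : muL p (Ω := Ω) (algebraMap ℂ Mero c) = algebraMap ℂ _ c := by
  have h := toE_rel (Rel.muL_const (p := p) (Ω := Ω) c)
  rwa [AlgHom.commutes] at h

theorem muR_algebraMap (c : ℂ) : muR p (Ω := Ω) (algebraMap ℂ Mero c) = algebraMap ℂ _ c := by
  have h := toE_rel (Rel.muR_const (p := p) (Ω := Ω) c)
  rwa [AlgHom.commutes] at h

theorem muL_one : muL p (Ω := Ω) 1 = 1 := by
  rw [show (1 : Mero) = algebraMap ℂ Mero 1 from (map_one _).symm, muL_algebraMap, map_one]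

theorem muR_one : muR p (Ω := Ω) 1 = 1 := by
  rw [show (1 : Mero) = algebraMap ℂ Mero 1 from (map_one _).symm, muR_algebraMap, map_one]

theorem muL_mul_muR (f g : Mero) : muL p (Ω := Ω) f * muR p g = muR p g * muL p f := by
  have h := toE_rel (Rel.mu_comm (p := p) (Ω := Ω) f g)
  rwa [map_mul, map_mul] at h

/-- A letter as an element of the algebra. -/
def gen (p : ℝ) (x : Letter Ω) : E p Ω := toE p (fletter x)

/-- The determinant without the correction by moment maps. -/
def det₀ (p : ℝ) (z : Ω.Pt) : E p Ω :=
  gen p (.L true true z) * gen p (.L false false (SpectralSet.move 1 z)) -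
    gen p (.L false true z) * gen p (.L true false (SpectralSet.move 1 z))

/-- The determinant. -/
def detE (p : ℝ) (z : Ω.Pt) : E p Ω :=
  muR p (Mero.of (detF p q)) * muL p (Mero.of fun l => (detF p q l)⁻¹) * det₀ p z

theorem toE_fdet (z : Ω.Pt) : toE p (fdet p z) = detE p z := by
  simp only [fdet, map_mul, map_sub]
  rfl

theorem detE_mul_detInv (z : Ω.Pt) : detE p z * gen p (.detInv z) = 1 := by
  have h := toE_rel (Rel.det_mul_detInv (p := p) z)
  rwa [map_mul, map_one, toE_fdet] at h

theorem detInv_mul_detE (z : Ω.Pt) : gen p (.detInv z) * detE p z = 1 := by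
  have h := toE_rel (Rel.detInv_mul_det (p := p) z)
  rwa [map_mul, map_one, toE_fdet] at h

theorem muL_mul_L (f : Mero) (a b : Bool) (z : Ω.Pt) :
    muL p f * gen p (.L a b z) = gen p (.L a b z) * muL p (shift (wt a) f) := by
  have h := toE_rel (Rel.muL_L (p := p) f a b z)
  rwa [map_mul, map_mul] at h

theorem muR_mul_L (f : Mero) (a b : Bool) (z : Ω.Pt) :
    muR p f * gen p (.L a b z) = gen p (.L a b z) * muR p (shift (wt b) f) := by
  have h := toE_rel (Rel.muR_L (p := p) f a b z)
  rwa [map_mul, map_mul] at h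

/-- Each of the two terms has one row index 1 and one row index -1, so the shifts cancel. -/
theorem muL_mul_det₀ (f : Mero) (z : Ω.Pt) : muL p f * det₀ p z = det₀ p z * muL p f := by
  have h : ∀ a b : Bool, ∀ z' : Ω.Pt, muL p f * (gen p (.L a true z) * gen p (.L b false z')) =
      gen p (.L a true z) * gen p (.L b false z') *
        muL p (shift ((wt b : ℂ) + (wt a : ℂ)) f) := by
    intro a b z'
    rw [← mul_assoc, muL_mul_L, mul_assoc, muL_mul_L, ← mul_assoc, shift_shift]
  have e1 : (wt false : ℂ) + (wt true : ℂ) = 0 := by simp [wt]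
  have e2 : (wt true : ℂ) + (wt false : ℂ) = 0 := by simp [wt]
  rw [det₀, mul_sub, h, h, e1, e2, shift_zero, sub_mul]

theorem muR_mul_det₀ (f : Mero) (z : Ω.Pt) : muR p f * det₀ p z = det₀ p z * muR p f := by
  have h : ∀ a b : Bool, ∀ z' : Ω.Pt, muR p f * (gen p (.L a true z) * gen p (.L b false z')) =
      gen p (.L a true z) * gen p (.L b false z') * muR p f := by
    intro a b z'
    have e1 : (wt false : ℂ) + (wt true : ℂ) = 0 := by simp [wt]
    rw [← mul_assoc, muR_mul_L, mul_assoc, muR_mul_L, ← mul_assoc, shift_shift, e1, shift_zero]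
  rw [det₀, mul_sub, h, h, sub_mul]

theorem mul_comm_mero (f g : Mero) : f * g = g * f := mul_comm f g

theorem muL_mul_detE (f : Mero) (z : Ω.Pt) : muL p f * detE p z = detE p z * muL p f := by
  have h1 : Commute (muL p (Ω := Ω) f) (muR p (Mero.of (detF p q))) := muL_mul_muR _ _
  have h2 : Commute (muL p (Ω := Ω) f) (muL p (Mero.of fun l => (detF p q l)⁻¹)) := by
    rw [Commute, SemiconjBy, ← muL_mul, ← muL_mul, mul_comm_mero]
  exact (h1.mul_right h2).mul_right (muL_mul_det₀ f z)

theorem muR_mul_detE (f : Mero) (z : Ω.Pt) : muR p f * detE p z = detE p z * muR p f := by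
  have h1 : Commute (muR p (Ω := Ω) f) (muL p (Mero.of fun l => (detF p q l)⁻¹)) :=
    (muL_mul_muR _ _).symm
  have h2 : Commute (muR p (Ω := Ω) f) (muR p (Mero.of (detF p q))) := by
    rw [Commute, SemiconjBy, ← muR_mul, ← muR_mul, mul_comm_mero]
  exact (h2.mul_right h1).mul_right (muR_mul_det₀ f z)

theorem comm_detInv_of_comm {X : E p Ω} {z : Ω.Pt} (h : X * detE p z = detE p z * X) :
    X * gen p (.detInv z) = gen p (.detInv z) * X := by
  calc X * gen p (.detInv z)
      = gen p (.detInv z) * detE p z * X * gen p (.detInv z) := by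
        rw [detInv_mul_detE, one_mul]
    _ = gen p (.detInv z) * X := by
        rw [mul_assoc _ (detE p z), ← h, mul_assoc, mul_assoc X, detE_mul_detInv, mul_one]

theorem muL_mul_gen (f : Mero) (x : Letter Ω) :
    muL p f * gen p x = gen p x * muL p (shift (x.wtL : ℂ) f) := by
  cases x with
  | L a b z => exact muL_mul_L f a b z
  | detInv z =>
    rw [show ((Letter.detInv z).wtL : ℂ) = 0 from Int.cast_zero, shift_zero]
    exact comm_detInv_of_comm (muL_mul_detE f z)

theorem muR_mul_gen (f : Mero) (x : Letter Ω) :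
    muR p f * gen p x = gen p x * muR p (shift (x.wtR : ℂ) f) := by
  cases x with
  | L a b z => exact muR_mul_L f a b z
  | detInv z =>
    rw [show ((Letter.detInv z).wtR : ℂ) = 0 from Int.cast_zero, shift_zero]
    exact comm_detInv_of_comm (muR_mul_detE f z)

theorem word_nil : word p ([] : List (Letter Ω)) = 1 := rfl

theorem word_cons (x : Letter Ω) (u : List (Letter Ω)) :
    word p (x :: u) = gen p x * word p u := by
  rw [word, List.map_cons, List.prod_cons]; rfl

theorem word_append (u v : List (Letter Ω)) : word p (u ++ v) = word p u * word p v := by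
  rw [word, List.map_append, List.prod_append]; rfl

theorem word_singleton (x : Letter Ω) : word p [x] = gen p x := by
  rw [word_cons, word_nil, mul_one]

theorem muL_mul_word (f : Mero) (u : List (Letter Ω)) :
    muL p f * word p u = word p u * muL p (shift (wordWtL u : ℂ) f) := by
  induction u generalizing f with
  | nil => rw [word_nil, mul_one, one_mul, show ((wordWtL ([] : List (Letter Ω)) : ℤ) : ℂ) = 0 from
      Int.cast_zero, shift_zero]
  | cons x u ih =>
    rw [word_cons, ← mul_assoc, muL_mul_gen, mul_assoc, ih, ← mul_assoc, shift_shift,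
      show wordWtL (x :: u) = x.wtL + wordWtL u from rfl, Int.cast_add, add_comm]

theorem muR_mul_word (f : Mero) (u : List (Letter Ω)) :
    muR p f * word p u = word p u * muR p (shift (wordWtR u : ℂ) f) := by
  induction u generalizing f with
  | nil => rw [word_nil, mul_one, one_mul, show ((wordWtR ([] : List (Letter Ω)) : ℤ) : ℂ) = 0 from
      Int.cast_zero, shift_zero]
  | cons x u ih =>
    rw [word_cons, ← mul_assoc, muR_mul_gen, mul_assoc, ih, ← mul_assoc, shift_shift,
      show wordWtR (x :: u) = x.wtR + wordWtR u from rfl, Int.cast_add, add_comm]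

/-- The elements in normal form span. -/
theorem mem_span_normal (a : E p Ω) :
    a ∈ Submodule.span ℂ {X : E p Ω | ∃ (f g : Mero) (u : List (Letter Ω)),
      X = muL p f * muR p g * word p u} := by
  set S := Submodule.span ℂ {X : E p Ω | ∃ (f g : Mero) (u : List (Letter Ω)),
      X = muL p f * muR p g * word p u} with hS
  -- The span contains 1, so it is enough that it is stable under left multiplication by every
  -- generator. Functions commute past a letter at the price of a shift by minus its weight.
  have key : ∀ t : Free Ω, ∀ X ∈ S, toE p t * X ∈ S := by
    intro t
    induction t using FreeAlgebra.induction with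
    | grade0 r =>
      intro X hX
      rw [AlgHom.commutes, ← Algebra.smul_def]
      exact S.smul_mem r hX
    | grade1 x =>
      intro X hX
      induction hX using Submodule.span_induction with
      | mem X hX =>
        obtain ⟨f, g, u, rfl⟩ := hX
        cases x with
        | muL h =>
          refine Submodule.subset_span ⟨h * f, g, u, ?_⟩
          change muL p h * _ = _
          rw [← mul_assoc, ← mul_assoc, ← muL_mul]
        | muR h =>
          refine Submodule.subset_span ⟨f, h * g, u, ?_⟩
          change muR p h * _ = _
          rw [← mul_assoc, ← mul_assoc, ← muL_mul_muR, muR_mul, ← mul_assoc]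
        | letter y =>
          refine Submodule.subset_span ⟨shift (-(y.wtL : ℂ)) f, shift (-(y.wtR : ℂ)) g, y :: u, ?_⟩
          change gen p y * _ = _
          rw [word_cons, mul_assoc (muL p f), mul_assoc (muL p (shift _ f)),
            ← mul_assoc (muR p (shift _ g)), muR_mul_gen, mul_assoc (gen p y),
            ← mul_assoc (muL p (shift _ f)), muL_mul_gen,
            shift_shift, shift_shift, add_neg_cancel, add_neg_cancel, shift_zero, shift_zero]
          simp only [mul_assoc]
      | zero => rw [mul_zero]; exact S.zero_mem
      | add X Y _ _ hX hY => rw [mul_add]; exact S.add_mem hX hY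
      | smul r X _ hX => rw [mul_smul_comm]; exact S.smul_mem r hX
    | mul a b ha hb =>
      intro X hX
      rw [map_mul, mul_assoc]
      exact ha _ (hb _ hX)
    | add a b ha hb =>
      intro X hX
      rw [map_add, add_mul]
      exact S.add_mem (ha _ hX) (hb _ hX)
  obtain ⟨t, rfl⟩ := RingQuot.mkAlgHom_surjective ℂ (Rel p) a
  have h := key t 1 (Submodule.subset_span ⟨1, 1, [], by
    rw [muL_one, muR_one, word_nil, mul_one, mul_one]⟩)
  rwa [mul_one] at h

theorem normal_eq_left (f g : Mero) (u : List (Letter Ω)) :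
    muL p f * muR p g * word p u =
      muL p f * (word p u * muR p (shift (wordWtR u : ℂ) g)) := by
  rw [mul_assoc, muR_mul_word]

theorem normal_eq_right (f g : Mero) (u : List (Letter Ω)) :
    muL p f * muR p g * word p u =
      muR p g * (word p u * muL p (shift (wordWtL u : ℂ) f)) := by
  rw [muL_mul_muR, mul_assoc, muL_mul_word]

end NormalForm

/-! ### Existence of the pairing -/

section Existence

instance instMonoidOp : Monoid Op := instRingOp.toMonoid

instance instSemigroupOp : Semigroup Op := instMonoidOp.toSemigroup

theorem exists_linear_lift {V N W : Type} [AddCommMonoid V] [Module ℂ V] [AddCommMonoid N]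
    [Module ℂ N] [AddCommMonoid W] [Module ℂ W] (r : N →ₗ[ℂ] W) (hr : Function.Injective r)
    (g : V →ₗ[ℂ] W) (h : ∀ x, ∃ n, r n = g x) : ∃ f : V →ₗ[ℂ] N, ∀ x, r (f x) = g x := by
  refine ⟨(LinearEquiv.ofInjective r hr).symm.toLinearMap ∘ₗ
    g.codRestrict (LinearMap.range r) h, fun x => ?_⟩
  have := LinearEquiv.apply_symm_apply (LinearEquiv.ofInjective r hr)
    (g.codRestrict (LinearMap.range r) h x)
  exact congrArg Subtype.val this

variable {p q : ℝ} {Ω Ω₁ Ω₂ : SpectralSet q}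

/-- The functionals that are compatible with the moment maps. -/
def momentDual (p : ℝ) (Ω : SpectralSet q) : Submodule ℂ (E p Ω →ₗ[ℂ] Op) where
  carrier := {φ | ∀ f a, φ (muL p f * a) = mulOp f * φ a ∧ φ (a * muR p f) = φ a * mulOp f}
  zero_mem' f a := ⟨(mul_zero _).symm, (zero_mul _).symm⟩
  add_mem' {φ ψ} hφ hψ f a := by
    constructor
    · rw [LinearMap.add_apply, LinearMap.add_apply, (hφ f a).1, (hψ f a).1, mul_add]
    · rw [LinearMap.add_apply, LinearMap.add_apply, (hφ f a).2, (hψ f a).2, add_mul]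
  smul_mem' c φ hφ f a := by
    constructor
    · rw [LinearMap.smul_apply, LinearMap.smul_apply, (hφ f a).1, mul_smul_comm]
    · rw [LinearMap.smul_apply, LinearMap.smul_apply, (hφ f a).2, smul_mul_assoc]

/-- In the normal form f · u · g the outer functions come out as multiplication operators, so such a
functional is determined by its values on words. -/
theorem momentDual_ext {φ ψ : E p Ω →ₗ[ℂ] Op} (hφ : φ ∈ momentDual p Ω) (hψ : ψ ∈ momentDual p Ω)
    (h : ∀ v, φ (word p v) = ψ (word p v)) : φ = ψ := by
  refine LinearMap.ext fun a => ?_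
  induction mem_span_normal a using Submodule.span_induction with
  | mem X hX =>
    obtain ⟨f, g, u, rfl⟩ := hX
    rw [normal_eq_left, (hφ _ _).1, (hφ _ _).2, (hψ _ _).1, (hψ _ _).2, h]
  | zero => rw [map_zero, map_zero]
  | add X Y _ _ hX hY => rw [map_add, map_add, hX, hY]
  | smul c X _ hX => rw [map_smul, map_smul, hX]

theorem mulOp_mul_mem_momentDual {φ ψ : E p Ω →ₗ[ℂ] Op} (hφ : φ ∈ momentDual p Ω) {f g : Mero}
    (hψ : ∀ a, ψ a = mulOp f * (φ a * mulOp g)) : ψ ∈ momentDual p Ω := by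
  intro h a
  constructor
  · rw [hψ, hψ, (hφ h a).1, mul_assoc, ← mul_assoc, ← mul_assoc, mulOp_comm f, mul_assoc, mul_assoc]
  · rw [hψ, hψ, (hφ h a).2, mul_assoc (φ a), mulOp_comm h, mul_assoc, mul_assoc]

/-- Evaluation of a convolution functional as a linear map. -/
def evalLinear {W : Type} {𝒲 : Alphabet W} (x : W) : Conv opRing 𝒲 →ₗ[ℂ] Op where
  toFun φ := φ x
  map_add' _ _ := rfl
  map_smul' _ _ := rfl

/-- The homomorphism given by the first argument. -/
def leftHom (H : Nomes p q) (hΩ : Separated p Ω₁ Ω₂) :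
    E p Ω₁ →ₐ[ℂ] Conv opRing (letters Ω₂).words := (isRealization_left H hΩ).lift

/-- The homomorphism given by the second argument. -/
def rightHom (H : Nomes p q) (hΩ : Separated p Ω₁ Ω₂) :
    E p Ω₂ →ₐ[ℂ] Conv opRing (letters Ω₁).cop.words := (isRealization_right H hΩ).lift

theorem leftHom_word (H : Nomes p q) (hΩ : Separated p Ω₁ Ω₂) (u : List (Letter Ω₁))
    (v : List (Letter Ω₂)) : leftHom H hΩ (word p u) v =
      pairWords opRing (letters Ω₁).cop (letters Ω₂) (letterPair p) u v := by
  have h : leftHom H hΩ (word p u) = (u.map fun x => (⟨extR opRing (letters Ω₁).cop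
      (letterPair p) x⟩ : Conv opRing (letters Ω₂).words)).prod :=
    (isRealization_left H hΩ).lift_word u
  rw [prod_extR] at h
  exact congrFun (congrArg Conv.toFun h) v

theorem rightHom_word (H : Nomes p q) (hΩ : Separated p Ω₁ Ω₂) (u : List (Letter Ω₁))
    (v : List (Letter Ω₂)) : rightHom H hΩ (word p v) u =
      pairWords opRing (letters Ω₁).cop (letters Ω₂) (letterPair p) u v := by
  have h : rightHom H hΩ (word p v) = (v.map fun y => (⟨extR opRing (letters Ω₂)
      (fun y x => letterPair p x y) y⟩ : Conv opRing (letters Ω₁).cop.words)).prod :=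
    (isRealization_right H hΩ).lift_word v
  rw [prod_extR] at h
  exact (congrFun (congrArg Conv.toFun h) u).trans
    (pairWords_symm (letterPair_isHomog (Ω₁ := Ω₁) (Ω₂ := Ω₂) H) u v)

theorem leftHom_muL (H : Nomes p q) (hΩ : Separated p Ω₁ Ω₂) (f : Mero) :
    leftHom H hΩ (muL p f) = rmu opRing _ (mulOp f) := (isRealization_left H hΩ).lift_muL f

theorem leftHom_muR (H : Nomes p q) (hΩ : Separated p Ω₁ Ω₂) (f : Mero) :
    leftHom H hΩ (muR p f) = lmu opRing _ (mulOp f) := (isRealization_left H hΩ).lift_muR f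

theorem rightHom_muL (H : Nomes p q) (hΩ : Separated p Ω₁ Ω₂) (f : Mero) :
    rightHom H hΩ (muL p f) = lmu opRing _ (mulOp f) := (isRealization_right H hΩ).lift_muL f

theorem rightHom_muR (H : Nomes p q) (hΩ : Separated p Ω₁ Ω₂) (f : Mero) :
    rightHom H hΩ (muR p f) = rmu opRing _ (mulOp f) := (isRealization_right H hΩ).lift_muR f

/-- The functional on the second argument given by a word. -/
def wordFunctional (H : Nomes p q) (hΩ : Separated p Ω₁ Ω₂) (u : List (Letter Ω₁)) :
    E p Ω₂ →ₗ[ℂ] Op := evalLinear u ∘ₗ (rightHom H hΩ).toLinearMap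

theorem wordFunctional_apply (H : Nomes p q) (hΩ : Separated p Ω₁ Ω₂) (u : List (Letter Ω₁))
    (a : E p Ω₂) : wordFunctional H hΩ u a = rightHom H hΩ a u := rfl

theorem wordFunctional_mem (H : Nomes p q) (hΩ : Separated p Ω₁ Ω₂) (u : List (Letter Ω₁)) :
    wordFunctional H hΩ u ∈ momentDual p Ω₂ := by
  intro f a
  simp only [wordFunctional_apply]
  constructor
  · rw [map_mul, rightHom_muL, lmu_mul_apply]
  · rw [map_mul, rightHom_muR, mul_rmu_apply]

/-- Multiplication of a functional by functions on both sides. -/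
def scaleFunctional (f g : Mero) (φ : E p Ω →ₗ[ℂ] Op) : E p Ω →ₗ[ℂ] Op where
  toFun a := mulOp f * (φ a * mulOp g)
  map_add' a b := by rw [map_add, add_mul, mul_add]
  map_smul' c a := by rw [map_smul, smul_mul_assoc, mul_smul_comm]; rfl

/-- The homomorphism `leftHom` only gives a function on words of the second argument; the point is
that it respects the relations there. For X = g · u · f in normal form it is the functional of the
word u, which `rightHom` defines on the whole algebra, multiplied by g and f. The two agree on words
by the symmetry of `pairWords`. -/
theorem exists_left_functional (H : Nomes p q) (hΩ : Separated p Ω₁ Ω₂) (X : E p Ω₁) :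
    ∃ φ ∈ momentDual p Ω₂, ∀ v, φ (word p v) = leftHom H hΩ X v := by
  induction mem_span_normal X using Submodule.span_induction with
  | mem X hX =>
    obtain ⟨f, g, u, rfl⟩ := hX
    refine ⟨scaleFunctional g (shift (wordWtL u : ℂ) f) (wordFunctional H hΩ u),
      mulOp_mul_mem_momentDual (wordFunctional_mem H hΩ u) fun a => rfl, fun v => ?_⟩
    change mulOp g * (rightHom H hΩ (word p v) u * _) = _
    rw [normal_eq_right, map_mul, map_mul, leftHom_muR, leftHom_muL, lmu_mul_apply, mul_rmu_apply,
      leftHom_word, rightHom_word]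
  | zero =>
    refine ⟨0, Submodule.zero_mem _, fun v => ?_⟩
    rw [map_zero]
    rfl
  | add X Y _ _ hX hY =>
    obtain ⟨φ, hφ, h⟩ := hX
    obtain ⟨ψ, hψ, h'⟩ := hY
    refine ⟨φ + ψ, Submodule.add_mem _ hφ hψ, fun v => ?_⟩
    rw [LinearMap.add_apply, h, h', map_add, Conv.add_apply]
  | smul c X _ hX =>
    obtain ⟨φ, hφ, h⟩ := hX
    refine ⟨c • φ, Submodule.smul_mem _ c hφ, fun v => ?_⟩
    rw [LinearMap.smul_apply, h, map_smul, Conv.smul_apply]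

theorem exists_pairing (H : Nomes p q) (hΩ : Separated p Ω₁ Ω₂) :
    ∃ P : E p Ω₁ →ₗ[ℂ] E p Ω₂ →ₗ[ℂ] Op, (∀ X, P X ∈ momentDual p Ω₂) ∧
      ∀ X v, P X (word p v) = leftHom H hΩ X v := by
  let r : momentDual p Ω₂ →ₗ[ℂ] (List (Letter Ω₂) → Op) :=
    { toFun := fun φ v => φ.1 (word p v)
      map_add' := fun _ _ => rfl
      map_smul' := fun _ _ => rfl }
  -- Functionals compatible with the moment maps embed into functions on words, so the functionals
  -- found one X at a time automatically depend linearly on X.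
  have hr : Function.Injective r := fun φ ψ h =>
    Subtype.ext (momentDual_ext φ.2 ψ.2 fun v => congrFun h v)
  let g : E p Ω₁ →ₗ[ℂ] (List (Letter Ω₂) → Op) :=
    { toFun := fun X v => leftHom H hΩ X v
      map_add' := fun X Y => by rw [map_add]; rfl
      map_smul' := fun c X => by rw [map_smul]; rfl }
  have hex : ∀ X, ∃ n, r n = g X := fun X => by
    obtain ⟨φ, hφ, h⟩ := exists_left_functional H hΩ X
    exact ⟨⟨φ, hφ⟩, funext h⟩
  obtain ⟨f, hf⟩ := exists_linear_lift r hr g hex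
  exact ⟨(momentDual p Ω₂).subtype ∘ₗ f, fun X => (f X).2, fun X v => congrFun (hf X) v⟩

theorem mulOp_mul_mem_opPart {i j : ℤ} {A : Op} (hA : A ∈ opPart i j) (f g : Mero) :
    mulOp f * (A * mulOp g) ∈ opPart i j := by
  rcases hA with rfl | ⟨h, k, rfl⟩
  · left
    rw [zero_mul, mul_zero]
  · refine Or.inr ⟨h, f * (k * shift (-(i : ℂ)) g), ?_⟩
    rw [mul_assoc (mulOp k), T_mul_mulOp, ← mul_assoc (mulOp k), ← mulOp_mul, ← mul_assoc, ← mulOp_mul]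

/-- Properties in the first argument come from `leftHom` and those in the second from `rightHom`.
The bridge is that for a word in the first argument the constructed map is also given by `rightHom`.
-/
theorem exists_isRMatrixPairing (H : Nomes p q) (hΩ : Separated p Ω₁ Ω₂) :
    ∃ P : E p Ω₁ →ₗ[ℂ] E p Ω₂ →ₗ[ℂ] Op, IsRMatrixPairing p P := by
  obtain ⟨P, hP, hw⟩ := exists_pairing H hΩ
  have hu : ∀ u a, P (word p u) a = rightHom H hΩ a u := by
    intro u a
    have h : P (word p u) = wordFunctional H hΩ u :=
      momentDual_ext (hP _) (wordFunctional_mem H hΩ u) fun v => by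
        rw [hw, leftHom_word, wordFunctional_apply, rightHom_word]
    rw [h, wordFunctional_apply]
  have hR : ∀ f X a, P (muR p f * X) a = mulOp f * P X a := by
    intro f X a
    have h : P (muR p f * X) = scaleFunctional f 1 (P X) :=
      momentDual_ext (hP _) (mulOp_mul_mem_momentDual (hP X) fun a => rfl) fun v => by
        change _ = mulOp f * (P X (word p v) * mulOp 1)
        rw [hw, hw, map_mul, leftHom_muR, lmu_mul_apply, mulOp_one, mul_one]
    rw [h]
    change mulOp f * (P X a * mulOp 1) = _
    rw [mulOp_one, mul_one]
  have hL : ∀ f X a, P (X * muL p f) a = P X a * mulOp f := by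
    intro f X a
    have h : P (X * muL p f) = scaleFunctional 1 f (P X) :=
      momentDual_ext (hP _) (mulOp_mul_mem_momentDual (hP X) fun a => rfl) fun v => by
        change _ = mulOp 1 * (P X (word p v) * mulOp f)
        rw [hw, hw, map_mul, leftHom_muL, mul_rmu_apply, mulOp_one, one_mul]
    rw [h]
    change mulOp 1 * (P X a * mulOp f) = _
    rw [mulOp_one, one_mul]
  refine ⟨P, ?_, hR, fun f X a => (hP X f a).1, hL, fun f X a => (hP X f a).2, ?_, ?_, ?_, ?_, ?_⟩
  · intro α β γ δ X hX a ha
    rw [← isHomog_iff_mem_opPart]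
    induction hX using Submodule.span_induction with
    | mem X hX =>
      obtain ⟨f, g, u, rfl, rfl, rfl⟩ := hX
      induction ha using Submodule.span_induction with
      | mem a ha =>
        obtain ⟨f', g', v, rfl, rfl, rfl⟩ := ha
        rw [isHomog_iff_mem_opPart, normal_eq_right, hR, hL, normal_eq_left, (hP _ _ _).1,
          (hP _ _ _).2]
        refine mulOp_mul_mem_opPart (mulOp_mul_mem_opPart ?_ _ _) _ _
        rw [hw, leftHom_word, ← isHomog_iff_mem_opPart]
        exact pairWords_isHomog (letterPair_isHomog (Ω₁ := Ω₁) (Ω₂ := Ω₂) H) u v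
      | zero => rw [map_zero]; exact .zero _ _
      | add a b _ _ h1 h2 => rw [map_add]; exact h1.add h2
      | smul c a _ h1 =>
        rw [map_smul, isHomog_iff_mem_opPart, Algebra.smul_def, ← mulOp_algebraMap,
          ← mul_one (P _ _), ← mulOp_one]
        exact mulOp_mul_mem_opPart (isHomog_iff_mem_opPart.1 h1) _ _
    | zero => rw [map_zero]; exact .zero _ _
    | add X Y _ _ h1 h2 => rw [map_add]; exact h1.add h2
    | smul c X _ h1 =>
      rw [map_smul, LinearMap.smul_apply, isHomog_iff_mem_opPart, Algebra.smul_def,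
        ← mulOp_algebraMap, ← mul_one (P _ _), ← mulOp_one]
      exact mulOp_mul_mem_opPart (isHomog_iff_mem_opPart.1 h1) _ _
  · intro X Y u
    rw [hw, map_mul, Conv.mul_apply]
    rw [sum_comulWord u fun v₁ v₂ => P X (word p v₁) * T (wordWtR v₁) * P Y (word p v₂)]
    simp only [hw]
    rfl
  · intro u a b
    rw [hu, map_mul, Conv.mul_apply, Alphabet.cop_words_sum]
    rw [sum_comulWord u fun v₁ v₂ => P (word p v₂) a * T (wordWtL v₂) * P (word p v₁) b]
    simp only [hu]
    rfl
  · intro u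
    rw [hu, map_one, counitWord_eq, ← counitOp_cop_words]
    rfl
  · intro u
    rw [hw, map_one, counitWord_eq]
    rfl
  · intro i j k l w z
    rw [hw, leftHom_word, pairWords_singleton_left, extR_singleton, letterPair, op, opRing_T]
    push_cast
    rfl

end Existence

/-! ### Uniqueness of the pairing -/

section Uniqueness

variable {p q : ℝ} {Ω Ω₁ Ω₂ : SpectralSet q}

theorem Alphabet.sum_congr_mem {A M : Type} [AddCommMonoid M] (𝒜 : Alphabet A) {x : A}
    {F G : A → A → M} (h : ∀ y ∈ 𝒜.comul x, F y.1 y.2 = G y.1 y.2) : 𝒜.sum x F = 𝒜.sum x G := by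
  unfold Alphabet.sum
  rw [List.map_congr_left h]

theorem sum_char_counit {A : Type} (𝒜 : Alphabet A) {x : A} {κ : A → ℂ}
    (hκ : ∀ y ∈ 𝒜.comul x, κ y.1 = κ x) (F : A → Op) :
    𝒜.sum x (fun y z => (κ y • counitOp opRing 𝒜 y) * opRing.T (𝒜.wr y) * F z) = κ x • F x := by
  rw [← Conv.counitOp_mul_sum (𝒟 := opRing) (𝒲 := 𝒜) F x, Algebra.smul_def, Alphabet.mul_sum]
  refine 𝒜.sum_congr_mem fun y hy => ?_
  rw [hκ y hy, Algebra.smul_def, mul_assoc, mul_assoc, mul_assoc]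

theorem eq_of_smul_eq_smul {D : Type} [Ring D] [Algebra ℂ D] {c : ℂ} (hc : c ≠ 0) {a b : D}
    (h : c • a = c • b) : a = b := by
  have h' := congrArg (fun x => c⁻¹ • x) h
  simpa only [smul_smul, inv_mul_cancel₀ hc, one_smul] using h'

/-- The letters `L`. -/
def Letter.IsL : Letter Ω → Prop
  | .L _ _ _ => True
  | .detInv _ => False

/-- A set of letters that is closed under comultiplication. -/
def ComulClosed (S : Letter Ω → Prop) : Prop :=
  ∀ x, S x → ∀ y ∈ (letters Ω).comul x, S y.1 ∧ S y.2

theorem comulClosed_isL : ComulClosed (Letter.IsL (Ω := Ω)) := by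
  intro x hx y hy
  cases x with
  | L a b z =>
    change y ∈ [_, _] at hy
    simp only [List.mem_cons, List.not_mem_nil, or_false] at hy
    rcases hy with rfl | rfl <;> exact ⟨trivial, trivial⟩
  | detInv z => exact hx.elim

theorem words_sum_singleton {A M : Type} [AddCommMonoid M] (𝒜 : Alphabet A) (x : A)
    (F : List A → List A → M) : 𝒜.words.sum [x] F = 𝒜.sum x fun y z => F [y] [z] := by
  rw [Alphabet.words_sum_cons]
  simp only [Alphabet.words_sum_nil]

theorem rightHom_detE (H : Nomes p q) (hΩ : Separated p Ω₁ Ω₂) (z : Ω₂.Pt) :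
    rightHom H hΩ (detE p z) = charConv opRing (letters Ω₁).cop (rightChar p z) := by
  have hg : ∀ y, rightHom H hΩ (gen p y) = rightLetter p Ω₁ y :=
    (isRealization_right H hΩ).lift_letter
  rw [← rightDet_eq H hΩ, detE, det₀, map_mul, map_mul, map_sub, map_mul, map_mul, hg, hg, hg, hg,
    rightHom_muL, rightHom_muR, mul_assoc]
  rfl

theorem leftHom_detE (H : Nomes p q) (hΩ : Separated p Ω₁ Ω₂) (w : Ω₁.Pt) :
    leftHom H hΩ (detE p w) = charConv opRing (letters Ω₂) (leftChar p w) := by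
  have hg : ∀ y, leftHom H hΩ (gen p y) = leftLetter p Ω₂ y :=
    (isRealization_left H hΩ).lift_letter
  rw [← leftDet_eq H hΩ, detE, det₀, ← muL_mul_muR, map_mul, map_mul, map_sub, map_mul, map_mul,
    hg, hg, hg, hg, leftHom_muL, leftHom_muR, mul_assoc]
  rfl

theorem charConv_singleton {B : Type} {ℬ : Alphabet B} (κ : B → ℂ) (y : B) :
    charConv opRing ℬ κ [y] = κ y • counitOp opRing ℬ y := by
  rw [charConv_cons, charConv_nil, mul_one]

variable {P : E p Ω₁ →ₗ[ℂ] E p Ω₂ →ₗ[ℂ] Op}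

theorem IsRMatrixPairing.right_mul (hP : IsRMatrixPairing p P) (x : Letter Ω₁) (a b : E p Ω₂) :
    P (word p [x]) (a * b) = (letters Ω₁).cop.sum x fun y z =>
      P (word p [y]) a * opRing.T ((letters Ω₁).cop.wr y) * P (word p [z]) b := by
  rw [hP.right_product,
    sum_comulWord [x] fun v₁ v₂ => P (word p v₂) a * T (wordWtL v₂) * P (word p v₁) b,
    words_sum_singleton, Alphabet.cop_sum]
  refine Alphabet.sum_congr_mem _ fun y _ => ?_
  rw [show wordWtL [y.2] = (letters Ω₁).cop.wr y.2 from add_zero _]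
  rfl

theorem IsRMatrixPairing.left_mul (hP : IsRMatrixPairing p P) (y : Letter Ω₂) (X Y : E p Ω₁) :
    P (X * Y) (word p [y]) = (letters Ω₂).sum y fun y₁ y₂ =>
      P X (word p [y₁]) * opRing.T ((letters Ω₂).wr y₁) * P Y (word p [y₂]) := by
  rw [hP.left_product,
    sum_comulWord [y] fun v₁ v₂ => P X (word p v₁) * T (wordWtR v₁) * P Y (word p v₂),
    words_sum_singleton]
  refine Alphabet.sum_congr_mem _ fun y _ => ?_
  rw [show wordWtR [y.1] = (letters Ω₂).wr y.1 from add_zero _]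
  rfl

theorem rightHom_mul_singleton (H : Nomes p q) (hΩ : Separated p Ω₁ Ω₂) (x : Letter Ω₁)
    (a b : E p Ω₂) :
    rightHom H hΩ (a * b) [x] = (letters Ω₁).cop.sum x fun y z =>
      rightHom H hΩ a [y] * opRing.T ((letters Ω₁).cop.wr y) * rightHom H hΩ b [z] := by
  rw [map_mul, Conv.mul_apply, words_sum_singleton]
  simp only [words_wr_cons, words_wr_nil, add_zero]

theorem leftHom_mul_singleton (H : Nomes p q) (hΩ : Separated p Ω₁ Ω₂) (y : Letter Ω₂)
    (X Y : E p Ω₁) :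
    leftHom H hΩ (X * Y) [y] = (letters Ω₂).sum y fun y₁ y₂ =>
      leftHom H hΩ X [y₁] * opRing.T ((letters Ω₂).wr y₁) * leftHom H hΩ Y [y₂] := by
  rw [map_mul, Conv.mul_apply, words_sum_singleton]
  simp only [words_wr_cons, words_wr_nil, add_zero]

/-- Pair x with det · det⁻¹ = 1. The values on det are already determined and equal a nonzero
character times the counit, so the coproduct sum collapses to one scalar times the unknown value,
which can then be solved for. -/
theorem right_detInv_of_L (H : Nomes p q) (hΩ : Separated p Ω₁ Ω₂) (hP : IsRMatrixPairing p P)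
    {S : Letter Ω₁ → Prop} (hS : ComulClosed S)
    (h : ∀ x, S x → ∀ a b z, P (word p [x]) (gen p (.L a b z)) =
      rightHom H hΩ (gen p (.L a b z)) [x])
    {x : Letter Ω₁} (hx : S x) (z : Ω₂.Pt) :
    P (word p [x]) (gen p (.detInv z)) = rightHom H hΩ (gen p (.detInv z)) [x] := by
  have hmul : ∀ a b, (∀ x, S x → P (word p [x]) a = rightHom H hΩ a [x]) →
      (∀ x, S x → P (word p [x]) b = rightHom H hΩ b [x]) →
      ∀ x, S x → P (word p [x]) (a * b) = rightHom H hΩ (a * b) [x] := by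
    intro a b ha hb x hx
    rw [hP.right_mul, rightHom_mul_singleton, Alphabet.cop_sum, Alphabet.cop_sum]
    refine Alphabet.sum_congr_mem _ fun y hy => ?_
    rw [ha _ (hS x hx y hy).2, hb _ (hS x hx y hy).1]
  have h1 : ∀ x, P (word p [x]) 1 = counitOp opRing (letters Ω₁).cop.words [x] := by
    intro x
    rw [hP.counit₁, counitWord_eq, ← counitOp_cop_words]
  have hL : ∀ f x, S x → P (word p [x]) (muL p f) = rightHom H hΩ (muL p f) [x] := by
    intro f x _
    rw [rightHom_muL, ← mul_one (muL p f), hP.left_moment₂, h1]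
    rfl
  have hR : ∀ f x, S x → P (word p [x]) (muR p f) = rightHom H hΩ (muR p f) [x] := by
    intro f x _
    rw [rightHom_muR, ← one_mul (muR p f), hP.right_moment₂, h1]
    rfl
  have hd : ∀ x, S x → P (word p [x]) (detE p z) = rightHom H hΩ (detE p z) [x] := by
    refine hmul _ _ (hmul _ _ (hR _) (hL _)) fun x hx => ?_
    rw [det₀, map_sub, map_sub, Conv.sub_apply,
      hmul _ _ (fun x hx => h x hx _ _ _) (fun x hx => h x hx _ _ _) x hx,
      hmul _ _ (fun x hx => h x hx _ _ _) (fun x hx => h x hx _ _ _) x hx]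
  have e1 := hP.right_mul x (detE p z) (gen p (.detInv z))
  have e2 := rightHom_mul_singleton H hΩ x (detE p z) (gen p (.detInv z))
  rw [detE_mul_detInv, h1] at e1
  rw [detE_mul_detInv, map_one, Conv.one_apply] at e2
  have hκ := fun y hy => (rightChar_comul (p := p) z x y hy).1
  have e3 : ∀ F : Letter Ω₁ → Op, ((letters Ω₁).cop.sum x fun y z' =>
      rightHom H hΩ (detE p z) [y] * opRing.T ((letters Ω₁).cop.wr y) * F z') =
      rightChar p z x • F x := by
    intro F
    rw [rightHom_detE H hΩ]
    simp only [charConv_singleton]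
    exact sum_char_counit _ hκ F
  rw [e3] at e2
  have e4 : ((letters Ω₁).cop.sum x fun y z' => P (word p [y]) (detE p z) *
      opRing.T ((letters Ω₁).cop.wr y) * P (word p [z']) (gen p (.detInv z))) =
      rightChar p z x • P (word p [x]) (gen p (.detInv z)) := by
    rw [← e3 fun z' => P (word p [z']) (gen p (.detInv z)), Alphabet.cop_sum, Alphabet.cop_sum]
    refine Alphabet.sum_congr_mem _ fun y hy => ?_
    rw [hd _ (hS x hx y hy).2]
  rw [e4] at e1
  exact eq_of_smul_eq_smul (rightChar_ne_zero H hΩ z x) (e1.symm.trans e2)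

theorem left_detInv_of_L (H : Nomes p q) (hΩ : Separated p Ω₁ Ω₂) (hP : IsRMatrixPairing p P)
    {S : Letter Ω₂ → Prop} (hS : ComulClosed S)
    (h : ∀ y, S y → ∀ a b w, P (gen p (.L a b w)) (word p [y]) =
      leftHom H hΩ (gen p (.L a b w)) [y])
    {y : Letter Ω₂} (hy : S y) (w : Ω₁.Pt) :
    P (gen p (.detInv w)) (word p [y]) = leftHom H hΩ (gen p (.detInv w)) [y] := by
  have hmul : ∀ a b, (∀ x, S x → P a (word p [x]) = leftHom H hΩ a [x]) →
      (∀ x, S x → P b (word p [x]) = leftHom H hΩ b [x]) →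
      ∀ x, S x → P (a * b) (word p [x]) = leftHom H hΩ (a * b) [x] := by
    intro a b ha hb x hx
    rw [hP.left_mul, leftHom_mul_singleton]
    refine Alphabet.sum_congr_mem _ fun y hy => ?_
    rw [ha _ (hS x hx y hy).1, hb _ (hS x hx y hy).2]
  have h1 : ∀ x, P 1 (word p [x]) = counitOp opRing (letters Ω₂).words [x] := by
    intro x
    rw [hP.counit₂, counitWord_eq]
  have hL : ∀ f x, S x → P (muL p f) (word p [x]) = leftHom H hΩ (muL p f) [x] := by
    intro f x _
    rw [leftHom_muL, ← one_mul (muL p f), hP.right_moment₁, h1]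
    rfl
  have hR : ∀ f x, S x → P (muR p f) (word p [x]) = leftHom H hΩ (muR p f) [x] := by
    intro f x _
    rw [leftHom_muR, ← mul_one (muR p f), hP.left_moment₁, h1]
    rfl
  have hd : ∀ x, S x → P (detE p w) (word p [x]) = leftHom H hΩ (detE p w) [x] := by
    refine hmul _ _ (hmul _ _ (hR _) (hL _)) fun x hx => ?_
    rw [det₀, map_sub, map_sub, Conv.sub_apply, LinearMap.sub_apply,
      hmul _ _ (fun x hx => h x hx _ _ _) (fun x hx => h x hx _ _ _) x hx,
      hmul _ _ (fun x hx => h x hx _ _ _) (fun x hx => h x hx _ _ _) x hx]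
  have e1 := hP.left_mul y (detE p w) (gen p (.detInv w))
  have e2 := leftHom_mul_singleton H hΩ y (detE p w) (gen p (.detInv w))
  rw [detE_mul_detInv, h1] at e1
  rw [detE_mul_detInv, map_one, Conv.one_apply] at e2
  have hκ := fun x hx => (leftChar_comul (p := p) w y x hx).1
  have e3 : ∀ F : Letter Ω₂ → Op, ((letters Ω₂).sum y fun y₁ y₂ =>
      leftHom H hΩ (detE p w) [y₁] * opRing.T ((letters Ω₂).wr y₁) * F y₂) =
      leftChar p w y • F y := by
    intro F
    rw [leftHom_detE H hΩ]
    simp only [charConv_singleton]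
    exact sum_char_counit _ hκ F
  rw [e3] at e2
  have e4 : ((letters Ω₂).sum y fun y₁ y₂ => P (detE p w) (word p [y₁]) *
      opRing.T ((letters Ω₂).wr y₁) * P (gen p (.detInv w)) (word p [y₂])) =
      leftChar p w y • P (gen p (.detInv w)) (word p [y]) := by
    rw [← e3 fun y₂ => P (gen p (.detInv w)) (word p [y₂])]
    refine Alphabet.sum_congr_mem _ fun x hx => ?_
    rw [hd _ (hS y hy x hx).1]
  rw [e4] at e1
  exact eq_of_smul_eq_smul (leftChar_ne_zero H hΩ w y) (e1.symm.trans e2)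

theorem leftHom_gen_singleton (H : Nomes p q) (hΩ : Separated p Ω₁ Ω₂) (x : Letter Ω₁)
    (y : Letter Ω₂) : leftHom H hΩ (gen p x) [y] = letterPair p x y := by
  rw [← word_singleton, leftHom_word, pairWords_singleton_left, extR_singleton]

theorem rightHom_gen_singleton (H : Nomes p q) (hΩ : Separated p Ω₁ Ω₂) (x : Letter Ω₁)
    (y : Letter Ω₂) : rightHom H hΩ (gen p y) [x] = letterPair p x y := by
  rw [← word_singleton, rightHom_word, pairWords_singleton_left, extR_singleton]

/-- The values of a pairing on letters. -/
theorem IsRMatrixPairing.letter_letter (H : Nomes p q) (hΩ : Separated p Ω₁ Ω₂)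
    (hP : IsRMatrixPairing p P) (x : Letter Ω₁) (y : Letter Ω₂) :
    P (gen p x) (gen p y) = letterPair p x y := by
  have hLL : ∀ i j w k l z, P (gen p (.L i j w)) (gen p (.L k l z)) =
      letterPair p (.L i j w) (.L k l z) := by
    intro i j w k l z
    have h := hP.generators i j k l w z
    rw [word_singleton, word_singleton] at h
    rw [h, letterPair, op, opRing_T]
    push_cast
    rfl
  have hLD : ∀ i j w z, P (gen p (.L i j w)) (gen p (.detInv z)) =
      letterPair p (.L i j w) (.detInv z) := by
    intro i j w z
    -- For pairs consisting of an `L` and a det⁻¹ only the values between generators `L` are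
    -- available; the pair of two inverse determinants is treated afterwards, when those mixed
    -- values are known.
    have h := right_detInv_of_L H hΩ hP comulClosed_isL (fun x hx a b z => by
      cases x with
      | L i j w => rw [word_singleton, hLL, rightHom_gen_singleton]
      | detInv w => exact hx.elim) (x := .L i j w) trivial z
    rw [word_singleton, rightHom_gen_singleton] at h
    exact h
  have hDL : ∀ w k l z, P (gen p (.detInv w)) (gen p (.L k l z)) =
      letterPair p (.detInv w) (.L k l z) := by
    intro w k l z
    have h := left_detInv_of_L H hΩ hP comulClosed_isL (fun y hy a b w => by
      cases y with
      | L k l z => rw [word_singleton, hLL, leftHom_gen_singleton]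
      | detInv w => exact hy.elim) (y := .L k l z) trivial w
    rw [word_singleton, leftHom_gen_singleton] at h
    exact h
  cases x with
  | L i j w =>
    cases y with
    | L k l z => exact hLL i j w k l z
    | detInv z => exact hLD i j w z
  | detInv w =>
    cases y with
    | L k l z => exact hDL w k l z
    | detInv z =>
      have h := right_detInv_of_L H hΩ hP (S := fun _ => True) (fun _ _ _ _ => ⟨trivial, trivial⟩)
        (fun x _ a b z => by
          rw [word_singleton, rightHom_gen_singleton]
          cases x with
          | L i j w => exact hLL i j w a b z
          | detInv w => exact hDL w a b z) (x := .detInv w) trivial z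
      rw [word_singleton, rightHom_gen_singleton] at h
      exact h

/-- The values of a pairing on words. -/
theorem IsRMatrixPairing.word_word (H : Nomes p q) (hΩ : Separated p Ω₁ Ω₂)
    (hP : IsRMatrixPairing p P) (u : List (Letter Ω₁)) (v : List (Letter Ω₂)) :
    P (word p u) (word p v) =
      pairWords opRing (letters Ω₁).cop (letters Ω₂) (letterPair p) u v := by
  have hx : ∀ (v : List (Letter Ω₂)) (x : Letter Ω₁), P (gen p x) (word p v) =
      extR opRing (letters Ω₁).cop (letterPair p) x v := by
    intro v
    induction v with
    | nil =>
      intro x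
      rw [word_nil, ← word_singleton, hP.counit₁, counitWord_eq, counitOp_cons, counitOp_nil,
        mul_one, ← counitOp_cop]
      rfl
    | cons y v ih =>
      intro x
      rw [word_cons, ← word_singleton, hP.right_mul, extR]
      simp only [word_singleton, ih, hP.letter_letter H hΩ]
  induction u generalizing v with
  | nil => rw [word_nil, hP.counit₂, counitWord_eq, pairWords_nil_left]
  | cons x u ih =>
    rw [word_cons, hP.left_product,
      sum_comulWord v fun v₁ v₂ => P (gen p x) (word p v₁) * T (wordWtR v₁) * P (word p u) (word p v₂),
      pairWords_cons_left]
    simp only [ih, hx]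
    rfl

/-- The values on pairs of words are forced, and the moment-map rules carry this over to the normal
forms, which span. -/
theorem IsRMatrixPairing.unique (H : Nomes p q) (hΩ : Separated p Ω₁ Ω₂)
    {P P' : E p Ω₁ →ₗ[ℂ] E p Ω₂ →ₗ[ℂ] Op} (hP : IsRMatrixPairing p P)
    (hP' : IsRMatrixPairing p P') : P' = P := by
  refine LinearMap.ext fun X => ?_
  induction mem_span_normal X using Submodule.span_induction with
  | mem X hX =>
    obtain ⟨f, g, u, rfl⟩ := hX
    refine momentDual_ext (fun f a => ⟨hP'.left_moment₂ _ _ _, hP'.right_moment₂ _ _ _⟩)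
      (fun f a => ⟨hP.left_moment₂ _ _ _, hP.right_moment₂ _ _ _⟩) fun v => ?_
    rw [normal_eq_right, hP.left_moment₁, hP'.left_moment₁, hP.right_moment₁, hP'.right_moment₁,
      hP.word_word H hΩ, hP'.word_word H hΩ]
  | zero => rw [map_zero, map_zero]
  | add X Y _ _ hX hY => rw [map_add, map_add, hX, hY]
  | smul c X _ hX => rw [map_smul, map_smul, hX]

end Uniqueness

/-! ### Sums over ladders -/

/-- The index of a basis vector as an occupation number. -/
def bit : Bool → ℤ
  | true => 1
  | false => 0

/-- The number of entries `true`. -/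
def cnt : List Bool → ℤ
  | [] => 0
  | b :: η => bit b + cnt η

/-- The sum over all lists of length `n`. -/
def sumCols {M : Type} [AddCommMonoid M] : ℕ → (List Bool → M) → M
  | 0, F => F []
  | n + 1, F => ∑ b : Bool, sumCols n fun η => F (b :: η)

section SumCols

variable {M M' : Type} [AddCommMonoid M] [AddCommMonoid M']

theorem sumCols_congr {n : ℕ} {F G : List Bool → M} (h : ∀ η, η.length = n → F η = G η) :
    sumCols n F = sumCols n G := by
  induction n generalizing F G with
  | zero => exact h [] rfl
  | succ n ih =>
    exact Finset.sum_congr rfl fun b _ => ih fun η hη => h _ (by rw [List.length_cons, hη])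

theorem map_sumCols {G : Type} [FunLike G M M'] [AddMonoidHomClass G M M'] (φ : G) (n : ℕ) (F : List Bool → M) :
    φ (sumCols n F) = sumCols n fun η => φ (F η) := by
  induction n generalizing F with
  | zero => rfl
  | succ n ih =>
    simp only [sumCols, map_sum, ih]

theorem sumCols_add (n : ℕ) (F G : List Bool → M) :
    (sumCols n fun η => F η + G η) = sumCols n F + sumCols n G := by
  induction n generalizing F G with
  | zero => rfl
  | succ n ih => simp only [sumCols, ih, Finset.sum_add_distrib]

theorem sumCols_comm (m n : ℕ) (F : List Bool → List Bool → M) :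
    (sumCols m fun η => sumCols n fun κ => F η κ) =
      sumCols n fun κ => sumCols m fun η => F η κ := by
  induction m generalizing F with
  | zero => rfl
  | succ m ih => simp only [sumCols, ih, Fintype.sum_bool, sumCols_add]

theorem sumCols_zero (n : ℕ) : (sumCols n fun _ => (0 : M)) = 0 := by
  induction n with
  | zero => rfl
  | succ n ih => simp only [sumCols, ih, Finset.sum_const_zero]

theorem mul_sumCols {R : Type} [Ring R] (a : R) (n : ℕ) (F : List Bool → R) :
    a * sumCols n F = sumCols n fun η => a * F η :=
  map_sumCols (AddMonoidHom.mulLeft a) n F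

end SumCols

theorem wt_eq_bit (b : Bool) : wt b = 2 * bit b - 1 := by cases b <;> rfl

section Ladder

variable {p q : ℝ} {Ω Ω₁ Ω₂ : SpectralSet q}

/-- The word `L_{ε₁η₁}(z) L_{ε₂η₂}(q²z) ⋯`. -/
def ladder : List Bool → List Bool → Ω.Pt → List (Letter Ω)
  | a :: ε, b :: η, z => .L a b z :: ladder ε η (SpectralSet.move 1 z)
  | _, _, _ => []

theorem sum_comulWord_ladder {M : Type} [AddCommMonoid M]
    (F : List (Letter Ω) → List (Letter Ω) → M) {ε η : List Bool} (h : η.length = ε.length)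
    (z : Ω.Pt) :
    ((comulWord (ladder ε η z)).map fun v => F v.1 v.2).sum =
      sumCols ε.length fun κ => F (ladder ε κ z) (ladder κ η z) := by
  induction ε generalizing η z F with
  | nil =>
    cases η with
    | nil => simp [ladder, comulWord, sumCols]
    | cons b η => simp at h
  | cons a ε ih =>
    cases η with
    | nil => simp at h
    | cons b η =>
      have h' : η.length = ε.length := by simpa using h
      simp only [ladder, comulWord, Letter.comul, List.flatMap_cons, List.flatMap_nil,
        List.append_nil, List.map_append, List.sum_append, List.map_map, Function.comp_def,
        List.length_cons, sumCols, Fintype.sum_bool]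
      rw [ih (fun u v => F (.L a true z :: u) (.L true b z :: v)) h',
        ih (fun u v => F (.L a false z :: u) (.L false b z :: v)) h']

theorem wordWtR_ladder {ε κ : List Bool} (h : κ.length = ε.length) (z : Ω.Pt) :
    wordWtR (ladder ε κ z) = 2 * cnt κ - ε.length := by
  induction ε generalizing κ z with
  | nil =>
    cases κ with
    | nil => simp [ladder, wordWtR, cnt]
    | cons b κ => simp at h
  | cons a ε ih =>
    cases κ with
    | nil => simp at h
    | cons b κ =>
      have h' : κ.length = ε.length := by simpa using h
      have := ih h' (SpectralSet.move 1 z)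
      simp only [wordWtR, ladder, List.map_cons, List.sum_cons, Letter.wtR, wt_eq_bit, cnt,
        List.length_cons, Nat.cast_add, Nat.cast_one] at this ⊢
      rw [this]
      ring

/-- The matrix elements of the tensor product of vector corepresentations at `z, q²z, …`, summed
over the column indices with `j` entries `1`. -/
def tau (p : ℝ) (ε : List Bool) (j : ℤ) (z : Ω.Pt) : E p Ω :=
  sumCols ε.length fun η => if cnt η = j then word p (ladder ε η z) else 0

theorem tau_nil (j : ℤ) (z : Ω.Pt) : tau p [] j z = if j = 0 then 1 else 0 := by
  by_cases h : j = 0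
  · rw [if_pos h]
    exact if_pos h.symm
  · rw [if_neg h]
    exact if_neg (Ne.symm h)

theorem tau_cons (a : Bool) (ε : List Bool) (j : ℤ) (z : Ω.Pt) :
    tau p (a :: ε) j z =
      ∑ b : Bool, gen p (.L a b z) * tau p ε (j - bit b) (SpectralSet.move 1 z) := by
  change (∑ b : Bool, sumCols ε.length fun η =>
    if cnt (b :: η) = j then word p (ladder (a :: ε) (b :: η) z) else 0) = _
  refine Finset.sum_congr rfl fun b _ => ?_
  rw [tau, mul_sumCols]
  refine sumCols_congr fun η _ => ?_
  rw [cnt, ladder, word_cons]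
  by_cases h : cnt η = j - bit b
  · rw [if_pos h, if_pos (by omega)]
  · rw [if_neg h, if_neg (by omega), mul_zero]

variable {P : E p Ω₁ →ₗ[ℂ] E p Ω₂ →ₗ[ℂ] Op}

/-- In the comultiplication of a ladder only the second tensor factor sees the column index, so the
restricted sum over columns passes to that factor. -/
theorem IsRMatrixPairing.mul_tau (hP : IsRMatrixPairing p P) (X Y : E p Ω₁) (ε : List Bool)
    (j : ℤ) (z : Ω₂.Pt) :
    P (X * Y) (tau p ε j z) = sumCols ε.length fun κ =>
      P X (word p (ladder ε κ z)) * T ((2 * cnt κ - ε.length : ℤ) : ℂ) * P Y (tau p κ j z) := by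
  have e : ∀ κ : List Bool, κ.length = ε.length →
      P X (word p (ladder ε κ z)) * T ((2 * cnt κ - ε.length : ℤ) : ℂ) * P Y (tau p κ j z) =
      sumCols ε.length fun η => if cnt η = j then P X (word p (ladder ε κ z)) *
        T (wordWtR (ladder ε κ z) : ℂ) * P Y (word p (ladder κ η z)) else 0 := by
    intro κ hκ
    rw [tau, hκ, map_sumCols (P Y), mul_sumCols, wordWtR_ladder hκ]
    refine sumCols_congr fun η _ => ?_
    by_cases h : cnt η = j
    · rw [if_pos h, if_pos h]
    · rw [if_neg h, if_neg h, map_zero, mul_zero]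
  rw [sumCols_congr e, sumCols_comm, tau, map_sumCols (P (X * Y))]
  refine sumCols_congr fun η hη => ?_
  by_cases h : cnt η = j
  · simp only [if_pos h]
    exact (hP.left_product X Y _).trans (sum_comulWord_ladder (fun u v => P X (word p u) *
      T (wordWtR u : ℂ) * P Y (word p v)) hη z)
  · simp only [if_neg h]
    rw [map_zero, sumCols_zero]

end Ladder

/-! ### Rows of the `L`-matrix -/

section Row

variable {p q : ℝ} {Ω : SpectralSet q}

/-- The addition formula with its twelve arguments entered in whatever form they occur, agreement
being checked by `ring`. -/
theorem sf_rel (H : Nomes p q) (a b c d x₁ x₂ x₃ x₄ y₁ y₂ y₃ y₄ z₁ z₂ z₃ z₄ : ℂ)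
    (hx₁ : x₁ = a := by ring) (hx₂ : x₂ = a + 2 * b + c + d := by ring)
    (hx₃ : x₃ = c := by ring) (hx₄ : x₄ = d := by ring)
    (hy₁ : y₁ = a + b := by ring) (hy₂ : y₂ = a + b + c + d := by ring)
    (hy₃ : y₃ = b + c := by ring) (hy₄ : y₄ = b + d := by ring)
    (hz₁ : z₁ = a + b + c := by ring) (hz₂ : z₂ = a + b + d := by ring)
    (hz₃ : z₃ = b := by ring) (hz₄ : z₄ = b + c + d := by ring) :
    sf p q x₁ * sf p q x₂ * sf p q x₃ * sf p q x₄ - sf p q y₁ * sf p q y₂ * sf p q y₃ * sf p q y₄ +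
      sf p q z₁ * sf p q z₂ * sf p q z₃ * sf p q z₄ = 0 := by
  rw [hx₁, hx₂, hx₃, hx₄, hy₁, hy₂, hy₃, hy₄, hz₁, hz₂, hz₃, hz₄]
  exact sf_add_formula H.p_pos H.p_lt H.q_pos a b c d

theorem muR_of_mul {f g : ℂ → ℂ} (hf : Meromorphic f) (hg : Meromorphic g) :
    muR p (Ω := Ω) (Mero.of f) * muR p (Mero.of g) = muR p (Mero.of fun l => f l * g l) := by
  rw [← muR_mul, Mero.of_mul hf hg]

theorem muR_of_add {f g : ℂ → ℂ} (hf : Meromorphic f) (hg : Meromorphic g) :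
    muR p (Ω := Ω) (Mero.of f) + muR p (Mero.of g) = muR p (Mero.of fun l => f l + g l) := by
  rw [← muR_add, Mero.of_add hf hg]

theorem muR_zero : muR p (Ω := Ω) 0 = 0 := by
  have h := muR_add (p := p) (Ω := Ω) 0 0
  rw [show (0 : Mero) + 0 = 0 from add_zero 0] at h
  exact left_eq_add.1 h

theorem muL_zero : muL p (Ω := Ω) 0 = 0 := by
  have h := muL_add (p := p) (Ω := Ω) 0 0
  rw [show (0 : Mero) + 0 = 0 from add_zero 0] at h
  exact left_eq_add.1 h

theorem L_mul_muR {f : ℂ → ℂ} (hf : Meromorphic f) (a b : Bool) (z : Ω.Pt) :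
    gen p (.L a b z) * muR p (Mero.of f) =
      muR p (Mero.of fun l => f (l - wt b)) * gen p (.L a b z) := by
  have hf' : Meromorphic fun l => f (l - wt b) := by
    simpa only [sub_eq_add_neg] using meromorphic_comp_add hf _
  rw [muR_mul_L, shift_of hf']
  simp only [add_sub_cancel_right]

/-- When both row indices are equal, only the constant diagonal entry of the R-matrix survives on
the left side of the RLL relation, so that relation becomes a genuine reordering rule. -/
theorem row_exchange (H : Nomes p q) (a b d : Bool) (z₁ z₂ : Ω.Pt) {u : ℂ}
    (hu : qp q (2 * u) = (z₁ : ℂ) / z₂) (h : sf p q (u + 1) ≠ 0) :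
    gen p (.L a b z₁) * gen p (.L a d z₂) = ∑ x : Bool, ∑ y : Bool,
      muR p (Mero.of (rm p q b d x y u)) * (gen p (.L a y z₂) * gen p (.L a x z₁)) := by
  have hr := toE_rel (Rel.rll (p := p) a b a d z₁ z₂)
  simp only [map_sum, map_mul] at hr
  change ∑ x : Bool, ∑ y : Bool, muL p (Mero.of (rNum p q x y a a ((z₁ : ℂ) / z₂))) *
    gen p (.L x b z₁) * gen p (.L y d z₂) = ∑ x : Bool, ∑ y : Bool,
      muR p (Mero.of (rNum p q b d x y ((z₁ : ℂ) / z₂))) * gen p (.L a y z₂) * gen p (.L a x z₁) at hr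
  have hc : qp q (u + 1) * sf p q (u + 1) ≠ 0 := mul_ne_zero (qp_ne_zero H.q_pos _) h
  set c := qp q (u + 1) * sf p q (u + 1)
  have e1 : ∑ x : Bool, ∑ y : Bool, muL p (Mero.of (rNum p q x y a a ((z₁ : ℂ) / z₂))) *
      gen p (.L x b z₁) * gen p (.L y d z₂) =
      algebraMap ℂ (E p Ω) c * (gen p (.L a b z₁) * gen p (.L a d z₂)) := by
    rw [← hu]
    cases a <;> simp only [Fintype.sum_bool, rNum_eq_rs H, rs, mul_zero, Mero.of_zero, Mero.of_const,
      muL_algebraMap, muL_zero, zero_mul, add_zero, zero_add, mul_assoc, c]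
  have e2 : ∀ x y, muR p (Ω := Ω) (Mero.of (rNum p q b d x y ((z₁ : ℂ) / z₂))) =
      algebraMap ℂ (E p Ω) c * muR p (Mero.of (rm p q b d x y u)) := by
    intro x y
    rw [← hu, ← muR_algebraMap, ← muR_mul, ← Mero.of_const,
      Mero.of_mul (fun l => MeromorphicAt.const _ _) (meromorphic_rm H _ _ _ _ _), rNum_eq_rs H]
    congr 2
    funext l
    simp only [rm, c]
    field_simp
  rw [e1] at hr
  simp only [e2, mul_assoc, ← Finset.mul_sum] at hr
  have hr' := congrArg (fun X => algebraMap ℂ (E p Ω) c⁻¹ * X) hr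
  simpa only [← mul_assoc, ← map_mul, inv_mul_cancel₀ hc, map_one, one_mul] using hr'

/-- The factor that appears when a letter is multiplied from the left to a row sum. -/
def rowFactor (p q : ℝ) : Bool → ℂ → ℂ → ℂ → ℂ
  | true, n, m, l => sf p q (m + 1) * sf p q (l + n - m + 1) / (sf p q (n + 1) * sf p q (l + 1))
  | false, n, m, l => sf p q (n - m + 1) * sf p q (l - m + 1) / (sf p q (n + 1) * sf p q (l + 1))

theorem meromorphic_rowFactor (H : Nomes p q) (b : Bool) (n m : ℂ) :
    Meromorphic (rowFactor p q b n m) := by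
  have h : ∀ {g : ℂ → ℂ}, Differentiable ℂ g → Meromorphic fun l => sf p q (g l) :=
    fun hg => meromorphic_sf H.p_pos H.p_lt H.q_pos hg
  have h1 : Meromorphic fun l => sf p q (l + 1) := h (by fun_prop)
  have h2 : Meromorphic fun l => sf p q (l + n - m + 1) := h (by fun_prop)
  have h3 : Meromorphic fun l => sf p q (l - m + 1) := h (by fun_prop)
  cases b
  · exact fun l => ((MeromorphicAt.const _ _).mul (h3 l)).div ((MeromorphicAt.const _ _).mul (h1 l))
  · exact fun l => ((MeromorphicAt.const _ _).mul (h2 l)).div ((MeromorphicAt.const _ _).mul (h1 l))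

/-- The decisive point is that the result does not depend on y, the column index of the letter left
in front. Two of the four cases are instances of the addition formula, in the other two a single
term survives. -/
theorem rowFactor_rec (H : Nomes p q) (b y : Bool) (n : ℕ) (m l : ℂ) (h0 : sf p q l ≠ 0)
    (h1 : sf p q (l + 1) ≠ 0) (h2 : sf p q (l + 2) ≠ 0) :
    ∑ c : Bool, ∑ x : Bool, rm p q b c x y (n + 1) l *
      rowFactor p q x n (m - bit c) (l - wt y) = rowFactor p q b (n + 1) m l := by
  have hn1 : sf p q ((n : ℂ) + 1) ≠ 0 := by
    exact_mod_cast sf_intCast_ne_zero H.p_pos H.p_lt H.q_pos H.generic (n := n + 1) (by omega)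
  have hn2 : sf p q ((n : ℂ) + 2) ≠ 0 := by
    exact_mod_cast sf_intCast_ne_zero H.p_pos H.p_lt H.q_pos H.generic (n := n + 2) (by omega)
  have e1 : (n : ℂ) + 1 + 1 = n + 2 := by ring
  have e2 : l - -1 + 1 = l + 2 := by ring
  have e3 : l - 1 + 1 = l := by ring
  have e4 : m - 1 + 1 = m := by ring
  generalize (n : ℂ) = n at *
  cases b <;> cases y <;>
    simp only [Fintype.sum_bool, rm, rs, rowFactor, bit, wt, Int.cast_one, Int.cast_zero,
      Int.cast_neg, sub_zero, zero_div, zero_mul, add_zero, zero_add,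
      e1, e2, e3, e4]
  · have k := sf_rel H (2 + n) (- 2 - l) (2 + l - m) (1 + l)
      (n+2) (n-m+1) (l-m+2) (l+1) (-(l-n)) (l+n-m+3) (-(m)) (-(1)) (n-m+2) (n+1) (-(l+2)) (l-m+1)
    simp only [sf_neg H.p_pos H.p_lt H.q_pos] at k
    field_simp
    linear_combination (norm := ring_nf) k
  · field_simp
    ring_nf
  · field_simp
    ring_nf
  · have k := sf_rel H (m) (- 1 - m) (1 + l) (2 + n)
     (m) (l+n-m+1) (l+1) (n+2) (-(1)) (l+n+2) (l-m) (n-m+1) (l) (n+1) (-(m+1)) (l+n-m+2)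
    simp only [sf_neg H.p_pos H.p_lt H.q_pos] at k
    field_simp
    linear_combination (norm := ring_nf) k

/-- A row of the tensor product of vector corepresentations. -/
def rowSum (p : ℝ) (a : Bool) (n : ℕ) (m : ℤ) (z : Ω.Pt) : E p Ω :=
  tau p (List.replicate n a) m z

theorem rowSum_succ (a : Bool) (n : ℕ) (m : ℤ) (z : Ω.Pt) :
    rowSum p a (n + 1) m z =
      ∑ b : Bool, gen p (.L a b z) * rowSum p a n (m - bit b) (SpectralSet.move 1 z) :=
  tau_cons _ _ _ _

theorem rowSum_zero (a : Bool) (m : ℤ) (z : Ω.Pt) :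
    rowSum p a 0 m z = if m = 0 then 1 else 0 := tau_nil _ _

theorem move_move (H : Nomes p q) (m n : ℤ) (z : Ω.Pt) :
    SpectralSet.move m (SpectralSet.move n z) = SpectralSet.move (n + m) z := by
  have hq : (q : ℂ) ≠ 0 := by exact_mod_cast H.q_pos.ne'
  refine Subtype.ext ?_
  change (q : ℂ) ^ (2 * m) * ((q : ℂ) ^ (2 * n) * (z : ℂ)) = (q : ℂ) ^ (2 * (n + m)) * (z : ℂ)
  rw [← mul_assoc, ← zpow_add₀ hq]
  ring_nf

theorem move_zero (z : Ω.Pt) : SpectralSet.move 0 z = z := by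
  refine Subtype.ext ?_
  change (q : ℂ) ^ (2 * (0 : ℤ)) * (z : ℂ) = z
  rw [mul_zero, zpow_zero, one_mul]

/-- The new letter is pulled through the row one position at a time. Exchanging it with the first
letter and applying the induction hypothesis to the rest gives coefficients that, by
`rowFactor_rec`, are the same for every first letter; the terms then reassemble to a longer row. -/
theorem L_mul_rowSum (H : Nomes p q) (a b : Bool) (n : ℕ) (m : ℤ) (z : Ω.Pt) :
    gen p (.L a b (SpectralSet.move n z)) * rowSum p a n m z =
      muR p (Mero.of (rowFactor p q b n m)) * rowSum p a (n + 1) (m + bit b) z := by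
  induction n generalizing b m z with
  | zero =>
    rw [rowSum_succ, Nat.cast_zero, move_zero]
    simp only [rowSum_zero, Fintype.sum_bool]
    by_cases hm : m = 0
    · subst hm
      have e : muR p (Ω := Ω) (Mero.of (rowFactor p q b (0 : ℕ) (0 : ℤ))) = 1 := by
        rw [← muR_one, ← Mero.of_one]
        congr 1
        refine Mero.of_congr (meromorphic_rowFactor H _ _ _) ?_
        filter_upwards [eventually_sf_add_ne_zero H.p_pos H.p_lt H.q_pos H.generic 1] with l h1
        have h1' := sf_one_ne_zero H
        cases b <;> simp [rowFactor, h1, h1']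
      rw [e]
      cases b <;> simp [bit]
    · rw [if_neg hm, mul_zero]
      cases b
      -- The row on the right does not vanish by its count here, but the factor contains sf 0.
      · by_cases h1 : m = 1
        · subst h1
          have e : Mero.of (rowFactor p q false (0 : ℕ) (1 : ℤ)) = 0 := by
            rw [← Mero.of_zero]
            congr 1
            funext l
            simp [rowFactor, sf_zero H.p_pos H.p_lt]
          rw [e, muR_zero, zero_mul]
        · simp [bit, hm, show m - 1 ≠ 0 by omega]
      · by_cases h1 : m = -1
        · subst h1
          have e : Mero.of (rowFactor p q true (0 : ℕ) (-1 : ℤ)) = 0 := by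
            rw [← Mero.of_zero]
            congr 1
            funext l
            simp [rowFactor, sf_zero H.p_pos H.p_lt]
          rw [e, muR_zero, zero_mul]
        · simp [bit, hm, show m + 1 ≠ 0 by omega]
  | succ n ih =>
    have hh : ∀ x c, Meromorphic (rowFactor p q x n (m - bit c : ℤ)) := fun x c =>
      meromorphic_rowFactor H _ _ _
    have hs : ∀ x y c, Meromorphic fun l => rowFactor p q x n (m - bit c : ℤ) (l - wt y) :=
      fun x y c => by simpa only [sub_eq_add_neg] using meromorphic_comp_add (hh x c) _
    have hu : qp q (2 * ((n : ℂ) + 1)) =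
        ((SpectralSet.move ((n + 1 : ℕ) : ℤ) z : Ω.Pt) : ℂ) / z := by
      have hz := z.ne_zero
      change _ = (q : ℂ) ^ (2 * ((n + 1 : ℕ) : ℤ)) * (z : ℂ) / z
      rw [mul_div_assoc, div_self hz, mul_one, ← qp_intCast]
      push_cast
      rfl
    have hn2 : sf p q ((n : ℂ) + 1 + 1) ≠ 0 := by
      rw [add_assoc, one_add_one_eq_two]
      exact_mod_cast sf_intCast_ne_zero H.p_pos H.p_lt H.q_pos H.generic (n := n + 2) (by omega)
    have hmv : SpectralSet.move ((n + 1 : ℕ) : ℤ) z = SpectralSet.move n (SpectralSet.move 1 z) := by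
      rw [move_move H, add_comm]
      rfl
    have term : ∀ c x y : Bool, muR p (Mero.of (rm p q b c x y (n + 1))) *
        (gen p (.L a y z) * gen p (.L a x (SpectralSet.move ((n + 1 : ℕ) : ℤ) z))) *
          rowSum p a n (m - bit c) (SpectralSet.move 1 z) =
        muR p (Mero.of fun l => rm p q b c x y (n + 1) l *
          rowFactor p q x n (m - bit c : ℤ) (l - wt y)) *
          (gen p (.L a y z) * rowSum p a (n + 1) (m + bit b - bit y) (SpectralSet.move 1 z)) := by
      intro c x y
      rw [hmv, mul_assoc, mul_assoc (gen p _), ih, ← mul_assoc (gen p _) (muR p _),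
        L_mul_muR (hh x c), mul_assoc (muR p _), ← mul_assoc (muR p _) (muR p _),
        muR_of_mul (meromorphic_rm H _ _ _ _ _) (hs x y c)]
      by_cases hw : wt b + wt c = wt x + wt y
      · rw [show m - bit c + bit x = m + bit b - bit y by
          simp only [wt_eq_bit] at hw
          omega]
      · simp only [rm_eq_zero hw, zero_mul, Mero.of_zero, muR_zero]
    rw [rowSum_succ, Finset.mul_sum, rowSum_succ, Finset.mul_sum]
    simp only [← mul_assoc (gen p (.L a b _)) (gen p _)]
    simp only [row_exchange H a b _ _ z hu hn2, Finset.sum_mul, term]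
    have key : ∀ y : Bool, (∑ c : Bool, ∑ x : Bool, muR p (Ω := Ω) (Mero.of fun l =>
        rm p q b c x y (n + 1) l * rowFactor p q x n (m - bit c : ℤ) (l - wt y))) =
        muR p (Mero.of (rowFactor p q b (n + 1 : ℕ) m)) := by
      intro y
      have hm : ∀ c x, Meromorphic fun l => rm p q b c x y (n + 1) l *
          rowFactor p q x n (m - bit c : ℤ) (l - wt y) := fun c x =>
        (meromorphic_rm H _ _ _ _ _).mul (hs x y c)
      have hm' : ∀ c, Meromorphic fun l => rm p q b c true y (n + 1) l *
          rowFactor p q true n (m - bit c : ℤ) (l - wt y) + rm p q b c false y (n + 1) l *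
          rowFactor p q false n (m - bit c : ℤ) (l - wt y) := fun c => (hm c true).add (hm c false)
      simp only [Fintype.sum_bool]
      rw [muR_of_add (hm _ _) (hm _ _), muR_of_add (hm _ _) (hm _ _),
        muR_of_add (hm' _) (hm' _)]
      congr 1
      refine Mero.of_congr ((hm' _).add (hm' _)) ?_
      filter_upwards [eventually_sf_add_ne_zero H.p_pos H.p_lt H.q_pos H.generic 0,
        eventually_sf_add_ne_zero H.p_pos H.p_lt H.q_pos H.generic 1,
        eventually_sf_add_ne_zero H.p_pos H.p_lt H.q_pos H.generic 2] with l h0 h1 h2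
      rw [add_zero] at h0
      have := rowFactor_rec H b y n m l h0 h1 h2
      simp only [Fintype.sum_bool] at this
      push_cast
      exact this
    have swap : ∀ G : Bool → Bool → Bool → E p Ω,
        ∑ c : Bool, ∑ x : Bool, ∑ y : Bool, G c x y = ∑ y : Bool, ∑ c : Bool, ∑ x : Bool, G c x y := by
      intro G
      rw [Finset.sum_comm' (t' := Finset.univ) (s' := fun _ => Finset.univ) (by simp)]
      simp only [Fintype.sum_bool]
      abel
    rw [swap]
    refine Finset.sum_congr rfl fun y _ => ?_
    rw [← key y, Finset.sum_mul]
    exact Finset.sum_congr rfl fun c _ => (Finset.sum_mul _ _ _).symm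

end Row

/-! ### Normal ordering of rows -/

section NormalOrder

variable {p q : ℝ} {Ω : SpectralSet q}

theorem ellFac_zero (a : ℂ) : ellFac p q a 0 = 1 := Finset.prod_range_zero _

theorem ellFac_succ (a : ℂ) (n : ℕ) :
    ellFac p q a ((n + 1 : ℕ) : ℤ) = ellFac p q a n * theta p (a * qp q (2 * n)) :=
  Finset.prod_range_succ _ _

theorem meromorphic_theta_qp (H : Nomes p q) {g : ℂ → ℂ} (hg : Differentiable ℂ g) :
    Meromorphic fun l => theta p (qp q (2 * g l)) := by
  have hq : (q : ℂ) ≠ 0 := by exact_mod_cast H.q_pos.ne'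
  have h1 : Differentiable ℂ fun l => qp q (g l) := by
    unfold qp
    exact fun l => (hg l).const_cpow (Or.inl hq)
  have h2 : Meromorphic fun l => qp q (g l) := fun l =>
    (h1.analyticAt l).meromorphicAt
  have e : (fun l => theta p (qp q (2 * g l))) = fun l => qp q (g l) * sf p q (g l) :=
    funext fun l => theta_qp H.q_pos _
  rw [e]
  exact h2.mul (meromorphic_sf H.p_pos H.p_lt H.q_pos hg)

theorem meromorphic_ellFac (H : Nomes p q) {g : ℂ → ℂ} (hg : Differentiable ℂ g) (n : ℕ) :
    Meromorphic fun l => ellFac p q (qp q (2 * g l)) n := by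
  induction n with
  | zero => exact fun l => MeromorphicAt.const 1 l
  | succ n ih =>
    simp only [ellFac_succ, ← qp_add H.q_pos, ← mul_add]
    exact ih.mul (meromorphic_theta_qp H (by fun_prop))

/-- The coefficient of the normally ordered form of a row. -/
def rowCoeff (p q : ℝ) (n m : ℕ) (x : ℂ) : ℂ :=
  ellBinom p q n m * (ellFac p q (qp q (2 * (x - m + 2))) m /
    ellFac p q (qp q (2 * (x + n - 2 * m + 2))) m)

theorem meromorphic_rowCoeff (H : Nomes p q) (n m : ℕ) : Meromorphic (rowCoeff p q n m) :=
  fun l => (MeromorphicAt.const _ _).mul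
    ((meromorphic_ellFac H (g := fun x => x - m + 2) (by fun_prop) m l).div
      (meromorphic_ellFac H (g := fun x => x + n - 2 * m + 2) (by fun_prop) m l))

/-- The argument x - 1 arises when the coefficient of the shorter row moves past a letter of right
weight 1; the quotient of the two coefficients is the factor of `L_mul_rowSum`. -/
theorem rowCoeff_succ (H : Nomes p q) (n m : ℕ) {x : ℂ} (h1 : sf p q (x + 1) ≠ 0)
    (h2 : sf p q (x + n - m + 1) ≠ 0) :
    (rowFactor p q true n m x)⁻¹ * rowCoeff p q n m (x - 1) = rowCoeff p q (n + 1) (m + 1) x := by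
  have hn1 : sf p q ((n : ℂ) + 1) ≠ 0 := by
    exact_mod_cast sf_intCast_ne_zero H.p_pos H.p_lt H.q_pos H.generic (n := n + 1) (by omega)
  have hm1 : sf p q ((m : ℂ) + 1) ≠ 0 := by
    exact_mod_cast sf_intCast_ne_zero H.p_pos H.p_lt H.q_pos H.generic (n := m + 1) (by omega)
  have eb : ellBinom p q (n + 1) (m + 1) = ellBinom p q n m *
      (theta p (qp q (2 * ((n : ℂ) + 1))) / theta p (qp q (2 * ((m : ℂ) + 1)))) := by
    unfold ellBinom
    rw [Finset.prod_Icc_succ_top (by omega)]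
    push_cast
    congr 1
    · refine Finset.prod_congr rfl fun i _ => ?_
      rw [add_sub_add_right_eq_sub]
    · rw [add_sub_add_right_eq_sub]
      congr 4
      ring
  have hqp : qp q ((n : ℂ) + 1) * qp q (x + 1) = qp q ((m : ℂ) + 1) * qp q (x + n - m + 1) := by
    rw [← qp_add H.q_pos, ← qp_add H.q_pos]
    congr 1
    ring
  have hθ : theta p (qp q (2 * ((n : ℂ) + 1))) / theta p (qp q (2 * ((m : ℂ) + 1))) *
      (theta p (qp q (2 * (x + 1))) / theta p (qp q (2 * (x + n - m + 1)))) =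
      (rowFactor p q true n m x)⁻¹ := by
    have hq := fun u => qp_ne_zero H.q_pos u
    simp only [theta_qp H.q_pos, rowFactor]
    have a1 := hq ((m : ℂ) + 1)
    have a2 := hq (x + n - m + 1)
    field_simp
    linear_combination hqp
  rw [rowCoeff, rowCoeff, eb, ellFac_succ, ellFac_succ, ← qp_add H.q_pos, ← qp_add H.q_pos, ← hθ]
  push_cast
  rw [show 2 * (x - 1 - (m : ℂ) + 2) = 2 * (x - (m + 1) + 2) by ring,
    show 2 * (x - 1 + (n : ℂ) - 2 * m + 2) = 2 * (x + (n + 1) - 2 * (m + 1) + 2) by ring,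
    show 2 * (x - ((m : ℂ) + 1) + 2) + 2 * m = 2 * (x + 1) by ring,
    show 2 * (x + ((n : ℂ) + 1) - 2 * (m + 1) + 2) + 2 * m = 2 * (x + n - m + 1) by ring]
  simp only [div_eq_mul_inv, mul_inv]
  ring

theorem tau_eq_zero {ε : List Bool} {j : ℤ} (h : j < 0 ∨ (ε.length : ℤ) < j) (z : Ω.Pt) :
    tau p ε j z = 0 := by
  induction ε generalizing j z with
  | nil =>
    rw [tau_nil, if_neg]
    rintro rfl
    simp at h
  | cons a ε ih =>
    rw [tau_cons]
    refine Finset.sum_eq_zero fun b _ => ?_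
    rw [ih, mul_zero]
    cases b <;> simp only [bit, List.length_cons, Nat.cast_add, Nat.cast_one] at h ⊢ <;> omega

theorem tau_append (H : Nomes p q) (ε ε' : List Bool) (j : ℤ) (z : Ω.Pt) :
    tau p (ε ++ ε') j z = ∑ m ∈ Finset.range (ε'.length + 1),
      tau p ε (j - m) z * tau p ε' m (SpectralSet.move ε.length z) := by
  induction ε generalizing j z with
  | nil =>
    simp only [List.nil_append, List.length_nil, Nat.cast_zero, move_zero, tau_nil]
    by_cases h : 0 ≤ j ∧ j ≤ ε'.length
    · obtain ⟨m, rfl⟩ := Int.eq_ofNat_of_zero_le h.1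
      rw [Finset.sum_eq_single m]
      · simp
      · intro b _ hb
        rw [if_neg (by omega), zero_mul]
      · intro hm
        simp at hm h
        omega
    · rw [tau_eq_zero (by omega), Finset.sum_eq_zero]
      intro m hm
      rw [if_neg, zero_mul]
      simp at hm
      omega
  | cons a ε ih =>
    simp only [List.cons_append, tau_cons, ih, Finset.mul_sum, Finset.sum_mul]
    rw [Finset.sum_comm]
    refine Finset.sum_congr rfl fun m _ => Finset.sum_congr rfl fun b _ => ?_
    rw [move_move H, List.length_cons, mul_assoc, sub_right_comm, add_comm]
    push_cast
    rfl

theorem descWord_eq (a b : Bool) (e : ℤ) (n : ℕ) (z : Ω.Pt) : descWord a b e n z =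
    (List.range n).map fun i : ℕ => .L a b (SpectralSet.move (e - (i : ℤ)) z) := by
  simp only [descWord, List.bind_eq_flatMap, List.pure_def, List.map_flatMap, List.map_cons,
    List.map_nil]
  exact List.flatMap_pure_eq_map _ _

theorem descWord_succ (a b : Bool) (e : ℤ) (n : ℕ) (z : Ω.Pt) :
    descWord a b e (n + 1) z = .L a b (SpectralSet.move e z) :: descWord a b (e - 1) n z := by
  rw [descWord_eq, descWord_eq]
  rw [List.range_succ_eq_map, List.map_cons, List.map_map]
  refine congr_arg₂ _ (by simp) (List.map_congr_left fun i _ => ?_)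
  simp only [Function.comp, Nat.succ_eq_add_one, Nat.cast_add, Nat.cast_one]
  rw [show e - ((i : ℤ) + 1) = e - 1 - i by ring]

/-- Normal ordering: the row is built up by letters multiplied from the left. Letters with column
index -1 enter with factor 1 as long as the count is 0; each later letter with column index 1 enters
with an invertible factor, and the inverses accumulate to the coefficient. -/
theorem rowSum_eq (H : Nomes p q) (a : Bool) {n m : ℕ} (h : m ≤ n) (z : Ω.Pt) :
    rowSum p a n m z = muR p (Mero.of (rowCoeff p q n m)) *
      word p (descWord a true ((n : ℤ) - 1) m z ++ descWord a false ((n : ℤ) - m - 1) (n - m) z) := by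
  induction m generalizing n with
  | zero =>
    have e : Mero.of (rowCoeff p q n 0) = 1 := by
      rw [← Mero.of_one]
      congr 1
      funext x
      simp [rowCoeff, ellBinom, ellFac_zero]
    rw [e, muR_one, one_mul, Nat.cast_zero, Nat.sub_zero, sub_zero]
    clear h e
    induction n with
    | zero => simp [rowSum_zero, descWord, word_nil]
    | succ n ih =>
      have hL := L_mul_rowSum H a false n 0 z
      have e : Mero.of (rowFactor p q false n (0 : ℤ)) = 1 := by
        rw [← Mero.of_one]
        refine Mero.of_congr (meromorphic_rowFactor H _ _ _) ?_
        have hn1 : sf p q ((n : ℂ) + 1) ≠ 0 := by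
          exact_mod_cast sf_intCast_ne_zero H.p_pos H.p_lt H.q_pos H.generic (n := n + 1) (by omega)
        filter_upwards [eventually_sf_add_ne_zero H.p_pos H.p_lt H.q_pos H.generic 1] with l h1
        simp [rowFactor, h1, hn1]
      rw [e, muR_one, one_mul, ih] at hL
      refine hL.symm.trans ?_
      rw [descWord_succ]
      simp [descWord, word_cons]
  | succ m ih =>
    obtain ⟨n, rfl⟩ : ∃ n', n = n' + 1 := ⟨n - 1, by omega⟩
    have hL := L_mul_rowSum H a true n m z
    rw [ih (by omega), ← mul_assoc, L_mul_muR (meromorphic_rowCoeff H _ _), mul_assoc] at hL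
    have hr := meromorphic_rowFactor H true n (m : ℤ)
    have hi : Meromorphic fun l => (rowFactor p q true n (m : ℤ) l)⁻¹ := fun l => (hr l).inv
    have hs : Meromorphic fun l => rowCoeff p q n m (l - wt true) := by
      simpa only [sub_eq_add_neg] using meromorphic_comp_add (meromorphic_rowCoeff H n m) _
    have hn1 : sf p q ((n : ℂ) + 1) ≠ 0 := by
      exact_mod_cast sf_intCast_ne_zero H.p_pos H.p_lt H.q_pos H.generic (n := n + 1) (by omega)
    have hm1 : sf p q ((m : ℂ) + 1) ≠ 0 := by
      exact_mod_cast sf_intCast_ne_zero H.p_pos H.p_lt H.q_pos H.generic (n := m + 1) (by omega)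
    have ev := (eventually_sf_add_ne_zero H.p_pos H.p_lt H.q_pos H.generic 1).and
      (eventually_sf_add_ne_zero H.p_pos H.p_lt H.q_pos H.generic ((n : ℂ) - m + 1))
    have hinv : muR p (Ω := Ω) (Mero.of fun l => (rowFactor p q true n (m : ℤ) l)⁻¹) *
        muR p (Mero.of (rowFactor p q true n (m : ℤ))) = 1 := by
      rw [muR_of_mul hi hr, ← muR_one, ← Mero.of_one]
      congr 1
      refine Mero.of_congr (hi.mul hr) ?_
      filter_upwards [ev] with l hl
      rw [show l + ((n : ℂ) - m + 1) = l + n - m + 1 by ring] at hl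
      refine inv_mul_cancel₀ ?_
      simp only [rowFactor, Int.cast_natCast]
      exact div_ne_zero (mul_ne_zero hm1 hl.2) (mul_ne_zero hn1 hl.1)
    have h2 := congrArg (fun X => muR p (Mero.of fun l => (rowFactor p q true n (m : ℤ) l)⁻¹) * X) hL
    simp only [← mul_assoc] at h2
    rw [hinv, one_mul, muR_of_mul hi hs] at h2
    refine h2.symm.trans ?_
    rw [mul_assoc]
    congr 1
    · congr 1
      refine Mero.of_congr (hi.mul hs) ?_
      filter_upwards [ev] with l hl
      rw [show l + ((n : ℂ) - m + 1) = l + n - m + 1 by ring] at hl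
      simpa [wt] using rowCoeff_succ H n m hl.1 hl.2
    · rw [← word_cons, descWord_succ, Nat.add_sub_add_right]
      push_cast
      rw [add_sub_cancel_right, add_sub_add_right_eq_sub]
      rfl

end NormalOrder

/-! ### The matrix elements as sums over ladders -/

section MatElt

variable {p q : ℝ} {Ω : SpectralSet q}

theorem wordWtR_append (u v : List (Letter Ω)) : wordWtR (u ++ v) = wordWtR u + wordWtR v := by
  simp [wordWtR]

theorem wordWtR_descWord (a b : Bool) (e : ℤ) (n : ℕ) (z : Ω.Pt) :
    wordWtR (descWord a b e n z) = n * wt b := by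
  induction n generalizing e with
  | zero => simp [descWord, wordWtR]
  | succ n ih =>
    have h := ih (e - 1)
    simp only [descWord_succ, wordWtR, List.map_cons, List.sum_cons, Letter.wtR] at h ⊢
    rw [h]
    push_cast
    ring

theorem word_mul_muR {f : ℂ → ℂ} (hf : Meromorphic f) (u : List (Letter Ω)) :
    word p u * muR p (Mero.of f) = muR p (Mero.of fun l => f (l - wordWtR u)) * word p u := by
  have hf' : Meromorphic fun l => f (l - wordWtR u) := by
    simpa only [sub_eq_add_neg] using meromorphic_comp_add hf _
  rw [muR_mul_word, shift_of hf']
  simp only [add_sub_cancel_right]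

theorem descWord_move (H : Nomes p q) (a b : Bool) (e d : ℤ) (n : ℕ) (z : Ω.Pt) :
    descWord a b e n (SpectralSet.move d z) = descWord a b (d + e) n z := by
  rw [descWord_eq, descWord_eq]
  refine List.map_congr_left fun i _ => ?_
  rw [move_move H]
  ring_nf

/-- The two factors belong to the row of -1s and the row of 1s. The argument of the second is
shifted by the right weight of the word that it has to pass. -/
theorem tCoeff_eq {N k j l : ℕ} (hk : k ≤ N) (hl : l ≤ j) (x : ℂ) :
    tCoeff p q N k j l x = rowCoeff p q (N - k) (j - l) x *
      rowCoeff p q k l (x - ((2 * ((j : ℤ) - l) - ((N : ℤ) - k) : ℤ) : ℂ)) := by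
  unfold tCoeff rowCoeff
  rw [show (j : ℤ) - l = ((j - l : ℕ) : ℤ) by omega]
  push_cast [hk, hl]
  rw [show 2 * (x - (2 * ((j : ℂ) - l) - (N - k)) - l + 2) = 2 * (x + N - k - 2 * j + l + 2) by ring,
    show 2 * (x - (2 * ((j : ℂ) - l) - (N - k)) + k - 2 * l + 2) = 2 * (x + N - 2 * j + 2) by ring,
    show 2 * (x - ((j : ℂ) - l) + 2) = 2 * (x + l - j + 2) by ring,
    show 2 * (x + ((N : ℂ) - k) - 2 * (j - l) + 2) = 2 * (x + N - 2 * j - k + 2 * l + 2) by ring]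
  ring

/-- The matrix elements of the irreducible corepresentation are row sums of the matrix elements of
a tensor product of vector corepresentations. -/
theorem matElt_eq (H : Nomes p q) {N k j : ℕ} (hk : k ≤ N) (z : Ω.Pt) :
    matElt p N k j z = tau p (List.replicate (N - k) false ++ List.replicate k true) j z := by
  rw [tau_append H, matElt]
  simp only [List.length_replicate]
  -- For l outside the range the first row would need a negative number of columns 1, or more than
  -- its length N - k, and its row sum is zero.
  rw [← Finset.sum_subset (s₁ := Finset.Icc (k + j - N) (min k j)) (s₂ := Finset.range (k + 1))]
  · refine Finset.sum_congr rfl fun l hl => ?_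
    have hl' := Finset.mem_Icc.1 hl
    have h1 : l ≤ k := hl'.2.trans (min_le_left _ _)
    have h2 : l ≤ j := hl'.2.trans (min_le_right _ _)
    have e := rowSum_eq H false (n := N - k) (m := j - l) (by omega) z
    have e' := rowSum_eq H true h1 (SpectralSet.move ((N - k : ℕ) : ℤ) z)
    unfold rowSum at e e'
    rw [show (j : ℤ) - l = ((j - l : ℕ) : ℤ) by omega, e, e', mul_assoc, ← mul_assoc (word p _),
      word_mul_muR (meromorphic_rowCoeff H _ _), ← mul_assoc, ← mul_assoc,
      muR_of_mul (meromorphic_rowCoeff H _ _) (by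
        simpa only [sub_eq_add_neg] using meromorphic_comp_add (meromorphic_rowCoeff H k l) _),
      mul_assoc, ← word_append, wordWtR_append, wordWtR_descWord, wordWtR_descWord,
      descWord_move H, descWord_move H]
    congr 1
    · congr 2
      funext x
      rw [tCoeff_eq hk h2]
      congr 4
      simp only [wt]
      push_cast [hk, h2, show j - l ≤ N - k by omega]
      ring
    · rw [List.append_assoc]
      push_cast [hk, h2]
      rw [show N - k - (j - l) = N + l - j - k by omega,
        show (N : ℤ) - k - (j - l) - 1 = N - j - k + l - 1 by ring,
        show (N : ℤ) - k + (k - 1) = N - 1 by ring,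
        show (N : ℤ) - k + (k - l - 1) = N - l - 1 by ring]
  · intro l hl
    have := Finset.mem_Icc.1 hl
    simp only [Finset.mem_range]
    omega
  · intro l hl hl'
    rw [tau_eq_zero, zero_mul]
    simp only [Finset.mem_range, Finset.mem_Icc, List.length_replicate] at hl hl' ⊢
    omega

end MatElt

/-! ### Pairing a letter with a row sum -/

section LetterTau

variable {p q : ℝ} {Ω Ω₁ Ω₂ : SpectralSet q}

/-- The value of the letter `L_{ij}` on a sum over ladders of length `n` with `k` row indices
`1`. -/
def letterVal (p q : ℝ) : Bool → Bool → ℂ → ℂ → ℂ → ℂ → ℂ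
  | true, true, n, k, u, l =>
      sf p q (u - n + k + 1) * sf p q (l + n - k + 1) / (sf p q (u + 1) * sf p q (l + 1))
  | true, false, n, k, u, l =>
      sf p q (n - k) * sf p q (l + n - k - u) / (sf p q (u + 1) * sf p q (l + 1))
  | false, true, _, k, u, l =>
      sf p q k * sf p q (l + u - k + 2) / (sf p q (u + 1) * sf p q (l + 1))
  | false, false, _, k, u, l =>
      sf p q (u - k + 1) * sf p q (l - k + 1) / (sf p q (u + 1) * sf p q (l + 1))

theorem meromorphic_letterVal (H : Nomes p q) (i j : Bool) (n k u : ℂ) :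
    Meromorphic (letterVal p q i j n k u) := by
  have h : ∀ {g : ℂ → ℂ}, Differentiable ℂ g → Meromorphic fun l => sf p q (g l) :=
    fun hg => meromorphic_sf H.p_pos H.p_lt H.q_pos hg
  have h0 : Meromorphic fun l => sf p q (l + 1) := h (by fun_prop)
  have key : ∀ {g : ℂ → ℂ} (c d : ℂ), Differentiable ℂ g →
      Meromorphic fun l => c * sf p q (g l) / (d * sf p q (l + 1)) := fun c d hg l =>
    ((MeromorphicAt.const _ _).mul (h hg l)).div ((MeromorphicAt.const _ _).mul (h0 l))
  cases i <;> cases j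
  · exact key _ _ (g := fun l => l - k + 1) (by fun_prop)
  · exact key _ _ (g := fun l => l + u - k + 2) (by fun_prop)
  · exact key _ _ (g := fun l => l + n - k - u) (by fun_prop)
  · exact key _ _ (g := fun l => l + n - k + 1) (by fun_prop)

/-- This is fusion: adding a factor to the tensor product keeps the value a single product, and
position enters only through the count of 1s. Each case is a cancellation or one instance of the
addition formula. -/
theorem letterVal_rec (H : Nomes p q) (i j e : Bool) (N k u l : ℂ) (hu0 : sf p q u ≠ 0)
    (hu1 : sf p q (u + 1) ≠ 0) (h0 : sf p q l ≠ 0) (h1 : sf p q (l + 1) ≠ 0)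
    (h2 : sf p q (l + 2) ≠ 0) :
    ∑ b : Bool, ∑ x : Bool, rm p q j b x e u l * letterVal p q i x N k (u - 1) (l - wt e) =
      letterVal p q i j (N + 1) (k + bit e) u l := by
  have e2 : l - -1 + 1 = l + 2 := by ring
  have e3 : l - 1 + 1 = l := by ring
  have e4 : u - 1 + 1 = u := by ring
  cases e <;> cases j <;> cases i <;>
    simp only [Fintype.sum_bool, rm, rs, letterVal, bit, wt, Int.cast_one, Int.cast_zero,
      Int.cast_neg, zero_div, zero_mul, add_zero, zero_add, e2, e3, e4]
  · have t := sf_rel H (1 + u) (- 1 + k - u) (- k + u) (2 - k + l)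
      (u+1) (l+1) (u-k) (l-k+2) (k) (l+u-k+2) (-(1)) (l+1-u) (u) (l+2) (-(u-k+1)) (l-k+1)
    simp only [sf_neg H.p_pos H.p_lt H.q_pos] at t
    field_simp
    linear_combination (norm := ring_nf) t
  · have t := sf_rel H (1 + u) (- 1 - N + k) (N - k) (2 + N - k + l - u)
      (u+1) (l+1) (N-k) (l+2+N-k-u) (u-N+k) (l+N-k+2) (-(1)) (l+1-u) (u) (l+2) (-(N-k+1)) (l+N-k+1-u)
    simp only [sf_neg H.p_pos H.p_lt H.q_pos] at t
    field_simp
    linear_combination (norm := ring_nf) t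
  · field_simp
    ring_nf
  · field_simp
    ring_nf
  · field_simp
    ring_nf
  · field_simp
    ring_nf
  · have t := sf_rel H (1 + u) (- u) (k) (- k + l + u)
      (u+1) (l+1) (k) (l+u-k) (1) (l+1+u) (-(u-k)) (l-k) (k+1) (l+u-k+1) (-(u)) (l)
    simp only [sf_neg H.p_pos H.p_lt H.q_pos] at t
    field_simp
    linear_combination (norm := ring_nf) t
  · have t := sf_rel H (1 + u) (- u) (- N + k + u) (N - k + l)
      (u+1) (l+1) (u-N+k) (l+N-k) (1) (l+1+u) (-(N-k)) (l+N-k-u) (u-N+k+1) (l+N-k+1) (-(u)) (l)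
    simp only [sf_neg H.p_pos H.p_lt H.q_pos] at t
    field_simp
    linear_combination (norm := ring_nf) t

variable {P : E p Ω₁ →ₗ[ℂ] E p Ω₂ →ₗ[ℂ] Op}

theorem word_mem_homog (u : List (Letter Ω)) : word p u ∈ homog p (wordWtL u) (wordWtR u) :=
  Submodule.subset_span ⟨1, 1, u, rfl, rfl, by rw [muL_one, muR_one, one_mul, one_mul]⟩

theorem IsRMatrixPairing.word_word_eq_zero (hP : IsRMatrixPairing p P) {u : List (Letter Ω₁)}
    {v : List (Letter Ω₂)} (h : wordWtR u + wordWtR v ≠ wordWtL u + wordWtL v) :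
    P (word p u) (word p v) = 0 := by
  rcases hP.target _ _ _ _ _ (word_mem_homog u) _ (word_mem_homog v) with h0 | ⟨h0, -⟩
  · exact h0
  · exact absurd h0 h

theorem wordWtL_ladder {ε κ : List Bool} (h : κ.length = ε.length) (z : Ω.Pt) :
    wordWtL (ladder ε κ z) = 2 * cnt ε - ε.length := by
  induction ε generalizing κ z with
  | nil =>
    cases κ with
    | nil => simp [ladder, wordWtL, cnt]
    | cons b κ => simp at h
  | cons a ε ih =>
    cases κ with
    | nil => simp at h
    | cons b κ =>
      have h' : κ.length = ε.length := by simpa using h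
      have := ih h' (SpectralSet.move 1 z)
      simp only [wordWtL, ladder, List.map_cons, List.sum_cons, Letter.wtL, wt_eq_bit, cnt,
        List.length_cons, Nat.cast_add, Nat.cast_one] at this ⊢
      rw [this]
      ring

theorem op_one (n : ℤ) : op (fun _ => 1) n = opRing.T n := by
  rw [op_const, one_smul]

/-- Induction over the ladder: the product rule splits off its first letter, which pairs by the
R-matrix, and the rest is evaluated at u - 1 since its spectral parameter is q²z. Summation over the
intermediate and column indices is `letterVal_rec`. The prescribed column count is the only one
allowed by weights. -/
theorem IsRMatrixPairing.letter_tau (H : Nomes p q) (hP : IsRMatrixPairing p P) (i j : Bool)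
    (w : Ω₁.Pt) (ε : List Bool) (z : Ω₂.Pt) {u : ℂ} (hu : qp q (2 * u) = (w : ℂ) / z)
    (hg : Generic p q u) :
    P (gen p (.L i j w)) (tau p ε (cnt ε + bit i - bit j) z) =
      op (letterVal p q i j ε.length (cnt ε) u) (-wt i - (2 * cnt ε - ε.length)) := by
  induction ε generalizing j z u with
  | nil =>
    have hu1 : sf p q (u + 1) ≠ 0 := by exact_mod_cast hg 1
    rw [tau_nil]
    by_cases hij : i = j
    · subst hij
      rw [if_pos (by simp [cnt]), ← word_singleton, hP.counit₁]
      simp only [counitWord, Letter.counit, List.map_cons, List.map_nil, List.prod_cons,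
        List.prod_nil, mul_one, if_true, cnt, List.length_nil, Nat.cast_zero, sub_zero, mul_zero]
      rw [op_congr (g := fun _ => 1) (meromorphic_letterVal H _ _ _ _ _), op_one, opRing_T]
      · push_cast
        rfl
      · filter_upwards [eventually_sf_add_ne_zero H.p_pos H.p_lt H.q_pos H.generic 1] with l h1
        cases i <;> simp [letterVal, h1, hu1]
    · rw [if_neg, map_zero]
      · have : letterVal p q i j ((0 : ℕ) : ℂ) ((0 : ℤ) : ℂ) u = fun _ => 0 := by
          funext l
          cases i <;> cases j <;> simp_all [letterVal, sf_zero H.p_pos H.p_lt]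
        rw [cnt, List.length_nil, this, op_zero]
      · cases i <;> cases j <;> simp_all [cnt, bit]
  | cons e ε ih =>
    have hu' : qp q (2 * (u - 1)) = (w : ℂ) / (SpectralSet.move 1 z : Ω₂.Pt) := by
      rw [← div_mul_div_cancel₀ (a := (w : ℂ)) z.ne_zero, ← hu, div_move H, ← qp_add H.q_pos]
      congr 1
      ring
    have hg' : Generic p q (u - 1) := fun n => by
      have := hg (n - 1)
      push_cast at this
      rwa [show u - 1 + (n : ℂ) = u + (n - 1) by ring]
    have hs : ∀ x, Meromorphic fun l =>
        letterVal p q i x ε.length (cnt ε) (u - 1) (l - wt e) := fun x => by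
      simpa only [sub_eq_add_neg] using
        meromorphic_comp_add (meromorphic_letterVal H i x ε.length (cnt ε) (u - 1)) _
    have term : ∀ b x : Bool, P (gen p (.L x j w)) (gen p (.L e b z)) * opRing.T (wt x) *
        P (gen p (.L i x w)) (tau p ε (cnt (e :: ε) + bit i - bit j - bit b)
          (SpectralSet.move 1 z)) =
        op (fun l => rm p q j b x e u l * letterVal p q i x ε.length (cnt ε) (u - 1) (l - wt e))
          (-wt i - (2 * cnt (e :: ε) - (e :: ε).length)) := by
      intro b x
      have hL : P (gen p (.L x j w)) (gen p (.L e b z)) = op (rm p q j b x e u) (-wt x - wt e) := by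
        have h := hP.generators x j e b w z
        rw [word_singleton, word_singleton, ← hu, rMat_eq_rm H] at h
        rw [h, op, opRing_T]
        push_cast
        rfl
      by_cases hw : wt j + wt b = wt x + wt e
      -- Weight conservation of the R-matrix turns the remaining column count into the one required
      -- by the induction hypothesis; otherwise the entry is zero.
      · have hc : cnt (e :: ε) + bit i - bit j - bit b = cnt ε + bit i - bit x := by
          simp only [wt_eq_bit, cnt] at hw ⊢
          omega
        rw [hc, ih x _ hu' hg', hL, op_mul_T, op_mul_op (meromorphic_rm H _ _ _ _ _)
          (meromorphic_letterVal H _ _ _ _ _)]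
        have e1 : -wt x - wt e + wt x = -wt e := by ring
        have e2 : -wt e + (-wt i - (2 * cnt ε - ε.length)) =
            -wt i - (2 * cnt (e :: ε) - (e :: ε).length) := by
          simp only [wt_eq_bit, cnt, List.length_cons, Nat.cast_add, Nat.cast_one]
          ring
        rw [e1, e2]
        simp only [Int.cast_neg, sub_eq_add_neg]
      · have e0 : rm p q j b x e u = fun _ => 0 := funext fun l => rm_eq_zero hw u l
        rw [hL, e0, op_zero, zero_mul, zero_mul]
        simp only [zero_mul]
        rw [op_zero]
    have hm : ∀ b x, Meromorphic fun l => rm p q j b x e u l *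
        letterVal p q i x ε.length (cnt ε) (u - 1) (l - wt e) := fun b x =>
      (meromorphic_rm H _ _ _ _ _).mul (hs x)
    have hmul : ∀ b, P (gen p (.L i j w)) (gen p (.L e b z) *
        tau p ε (cnt (e :: ε) + bit i - bit j - bit b) (SpectralSet.move 1 z)) =
        op (fun l => ∑ x : Bool, rm p q j b x e u l *
          letterVal p q i x ε.length (cnt ε) (u - 1) (l - wt e))
          (-wt i - (2 * cnt (e :: ε) - (e :: ε).length)) := by
      intro b
      rw [← word_singleton, hP.right_mul, Alphabet.cop_sum, letters_sum_L]
      simp only [word_singleton]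
      rw [← op_sum _ (hm b)]
      exact Finset.sum_congr rfl fun x _ => term b x
    have hm' : ∀ b, Meromorphic fun l => ∑ x : Bool, rm p q j b x e u l *
        letterVal p q i x ε.length (cnt ε) (u - 1) (l - wt e) := fun b l =>
      MeromorphicAt.fun_sum fun x _ => hm b x l
    rw [tau_cons, map_sum]
    simp only [hmul]
    rw [op_sum _ hm']
    refine op_congr (fun l => MeromorphicAt.fun_sum fun b _ => hm' b l) ?_ _
    filter_upwards [eventually_sf_add_ne_zero H.p_pos H.p_lt H.q_pos H.generic 0,
      eventually_sf_add_ne_zero H.p_pos H.p_lt H.q_pos H.generic 1,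
      eventually_sf_add_ne_zero H.p_pos H.p_lt H.q_pos H.generic 2] with l h0 h1 h2
    rw [add_zero] at h0
    have hu0 : sf p q u ≠ 0 := by simpa using hg 0
    have hu1 : sf p q (u + 1) ≠ 0 := by exact_mod_cast hg 1
    have := letterVal_rec H i j e ε.length (cnt ε) u l hu0 hu1 h0 h1 h2
    rw [this]
    simp only [cnt, List.length_cons]
    push_cast
    rw [add_comm (cnt ε : ℂ)]

end LetterTau

/-! ### Pairing a word with a row sum -/

section WordTau

variable {p q : ℝ} {Ω Ω₁ Ω₂ : SpectralSet q}

/-- The product of the values of the letters `L_{ij}(q^{2t} w)`, listed as triples `(i, j, t)`, on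
a sum over ladders of length `n` with `k` row indices `1`. -/
def wordVal (p q : ℝ) (n u : ℂ) : List (Bool × Bool × ℤ) → ℤ → ℂ → ℂ
  | [], _, _ => 1
  | x :: v, k, l => letterVal p q x.1 x.2.1 n k (u + x.2.2) l *
      wordVal p q n u v (k + bit x.1 - bit x.2.1) (l - wt x.2.1)

/-- The word of the letters `L_{ij}(q^{2t} w)`, listed as triples `(i, j, t)`. -/
def shiftWord (w : Ω.Pt) (v : List (Bool × Bool × ℤ)) : List (Letter Ω) :=
  v.map fun x => .L x.1 x.2.1 (SpectralSet.move x.2.2 w)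

/-- The change of the number of indices `1`. -/
def netShift : List (Bool × Bool × ℤ) → ℤ
  | [] => 0
  | x :: v => bit x.1 - bit x.2.1 + netShift v

/-- The right weight of a list of triples. -/
def colWt : List (Bool × Bool × ℤ) → ℤ
  | [] => 0
  | x :: v => wt x.2.1 + colWt v

theorem meromorphic_wordVal (H : Nomes p q) (n u : ℂ) (v : List (Bool × Bool × ℤ)) (k : ℤ) :
    Meromorphic (wordVal p q n u v k) := by
  induction v generalizing k with
  | nil => exact fun l => MeromorphicAt.const 1 l
  | cons x v ih =>
    have h : Meromorphic fun l => wordVal p q n u v (k + bit x.1 - bit x.2.1) (l - wt x.2.1) := by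
      simpa only [sub_eq_add_neg] using meromorphic_comp_add (ih (k + bit x.1 - bit x.2.1)) _
    exact (meromorphic_letterVal H _ _ _ _ _).mul h

variable {P : E p Ω₁ →ₗ[ℂ] E p Ω₂ →ₗ[ℂ] Op}

theorem IsRMatrixPairing.one_tau (hP : IsRMatrixPairing p P) (ε : List Bool) (j : ℤ) (z : Ω₂.Pt) :
    P 1 (tau p ε j z) = if cnt ε = j then opRing.T (ε.length - 2 * j) else 0 := by
  have h1 : ∀ a b : E p Ω₂, P 1 (a * b) = P 1 a * P 1 b := by
    intro a b
    have h := hP.right_product [] a b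
    simp only [comulWord, List.map_cons, List.map_nil, List.sum_cons, List.sum_nil, add_zero,
      word_nil, wordWtL, Int.cast_zero, T_zero, mul_one] at h
    exact h
  have hg : ∀ e b z, P 1 (gen p (.L e b z)) = if e = b then opRing.T (-wt e) else 0 := by
    intro e b z
    rw [← word_singleton, hP.counit₂]
    simp only [counitWord, Letter.counit, List.map_cons, List.map_nil, List.prod_cons,
      List.prod_nil, mul_one, opRing_T, Int.cast_neg]
  induction ε generalizing j z with
  | nil =>
    rw [tau_nil]
    by_cases hj : j = 0
    · subst hj
      rw [if_pos rfl, ← word_nil (p := p) (Ω := Ω₁), hP.counit₁]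
      simp [cnt, counitWord, opRing_T, T_zero]
    · rw [if_neg hj, map_zero, if_neg]
      exact Ne.symm hj
  | cons e ε ih =>
    rw [tau_cons, map_sum, Finset.sum_eq_single e]
    · rw [h1, hg, if_pos rfl, ih, mul_ite, mul_zero, opRing.T_mul]
      by_cases h : cnt ε = j - bit e
      · rw [if_pos h, if_pos (by rw [cnt]; omega)]
        congr 1
        rw [wt_eq_bit, List.length_cons]
        push_cast
        ring
      · rw [if_neg h, if_neg (by rw [cnt]; omega)]
    · intro b _ hb
      rw [h1, hg, if_neg (Ne.symm hb), zero_mul]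
    · exact fun h => absurd (Finset.mem_univ _) h

/-- Weights fix the number of 1s in the intermediate row index κ. As Y only sees that number, its
value comes out of the sum over κ, and what is left is the pairing of the letter with a column sum.
-/
theorem IsRMatrixPairing.letter_mul_tau (H : Nomes p q) (hP : IsRMatrixPairing p P)
    (i i' : Bool) (w : Ω₁.Pt) (Y : E p Ω₁) (n : ℕ) (j : ℤ) (z : Ω₂.Pt) (G : ℤ → Op)
    (hG : ∀ κ : List Bool, κ.length = n → P Y (tau p κ j z) = G (cnt κ))
    {u : ℂ} (hu : qp q (2 * u) = (w : ℂ) / z) (hg : Generic p q u) {ε : List Bool}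
    (hε : ε.length = n) :
    P (gen p (.L i i' w) * Y) (tau p ε j z) =
      op (letterVal p q i i' n (cnt ε) u) (-wt i') * G (cnt ε + bit i - bit i') := by
  set m := cnt ε + bit i - bit i' with hm
  have hsum : P (gen p (.L i i' w)) (tau p ε m z) * opRing.T (2 * m - n) * G m =
      sumCols ε.length fun κ => (if cnt κ = m then P (gen p (.L i i' w)) (word p (ladder ε κ z))
        else 0) * opRing.T (2 * m - n) * G m := by
    rw [tau, map_sumCols (P (gen p (.L i i' w)))]
    have h := map_sumCols ((AddMonoidHom.mulRight (G m)).comp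
      (AddMonoidHom.mulRight (opRing.T (2 * m - n)))) ε.length
      (fun η => P (gen p (.L i i' w)) (if cnt η = m then word p (ladder ε η z) else 0))
    refine h.trans (sumCols_congr fun κ _ => ?_)
    change P (gen p (.L i i' w)) (if cnt κ = m then word p (ladder ε κ z) else 0) *
      opRing.T (2 * m - n) * G m = _
    rw [apply_ite (P (gen p (.L i i' w))), map_zero]
  rw [hP.letter_tau H i i' w ε z hu hg, op_mul_T] at hsum
  rw [hP.mul_tau, ← hε, show -wt i' = -wt i - (2 * cnt ε - ε.length) + (2 * m - n) by
    rw [hm, hε, wt_eq_bit, wt_eq_bit]; ring, hsum]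
  refine sumCols_congr fun κ hκ => ?_
  by_cases h : cnt κ = m
  · rw [if_pos h, hG κ (hκ.trans hε), h, hε, opRing_T]
  · rw [if_neg h, ← word_singleton, hP.word_word_eq_zero, zero_mul, zero_mul, zero_mul, zero_mul]
    rw [wordWtL_ladder hκ, wordWtR_ladder hκ]
    simp only [wordWtL, wordWtR, List.map_cons, List.map_nil, List.sum_cons, List.sum_nil,
      Letter.wtL, Letter.wtR, wt_eq_bit]
    omega

/-- Letters are split off from the left; each contributes one factor and moves the count of 1s, so
no summation remains. -/
theorem IsRMatrixPairing.word_tau (H : Nomes p q) (hP : IsRMatrixPairing p P)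
    (v : List (Bool × Bool × ℤ)) (w : Ω₁.Pt) (j : ℤ) (z : Ω₂.Pt) {u : ℂ}
    (hu : qp q (2 * u) = (w : ℂ) / z) (hg : Generic p q u) (ε : List Bool) :
    P (word p (shiftWord w v)) (tau p ε j z) = if cnt ε + netShift v = j then
      op (wordVal p q ε.length u v (cnt ε)) (ε.length - 2 * j - colWt v) else 0 := by
  obtain ⟨n, hn⟩ : ∃ n, ε.length = n := ⟨_, rfl⟩
  rw [hn]
  induction v generalizing ε with
  | nil =>
    rw [shiftWord, List.map_nil, word_nil, hP.one_tau, netShift, add_zero, colWt, sub_zero, hn]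
    refine if_congr Iff.rfl ?_ rfl
    exact (op_one _).symm
  | cons x v ih =>
    have hu' : qp q (2 * (u + x.2.2)) = ((SpectralSet.move x.2.2 w : Ω₁.Pt) : ℂ) / z := by
      change _ = (q : ℂ) ^ (2 * x.2.2) * (w : ℂ) / z
      rw [mul_div_assoc, ← hu, mul_add, qp_add H.q_pos, ← qp_intCast, mul_comm]
      push_cast
      rfl
    have hg' : Generic p q (u + x.2.2) := fun m => by
      have := hg (x.2.2 + m)
      push_cast at this
      rwa [add_assoc]
    have h := hP.letter_mul_tau H x.1 x.2.1 (SpectralSet.move x.2.2 w) (word p (shiftWord w v)) n j z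
      (fun k => if k + netShift v = j then op (wordVal p q n u v k) (n - 2 * j - colWt v) else 0)
      (fun κ hκ => ih κ hκ) hu' hg' hn
    rw [shiftWord, List.map_cons, word_cons]
    refine h.trans ?_
    have hc : cnt ε + bit x.1 - bit x.2.1 + netShift v = cnt ε + netShift (x :: v) := by
      rw [netShift]
      ring
    rw [hc, mul_ite, mul_zero, op_mul_op (meromorphic_letterVal H _ _ _ _ _)
      (meromorphic_wordVal H _ _ _ _)]
    refine if_congr Iff.rfl ?_ rfl
    rw [show -wt x.2.1 + ((n : ℤ) - 2 * j - colWt v) = n - 2 * j - colWt (x :: v) by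
      rw [colWt]; ring]
    congr 1
    funext l
    rw [wordVal, Int.cast_neg, ← sub_eq_add_neg]

theorem wordVal_append (n u : ℂ) (v v' : List (Bool × Bool × ℤ)) (k : ℤ) (l : ℂ) :
    wordVal p q n u (v ++ v') k l =
      wordVal p q n u v k l * wordVal p q n u v' (k + netShift v) (l - colWt v) := by
  induction v generalizing k l with
  | nil => simp [wordVal, netShift, colWt]
  | cons x v ih =>
    rw [List.cons_append, wordVal, wordVal, ih, netShift, colWt, mul_assoc]
    congr 3
    · ring
    · push_cast
      ring

/-- The letters of `descWord`. -/
def descList (a b : Bool) (e : ℤ) (n : ℕ) : List (Bool × Bool × ℤ) :=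
  (List.range n).map fun i : ℕ => (a, b, e - (i : ℤ))

theorem shiftWord_descList (a b : Bool) (e : ℤ) (n : ℕ) (w : Ω.Pt) :
    shiftWord w (descList a b e n) = descWord a b e n w := by
  rw [descWord_eq, shiftWord, descList, List.map_map]
  rfl

theorem descList_succ (a b : Bool) (e : ℤ) (n : ℕ) :
    descList a b e (n + 1) = (a, b, e) :: descList a b (e - 1) n := by
  unfold descList
  rw [List.range_succ_eq_map, List.map_cons, List.map_map]
  refine congr_arg₂ _ (by simp) (List.map_congr_left fun i _ => ?_)
  simp only [Function.comp, Nat.succ_eq_add_one, Nat.cast_add, Nat.cast_one]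
  rw [show e - ((i : ℤ) + 1) = e - 1 - i by ring]

theorem netShift_descList (a b : Bool) (e : ℤ) (n : ℕ) :
    netShift (descList a b e n) = n * (bit a - bit b) := by
  induction n generalizing e with
  | zero => simp [descList, netShift]
  | succ n ih =>
    rw [descList_succ, netShift, ih]
    push_cast
    ring

theorem colWt_descList (a b : Bool) (e : ℤ) (n : ℕ) :
    colWt (descList a b e n) = n * wt b := by
  induction n generalizing e with
  | zero => simp [descList, colWt]
  | succ n ih =>
    rw [descList_succ, colWt, ih]
    push_cast
    ring

theorem netShift_append (v v' : List (Bool × Bool × ℤ)) :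
    netShift (v ++ v') = netShift v + netShift v' := by
  induction v with
  | nil => simp [netShift]
  | cons x v ih => rw [List.cons_append, netShift, ih, netShift, add_assoc]

theorem colWt_append (v v' : List (Bool × Bool × ℤ)) :
    colWt (v ++ v') = colWt v + colWt v' := by
  induction v with
  | nil => simp [colWt]
  | cons x v ih => rw [List.cons_append, colWt, ih, colWt, add_assoc]

theorem wordVal_descList (n u : ℂ) (a b : Bool) (e : ℤ) (m : ℕ) (k : ℤ) (l : ℂ) :
    wordVal p q n u (descList a b e m) k l = ∏ i ∈ Finset.range m,
      letterVal p q a b n (k + i * (bit a - bit b) : ℤ) (u + (e - i : ℤ)) (l - i * wt b) := by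
  induction m generalizing e k l with
  | zero => simp [descList, wordVal]
  | succ m ih =>
    rw [descList_succ, wordVal, ih, Finset.prod_range_succ', mul_comm]
    congr 1
    · refine Finset.prod_congr rfl fun i _ => ?_
      congr 1
      · push_cast
        ring
      · push_cast
        ring
      · push_cast
        ring
    · simp

theorem cnt_append (ε ε' : List Bool) : cnt (ε ++ ε') = cnt ε + cnt ε' := by
  induction ε with
  | nil => simp [cnt]
  | cons a ε ih => rw [List.cons_append, cnt, ih, cnt, add_assoc]

theorem cnt_replicate (a : Bool) (n : ℕ) : cnt (List.replicate n a) = n * bit a := by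
  induction n with
  | zero => simp [cnt]
  | succ n ih =>
    rw [List.replicate_succ, cnt, ih]
    push_cast
    ring

theorem op_sum_mem {ι : Type} (s : Finset ι) {f : ι → ℂ → ℂ} (hf : ∀ i ∈ s, Meromorphic (f i))
    (n : ℤ) : ∑ i ∈ s, op (f i) n = op (fun x => ∑ i ∈ s, f i x) n := by
  classical
  have h : ∀ i, Meromorphic (if i ∈ s then f i else fun _ => 0) := by
    intro i
    by_cases hi : i ∈ s
    · rw [if_pos hi]
      exact hf i hi
    · rw [if_neg hi]
      exact fun l => MeromorphicAt.const 0 l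
  have e := op_sum s h n
  rw [Finset.sum_congr rfl fun i hi => by rw [if_pos hi]] at e
  rw [e]
  congr 1
  funext x
  exact Finset.sum_congr rfl fun i hi => by rw [if_pos hi]

/-- The letters of the `l`-th term of `t^M_{rs}`. -/
def termList (M r s l : ℕ) : List (Bool × Bool × ℤ) :=
  descList false true ((M : ℤ) - r - 1) (s - l) ++
    descList false false ((M : ℤ) - s - r + l - 1) (M + l - s - r) ++
    descList true true ((M : ℤ) - 1) l ++ descList true false ((M : ℤ) - l - 1) (r - l)

theorem meromorphic_tCoeff (H : Nomes p q) {N k j l : ℕ} (hk : k ≤ N) (hl : l ≤ j) :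
    Meromorphic (tCoeff p q N k j l) := by
  have e : tCoeff p q N k j l = fun x => rowCoeff p q (N - k) (j - l) x *
      rowCoeff p q k l (x - ((2 * ((j : ℤ) - l) - ((N : ℤ) - k) : ℤ) : ℂ)) :=
    funext fun x => tCoeff_eq hk hl x
  have h : Meromorphic fun x =>
      rowCoeff p q k l (x - ((2 * ((j : ℤ) - l) - ((N : ℤ) - k) : ℤ) : ℂ)) := by
    simpa only [sub_eq_add_neg] using meromorphic_comp_add (meromorphic_rowCoeff H k l) _
  rw [e]
  exact (meromorphic_rowCoeff H _ _).mul h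

/-- The pairing of matrix elements as a sum of products. -/
theorem IsRMatrixPairing.matElt_matElt (H : Nomes p q) (hP : IsRMatrixPairing p P) {M N r s k j : ℕ}
    (hr : r ≤ M) (hk : k ≤ N) (w : Ω₁.Pt) (z : Ω₂.Pt) {u : ℂ}
    (hu : qp q (2 * u) = (w : ℂ) / z) (hg : Generic p q u) :
    P (matElt p M r s w) (matElt p N k j z) = if s + j = r + k then
      op (fun l => ∑ n ∈ Finset.Icc (r + s - M) (min r s),
        tCoeff p q M r s n l * wordVal p q N u (termList M r s n) k l)
        (N + M - 2 * s - 2 * j) else 0 := by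
  rw [matElt_eq H hk z, matElt, map_sum, LinearMap.sum_apply]
  have hc : cnt (List.replicate (N - k) false ++ List.replicate k true) = k := by
    simp [cnt_append, cnt_replicate, bit]
  have hlen : (List.replicate (N - k) false ++ List.replicate k true).length = N := by
    simp [hk]
  have hS : ∀ n ∈ Finset.Icc (r + s - M) (min r s), n ≤ r ∧ n ≤ s ∧ s + r ≤ M + n := by
    intro n hn
    have h1 := (Finset.mem_Icc.1 hn).1
    have h2 := (Finset.mem_Icc.1 hn).2
    omega
  have term : ∀ n ∈ Finset.Icc (r + s - M) (min r s),
      P (muR p (Mero.of (tCoeff p q M r s n)) *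
        word p (descWord false true ((M : ℤ) - r - 1) (s - n) w ++
          descWord false false ((M : ℤ) - s - r + n - 1) (M + n - s - r) w ++
          descWord true true ((M : ℤ) - 1) n w ++
          descWord true false ((M : ℤ) - n - 1) (r - n) w))
        (tau p (List.replicate (N - k) false ++ List.replicate k true) j z) =
      if s + j = r + k then op (fun l => tCoeff p q M r s n l *
        wordVal p q N u (termList M r s n) k l) (N + M - 2 * s - 2 * j) else 0 := by
    intro n hn
    obtain ⟨h1, h2, h3⟩ := hS n hn
    have e : shiftWord w (termList M r s n) =
        descWord false true ((M : ℤ) - r - 1) (s - n) w ++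
          descWord false false ((M : ℤ) - s - r + n - 1) (M + n - s - r) w ++
          descWord true true ((M : ℤ) - 1) n w ++
          descWord true false ((M : ℤ) - n - 1) (r - n) w := by
      simp only [← shiftWord_descList, shiftWord, termList, List.map_append]
    have hns : netShift (termList M r s n) = r - s := by
      simp only [termList, netShift_append, netShift_descList, bit]
      push_cast [h1, h2, show s ≤ M + n by omega, show r ≤ M + n - s by omega]
      ring
    have hcw : colWt (termList M r s n) = 2 * s - M := by
      simp only [termList, colWt_append, colWt_descList, wt]
      push_cast [h1, h2, show s ≤ M + n by omega, show r ≤ M + n - s by omega]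
      ring
    rw [hP.left_moment₁, ← e, hP.word_tau H _ w j z hu hg, hc, hlen, hns, hcw, mul_ite, mul_zero,
      mulOp_mul_op (meromorphic_tCoeff H hr h2) (meromorphic_wordVal H _ _ _ _)]
    refine if_congr (by omega) ?_ rfl
    congr 1
    ring
  rw [Finset.sum_congr rfl term]
  by_cases h : s + j = r + k
  · simp only [if_pos h]
    exact op_sum_mem _ (fun n hn => (meromorphic_tCoeff H hr (hS n hn).2.1).mul
      (meromorphic_wordVal H _ _ _ _)) _
  · simp only [if_neg h, Finset.sum_const_zero]

end WordTau

/-! ### Shifted factorials in additive notation -/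

section Factorials

variable {p q : ℝ}

/-- The shifted factorial `f(a) f(a + 1) ⋯ f(a + n - 1)` of the odd theta function `f`, extended
to negative `n`. -/
def sfac (p q : ℝ) (a : ℂ) : ℤ → ℂ
  | Int.ofNat n => ∏ i ∈ Finset.range n, sf p q (a + i)
  | Int.negSucc n => (∏ i ∈ Finset.range (n + 1), sf p q (a - (i + 1)))⁻¹

theorem sfac_zero (a : ℂ) : sfac p q a 0 = 1 := Finset.prod_range_zero _

theorem sfac_natCast (a : ℂ) (n : ℕ) : sfac p q a n = ∏ i ∈ Finset.range n, sf p q (a + i) := rfl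

theorem sfac_neg_natCast (a : ℂ) (n : ℕ) :
    sfac p q a (-(n : ℤ)) = (∏ i ∈ Finset.range n, sf p q (a - (i + 1)))⁻¹ := by
  cases n with
  | zero => simp [sfac_zero]
  | succ n => rfl

theorem sfac_one (a : ℂ) : sfac p q a 1 = sf p q a := by
  have h := sfac_natCast (p := p) (q := q) a 1
  simpa using h

theorem sfac_add_one (a : ℂ) {n : ℤ} (h : n < 0 → sf p q (a + n) ≠ 0) :
    sfac p q a (n + 1) = sfac p q a n * sf p q (a + n) := by
  obtain ⟨m, rfl | rfl⟩ := Int.eq_nat_or_neg n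
  · exact Finset.prod_range_succ _ _
  · cases m with
    | zero => simp [sfac_zero, sfac_one]
    | succ m =>
      have h' := h (by omega)
      rw [show -((m + 1 : ℕ) : ℤ) + 1 = -(m : ℤ) by push_cast; ring, sfac_neg_natCast,
        sfac_neg_natCast, Finset.prod_range_succ, mul_inv]
      push_cast at h' ⊢
      rw [← sub_eq_add_neg] at h' ⊢
      rw [mul_assoc, inv_mul_cancel₀ h', mul_one]

theorem sfac_ne_zero {c : ℂ} {lo hi : ℤ} (h : ∀ i : ℤ, lo ≤ i → i < hi → sf p q (c + i) ≠ 0) {m : ℤ}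
    (h1 : lo ≤ m) (h2 : m ≤ hi) (h3 : lo ≤ 0) (h4 : 0 ≤ hi) : sfac p q c m ≠ 0 := by
  obtain ⟨n, rfl | rfl⟩ := Int.eq_nat_or_neg m
  · rw [sfac_natCast, Finset.prod_ne_zero_iff]
    intro i hi'
    rw [Finset.mem_range] at hi'
    exact_mod_cast h i (by omega) (by omega)
  · rw [sfac_neg_natCast]
    refine inv_ne_zero (Finset.prod_ne_zero_iff.2 fun i hi' => ?_)
    rw [Finset.mem_range] at hi'
    have := h (-(i + 1)) (by omega) (by omega)
    push_cast at this
    rwa [← sub_eq_add_neg] at this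

theorem sfac_mul_sfac {c : ℂ} {lo hi : ℤ} (h : ∀ i : ℤ, lo ≤ i → i < hi → sf p q (c + i) ≠ 0)
    {m n : ℤ} (h1 : lo ≤ m) (h2 : m ≤ hi) (h3 : lo ≤ m + n) (h4 : m + n ≤ hi) :
    sfac p q c m * sfac p q (c + m) n = sfac p q c (m + n) := by
  obtain ⟨j, rfl | rfl⟩ := Int.eq_nat_or_neg n
  · induction j with
    | zero => simp [sfac_zero]
    | succ j ih =>
      have h5 : sf p q (c + (m + j : ℤ)) ≠ 0 := h _ (by push_cast at h3 h4; omega) (by push_cast at h4; omega)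
      push_cast at h3 h4 h5 ⊢
      rw [sfac_add_one (c + m) (fun _ => by rw [add_assoc]; exact_mod_cast h5), ← mul_assoc,
        ih (by omega) (by omega), ← add_assoc, sfac_add_one c (fun _ => by push_cast; exact h5)]
      push_cast
      rw [add_assoc]
  · induction j with
    | zero => simp [sfac_zero]
    | succ j ih =>
      have h5 : sf p q (c + (m - (j + 1) : ℤ)) ≠ 0 := h _ (by push_cast at h3 h4; omega) (by push_cast at h4; omega)
      have ih' := ih (by push_cast at h3; omega) (by push_cast at h4; omega)
      have e1 := sfac_add_one (p := p) (q := q) (c + m) (n := -((j + 1 : ℕ) : ℤ)) (fun _ => by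
        push_cast at h5 ⊢
        rwa [show c + (m : ℂ) + -((j : ℂ) + 1) = c + (m - (j + 1)) by ring])
      have e2 := sfac_add_one (p := p) (q := q) c (n := m + -((j + 1 : ℕ) : ℤ)) (fun _ => by
        push_cast at h5 ⊢
        rwa [show c + ((m : ℂ) + -((j : ℂ) + 1)) = c + (m - (j + 1)) by ring])
      rw [show -((j + 1 : ℕ) : ℤ) + 1 = -(j : ℤ) by push_cast; ring] at e1
      rw [show m + -((j + 1 : ℕ) : ℤ) + 1 = m + -(j : ℤ) by push_cast; ring] at e2
      rw [e1, e2] at ih'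
      have e3 : c + (m : ℂ) + ((-((j + 1 : ℕ) : ℤ) : ℤ) : ℂ) = c + (m - (j + 1) : ℤ) := by
        push_cast; ring
      have e4 : c + ((m + -((j + 1 : ℕ) : ℤ) : ℤ) : ℂ) = c + (m - (j + 1) : ℤ) := by
        push_cast; ring
      rw [e3, e4, ← mul_assoc] at ih'
      exact mul_right_cancel₀ h5 ih'

/-- Every factorial based at a point of c + ℤ is a quotient of two factorials based at c. Identities
among such factorials thereby become cancellations of monomials. -/
theorem sfac_eq_div {c a : ℂ} {lo hi : ℤ} (h : ∀ i : ℤ, lo ≤ i → i < hi → sf p q (c + i) ≠ 0)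
    (m n : ℤ) (ha : a = c + m) (h1 : lo ≤ m) (h2 : m ≤ hi) (h3 : lo ≤ m + n) (h4 : m + n ≤ hi)
    (h5 : lo ≤ 0) (h6 : 0 ≤ hi) : sfac p q a n = sfac p q c (m + n) / sfac p q c m := by
  rw [ha, eq_div_iff (sfac_ne_zero h h1 h2 h5 h6), mul_comm, sfac_mul_sfac h h1 h2 h3 h4]

/-- Oddness of `sf`, with the factors taken in reverse order. -/
theorem sfac_reflect (H : Nomes p q) (a : ℂ) (n : ℤ) :
    sfac p q a n = (-1) ^ n * sfac p q (1 - a - n) n := by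
  have hc : ∀ m : ℕ, (-1 : ℂ) ^ m = ∏ _i ∈ Finset.range m, (-1 : ℂ) := fun m => by
    rw [Finset.prod_const, Finset.card_range]
  obtain ⟨m, rfl | rfl⟩ := Int.eq_nat_or_neg n
  · rw [sfac_natCast, sfac_natCast, ← Finset.prod_range_reflect, zpow_natCast, hc,
      ← Finset.prod_mul_distrib]
    refine Finset.prod_congr rfl fun i hi => ?_
    have hi' := Finset.mem_range.1 hi
    rw [neg_one_mul, ← sf_neg H.p_pos H.p_lt H.q_pos]
    congr 1
    rw [Nat.sub_sub]
    push_cast [show 1 + i ≤ m by omega]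
    ring
  · rw [sfac_neg_natCast, sfac_neg_natCast, ← Finset.prod_range_reflect, zpow_neg, zpow_natCast,
      ← mul_inv]
    congr 1
    rw [hc, ← Finset.prod_mul_distrib]
    refine Finset.prod_congr rfl fun i hi => ?_
    have hi' := Finset.mem_range.1 hi
    rw [neg_one_mul, ← sf_neg H.p_pos H.p_lt H.q_pos]
    congr 1
    rw [Nat.sub_sub]
    push_cast [show 1 + i ≤ m by omega]
    ring

/-- Each factor θ(q^{2b}) contributes q^b, and these exponents form an arithmetic progression. The
formula also holds for negative subscripts. -/
theorem ellFac_qp (H : Nomes p q) (a : ℂ) (n : ℤ) :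
    ellFac p q (qp q (2 * a)) n = qp q (n * a + n * (n - 1) / 2) * sfac p q a n := by
  cases n with
  | ofNat n =>
    induction n with
    | zero => simp [ellFac, sfac, qp_zero]
    | succ n ih =>
      simp only [ellFac, sfac, Int.ofNat_eq_natCast] at ih ⊢
      rw [Finset.prod_range_succ, Finset.prod_range_succ, ih, ← qp_add H.q_pos, ← mul_add,
        theta_qp H.q_pos]
      rw [show (((n + 1 : ℕ) : ℤ) : ℂ) * a + (((n + 1 : ℕ) : ℤ) : ℂ) * ((((n + 1 : ℕ) : ℤ) : ℂ) - 1) / 2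
        = ((n : ℤ) * a + (n : ℤ) * ((n : ℤ) - 1) / 2) + (a + n) by push_cast; ring, qp_add H.q_pos _ (a + n)]
      ring
  | negSucc n =>
    have key : ∀ m : ℕ, ∏ i ∈ Finset.range m, theta p (qp q (2 * a) * qp q (-2 * (i + 1))) =
        qp q (m * a - m * (m + 1) / 2) * ∏ i ∈ Finset.range m, sf p q (a - (i + 1)) := by
      intro m
      induction m with
      | zero => simp [qp_zero]
      | succ m ih =>
        rw [Finset.prod_range_succ, Finset.prod_range_succ, ih, ← qp_add H.q_pos,
          show 2 * a + -2 * ((m : ℂ) + 1) = 2 * (a - (m + 1)) by ring, theta_qp H.q_pos,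
          show ((m + 1 : ℕ) : ℂ) * a - ((m + 1 : ℕ) : ℂ) * (((m + 1 : ℕ) : ℂ) + 1) / 2
          = (m * a - m * (m + 1) / 2) + (a - (m + 1)) by push_cast; ring, qp_add H.q_pos _ (a - (m + 1))]
        ring
    simp only [ellFac, sfac]
    rw [key, mul_inv, ← qp_neg]
    congr 2
    push_cast
    ring

theorem prod_sf_sub (a : ℂ) (m : ℕ) :
    ∏ i ∈ Finset.range m, sf p q (a - i) = sfac p q (a - m + 1) m := by
  rw [sfac_natCast, ← Finset.prod_range_reflect]
  refine Finset.prod_congr rfl fun i hi => ?_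
  have hi' := Finset.mem_range.1 hi
  rw [Nat.sub_sub]
  push_cast [show 1 + i ≤ m by omega]
  congr 1
  ring

theorem ellBinom_eq (H : Nomes p q) {k l : ℕ} :
    ellBinom p q k l =
      qp q (l * ((k : ℂ) - l)) * (sfac p q ((k : ℂ) - l + 1) l / sfac p q 1 l) := by
  unfold ellBinom
  rw [sfac_natCast, sfac_natCast, ← Finset.prod_div_distrib]
  rw [← Finset.Ico_add_one_right_eq_Icc, Finset.prod_Ico_eq_prod_range]
  have h : ∀ m : ℕ, qp q (m * ((k : ℂ) - l)) = ∏ _i ∈ Finset.range m, qp q ((k : ℂ) - l) := by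
    intro m
    induction m with
    | zero => simp [qp_zero]
    | succ m ih =>
      rw [Finset.prod_range_succ, ← ih, ← qp_add H.q_pos]
      congr 1
      push_cast
      ring
  rw [h, ← Finset.prod_mul_distrib, Nat.add_sub_cancel]
  refine Finset.prod_congr rfl fun i _ => ?_
  rw [theta_qp H.q_pos, theta_qp H.q_pos]
  push_cast
  rw [show (k : ℂ) - l + (1 + i) = (k - l) + (1 + i) by ring, qp_add H.q_pos,
    show (k : ℂ) - l + (1 + i) = k - l + 1 + i by ring]
  have := qp_ne_zero H.q_pos (1 + (i : ℂ))
  field_simp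

end Factorials

/-! ### Comparison of shifted factorials -/

section Cosets

variable {p q : ℝ}

/-- `f` has no zeros at the points `c + i` with `|i| ≤ B`. -/
def Near (p q : ℝ) (B : ℤ) (c : ℂ) : Prop := ∀ i : ℤ, -B ≤ i → i < B → sf p q (c + i) ≠ 0

theorem Near.eq_div {B : ℤ} {c a : ℂ} (h : Near p q B c) (m n : ℤ) (ha : a = c + m) (h1 : -B ≤ m)
    (h2 : m ≤ B) (h3 : -B ≤ m + n) (h4 : m + n ≤ B) (hB : 0 ≤ B) :
    sfac p q a n = sfac p q c (m + n) / sfac p q c m :=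
  sfac_eq_div h m n ha h1 h2 h3 h4 (by omega) hB

theorem Near.sfac_ne_zero {B : ℤ} {c : ℂ} (h : Near p q B c) {m : ℤ} (h1 : -B ≤ m) (h2 : m ≤ B)
    (hB : 0 ≤ B) : sfac p q c m ≠ 0 := EllU2.sfac_ne_zero h h1 h2 (by omega) hB

variable {M r s N k n B : ℤ}

/-- All arguments lie in l + ℤ. Rewritten with factorials based at l, both sides are the same
monomial. Subscripts such as M - r - s may be negative, so nonvanishing is needed on both sides of
l. -/
theorem coset_dynamical {l : ℂ} (h : Near p q B l) (hM : 0 ≤ M) (hr : 0 ≤ r) (hs : 0 ≤ s)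
    (hN : 0 ≤ N) (hk : 0 ≤ k) (hn : 0 ≤ n) (hB : 4 * (M + r + s + N + k + n) + 10 ≤ B) :
    sfac p q (l - s + 1) n * (sf p q (l + M - 2 * s - r + 1 + 2 * n) / sf p q (l + M - 2 * s - r + 1)) *
      sfac p q (l + M - 2 * s - r + 1) n * sfac p q (l + M - k - s - r + 1) n *
      sfac p q (l - k + 1) (M - r - s) /
      (sfac p q (l + M - 2 * s - r + 2) s * sfac p q (l + M - 2 * s - r + 1) r *
        sfac p q (l - s + 1) (M - r - s) * sfac p q (l + M - s - r + 2) n) =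
    sfac p q (l + M - r - 2 * s + n + 2) n * sfac p q (l + n - s + 2) (s - n) /
      sfac p q (l + M - 2 * s - r + 2 * n + 2) (s - n) *
      (sfac p q (l - k + 1) (M + n - s - r) / (sfac p q (l + n - s + 2) (s - n) *
        sfac p q (l + n - s + 1) (M + n - s - r) * sfac p q (l + M - r - 2 * s + n + 2) n *
        sfac p q (l + M - r - 2 * s + n + 1) (r - n))) := by
  obtain ⟨A, hA⟩ : ∃ A : ℤ, A = M - 2 * s - r + 1 := ⟨_, rfl⟩
  have e : ∀ (a : ℂ) (m t n : ℤ), t = m + n → a = l + m → -B ≤ m → m ≤ B → -B ≤ t → t ≤ B →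
      sfac p q a n = sfac p q l t / sfac p q l m := fun a m t n ht ha h1 h2 h3 h4 =>
    ht ▸ h.eq_div m n ha h1 h2 (ht ▸ h3) (ht ▸ h4) (by omega)
  have G : ∀ m : ℤ, -B ≤ m → m ≤ B → sfac p q l m ≠ 0 := fun m h1 h2 =>
    h.sfac_ne_zero h1 h2 (by omega)
  rw [← sfac_one (l + M - 2 * s - r + 1 + 2 * n), ← sfac_one (l + M - 2 * s - r + 1),
    e (l - s + 1) (1 - s) (1 - s + n) (n) (by omega) (by push_cast; ring) (by omega) (by omega) (by omega) (by omega),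
    e (l + M - 2 * s - r + 1 + 2 * n) (A + 2 * n) (A + 2 * n + 1) (1) (by omega) (by rw [hA]; push_cast; ring) (by omega) (by omega) (by omega)
      (by omega),
    e (l + M - 2 * s - r + 1) (A) (A + 1) (1) (by omega) (by rw [hA]; push_cast; ring) (by omega) (by omega) (by omega)
      (by omega),
    e (l + M - 2 * s - r + 1) (A) (A + n) (n) (by omega) (by rw [hA]; push_cast; ring) (by omega) (by omega) (by omega)
      (by omega),
    e (l + M - k - s - r + 1) (A + s - k) (A + s - k + n) (n) (by omega) (by rw [hA]; push_cast; ring) (by omega) (by omega) (by omega)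
      (by omega),
    e (l - k + 1) (1 - k) (A + s - k) (M - r - s) (by omega) (by push_cast; ring) (by omega) (by omega) (by omega) (by omega),
    e (l + M - 2 * s - r + 2) (A + 1) (A + s + 1) (s) (by omega) (by rw [hA]; push_cast; ring) (by omega) (by omega) (by omega)
      (by omega),
    e (l + M - 2 * s - r + 1) (A) (A + r) (r) (by omega) (by rw [hA]; push_cast; ring) (by omega) (by omega) (by omega)
      (by omega),
    e (l - s + 1) (1 - s) (A) (M - r - s) (by omega) (by push_cast; ring) (by omega) (by omega) (by omega) (by omega),
    e (l + M - s - r + 2) (A + s + 1) (A + s + 1 + n) (n) (by omega) (by rw [hA]; push_cast; ring) (by omega) (by omega) (by omega)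
      (by omega),
    e (l + M - r - 2 * s + n + 2) (A + n + 1) (A + 2 * n + 1) (n) (by omega) (by rw [hA]; push_cast; ring) (by omega) (by omega) (by omega)
      (by omega),
    e (l + n - s + 2) (n - s + 2) (2) (s - n) (by omega) (by push_cast; ring) (by omega) (by omega) (by omega) (by omega),
    e (l + M - 2 * s - r + 2 * n + 2) (A + 2 * n + 1) (A + s + 1 + n) (s - n) (by omega) (by rw [hA]; push_cast; ring) (by omega) (by omega) (by omega)
      (by omega),
    e (l - k + 1) (1 - k) (A + s - k + n) (M + n - s - r) (by omega) (by push_cast; ring) (by omega) (by omega) (by omega) (by omega),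
    e (l + n - s + 1) (1 - s + n) (A + 2 * n) (M + n - s - r) (by omega) (by push_cast; ring) (by omega) (by omega) (by omega) (by omega),
    e (l + M - r - 2 * s + n + 1) (A + n) (A + r) (r - n) (by omega) (by rw [hA]; push_cast; ring) (by omega) (by omega) (by omega)
      (by omega)]
  have := G (1 - s) (by omega) (by omega)
  have := G (1 - s + n) (by omega) (by omega)
  have := G (A + 2 * n) (by omega) (by omega)
  have := G (A + 2 * n + 1) (by omega) (by omega)
  have := G (A) (by omega) (by omega)
  have := G (A + 1) (by omega) (by omega)
  have := G (A + n) (by omega) (by omega)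
  have := G (A + s - k) (by omega) (by omega)
  have := G (A + s - k + n) (by omega) (by omega)
  have := G (1 - k) (by omega) (by omega)
  have := G (A + s + 1) (by omega) (by omega)
  have := G (A + r) (by omega) (by omega)
  have := G (A + s + 1 + n) (by omega) (by omega)
  have := G (A + n + 1) (by omega) (by omega)
  have := G (n - s + 2) (by omega) (by omega)
  have := G (2) (by omega) (by omega)
  field_simp

/-- The same comparison for arguments in u + ℤ. -/
theorem coset_spectral {u : ℂ} (h : Near p q B u) (hM : 0 ≤ M) (hr : 0 ≤ r) (hs : 0 ≤ s)
    (hN : 0 ≤ N) (hk : 0 ≤ k) (hn : 0 ≤ n) (hB : 4 * (M + r + s + N + k + n) + 10 ≤ B) :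
    sfac p q (u + s - k + 1) (M - r - s) * sfac p q (u + s - k - n + 1) n /
      (sfac p q (u + M - r - s + 1) s * sfac p q (u + M - r + 1) r *
        sfac p q (u + 1) (M - r - s)) =
    sfac p q (u + s - k - n + 1) (M + n - s - r) / (sfac p q (u + M - r - s + n + 1) (s - n) *
      sfac p q (u + 1) (M + n - s - r) * sfac p q (u + M - n + 1) n *
      sfac p q (u + M - r + 1) (r - n)) := by
  obtain ⟨D, hD⟩ : ∃ D : ℤ, D = M - r - s := ⟨_, rfl⟩
  have e : ∀ (a : ℂ) (m t n : ℤ), t = m + n → a = u + m → -B ≤ m → m ≤ B → -B ≤ t → t ≤ B →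
      sfac p q a n = sfac p q u t / sfac p q u m := fun a m t n ht ha h1 h2 h3 h4 =>
    ht ▸ h.eq_div m n ha h1 h2 (ht ▸ h3) (ht ▸ h4) (by omega)
  have G : ∀ m : ℤ, -B ≤ m → m ≤ B → sfac p q u m ≠ 0 := fun m h1 h2 =>
    h.sfac_ne_zero h1 h2 (by omega)
  rw [e (u + s - k + 1) (s - k + 1) (s - k + 1 + D) (M - r - s) (by omega) (by push_cast; ring) (by omega) (by omega) (by omega) (by omega),
    e (u + s - k - n + 1) (s - k + 1 - n) (s - k + 1) (n) (by omega) (by push_cast; ring) (by omega) (by omega) (by omega) (by omega),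
    e (u + M - r - s + 1) (D + 1) (M - r + 1) (s) (by omega) (by rw [hD]; push_cast; ring) (by omega) (by omega) (by omega)
      (by omega),
    e (u + M - r + 1) (M - r + 1) (M + 1) (r) (by omega) (by push_cast; ring) (by omega) (by omega) (by omega) (by omega),
    e (u + 1) (1) (D + 1) (M - r - s) (by omega) (by push_cast; ring) (by omega) (by omega) (by omega) (by omega),
    e (u + s - k - n + 1) (s - k + 1 - n) (s - k + 1 + D) (M + n - s - r) (by omega) (by push_cast; ring) (by omega) (by omega) (by omega) (by omega),
    e (u + M - r - s + n + 1) (D + n + 1) (M - r + 1) (s - n) (by omega) (by rw [hD]; push_cast; ring) (by omega) (by omega) (by omega)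
      (by omega),
    e (u + 1) (1) (D + n + 1) (M + n - s - r) (by omega) (by push_cast; ring) (by omega) (by omega) (by omega) (by omega),
    e (u + M - n + 1) (M - n + 1) (M + 1) (n) (by omega) (by push_cast; ring) (by omega) (by omega) (by omega) (by omega),
    e (u + M - r + 1) (M - r + 1) (M - n + 1) (r - n) (by omega) (by push_cast; ring) (by omega) (by omega) (by omega) (by omega)]
  have := G (s - k + 1) (by omega) (by omega)
  have := G (s - k + 1 + D) (by omega) (by omega)
  have := G (s - k + 1 - n) (by omega) (by omega)
  have := G (D + 1) (by omega) (by omega)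
  have := G (M - r + 1) (by omega) (by omega)
  have := G (M + 1) (by omega) (by omega)
  have := G (1) (by omega) (by omega)
  have := G (D + n + 1) (by omega) (by omega)
  have := G (M - n + 1) (by omega) (by omega)
  field_simp

theorem sfac_div_sfac {a : ℂ} {n t : ℤ} (h : ∀ i : ℤ, 0 ≤ i → i < t → sf p q (a + i) ≠ 0)
    (hn : 0 ≤ n) (ht : n ≤ t) : sfac p q a t / sfac p q a n = sfac p q (a + n) (t - n) := by
  rw [sfac_eq_div h n (t - n) rfl hn ht (by omega) (by omega) le_rfl (by omega),
    add_sub_cancel]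

theorem sf_int_ne_zero (H : Nomes p q) {a : ℂ} {m : ℤ} (ha : a = m) (hm : 0 < m) :
    sf p q a ≠ 0 := by
  rw [ha]
  exact sf_intCast_ne_zero H.p_pos H.p_lt H.q_pos H.generic hm.ne'

/-- At integer arguments theta factors can vanish, so only factorials of positive arguments are
cancelled. The condition on N - k + s - r says j ≤ N when s + j = r + k. The factors that may
vanish, those starting at M - r - s + 1 + n and k - s + 1 + n, are left untouched by the comparison.
-/
theorem coset_int (H : Nomes p q) (hn : 0 ≤ n) (hr : n ≤ r) (hs : n ≤ s) (hN : 0 ≤ N - k + s - r) :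
    sfac p q (N - k + s - r + 1) r * sfac p q (-r) n * sfac p q (-s) n /
      (sfac p q 1 s * sfac p q (-s - N + k) n) =
    (-1) ^ n * (sfac p q (r - n + 1) n / sfac p q 1 (s - n) *
      sfac p q (N - k + s - r + 1) (r - n)) := by
  have h1 : ∀ i : ℤ, 0 ≤ i → i < s → sf p q (1 + i) ≠ 0 := fun i hi _ =>
    sf_int_ne_zero H (m := 1 + i) (by push_cast; ring) (by omega)
  have h2 : ∀ i : ℤ, 0 ≤ i → i < r → sf p q ((N - k + s - r + 1 : ℂ) + i) ≠ 0 := fun i hi _ =>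
    sf_int_ne_zero H (m := N - k + s - r + 1 + i) (by push_cast; ring) (by omega)
  have e1 := sfac_div_sfac h1 (n := s - n) (by omega) (by omega)
  have e2 := sfac_div_sfac h2 (n := r - n) (by omega) (by omega)
  have n1 := sfac_ne_zero h1 (m := s - n) (by omega) (by omega) le_rfl (by omega)
  have n2 := sfac_ne_zero h1 (m := s) (by omega) (by omega) le_rfl (by omega)
  have n3 := sfac_ne_zero h2 (m := r - n) (by omega) (by omega) le_rfl (by omega)
  have n4 := sfac_ne_zero h2 (m := r) (by omega) (by omega) le_rfl (by omega)
  rw [sub_sub_cancel] at e1 e2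
  rw [sfac_reflect H (-r) n, sfac_reflect H (-s) n, sfac_reflect H (-s - N + k) n,
    show (1 - -(r : ℂ) - n) = r - n + 1 by ring,
    show (1 - -(s : ℂ) - n) = 1 + (s - n : ℤ) by push_cast; ring,
    show (1 - (-(s : ℂ) - N + k) - n) = N - k + s - r + 1 + (r - n : ℤ) by push_cast; ring,
    ← e1, ← e2]
  have h3 : ((-1 : ℂ) ^ n) ≠ 0 := zpow_ne_zero _ (by norm_num)
  field_simp

end Cosets

/-! ### The terms of the series -/

section Terms

variable {p q : ℝ}

/-- In this lemma and the next three the letters of the name give the row and column index. The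
arguments are passed as equations so that each can be used in the form in which it occurs in the
final product. -/
theorem wordVal_ft (n u : ℂ) (e : ℤ) (m : ℕ) (k : ℤ) (l : ℂ) {a b c d : ℂ} (ha : a = k - m + 1)
    (hb : b = l + u + e - k + 2 - m + 1) (hc : c = u + e + 1 - m + 1) (hd : d = l + 1 - m + 1) :
    wordVal p q n u (descList false true e m) k l =
      sfac p q a m * sfac p q b m / (sfac p q c m * sfac p q d m) := by
  rw [ha, hb, hc, hd, wordVal_descList, ← prod_sf_sub, ← prod_sf_sub, ← prod_sf_sub, ← prod_sf_sub,
    ← Finset.prod_mul_distrib, ← Finset.prod_mul_distrib, ← Finset.prod_div_distrib]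
  refine Finset.prod_congr rfl fun i _ => ?_
  simp only [letterVal, bit, wt]
  push_cast
  ring_nf

theorem wordVal_ff (n u : ℂ) (e : ℤ) (m : ℕ) (k : ℤ) (l : ℂ) {a b c d : ℂ}
    (ha : a = u + e - k + 1 - m + 1) (hb : b = l - k + 1) (hc : c = u + e + 1 - m + 1)
    (hd : d = l + 1) :
    wordVal p q n u (descList false false e m) k l =
      sfac p q a m * sfac p q b m / (sfac p q c m * sfac p q d m) := by
  rw [ha, hb, hc, hd, wordVal_descList, ← prod_sf_sub, ← prod_sf_sub, sfac_natCast, sfac_natCast,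
    ← Finset.prod_mul_distrib, ← Finset.prod_mul_distrib, ← Finset.prod_div_distrib]
  refine Finset.prod_congr rfl fun i _ => ?_
  simp only [letterVal, bit, wt]
  push_cast
  ring_nf

theorem wordVal_tt (n u : ℂ) (e : ℤ) (m : ℕ) (k : ℤ) (l : ℂ) {a b c d : ℂ}
    (ha : a = u + e - n + k + 1 - m + 1) (hb : b = l + n - k + 1 - m + 1)
    (hc : c = u + e + 1 - m + 1) (hd : d = l + 1 - m + 1) :
    wordVal p q n u (descList true true e m) k l =
      sfac p q a m * sfac p q b m / (sfac p q c m * sfac p q d m) := by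
  rw [ha, hb, hc, hd, wordVal_descList, ← prod_sf_sub, ← prod_sf_sub, ← prod_sf_sub, ← prod_sf_sub,
    ← Finset.prod_mul_distrib, ← Finset.prod_mul_distrib, ← Finset.prod_div_distrib]
  refine Finset.prod_congr rfl fun i _ => ?_
  simp only [letterVal, bit, wt]
  push_cast
  ring_nf

theorem wordVal_tf (n u : ℂ) (e : ℤ) (m : ℕ) (k : ℤ) (l : ℂ) {a b c d : ℂ}
    (ha : a = n - k - m + 1) (hb : b = l + n - k - u - e) (hc : c = u + e + 1 - m + 1)
    (hd : d = l + 1) :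
    wordVal p q n u (descList true false e m) k l =
      sfac p q a m * sfac p q b m / (sfac p q c m * sfac p q d m) := by
  rw [ha, hb, hc, hd, wordVal_descList, ← prod_sf_sub, ← prod_sf_sub, sfac_natCast, sfac_natCast,
    ← Finset.prod_mul_distrib, ← Finset.prod_mul_distrib, ← Finset.prod_div_distrib]
  refine Finset.prod_congr rfl fun i _ => ?_
  simp only [letterVal, bit, wt]
  push_cast
  ring_nf

/-- The four factors come from the blocks γ, δ, α, β in this order; each is evaluated at the count
and dynamical variable left by its predecessors. -/
theorem wordVal_termList {M r s n : ℕ} (h1 : n ≤ r) (h2 : n ≤ s) (h3 : r + s ≤ M + n) (N k : ℕ)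
    (u l : ℂ) :
    wordVal p q N u (termList M r s n) k l =
      sfac p q (k - s + 1 + n) (s - n) * sfac p q (l + u + M - s - k - r + 2 + n) (s - n) /
        (sfac p q (u + M - r - s + n + 1) (s - n) * sfac p q (l + n - s + 2) (s - n)) *
      (sfac p q (u + s - k - n + 1) (M + n - s - r) * sfac p q (l - k + 1) (M + n - s - r) /
        (sfac p q (u + 1) (M + n - s - r) * sfac p q (l + n - s + 1) (M + n - s - r))) *
      (sfac p q (u + M - N + k - s + 1) n * sfac p q (l + M + N - k - s - r + 2) n /
        (sfac p q (u + M - n + 1) n * sfac p q (l + M - r - 2 * s + n + 2) n)) *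
      (sfac p q (N - k + s - r + 1) (r - n) * sfac p q (l - u + N - k - s - r + 1 + n) (r - n) /
        (sfac p q (u + M - r + 1) (r - n) * sfac p q (l + M - r - 2 * s + n + 1) (r - n))) := by
  rw [termList, wordVal_append, wordVal_append, wordVal_append]
  simp only [netShift_append, netShift_descList, colWt_append, colWt_descList, bit, wt]
  have e1 : ((s - n : ℕ) : ℂ) = s - n := by push_cast [h2]; ring
  have e2 : ((r - n : ℕ) : ℂ) = r - n := by push_cast [h1]; ring
  have e3 : ((M + n - s - r : ℕ) : ℂ) = M + n - s - r := by
    push_cast [show s ≤ M + n by omega, show r ≤ M + n - s by omega]; ring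
  have i1 : ((s - n : ℕ) : ℤ) = s - n := by omega
  have i2 : ((r - n : ℕ) : ℤ) = r - n := by omega
  have i3 : ((M + n - s - r : ℕ) : ℤ) = M + n - s - r := by omega
  rw [wordVal_ft (a := k - s + 1 + n) (b := l + u + M - s - k - r + 2 + n)
      (c := u + M - r - s + n + 1) (d := l + n - s + 2) (ha := by rw [e1]; push_cast; ring)
      (hb := by rw [e1]; push_cast; ring) (hc := by rw [e1]; push_cast; ring)
      (hd := by rw [e1]; ring),
    wordVal_ff (a := u + s - k - n + 1) (b := l - k + 1) (c := u + 1) (d := l + n - s + 1)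
      (ha := by rw [e3, i1]; push_cast; ring) (hb := by rw [i1]; push_cast; ring)
      (hc := by rw [e3]; push_cast; ring) (hd := by rw [i1]; push_cast; ring),
    wordVal_tt (a := u + M - N + k - s + 1) (b := l + M + N - k - s - r + 2) (c := u + M - n + 1)
      (d := l + M - r - 2 * s + n + 2) (ha := by rw [i1, i3]; push_cast; ring)
      (hb := by rw [i1, i3]; push_cast; ring) (hc := by push_cast; ring)
      (hd := by rw [i1, i3]; push_cast; ring),
    wordVal_tf (a := N - k + s - r + 1) (b := l - u + N - k - s - r + 1 + n) (c := u + M - r + 1)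
      (d := l + M - r - 2 * s + n + 1) (ha := by rw [e2, i1, i3]; push_cast; ring)
      (hb := by rw [i1, i3]; push_cast; ring) (hc := by rw [e2]; push_cast; ring)
      (hd := by rw [i1, i3]; push_cast; ring), i1, i2, i3]

/-- The power of `q` in a shifted factorial. -/
def qe (q : ℝ) (a : ℂ) (n : ℤ) : ℂ := qp q (n * a + n * (n - 1) / 2)

theorem ellFac_eq (H : Nomes p q) {y : ℂ} (a : ℂ) (n : ℤ) (hy : y = qp q (2 * a)) :
    ellFac p q y n = qe q a n * sfac p q a n := by
  rw [hy, ellFac_qp H, qe]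

theorem constReg_eq (H : Nomes p q) (M r s N k : ℕ) (u l : ℂ) :
    constReg p q M r s N k (qp q (2 * u)) l =
      qp q (((M : ℂ) - r - s) * (2 * (l - s + 1) + ((M : ℂ) - r - s - 1))) *
      (qe q (l + u + M - s - k - r + 2) s /
        (qe q 1 s * qe q (l + M - 2 * s - r + 2) s * qe q (u + M - r - s + 1) s) *
      (qe q (N - k + s - r + 1) r * qe q (-l + u - N + k + s) r /
        (qe q (-(l + M - 2 * s)) r * qe q (u + M - r + 1) r)) *
      (qe q (k + s + r - l - M) (M - r - s) * qe q (u + s - k + 1) (M - r - s) /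
        (qe q (l - s + 1) (M - r - s) * qe q (u + 1) (M - r - s)))) *
      ((-1) ^ ((M : ℤ) - r - s) * (sfac p q (l + u + M - s - k - r + 2) s /
        (sfac p q 1 s * sfac p q (l + M - 2 * s - r + 2) s * sfac p q (u + M - r - s + 1) s) *
      (sfac p q (N - k + s - r + 1) r * sfac p q (-l + u - N + k + s) r /
        (sfac p q (-(l + M - 2 * s)) r * sfac p q (u + M - r + 1) r)) *
      (sfac p q (k + s + r - l - M) (M - r - s) * sfac p q (u + s - k + 1) (M - r - s) /
        (sfac p q (l - s + 1) (M - r - s) * sfac p q (u + 1) (M - r - s))))) := by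
  simp only [constReg, ellFacs, List.map_cons, List.map_nil, List.prod_cons, List.prod_nil, mul_one]
  rw [ellFac_eq H (l + u + M - s - k - r + 2) s (by rw [← qp_add H.q_pos]; ring_nf),
    ellFac_eq H 1 s (by rw [mul_one]),
    ellFac_eq H (l + M - 2 * s - r + 2) s rfl,
    ellFac_eq H (u + M - r - s + 1) s (by rw [← qp_add H.q_pos]; ring_nf),
    ellFac_eq H (N - k + s - r + 1) r rfl,
    ellFac_eq H (-l + u - N + k + s) r (by rw [← qp_add H.q_pos]; ring_nf),
    ellFac_eq H (-(l + M - 2 * s)) r (by ring_nf),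
    ellFac_eq H (u + M - r + 1) r (by rw [← qp_add H.q_pos]; ring_nf),
    ellFac_eq H (k + s + r - l - M) (M - r - s) rfl,
    ellFac_eq H (u + s - k + 1) (M - r - s) (by rw [← qp_add H.q_pos]; ring_nf),
    ellFac_eq H (l - s + 1) (M - r - s) rfl,
    ellFac_eq H (u + 1) (M - r - s) (by rw [← qp_add H.q_pos]; ring_nf)]
  generalize (-1 : ℂ) ^ ((M : ℤ) - r - s) = σ
  ring

theorem tCoeff_eq_sfac (H : Nomes p q) {M r s n : ℕ} (hr : r ≤ M) (h2 : n ≤ s) (l : ℂ) :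
    tCoeff p q M r s n l =
      qp q (n * ((r : ℂ) - n)) * qp q (((s : ℂ) - n) * ((M : ℂ) - r - (s - n))) *
      (qe q (l + M - r - 2 * s + n + 2) n / qe q (l + M - 2 * s + 2) n *
        (qe q (l + n - s + 2) (s - n) / qe q (l + M - 2 * s - r + 2 * n + 2) (s - n))) *
      (sfac p q (r - n + 1) n / sfac p q 1 n *
        (sfac p q (M - r - s + 1 + n) (s - n) / sfac p q 1 (s - n)) *
      (sfac p q (l + M - r - 2 * s + n + 2) n / sfac p q (l + M - 2 * s + 2) n *
        (sfac p q (l + n - s + 2) (s - n) /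
          sfac p q (l + M - 2 * s - r + 2 * n + 2) (s - n)))) := by
  have i1 : ((s - n : ℕ) : ℤ) = s - n := by omega
  have e1 : ((s - n : ℕ) : ℂ) = s - n := by push_cast [h2]; ring
  have e2 : ((M - r : ℕ) : ℂ) = M - r := by push_cast [hr]; ring
  rw [tCoeff, ellBinom_eq H, ellBinom_eq H, i1, e1, e2,
    show (M : ℂ) - r - (s - n) + 1 = M - r - s + 1 + n by ring,
    ellFac_eq H (l + M - r - 2 * s + n + 2) n rfl, ellFac_eq H (l + M - 2 * s + 2) n rfl,
    ellFac_eq H (l + n - s + 2) (s - n) rfl,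
    ellFac_eq H (l + M - 2 * s - r + 2 * n + 2) (s - n) (by ring_nf)]
  ring

end Terms

/-! ### Separation of the powers of q from the odd theta factors in the series. -/

section Terms

variable {p q : ℝ}

theorem qp_sub (hq : 0 < q) (a b : ℂ) : qp q (a - b) = qp q a / qp q b := by
  rw [sub_eq_add_neg, qp_add hq, qp_neg, div_eq_mul_inv]

theorem ellVTerm_eq (H : Nomes p q) (M r s N k n : ℕ) (u l : ℂ) :
    ellVTerm p q (vBase q M r s l)
      [qp q (-2 * r), qp q (-2 * s), qp q (2 * (l + M + N - k - s - r + 2)),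
        qp q (2 * ((k : ℂ) - s)) * (qp q (2 * u))⁻¹,
        qp q (2 * ((M : ℂ) - N + k - s + 1)) * qp q (2 * u)] n =
      qp q (l + M - 2 * s - r + 1 + 2 * n) / qp q (l + M - 2 * s - r + 1) * (qp q (2 * n) *
        (qe q (l + M - 2 * s - r + 1) n * qe q (-r) n * qe q (-s) n *
          qe q (l + M + N - k - s - r + 2) n * qe q (k - s - u) n *
          qe q (u + M - N + k - s + 1) n) /
        (qe q 1 n * qe q (l + M - 2 * s + 2) n * qe q (l + M - s - r + 2) n *
          qe q (-s - N + k) n * qe q (l + u + M - s - k - r + 2) n *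
          qe q (l - u + N - k - s - r + 1) n)) *
      (sf p q (l + M - 2 * s - r + 1 + 2 * n) / sf p q (l + M - 2 * s - r + 1) *
        ((sfac p q (l + M - 2 * s - r + 1) n * sfac p q (-r) n * sfac p q (-s) n *
          sfac p q (l + M + N - k - s - r + 2) n * sfac p q (k - s - u) n *
          sfac p q (u + M - N + k - s + 1) n) /
        (sfac p q 1 n * sfac p q (l + M - 2 * s + 2) n * sfac p q (l + M - s - r + 2) n *
          sfac p q (-s - N + k) n * sfac p q (l + u + M - s - k - r + 2) n *
          sfac p q (l - u + N - k - s - r + 1) n))) := by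
  have hq := H.q_pos
  simp only [ellVTerm, vBase, ellFacs, List.map_cons, List.map_nil, List.prod_cons, List.prod_nil,
    mul_one, ← qp_neg, ← qp_add hq, ← qp_sub hq]
  rw [show 2 * (l + M - 2 * s - r + 1) + 4 * (n : ℂ) = 2 * (l + M - 2 * s - r + 1 + 2 * n) by ring,
    theta_qp hq, theta_qp hq,
    ellFac_eq H (l + M - 2 * s - r + 1) n rfl, ellFac_eq H (-r) n (by ring_nf),
    ellFac_eq H (-s) n (by ring_nf), ellFac_eq H (l + M + N - k - s - r + 2) n rfl,
    ellFac_eq H (k - s - u) n (by ring_nf), ellFac_eq H (u + M - N + k - s + 1) n (by ring_nf),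
    ellFac_eq H 1 n (by rw [mul_one]), ellFac_eq H (l + M - 2 * s + 2) n (by ring_nf),
    ellFac_eq H (l + M - s - r + 2) n (by ring_nf), ellFac_eq H (-s - N + k) n (by ring_nf),
    ellFac_eq H (l + u + M - s - k - r + 2) n (by ring_nf),
    ellFac_eq H (l - u + N - k - s - r + 1) n (by ring_nf)]
  rw [qp_sub hq]
  ring

/-- All factors are powers of q, so this is an identity between exponents, polynomial in the
parameters. -/
theorem qe_identity (H : Nomes p q) (M r s N k n : ℤ) (u l : ℂ) :
    qp q (((M : ℂ) - r - s) * (2 * (l - s + 1) + ((M : ℂ) - r - s - 1))) *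
      (qe q (l + u + M - s - k - r + 2) s /
        (qe q 1 s * qe q (l + M - 2 * s - r + 2) s * qe q (u + M - r - s + 1) s) *
      (qe q (N - k + s - r + 1) r * qe q (-l + u - N + k + s) r /
        (qe q (-(l + M - 2 * s)) r * qe q (u + M - r + 1) r)) *
      (qe q (k + s + r - l - M) (M - r - s) * qe q (u + s - k + 1) (M - r - s) /
        (qe q (l - s + 1) (M - r - s) * qe q (u + 1) (M - r - s)))) *
      (qe q (M - r - s + 1 + n) (s - n) * qe q (k - s + 1 + n) (s - n) *
        (qe q (l - s + 1) n * qe q (l + M - k - s - r + 1) n)) *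
      (qp q (l + M - 2 * s - r + 1 + 2 * n) / qp q (l + M - 2 * s - r + 1) * (qp q (2 * n) *
        (qe q (l + M - 2 * s - r + 1) n * qe q (-r) n * qe q (-s) n *
          qe q (l + M + N - k - s - r + 2) n * qe q (k - s - u) n *
          qe q (u + M - N + k - s + 1) n) /
        (qe q 1 n * qe q (l + M - 2 * s + 2) n * qe q (l + M - s - r + 2) n *
          qe q (-s - N + k) n * qe q (l + u + M - s - k - r + 2) n *
          qe q (l - u + N - k - s - r + 1) n))) =
      qp q (n * ((r : ℂ) - n)) * qp q (((s : ℂ) - n) * ((M : ℂ) - r - (s - n))) *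
      (qe q (l + M - r - 2 * s + n + 2) n / qe q (l + M - 2 * s + 2) n *
        (qe q (l + n - s + 2) (s - n) / qe q (l + M - 2 * s - r + 2 * n + 2) (s - n))) := by
  simp only [qe, ← qp_add H.q_pos, ← qp_sub H.q_pos]
  congr 1
  push_cast
  ring

end Terms

/-! ### Term-by-term comparison of the sum with the series. -/

section Terms

variable {p q : ℝ}

/-- After reflecting the factorials with negated arguments, the factors sort into the cosets of 0,
u, l, l + u and l - u, each handled by its own lemma. The signs cancel in pairs, and factors common
to both sides are never divided out. -/
theorem sfac_identity (H : Nomes p q) {M r s N k n : ℕ} {B : ℤ} (h1 : n ≤ r) (h2 : n ≤ s)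
    (hN : r + k ≤ N + s)
    {u l : ℂ} (hl : Near p q B l) (hu : Near p q B u) (hp : Near p q B (l + u))
    (hm : Near p q B (l - u)) (hB : 4 * ((M : ℤ) + r + s + N + k + n) + 10 ≤ B) :
    (-1) ^ ((M : ℤ) - r - s) * (sfac p q (l + u + M - s - k - r + 2) s /
        (sfac p q 1 s * sfac p q (l + M - 2 * s - r + 2) s * sfac p q (u + M - r - s + 1) s) *
      (sfac p q (N - k + s - r + 1) r * sfac p q (-l + u - N + k + s) r /
        (sfac p q (-(l + M - 2 * s)) r * sfac p q (u + M - r + 1) r)) *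
      (sfac p q (k + s + r - l - M) (M - r - s) * sfac p q (u + s - k + 1) (M - r - s) /
        (sfac p q (l - s + 1) (M - r - s) * sfac p q (u + 1) (M - r - s)))) *
      (sfac p q (M - r - s + 1 + n) (s - n) * sfac p q (k - s + 1 + n) (s - n) *
        (sfac p q (l - s + 1) n * sfac p q (l + M - k - s - r + 1) n)) *
      (sf p q (l + M - 2 * s - r + 1 + 2 * n) / sf p q (l + M - 2 * s - r + 1) *
        ((sfac p q (l + M - 2 * s - r + 1) n * sfac p q (-r) n * sfac p q (-s) n *
          sfac p q (l + M + N - k - s - r + 2) n * sfac p q (k - s - u) n *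
          sfac p q (u + M - N + k - s + 1) n) /
        (sfac p q 1 n * sfac p q (l + M - 2 * s + 2) n * sfac p q (l + M - s - r + 2) n *
          sfac p q (-s - N + k) n * sfac p q (l + u + M - s - k - r + 2) n *
          sfac p q (l - u + N - k - s - r + 1) n))) =
    (sfac p q (r - n + 1) n / sfac p q 1 n *
        (sfac p q (M - r - s + 1 + n) (s - n) / sfac p q 1 (s - n)) *
      (sfac p q (l + M - r - 2 * s + n + 2) n / sfac p q (l + M - 2 * s + 2) n *
        (sfac p q (l + n - s + 2) (s - n) /
          sfac p q (l + M - 2 * s - r + 2 * n + 2) (s - n)))) *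
      (sfac p q (k - s + 1 + n) (s - n) * sfac p q (l + u + M - s - k - r + 2 + n) (s - n) /
        (sfac p q (u + M - r - s + n + 1) (s - n) * sfac p q (l + n - s + 2) (s - n)) *
      (sfac p q (u + s - k - n + 1) (M + n - s - r) * sfac p q (l - k + 1) (M + n - s - r) /
        (sfac p q (u + 1) (M + n - s - r) * sfac p q (l + n - s + 1) (M + n - s - r))) *
      (sfac p q (u + M - N + k - s + 1) n * sfac p q (l + M + N - k - s - r + 2) n /
        (sfac p q (u + M - n + 1) n * sfac p q (l + M - r - 2 * s + n + 2) n)) *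
      (sfac p q (N - k + s - r + 1) (r - n) * sfac p q (l - u + N - k - s - r + 1 + n) (r - n) /
        (sfac p q (u + M - r + 1) (r - n) * sfac p q (l + M - r - 2 * s + n + 1) (r - n)))) := by
  have eI := coset_int H (N := N) (k := k) (r := r) (s := s) (n := n) (by omega) (by omega)
    (by omega) (by omega)
  have eU := coset_spectral hu (M := M) (N := N) (k := k) (r := r) (s := s) (n := n) (by omega)
    (by omega) (by omega) (by omega) (by omega) (by omega) hB
  have eL := coset_dynamical hl (M := M) (N := N) (k := k) (r := r) (s := s) (n := n) (by omega)
    (by omega) (by omega) (by omega) (by omega) (by omega) hB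
  have eP := sfac_div_sfac (p := p) (q := q) (a := l + u + M - s - k - r + 2) (n := n) (t := s)
    (fun i hi hi' => by
      have := hp (M - s - k - r + 2 + i) (by omega) (by omega)
      push_cast at this
      rwa [show l + u + (M : ℂ) - s - k - r + 2 + i = l + u + (M - s - k - r + 2 + i) by ring])
    (by omega) (by omega)
  have eM := sfac_div_sfac (p := p) (q := q) (a := l - u + N - k - s - r + 1) (n := n) (t := r)
    (fun i hi hi' => by
      have := hm (N - k - s - r + 1 + i) (by omega) (by omega)
      push_cast at this
      rwa [show l - u + (N : ℂ) - k - s - r + 1 + i = l - u + (N - k - s - r + 1 + i) by ring])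
    (by omega) (by omega)
  simp only [Int.cast_natCast] at eI eU eL eP eM
  rw [sfac_reflect H (-l + u - N + k + s) r, sfac_reflect H (-(l + M - 2 * s)) r,
    sfac_reflect H (k + s + r - l - M) (M - r - s), sfac_reflect H (k - s - u) n]
  simp only [Int.cast_natCast, Int.cast_sub]
  rw [show 1 - (-l + u - (N : ℂ) + k + s) - r = l - u + N - k - s - r + 1 by ring,
    show 1 - -(l + (M : ℂ) - 2 * s) - r = l + M - 2 * s - r + 1 by ring,
    show 1 - ((k : ℂ) + s + r - l - M) - (M - r - s) = l - k + 1 by ring,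
    show 1 - ((k : ℂ) - s - u) - n = u + s - k - n + 1 by ring]
  have hσ : (-1 : ℂ) ^ ((M : ℤ) - r - s) * (-1 : ℂ) ^ ((M : ℤ) - r - s) = 1 := by
    rw [← mul_zpow]; norm_num
  have hν : (-1 : ℂ) ^ (n : ℤ) * (-1 : ℂ) ^ (n : ℤ) = 1 := by
    rw [← mul_zpow]; norm_num
  have hρ : (-1 : ℂ) ^ (r : ℤ) * ((-1 : ℂ) ^ (r : ℤ))⁻¹ = 1 :=
    mul_inv_cancel₀ (zpow_ne_zero _ (by norm_num))
  generalize (-1 : ℂ) ^ ((M : ℤ) - r - s) = σ at *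
  generalize (-1 : ℂ) ^ (n : ℤ) = ν at *
  generalize (-1 : ℂ) ^ (r : ℤ) = ρ at *
  -- Grouping in the order: signs, integers, u, l, l + u, l - u, and the factors that already agree.
  calc _ = (σ * σ) * (ρ * ρ⁻¹) *
      (ν * (sfac p q (N - k + s - r + 1) r * sfac p q (-r) n * sfac p q (-s) n /
        (sfac p q 1 s * sfac p q (-s - N + k) n))) *
      (sfac p q (u + s - k + 1) (M - r - s) * sfac p q (u + s - k - n + 1) n /
        (sfac p q (u + M - r - s + 1) s * sfac p q (u + M - r + 1) r *
          sfac p q (u + 1) (M - r - s))) *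
      (sfac p q (l - s + 1) n *
        (sf p q (l + M - 2 * s - r + 1 + 2 * n) / sf p q (l + M - 2 * s - r + 1)) *
        sfac p q (l + M - 2 * s - r + 1) n * sfac p q (l + M - k - s - r + 1) n *
        sfac p q (l - k + 1) (M - r - s) /
        (sfac p q (l + M - 2 * s - r + 2) s * sfac p q (l + M - 2 * s - r + 1) r *
          sfac p q (l - s + 1) (M - r - s) * sfac p q (l + M - s - r + 2) n)) *
      (sfac p q (l + u + M - s - k - r + 2) s / sfac p q (l + u + M - s - k - r + 2) n) *
      (sfac p q (l - u + N - k - s - r + 1) r / sfac p q (l - u + N - k - s - r + 1) n) *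
      (sfac p q (M - r - s + 1 + n) (s - n) * sfac p q (k - s + 1 + n) (s - n) *
        sfac p q (l + M + N - k - s - r + 2) n * sfac p q (u + M - N + k - s + 1) n /
        (sfac p q 1 n * sfac p q (l + M - 2 * s + 2) n)) := by
          ring
    _ = _ := by
          rw [hσ, hρ, eI, ← mul_assoc ν ν, hν, eU, eL, eP, eM]
          ring

theorem term_identity (H : Nomes p q) {M r s N k n : ℕ} {B : ℤ} (hr : r ≤ M) (h1 : n ≤ r)
    (h2 : n ≤ s) (h3 : r + s ≤ M + n) (hN : r + k ≤ N + s)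
    {u l : ℂ} (hl : Near p q B l) (hu : Near p q B u) (hp : Near p q B (l + u))
    (hm : Near p q B (l - u)) (hB : 4 * ((M : ℤ) + r + s + N + k + n) + 10 ≤ B) :
    constReg p q M r s N k (qp q (2 * u)) l *
      (ellFacs p q [qp q (2 * ((M : ℂ) - r - s + 1 + n)), qp q (2 * ((k : ℂ) - s + 1 + n))]
          ((s : ℤ) - n) *
        (ellFacs p q [qp q (2 * (l - s + 1)), qp q (2 * (l + M - k - s - r + 1))] n *
          ellVTerm p q (vBase q M r s l)
            [qp q (-2 * r), qp q (-2 * s), qp q (2 * (l + M + N - k - s - r + 2)),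
              qp q (2 * ((k : ℂ) - s)) * (qp q (2 * u))⁻¹,
              qp q (2 * ((M : ℂ) - N + k - s + 1)) * qp q (2 * u)] n)) =
      tCoeff p q M r s n l * wordVal p q N u (termList M r s n) k l := by
  have hQ := qe_identity H (M : ℤ) r s N k n u l
  simp only [Int.cast_natCast] at hQ
  have hS := sfac_identity H (M := M) h1 h2 hN hl hu hp hm hB
  rw [constReg_eq H, ellVTerm_eq H, tCoeff_eq_sfac H hr h2, wordVal_termList h1 h2 h3]
  simp only [ellFacs, List.map_cons, List.map_nil, List.prod_cons, List.prod_nil, mul_one]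
  rw [ellFac_eq H (M - r - s + 1 + n) (s - n) rfl, ellFac_eq H (k - s + 1 + n) (s - n) rfl,
    ellFac_eq H (l - s + 1) n rfl, ellFac_eq H (l + M - k - s - r + 1) n rfl]
  have key := congr_arg₂ (· * ·) hQ hS
  refine Eq.trans ?_ (key.trans ?_)
  · ring
  · ring

end Terms

/-! ### The series -/

section Series

variable {p q : ℝ}

theorem ellFac_eq_zero (H : Nomes p q) {y a : ℂ} (hy : y = qp q (2 * a)) {n : ℕ} (i : ℕ) (hi : i < n)
    (ha : a + i = 0) : ellFac p q y n = 0 := by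
  rw [ellFac_eq H a n hy, sfac_natCast, Finset.prod_eq_zero (Finset.mem_range.2 hi), mul_zero]
  rw [ha, sf_zero H.p_pos H.p_lt]

/-- The two sums have the same terms but different ranges; those of the series with n < r + s - M
vanish. -/
theorem regProduct_eq (H : Nomes p q) {M r s N k : ℕ} {B : ℤ} (hr : r ≤ M)
    (hN : r + k ≤ N + s) {u l : ℂ} (hl : Near p q B l) (hu : Near p q B u)
    (hp : Near p q B (l + u)) (hm : Near p q B (l - u))
    (hB : 4 * ((M : ℤ) + r + s + N + k + r) + 10 ≤ B) :
    ∑ n ∈ Finset.Icc (r + s - M) (min r s),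
        tCoeff p q M r s n l * wordVal p q N u (termList M r s n) k l =
      regProduct p q M r s N k (qp q (2 * u)) l := by
  rw [regProduct, Finset.mul_sum]
  rw [← Finset.sum_subset (s₁ := Finset.Icc (r + s - M) (min r s))
    (s₂ := Finset.range (min r s + 1))]
  · refine Finset.sum_congr rfl fun n hn => ?_
    have h1 := (Finset.mem_Icc.1 hn).1
    have h2 := (Finset.mem_Icc.1 hn).2
    exact (term_identity H hr (by omega) (by omega) (by omega) hN hl hu hp hm (by omega)).symm
  · intro n hn
    have h2 := (Finset.mem_Icc.1 hn).2
    exact Finset.mem_range.2 (by omega)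
  · intro n hn hn'
    have h1 := Finset.mem_range.1 hn
    rw [Finset.mem_Icc] at hn'
    have h0 : ellFac p q (qp q (2 * ((M : ℂ) - r - s + 1 + n))) ((s : ℤ) - n) = 0 := by
      rw [show (s : ℤ) - n = ((s - n : ℕ) : ℤ) by omega]
      -- The factor at this index is θ(1). The index is smaller than s - n because r ≤ M.
      refine ellFac_eq_zero H rfl (r + s - M - 1 - n) (by omega) ?_
      rw [show r + s - M - 1 - n = r + s - (M + 1 + n) by omega]
      push_cast [show M + 1 + n ≤ r + s by omega]
      ring
    simp only [ellFacs, List.map_cons, List.prod_cons]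
    rw [h0, zero_mul, zero_mul, mul_zero]

theorem ellFac_split (H : Nomes p q) (a : ℂ) {n s : ℕ} (h : n ≤ s) :
    ellFac p q (qp q (2 * a)) s =
      ellFac p q (qp q (2 * a)) n * ellFac p q (qp q (2 * (a + n))) ((s : ℤ) - n) := by
  obtain ⟨t, rfl⟩ := Nat.exists_eq_add_of_le h
  rw [show ((n + t : ℕ) : ℤ) - n = (t : ℤ) by push_cast; ring]
  change ∏ i ∈ Finset.range (n + t), _ = (∏ i ∈ Finset.range n, _) * ∏ i ∈ Finset.range t, _
  rw [Finset.prod_range_add]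
  congr 1
  refine Finset.prod_congr rfl fun i _ => ?_
  rw [← qp_add H.q_pos, ← qp_add H.q_pos]
  congr 2
  push_cast
  ring

theorem ellFac_pos_ne_zero (H : Nomes p q) {y a : ℂ} (hy : y = qp q (2 * a)) {m : ℤ} (ha : a = m)
    (hm : 0 < m) (n : ℕ) : ellFac p q y n ≠ 0 := by
  rw [ellFac_eq H a n hy, sfac_natCast]
  refine mul_ne_zero (qp_ne_zero H.q_pos _) (Finset.prod_ne_zero_iff.2 fun i _ => ?_)
  exact sf_int_ne_zero H (m := m + i) (by rw [ha]; push_cast; ring) (by omega)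

theorem ellVTerm_eq_zero (H : Nomes p q) {M r s N k n : ℕ} (hn : min r s < n) (x l : ℂ) :
    ellVTerm p q (vBase q M r s l) (vParams q M r s N k x l) n = 0 := by
  have h : ellFac p q (qp q (-2 * r)) n * ellFac p q (qp q (-2 * s)) n = 0 := by
    rcases min_lt_iff.1 hn with h | h
    · rw [ellFac_eq_zero H (a := -(r : ℂ)) (by ring_nf) r h (by ring), zero_mul]
    · rw [ellFac_eq_zero H (y := qp q (-2 * s)) (a := -(s : ℂ)) (by ring_nf) s h (by ring), mul_zero]
  simp only [ellVTerm, vParams, ellFacs, List.map_cons, List.prod_cons]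
  rw [← mul_assoc (ellFac p q (qp q (-2 * r)) n), h]
  ring

/-- The denominators belonging to a₈ and a₁₀ are (q^{2(M-r-s+1)})_n and (q^{2(k-s+1)})_n. Under the
two inequalities they are products of θ(q^{2m}) with m > 0, hence nonzero, and divide the
corresponding factors of C. -/
theorem constC_mul_ellV (H : Nomes p q) {M r s N k : ℕ} (hrs : r + s ≤ M) (hsk : s ≤ k) (x l : ℂ) :
    constC p q M r s N k x l * ellV p q (vBase q M r s l) (vParams q M r s N k x l) =
      regProduct p q M r s N k x l := by
  rw [ellV, tsum_eq_sum (s := Finset.range (min r s + 1)) (fun n hn =>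
    ellVTerm_eq_zero H (by rw [Finset.mem_range] at hn; omega) x l), regProduct, constC, mul_comm
    (ellFacs p q _ s), mul_assoc, Finset.mul_sum]
  congr 1
  refine Finset.sum_congr rfl fun n hn => ?_
  have hn' := Finset.mem_range.1 hn
  have hq := H.q_pos
  have e1 : qp q 2 * vBase q M r s l / qp q (2 * (l - s + 1)) = qp q (2 * ((M : ℂ) - r - s + 1)) := by
    rw [vBase, ← qp_add hq, ← qp_sub hq]
    ring_nf
  have e2 : qp q 2 * vBase q M r s l / qp q (2 * (l + M - k - s - r + 1)) =
      qp q (2 * ((k : ℂ) - s + 1)) := by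
    rw [vBase, ← qp_add hq, ← qp_sub hq]
    ring_nf
  have n1 := ellFac_pos_ne_zero H (y := qp q (2 * ((M : ℂ) - r - s + 1))) rfl
    (m := M - r - s + 1) (by push_cast; ring) (by omega) n
  have n2 := ellFac_pos_ne_zero H (y := qp q (2 * ((k : ℂ) - s + 1))) rfl
    (m := k - s + 1) (by push_cast; ring) (by omega) n
  simp only [ellFacs, ellVTerm, vParams, List.map_cons, List.map_nil, List.prod_cons, List.prod_nil,
    mul_one, e1, e2]
  rw [ellFac_split H ((M : ℂ) - r - s + 1) (n := n) (s := s) (by omega),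
    ellFac_split H ((k : ℂ) - s + 1) (n := n) (s := s) (by omega)]
  generalize ellFac p q (qp q (2 * ((M : ℂ) - r - s + 1))) n = X at *
  generalize ellFac p q (qp q (2 * ((k : ℂ) - s + 1))) n = Y at *
  have hX := mul_inv_cancel₀ n1
  have hY := mul_inv_cancel₀ n2
  have cancel : ∀ A C : ℂ, A = X * X⁻¹ * (Y * Y⁻¹) * C → A = C := fun A C h => by
    rw [h, hX, hY, one_mul, one_mul]
  refine cancel _ _ ?_
  ring

theorem qp_pow (a : ℂ) (n : ℕ) : qp q a ^ n = qp q (n * a) := (Complex.cpow_nat_mul _ _ _).symm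

theorem ellBalanced_vParams (H : Nomes p q) (M r s N k : ℕ) (u l : ℂ) :
    EllBalanced q (vBase q M r s l) (vParams q M r s N k (qp q (2 * u)) l) := by
  simp only [EllBalanced, vBase, vParams, List.prod_cons, List.prod_nil, mul_one, List.length_cons,
    List.length_nil, ← qp_neg, ← qp_add H.q_pos, qp_pow]
  congr 1
  push_cast
  ring

end Series

/-! ### The value of the pairing on matrix elements. -/

section Value

variable {p q : ℝ} {Ω₁ Ω₂ : SpectralSet q}

theorem Generic.near {u : ℂ} (h : Generic p q u) (B : ℤ) : Near p q B u := fun i _ _ => h i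

theorem eventually_near (H : Nomes p q) (B : ℤ) (c : ℂ) :
    ∀ᶠ l in codiscrete ℂ, Near p q B (l + c) := by
  filter_upwards [eventually_forall_sf_add_ne_zero H.p_pos H.p_lt H.q_pos H.generic c B] with l hl
  exact fun i h1 h2 => hl i h1 h2.le

variable {P : E p Ω₁ →ₗ[ℂ] E p Ω₂ →ₗ[ℂ] Op}

/-- The pairing of matrix elements as an elliptic hypergeometric series. -/
theorem IsRMatrixPairing.matElt_matElt_eq_regProduct (H : Nomes p q) (hP : IsRMatrixPairing p P)
    {M N r s k j : ℕ} (hr : r ≤ M) (hk : k ≤ N) (hj : j ≤ N) (h : s + j = r + k) (w : Ω₁.Pt)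
    (z : Ω₂.Pt) {u : ℂ} (hu : qp q (2 * u) = (w : ℂ) / z) (hg : Generic p q u) :
    P (matElt p M r s w) (matElt p N k j z) =
      mulOp (Mero.of fun l => regProduct p q M r s N k (qp q (2 * u)) l) *
        T ((N : ℂ) + M - 2 * s - 2 * j) := by
  rw [hP.matElt_matElt H hr hk w z hu hg, if_pos h]
  set B : ℤ := 4 * ((M : ℤ) + r + s + N + k + r) + 10 with hB
  have hm : Meromorphic fun l => ∑ n ∈ Finset.Icc (r + s - M) (min r s),
      tCoeff p q M r s n l * wordVal p q N u (termList M r s n) k l := fun l =>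
    MeromorphicAt.fun_sum fun n hn =>
      (meromorphic_tCoeff H hr ((Finset.mem_Icc.1 hn).2.trans (min_le_right _ _)) l).mul
        (meromorphic_wordVal H _ _ _ _ l)
  rw [op_congr hm (g := fun l => regProduct p q M r s N k (qp q (2 * u)) l), op, opRing_T]
  · push_cast
    rfl
  -- The comparison of terms divides by theta factors at integer translates of l, l + u and l - u
  -- within the bound B, which are nonzero for generic l; the translates of u are covered by the
  -- separation of the spectral sets.
  · filter_upwards [eventually_near H B 0, eventually_near H B u, eventually_near H B (-u)]
      with l h0 h1 h2
    rw [add_zero] at h0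
    rw [← sub_eq_add_neg] at h2
    exact regProduct_eq H hr (by omega) h0 (hg.near B) h1 h2 hB.ge

end Value

end EllU2

end

theorem mainTheorem2 (p q : ℝ) (hp₀ : 0 < p) (hp₁ : p < 1) (hq₀ : 0 < q) (hq₁ : q < 1)
    (hpq : ∀ n : ℕ, 0 < n → ∀ m : ℤ, q ^ (2 * n) ≠ p ^ m)
    (Ω₁ Ω₂ : EllU2.SpectralSet q)
    (hΩ : ∀ w ∈ Ω₁.carrier, ∀ z ∈ Ω₂.carrier, ∀ m : ℤ, w ≠ (p : ℂ) ^ m * z) :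
    ∃ P : EllU2.E p Ω₁ →ₗ[ℂ] EllU2.E p Ω₂ →ₗ[ℂ] EllU2.Op,
      EllU2.IsRMatrixPairing p P ∧
      (∀ P' : EllU2.E p Ω₁ →ₗ[ℂ] EllU2.E p Ω₂ →ₗ[ℂ] EllU2.Op,
        EllU2.IsRMatrixPairing p P' → P' = P) ∧
      ∀ (M N r s k j : ℕ), r ≤ M → s ≤ M → k ≤ N → j ≤ N →
        ∀ (w : Ω₁.Pt) (z : Ω₂.Pt),
          (s + j ≠ r + k → P (EllU2.matElt p M r s w) (EllU2.matElt p N k j z) = 0) ∧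
          (s + j = r + k →
            P (EllU2.matElt p M r s w) (EllU2.matElt p N k j z) =
              EllU2.mulOp (EllU2.Mero.of fun l =>
                EllU2.regProduct p q M r s N k ((w : ℂ) / z) l) *
              EllU2.T ((N : ℂ) + M - 2 * s - 2 * j)) ∧
          (s + j = r + k → r + s ≤ M → s ≤ k →
            P (EllU2.matElt p M r s w) (EllU2.matElt p N k j z) =
              EllU2.mulOp (EllU2.Mero.of fun l =>
                EllU2.constC p q M r s N k ((w : ℂ) / z) l *
                  EllU2.ellV p q (EllU2.vBase q M r s l)
                    (EllU2.vParams q M r s N k ((w : ℂ) / z) l)) *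
              EllU2.T ((N : ℂ) + M - 2 * s - 2 * j)) ∧
          (∀ l : ℂ, EllU2.EllBalanced q (EllU2.vBase q M r s l)
            (EllU2.vParams q M r s N k ((w : ℂ) / z) l)) := by
  have H : EllU2.Nomes p q := ⟨hp₀, hp₁, hq₀, hq₁, hpq⟩
  have hS : EllU2.Separated p Ω₁ Ω₂ := hΩ
  obtain ⟨P, hP⟩ := EllU2.exists_isRMatrixPairing H hS
  refine ⟨P, hP, fun P' hP' => hP.unique H hS hP', ?_⟩
  intro M N r s k j hr _ hk hj w z
  obtain ⟨a, ha⟩ := EllU2.exists_log H w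
  obtain ⟨b, hb⟩ := EllU2.exists_log H z
  have hu : EllU2.qp q (2 * (a - b)) = (w : ℂ) / z := by rw [← EllU2.qp_div H, ha, hb]
  have hg := hS.generic H w z ha hb
  have hval : s + j = r + k → P (EllU2.matElt p M r s w) (EllU2.matElt p N k j z) =
      EllU2.mulOp (EllU2.Mero.of fun l => EllU2.regProduct p q M r s N k ((w : ℂ) / z) l) *
        EllU2.T ((N : ℂ) + M - 2 * s - 2 * j) := by
    intro h
    rw [← hu]
    exact hP.matElt_matElt_eq_regProduct H hr hk hj h w z hu hg
  refine ⟨fun h => ?_, hval, fun h h1 h2 => ?_, fun l => ?_⟩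
  · rw [hP.matElt_matElt H hr hk w z hu hg, if_neg h]
  · rw [hval h]
    simp only [EllU2.constC_mul_ellV H h1 h2]
  · rw [← hu]
    exact EllU2.ellBalanced_vParams H M r s N k _ l
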